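/- Let $k$ be an algebraically closed field with $\operatorname{char} k\neq 2,3$, let $Q$ be the quiver with vertices $1,2,3$ and arrows $\alpha_i\colon i\to i+1$ (indices modulo $3$), and let $A=kQ/R_Q^2$, where $R_Q$ is the arrow ideal; thus $A$ has the basis $e_1,e_2,e_3,\alpha_1,\alpha_2,\alpha_3$ with $e_ie_i=e_i$, $e_i\alpha_i=\alpha_i=\alpha_ie_{i+1}$ and all other products of basis elements zero. Let $\langle a,b\rangle=\operatorname{tr}(ab)$, where $\operatorname{tr}(e_i)=0$, $\operatorname{tr}(\alpha_i)=1$. This is a Frobenius form with Nakayama automorphism $\nu(e_i)=e_{i+1}$, $\nu(\alpha_i)=\alpha_{i+1}$, $\langle a,b\rangle=\langle b,\nu(a)\rangle$. Let $(u_i)$, $(v_i)$ be bases of $A$ with $\langle v_i,u_j\rangle=\delta_{ij}$, and put $\overline A=A/k1$. *The complete complex.* $\widehat{\mathrm{HH}}^\bullet(A)$ is the cohomology of the complex $\mathcal D^\bullet$ with $\mathcal D^r=C^r(A,A)=\operatorname{Hom}_k(\overline A^{\otimes r},A)$ for $r\ge 0$ and $\mathcal D^{-p-1}=C_p(A,A_{\nu^{-1}})=A\otimes\overline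 A^{\otimes p}$ for $p\ge0$. Its differential is the Hochschild differential in degrees $\geq 0$, the Hochschild boundary $\partial(a_0\otimes\cdots\otimes a_{p})=a_0\nu^{-1}(a_1)\otimes a_2\otimes\cdots\otimes a_p+\sum_{i=1}^{p-1}(-1)^ia_0\otimes\cdots\otimes a_ia_{i+1}\otimes\cdots\otimes a_p+(-1)^pa_pa_0\otimes a_1\otimes\cdots\otimes a_{p-1}$ in degrees $-p-1\leq -2$, and $a\mapsto\sum_iu_iav_i$ from $\mathcal D^{-1}=A$ to $\mathcal D^0=A$. *The product.* The $\star$-product is induced by the following pairings, for $f\in C^m(A,A)$, $g\in C^n(A,A)$, $x=a_0\otimes\cdots\otimes a_p$, $y=b_0\otimes\cdots\otimes b_q$: $f\star g$ is the cup product; $x\star f=a_0\nu^{-1}(f(a_1,\dots,a_m))\otimes a_{m+1}\otimes\cdots\otimes a_p$ and $f\star x=f(a_{p-m+1},\dots,a_p)a_0\otimes a_1\otimes\cdots\otimes a_{p-m}$ if $m\le p$; if $m=p+1+n$ with $n\geq 0$, then $(f\star x)(c_1,\dots,c_n)=\sum_if(c_1,\dots,c_n,u_i\nu(a_0),a_1,\dots,a_p)v_i$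 and $(x\star f)(c_1,\dots,c_n)=\sum_iu_i\nu(a_0)f(a_1,\dots,a_p,v_i,c_1,\dots,c_n)$; and $x\star y=\sum_iv_ib_0\otimes b_1\otimes\cdots\otimes b_q\otimes u_i\nu(a_0)\otimes a_1\otimes\cdots\otimes a_p$. *The BV operator.* Let $A_\mu$ be the eigenspace of $\nu$ for $\mu\in k$. The weight one part $\mathcal D_{(1)}^\bullet$ consists of the cochains mapping $\overline A_{\mu_1}\otimes\cdots\otimes\overline A_{\mu_r}$ into $A_{\mu_1\cdots\mu_r}$ for all $\mu_1,\dots,\mu_r$, and of the sums of tensors in $A_{\mu_0}\otimes\overline A_{\mu_1}\otimes\cdots\otimes\overline A_{\mu_p}$ with $\mu_0\cdots\mu_p=1$; the inclusion $\mathcal D_{(1)}^\bullet\to\mathcal D^\bullet$ is bijective on cohomology. The BV differential $\widehat\Delta_r\colon\widehat{\mathrm{HH}}^r(A)\to\widehat{\mathrm{HH}}^{r-1}(A)$ is obtained by applying to weight one cocycles the following map: for $r\ge1$ the map $\Delta^\nu$ given by $\langle\Delta^\nu(f)(a_1,\dots,a_{r-1}),b\rangle=\sum_{i=1}^{r}(-1)^{i(r-1)}\langle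 f(a_i,\dots,a_{r-1},b,\nu(a_1),\dots,\nu(a_{i-1})),1\rangle$; for $r=0$ the map $0$; and for $r=-p-1\le-1$ the map $(-1)^rB$, where $B(a_0\otimes\cdots\otimes a_p)=\sum_{i=1}^{p+1}(-1)^{ip}\,1\otimes a_i\otimes\cdots\otimes a_p\otimes a_0\otimes\nu^{-1}(a_1)\otimes\cdots\otimes\nu^{-1}(a_{i-1})$. The Gerstenhaber bracket is $\{x,y\}=(-1)^{|x||y|+|x|+|y|}\bigl((-1)^{|x|+1}\widehat\Delta(x\star y)+(-1)^{|x|}\widehat\Delta(x)\star y+x\star\widehat\Delta(y)\bigr)$. **Claim.** The product $\star$ and the operator $\widehat\Delta$ are well defined on $\widehat{\mathrm{HH}}^\bullet(A)$, and there is an isomorphism of graded rings $$(\widehat{\mathrm{HH}}^\bullet(A),\star)\;\cong\;k[\alpha,\beta,\alpha^{-1}]/(\beta^2),\qquad|\alpha|=6,\ |\beta|=1,\ |\alpha^{-1}|=-6,$$ under which, for all integers $l\ge0$, $$\widehat\Delta_{6l+1}(\alpha^l\beta)=\tfrac{6l+1}{3}\,\alpha^l,\qquad\widehat\Delta_{-6l-5}(\alpha^{-l-1}\beta)=\tfrac{-6l-5}{3}\,\alpha^{-l-1},$$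 while $\widehat\Delta(\alpha^n)=0$ for all $n\in\mathbb Z$. Moreover $\{\alpha,\beta\}=2\alpha$ and $\{\beta,\alpha^{-1}\}=2\alpha^{-1}$, and, for all $m,n\in\mathbb Z$, the brackets of monomials are $$\{\alpha^m,\alpha^n\}=0,\quad\{\alpha^m,\alpha^n\beta\}=2m\,\alpha^{m+n},\quad\{\alpha^m\beta,\alpha^n\}=-2n\,\alpha^{m+n},\quad\{\alpha^m\beta,\alpha^n\beta\}=2(m-n)\,\alpha^{m+n}\beta.$$ -/

import Mathlib

open scoped DirectSum TensorProduct LaurentPolynomial DualNumber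

namespace CompleteHochschild

universe u

section Words

variable {k : Type*} [Field k] {A : Type*} [Ring A] [Algebra k A]
variable {N : Type*} [AddCommGroup N] [Module k N]

/-- A finite tuple, read as a sequence (extended by zero). Tuples of varying length are
described below by formulas in the position `t : ℕ`. -/
def seq {n : ℕ} (a : Fin n → A) : ℕ → A := fun t => if h : t < n then a ⟨t, h⟩ else 0

theorem seq_val {n : ℕ} (a : Fin n → A) (t : Fin n) : seq a t = a t := by
  simp [seq]

theorem seq_update {n : ℕ} [DecidableEq (Fin n)] (a : Fin n → A) (j : Fin n) (x : A) :
    seq (Function.update a j x) = Function.update (seq a) (j : ℕ) x := by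
  funext t
  by_cases ht : t < n
  · by_cases hj : (⟨t, ht⟩ : Fin n) = j
    · subst hj; simp [seq, ht]
    · have : t ≠ (j : ℕ) := fun h => hj (Fin.ext h)
      simp [seq, ht, Function.update_of_ne this, Function.update_of_ne hj]
  · have : t ≠ (j : ℕ) := fun h => ht (h ▸ j.2)
    simp [seq, ht, Function.update_of_ne this]

/-- `G` is linear in each of the entries `w 0, …, w (n-1)` of a sequence `w`. -/
def LinearInEach (n : ℕ) (G : (ℕ → A) → N) (k : Type*) [Field k] [Algebra k A] [Module k N] :
    Prop :=
  ∀ (w : ℕ → A) (j : ℕ), j < n → ∃ L : A →ₗ[k] N, ∀ x, G (Function.update w j x) = L x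

/-- The multilinear map `(a_0, …, a_{n-1}) ↦ G (a_0, …, a_{n-1})`. -/
def mkMulti (n : ℕ) (G : (ℕ → A) → N) (h : LinearInEach n G k) :
    MultilinearMap k (fun _ : Fin n => A) N where
  toFun a := G (seq a)
  map_update_add' a j x y := by
    obtain ⟨L, hL⟩ := h (seq a) j j.2
    simp only [seq_update, hL, map_add]
  map_update_smul' a j c x := by
    obtain ⟨L, hL⟩ := h (seq a) j j.2
    simp only [seq_update, hL, map_smul]

@[simp] theorem mkMulti_apply (n : ℕ) (G : (ℕ → A) → N) (h : LinearInEach n G k)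
    (a : Fin n → A) : mkMulti n G h a = G (seq a) := rfl

/-- The value of a multilinear map on the first `r` entries of a sequence. -/
def ev {r : ℕ} (f : MultilinearMap k (fun _ : Fin r => A) N) (w : ℕ → A) : N :=
  f (fun t : Fin r => w t)

theorem ev_congr {r : ℕ} (f : MultilinearMap k (fun _ : Fin r => A) N) {w w' : ℕ → A}
    (h : ∀ t < r, w t = w' t) : ev f w = ev f w' := by
  unfold ev; congr 1; funext t; exact h t t.2

theorem ev_lin {r : ℕ} (f : MultilinearMap k (fun _ : Fin r => A) N) (w : ℕ → A) {s : ℕ}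
    (hs : s < r) (F : A → ℕ → A) (T : A →ₗ[k] A)
    (hF : ∀ x, ∀ t < r, F x t = if t = s then T x else w t) :
    ∃ L : A →ₗ[k] N, ∀ x, ev f (F x) = L x := by
  refine ⟨(f.toLinearMap (fun t : Fin r => w t) ⟨s, hs⟩).comp T, fun x => ?_⟩
  simp only [ev, LinearMap.comp_apply, MultilinearMap.toLinearMap_apply]
  congr 1
  funext t
  rw [hF x t t.2]
  by_cases h : (t : ℕ) = s
  · have : t = ⟨s, hs⟩ := Fin.ext h
    subst this; simp
  · have : t ≠ ⟨s, hs⟩ := fun e => h (by rw [e])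
    simp [h, Function.update_of_ne this]

theorem LinearInEach.add {n : ℕ} {G H : (ℕ → A) → N} (hG : LinearInEach n G k)
    (hH : LinearInEach n H k) : LinearInEach n (fun w => G w + H w) k := fun w j hj => by
  obtain ⟨L, hL⟩ := hG w j hj
  obtain ⟨M, hM⟩ := hH w j hj
  exact ⟨L + M, fun x => by simp [hL, hM]⟩

theorem LinearInEach.sum {n : ℕ} {ι : Type*} (s : Finset ι) {G : ι → (ℕ → A) → N}
    (hG : ∀ i ∈ s, LinearInEach n (G i) k) : LinearInEach n (fun w => ∑ i ∈ s, G i w) k :=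
  fun w j hj => by
    choose! L hL using fun i (hi : i ∈ s) => hG i hi w j hj
    refine ⟨∑ i ∈ s, L i, fun x => ?_⟩
    simp only [LinearMap.sum_apply]
    exact Finset.sum_congr rfl fun i hi => hL i hi x

theorem LinearInEach.smul {n : ℕ} (c : k) {G : (ℕ → A) → N} (hG : LinearInEach n G k) :
    LinearInEach n (fun w => c • G w) k := fun w j hj => by
  obtain ⟨L, hL⟩ := hG w j hj
  exact ⟨c • L, fun x => by simp [hL]⟩

theorem LinearInEach.comp {n : ℕ} {N' : Type*} [AddCommGroup N'] [Module k N']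
    (T : N →ₗ[k] N') {G : (ℕ → A) → N} (hG : LinearInEach n G k) :
    LinearInEach n (fun w => T (G w)) k := fun w j hj => by
  obtain ⟨L, hL⟩ := hG w j hj
  exact ⟨T.comp L, fun x => by simp [hL]⟩

/-- `(w_0, …, w_{i} w_{i+1}, …)`. -/
def merge (i : ℕ) (w : ℕ → A) : ℕ → A := fun t =>
  if t < i then w t else if t = i then w i * w (i + 1) else w (t + 1)

theorem merge_lin {n i : ℕ} (hi : i < n) (f : MultilinearMap k (fun _ : Fin n => A) N) :
    LinearInEach (n + 1) (fun w => ev f (merge i w)) k := by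
  intro w j hj
  rcases lt_trichotomy j i with h | h | h
  · refine ev_lin f (merge i w) (s := j) (by omega) _ LinearMap.id fun x t ht => ?_
    simp only [merge, Function.update_apply, LinearMap.id_apply]
    grind
  · refine ev_lin f (merge i w) (s := i) (by omega) _ (LinearMap.mulRight k (w (i + 1)))
      fun x t ht => ?_
    simp only [merge, Function.update_apply, LinearMap.mulRight_apply]
    grind
  · rcases eq_or_ne j (i + 1) with h' | h'
    · refine ev_lin f (merge i w) (s := i) (by omega) _ (LinearMap.mulLeft k (w i))
        fun x t ht => ?_
      simp only [merge, Function.update_apply, LinearMap.mulLeft_apply]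
      grind
    · refine ev_lin f (merge i w) (s := j - 1) (by omega) _ LinearMap.id fun x t ht => ?_
      simp only [merge, Function.update_apply, LinearMap.id_apply]
      grind

end Words

section Complex

variable {k : Type*} [Field k] {A : Type*} [Ring A] [Algebra k A]

variable (k A) in
/-- `C^r(A, A) = Hom(Ā^{⊗ r}, A)`, `Ā = A / k·1`: multilinear maps in `r` variables vanishing as
soon as one of the arguments is `1`. -/
def Cochain (r : ℕ) : Submodule k (MultilinearMap k (fun _ : Fin r => A) A) where
  carrier := {f | ∀ a : Fin r → A, (∃ t, a t = 1) → f a = 0}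
  zero_mem' := by intro a _; rfl
  add_mem' {f g} hf hg := by intro a ha; simp [hf a ha, hg a ha]
  smul_mem' c f hf := by intro a ha; simp [hf a ha]

theorem Cochain.ev_eq_zero {r : ℕ} (f : Cochain k A r) {w : ℕ → A} (t : ℕ) (ht : t < r)
    (hw : w t = 1) : ev f.1 w = 0 :=
  f.2 _ ⟨⟨t, ht⟩, hw⟩

variable (k A) in
/-- The span of the tensors `a_0 ⊗ a_1 ⊗ ⋯ ⊗ a_p` with `a_l = 1` for some `l ≥ 1`. -/
def degenerate (p : ℕ) : Submodule k (PiTensorProduct k (fun _ : Fin (p + 1) => A)) :=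
  Submodule.span k
    {x | ∃ a : Fin (p + 1) → A, (∃ l : Fin p, a l.succ = 1) ∧ x = PiTensorProduct.tprod k a}

variable (k A) in
/-- `C_p(A, A_σ) = A ⊗ Ā^{⊗ p}` (as a vector space it does not depend on `σ`). -/
abbrev Chain (p : ℕ) : Type _ :=
  (PiTensorProduct k (fun _ : Fin (p + 1) => A)) ⧸ degenerate k A p

variable (k A) in
/-- `(a_0, …, a_p) ↦ a_0 ⊗ ā_1 ⊗ ⋯ ⊗ ā_p`. -/
noncomputable def gen (p : ℕ) : MultilinearMap k (fun _ : Fin (p + 1) => A) (Chain k A p) :=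
  (degenerate k A p).mkQ.compMultilinearMap (PiTensorProduct.tprod k)

variable {N : Type*} [AddCommGroup N] [Module k N]

theorem gen_eq_zero {p : ℕ} {w : ℕ → A} (l : ℕ) (h0 : 0 < l) (hl : l ≤ p) (hw : w l = 1) :
    ev (gen k A p) w = 0 := by
  obtain ⟨l, rfl⟩ := Nat.exists_eq_add_of_lt h0
  refine (Submodule.Quotient.mk_eq_zero _).2 (Submodule.subset_span ⟨_, ⟨⟨l, by omega⟩, ?_⟩, rfl⟩)
  simpa [add_comm] using hw

/-- A linear map out of `A ⊗ Ā^{⊗ p}`. -/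
noncomputable def Chain.lift {p : ℕ} (g : MultilinearMap k (fun _ : Fin (p + 1) => A) N)
    (hg : ∀ (a : Fin (p + 1) → A) (l : Fin p), a l.succ = 1 → g a = 0) : Chain k A p →ₗ[k] N :=
  (degenerate k A p).liftQ (PiTensorProduct.lift g) (by
    rw [degenerate, Submodule.span_le]
    rintro _ ⟨a, ⟨l, hl⟩, rfl⟩
    simpa using hg a l hl)

@[simp] theorem Chain.lift_gen {p : ℕ} (g : MultilinearMap k (fun _ : Fin (p + 1) => A) N)
    (hg : ∀ (a : Fin (p + 1) → A) (l : Fin p), a l.succ = 1 → g a = 0) (a : Fin (p + 1) → A) :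
    Chain.lift g hg (gen k A p a) = g a := by
  simp [Chain.lift, gen]

theorem Chain.hom_ext {p : ℕ} {S T : Chain k A p →ₗ[k] N}
    (h : ∀ a, S (gen k A p a) = T (gen k A p a)) : S = T := by
  refine Submodule.linearMap_qext _ (PiTensorProduct.ext ?_)
  ext a
  exact h a

/-- The linear map `a_0 ⊗ ā_1 ⊗ ⋯ ⊗ ā_p ↦ G (a_0, …, a_p)`. -/
noncomputable def Chain.map {p : ℕ} (G : (ℕ → A) → N) (hG : LinearInEach (p + 1) G k)
    (h1 : ∀ (w : ℕ → A) (l : ℕ), 0 < l → l ≤ p → w l = 1 → G w = 0) : Chain k A p →ₗ[k] N :=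
  Chain.lift (mkMulti (p + 1) G hG) (fun a l hl => h1 _ (l + 1) (by omega) (by omega) (by
    have := seq_val a l.succ
    simp only [Fin.val_succ] at this
    rw [this, hl]))

theorem Chain.map_gen {p : ℕ} (G : (ℕ → A) → N) (hG : LinearInEach (p + 1) G k)
    (h1 : ∀ (w : ℕ → A) (l : ℕ), 0 < l → l ≤ p → w l = 1 → G w = 0) (a : Fin (p + 1) → A) :
    Chain.map G hG h1 (gen k A p a) = G (seq a) :=
  Chain.lift_gen _ _ a

/-- The cochain `(a_1, …, a_r) ↦ G (a_1, …, a_r)`; here `a_i` is the entry `w (i-1)`. -/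
def Cochain.mk {r : ℕ} (G : (ℕ → A) → A) (hG : LinearInEach r G k)
    (h1 : ∀ (w : ℕ → A) (t : ℕ), t < r → w t = 1 → G w = 0) : Cochain k A r :=
  ⟨mkMulti r G hG, fun a ⟨t, ht⟩ => h1 _ t t.2 (by rw [seq_val, ht])⟩

theorem alternating_cancel {n l : ℕ} (hl : l + 1 < n) (c : ℕ → N)
    (h : ∀ i < n, i ≠ l → i ≠ l + 1 → c i = 0) (h' : c l = c (l + 1)) :
    ∑ i ∈ Finset.range n, ((-1 : k) ^ i) • c i = 0 := by
  rw [Finset.sum_eq_add_of_mem l (l + 1) (by simp; omega) (by simp; omega) (by omega)]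
  · rw [h', pow_succ]; simp
  · intro i hi hne
    rw [h i (by simpa using hi) hne.1 hne.2, smul_zero]

/-- The `i`-th term, without its sign, of `(δ f)(a_1, …, a_{r+1})`:
`a_1 f(a_2, …)` for `i = 0`, `f(…, a_i a_{i+1}, …)` for `1 ≤ i ≤ r`, `f(a_1, …, a_r) a_{r+1}` for
`i = r + 1`. -/
def coface {r : ℕ} (f : Cochain k A r) (i : ℕ) (w : ℕ → A) : A :=
  if i = 0 then w 0 * ev f.1 (fun t => w (t + 1))
  else if i = r + 1 then ev f.1 w * w r
  else ev f.1 (merge (i - 1) w)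

theorem coface_lin {r : ℕ} (f : Cochain k A r) (i : ℕ) (hi : i < r + 2) :
    LinearInEach (r + 1) (coface f i) k := by
  unfold coface
  split_ifs with h0 h1
  · intro w j hj
    rcases Nat.eq_zero_or_pos j with rfl | hj0
    · refine ⟨LinearMap.mulRight k (ev f.1 fun t => w (t + 1)), fun x => ?_⟩
      simp
    · obtain ⟨L, hL⟩ := ev_lin f.1 (fun t => w (t + 1)) (s := j - 1) (by omega)
        (fun x t => Function.update w j x (t + 1)) LinearMap.id (by
          intro x t ht; simp only [Function.update_apply, LinearMap.id_apply]; grind)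
      refine ⟨(LinearMap.mulLeft k (w 0)).comp L, fun x => ?_⟩
      simp [hL, Function.update_of_ne hj0.ne]
  · intro w j hj
    rcases eq_or_ne j r with rfl | hjr
    · refine ⟨LinearMap.mulLeft k (ev f.1 w), fun x => ?_⟩
      have e : ev f.1 (Function.update w j x) = ev f.1 w :=
        ev_congr f.1 fun t ht => Function.update_of_ne ht.ne _ _
      simp [e]
    · obtain ⟨L, hL⟩ := ev_lin f.1 w (s := j) (by omega)
        (fun x => Function.update w j x) LinearMap.id (by
          intro x t ht; simp only [Function.update_apply, LinearMap.id_apply])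
      refine ⟨(LinearMap.mulRight k (w r)).comp L, fun x => ?_⟩
      simp [hL, Function.update_of_ne (Ne.symm hjr)]
  · exact merge_lin (by omega) f.1

theorem coface_cancel {r : ℕ} (f : Cochain k A r) (w : ℕ → A) (t : ℕ) (ht : t < r + 1)
    (hw : w t = 1) : ∑ i ∈ Finset.range (r + 2), ((-1 : k) ^ i) • coface f i w = 0 := by
  refine alternating_cancel (l := t) (by omega) _ (fun i hi h1 h2 => ?_) ?_
  · unfold coface
    split_ifs with h3 h4
    · rw [Cochain.ev_eq_zero f (t - 1) (by omega) (by simpa [show t - 1 + 1 = t by omega] using hw),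
        mul_zero]
    · rw [Cochain.ev_eq_zero f t (by omega) hw, zero_mul]
    · rcases lt_or_ge t i with h | h
      · exact Cochain.ev_eq_zero f t (by omega) (by simp [merge, hw, show t < i - 1 by omega])
      · exact Cochain.ev_eq_zero f (t - 1) (by omega) (by
          simp [merge, show ¬ t - 1 < i - 1 by omega, show t - 1 ≠ i - 1 by omega,
            show t - 1 + 1 = t by omega, hw])
  · have e : ∀ s, merge t w s = if s < t then w s else w (s + 1) := by
      intro s; simp only [merge, hw, one_mul]; grind
    have e' : 0 < t → ∀ s, merge (t - 1) w s = if s < t then w s else w (s + 1) := by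
      intro h0 s; simp only [merge, show t - 1 + 1 = t by omega, hw, mul_one]; grind
    have hl : coface f t w = ev f.1 (fun s => if s < t then w s else w (s + 1)) := by
      unfold coface
      split_ifs with h3 h4
      · subst h3; simp [hw]
      · omega
      · exact ev_congr _ fun s _ => e' (by omega) s
    have hr : coface f (t + 1) w = ev f.1 (fun s => if s < t then w s else w (s + 1)) := by
      unfold coface
      rw [if_neg (by omega)]
      split_ifs with h4
      · obtain rfl : t = r := by omega
        rw [hw, mul_one]
        exact ev_congr _ fun s hs => by simp [hs]
      · exact ev_congr _ fun s _ => e s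
    rw [hl, hr]

/-- The Hochschild differential `δ^r : C^r(A, A) → C^{r+1}(A, A)`. -/
noncomputable def δ (r : ℕ) : Cochain k A r →ₗ[k] Cochain k A (r + 1) where
  toFun f := Cochain.mk (fun w => ∑ i ∈ Finset.range (r + 2), ((-1 : k) ^ i) • coface f i w)
    (LinearInEach.sum _ fun i hi => (coface_lin f i (by simpa using hi)).smul _)
    (coface_cancel f)
  map_add' f g := by
    ext a
    simp only [Cochain.mk, mkMulti_apply, Submodule.coe_add, add_apply,
      ← Finset.sum_add_distrib, ← smul_add]
    refine Finset.sum_congr rfl fun i _ => ?_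
    congr 1
    unfold coface ev
    split_ifs <;> simp [mul_add, add_mul]
  map_smul' c f := by
    ext a
    simp only [Cochain.mk, mkMulti_apply, Submodule.coe_smul, smul_apply,
      Finset.smul_sum, RingHom.id_apply]
    refine Finset.sum_congr rfl fun i _ => ?_
    rw [smul_comm]
    congr 1
    unfold coface ev
    split_ifs <;> simp

/-- The tuple of the `i`-th term of `∂(a_0 ⊗ ā_1 ⊗ ⋯ ⊗ ā_{p+1})`, coefficients in `A_σ`:
`(a_0 σ(a_1), a_2, …)` for `i = 0`, `(…, a_i a_{i+1}, …)` for `1 ≤ i ≤ p`,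
`(a_{p+1} a_0, a_1, …, a_p)` for `i = p + 1`. -/
def face (σ : A ≃ₐ[k] A) (p i : ℕ) (w : ℕ → A) : ℕ → A :=
  if i = 0 then fun t => if t = 0 then w 0 * σ (w 1) else w (t + 1)
  else if i = p + 1 then fun t => if t = 0 then w (p + 1) * w 0 else w t
  else merge i w

theorem face_lin (σ : A ≃ₐ[k] A) (p i : ℕ) (hi : i < p + 2) :
    LinearInEach (p + 2) (fun w => ev (gen k A p) (face σ p i w)) k := by
  unfold face
  split_ifs with h0 h1
  · intro w j hj
    rcases Nat.lt_or_ge 1 j with h | h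
    · refine ev_lin _ (fun t => if t = 0 then w 0 * σ (w 1) else w (t + 1)) (s := j - 1)
        (by omega) _ LinearMap.id fun x t ht => ?_
      simp only [Function.update_apply, LinearMap.id_apply]; grind
    · obtain rfl | rfl : j = 0 ∨ j = 1 := by omega
      · refine ev_lin _ (fun t => if t = 0 then w 0 * σ (w 1) else w (t + 1)) (s := 0)
          (by omega) _ (LinearMap.mulRight k (σ (w 1))) fun x t ht => ?_
        simp only [Function.update_apply, LinearMap.mulRight_apply]; grind
      · refine ev_lin _ (fun t => if t = 0 then w 0 * σ (w 1) else w (t + 1)) (s := 0)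
          (by omega) _ ((LinearMap.mulLeft k (w 0)).comp σ.toLinearMap) fun x t ht => ?_
        simp only [Function.update_apply, LinearMap.comp_apply, LinearMap.mulLeft_apply,
          AlgEquiv.toLinearMap_apply]; grind
  · intro w j hj
    rcases Nat.eq_zero_or_pos j with rfl | hj0
    · refine ev_lin _ (fun t => if t = 0 then w (p + 1) * w 0 else w t) (s := 0)
        (by omega) _ (LinearMap.mulLeft k (w (p + 1))) fun x t ht => ?_
      simp only [Function.update_apply, LinearMap.mulLeft_apply]; grind
    · rcases eq_or_ne j (p + 1) with rfl | hne
      · refine ev_lin _ (fun t => if t = 0 then w (p + 1) * w 0 else w t) (s := 0)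
          (by omega) _ (LinearMap.mulRight k (w 0)) fun x t ht => ?_
        simp only [Function.update_apply, LinearMap.mulRight_apply]; grind
      · refine ev_lin _ (fun t => if t = 0 then w (p + 1) * w 0 else w t) (s := j)
          (by omega) _ LinearMap.id fun x t ht => ?_
        simp only [Function.update_apply, LinearMap.id_apply]; grind
  · exact merge_lin (by omega) _

theorem face_cancel (σ : A ≃ₐ[k] A) (p : ℕ) (w : ℕ → A) (l : ℕ) (h0 : 0 < l) (hl : l ≤ p + 1)
    (hw : w l = 1) :
    ∑ i ∈ Finset.range (p + 2), ((-1 : k) ^ i) • ev (gen k A p) (face σ p i w) = 0 := by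
  obtain ⟨l, rfl⟩ : ∃ m, l = m + 1 := ⟨l - 1, by omega⟩
  refine alternating_cancel (l := l) (by omega) _ (fun i hi h1 h2 => ?_) ?_
  · rcases lt_or_ge l i with h | h
    · refine gen_eq_zero (l + 1) (by omega) (by omega) ?_
      simp only [face]
      split_ifs <;> simp only [merge] <;> grind
    · refine gen_eq_zero l (by omega) (by omega) ?_
      simp only [face]
      split_ifs <;> simp only [merge] <;> grind
  · refine ev_congr _ fun t ht => ?_
    simp only [face]
    split_ifs <;> simp only [merge] <;> grind

/-- The Hochschild differential `∂_{p+1} : C_{p+1}(A, A_σ) → C_p(A, A_σ)`. -/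
noncomputable def bdry (σ : A ≃ₐ[k] A) (p : ℕ) : Chain k A (p + 1) →ₗ[k] Chain k A p :=
  Chain.map (fun w => ∑ i ∈ Finset.range (p + 2), ((-1 : k) ^ i) • ev (gen k A p) (face σ p i w))
    (LinearInEach.sum _ fun i hi => (face_lin σ p i (by simpa using hi)).smul _)
    (face_cancel σ p)

theorem LinearInEach.of_forall {n : ℕ} {G : (ℕ → A) → N}
    (h : ∀ (w : ℕ → A) (j : ℕ), j < n → ∀ (c : k) (x y : A),
      G (Function.update w j (c • x + y))
        = c • G (Function.update w j x) + G (Function.update w j y)) :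
    LinearInEach n G k := fun w j hj => by
  have h0 : G (Function.update w j 0) = 0 := by simpa using h w j hj 1 0 0
  exact ⟨{ toFun := fun x => G (Function.update w j x)
           map_add' := fun x y => by simpa using h w j hj 1 x y
           map_smul' := fun c x => by simpa [h0] using h w j hj c x 0 }, fun _ => rfl⟩

theorem LinearInEach.of_cochain {n r : ℕ} {G : (ℕ → A) → Cochain k A r}
    (h : ∀ b : Fin r → A, LinearInEach n (fun w => (G w).1 b) k) : LinearInEach n G k :=
  LinearInEach.of_forall fun w j hj c x y => by
    ext b
    obtain ⟨L, hL⟩ := h b w j hj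
    simp [hL]

theorem LinearInEach.of_hom {n q : ℕ} {G : (ℕ → A) → (Chain k A q →ₗ[k] N)}
    (h : ∀ b : Fin (q + 1) → A, LinearInEach n (fun w => G w (gen k A q b)) k) :
    LinearInEach n G k :=
  LinearInEach.of_forall fun w j hj c x y => by
    refine Chain.hom_ext fun b => ?_
    obtain ⟨L, hL⟩ := h b w j hj
    simp [hL]

end Complex

section Frobenius

/-- A Frobenius algebra: an associative bilinear form `⟨ , ⟩`, dual bases `(u_i)`, `(v_i)` with
`⟨v_i, u_j⟩ = δ_{ij}` (so the form is non-degenerate), and the Nakayama automorphism `ν`,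
`⟨a, b⟩ = ⟨b, ν a⟩`. -/
structure FrobeniusData (k : Type*) [Field k] (A : Type*) [Ring A] [Algebra k A]
    (ι : Type*) [Fintype ι] [DecidableEq ι] where
  form : A →ₗ[k] A →ₗ[k] k
  form_assoc : ∀ a b c, form (a * b) c = form a (b * c)
  u : Module.Basis ι k A
  v : Module.Basis ι k A
  form_dual : ∀ i j, form (v i) (u j) = if i = j then 1 else 0
  ν : A ≃ₐ[k] A
  form_ν : ∀ a b, form a b = form b (ν a)

variable {k A : Type u} [Field k] [Ring A] [Algebra k A]
  {ι : Type*} [Fintype ι] [DecidableEq ι] (F : FrobeniusData k A ι)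

variable (k A) in
/-- The identification of `A` with `C^0(A, A)`. -/
def ofScalar : A →ₗ[k] Cochain k A 0 where
  toFun a := ⟨MultilinearMap.constOfIsEmpty k _ a, fun _ ⟨t, _⟩ => t.elim0⟩
  map_add' a b := by ext; rfl
  map_smul' c a := by ext; rfl

/-- `μ(a) = ∑ u_i a v_i`. -/
noncomputable def FrobeniusData.norm : Chain k A 0 →ₗ[k] Cochain k A 0 :=
  (ofScalar k A).comp (Chain.map (fun w => ∑ i, F.u i * w 0 * F.v i)
    (fun w j hj => by
      obtain rfl : j = 0 := by omega
      exact ⟨∑ i, (LinearMap.mulRight k (F.v i)).comp (LinearMap.mulLeft k (F.u i)),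
        fun x => by simp [LinearMap.sum_apply]⟩)
    (fun w l h0 hl => by omega))

/-- The underlying space of the complete cochain complex: `C^r(A, A)` in degree `r ≥ 0` and
`C_p(A, A_{ν⁻¹})` in degree `-p-1`. -/
def CplxType (k A : Type u) [Field k] [Ring A] [Algebra k A] : ℤ → Type u
  | Int.ofNat r => Cochain k A r
  | Int.negSucc p => Chain k A p

noncomputable instance : ∀ n : ℤ, AddCommGroup (CplxType k A n)
  | Int.ofNat r => inferInstanceAs (AddCommGroup (Cochain k A r))
  | Int.negSucc p => inferInstanceAs (AddCommGroup (Chain k A p))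

noncomputable instance : ∀ n : ℤ, Module k (CplxType k A n)
  | Int.ofNat r => inferInstanceAs (Module k (Cochain k A r))
  | Int.negSucc p => inferInstanceAs (Module k (Chain k A p))

/-- Cup product: `(f ⌣ g)(a_1, …, a_{m+n}) = f(a_1, …, a_m) g(a_{m+1}, …, a_{m+n})`. -/
noncomputable def cup {m n s : ℕ} (h : m + n = s) (f : Cochain k A m) (g : Cochain k A n) :
    Cochain k A s :=
  Cochain.mk (fun w => ev f.1 w * ev g.1 (fun t => w (m + t)))
    (fun w j hj => by
      rcases lt_or_ge j m with hjm | hjm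
      · obtain ⟨L, hL⟩ := ev_lin f.1 w hjm (fun x => Function.update w j x) LinearMap.id
          (fun x t _ => by simp [Function.update_apply])
        refine ⟨(LinearMap.mulRight k (ev g.1 fun t => w (m + t))).comp L, fun x => ?_⟩
        have e : ev g.1 (fun t => Function.update w j x (m + t)) = ev g.1 (fun t => w (m + t)) :=
          ev_congr _ fun t _ => Function.update_of_ne (by omega) _ _
        simp [e, hL]
      · obtain ⟨L, hL⟩ := ev_lin g.1 (fun t => w (m + t)) (s := j - m) (by omega)
          (fun x t => Function.update w j x (m + t)) LinearMap.id
          (fun x t _ => by simp only [Function.update_apply, LinearMap.id_apply]; grind)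
        refine ⟨(LinearMap.mulLeft k (ev f.1 w)).comp L, fun x => ?_⟩
        have e : ev f.1 (Function.update w j x) = ev f.1 w :=
          ev_congr _ fun t _ => Function.update_of_ne (by omega) _ _
        simp [e, hL])
    (fun w t ht hw => by
      rcases lt_or_ge t m with htm | htm
      · rw [Cochain.ev_eq_zero f t htm hw, zero_mul]
      · rw [Cochain.ev_eq_zero g (t - m) (by omega)
          (by simpa [show m + (t - m) = t by omega] using hw), mul_zero])

/-- `α ⋆ f = a_0 ν⁻¹(f(a_1, …, a_m)) ⊗ a_{m+1} ⊗ ⋯ ⊗ a_p` for `α = a_0 ⊗ a_1 ⊗ ⋯ ⊗ a_p`,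
`m ≤ p`. -/
noncomputable def FrobeniusData.capRight {p m q : ℕ} (h : p = m + q) (f : Cochain k A m) :
    Chain k A p →ₗ[k] Chain k A q :=
  Chain.map (fun w => ev (gen k A q) (fun t =>
      if t = 0 then w 0 * F.ν.symm (ev f.1 (fun s => w (s + 1))) else w (m + t)))
    (fun w j hj => by
      rcases Nat.eq_zero_or_pos j with rfl | hj0
      · refine ev_lin _ (fun t =>
          if t = 0 then w 0 * F.ν.symm (ev f.1 (fun s => w (s + 1))) else w (m + t)) (s := 0)
          (by omega) _ (LinearMap.mulRight k (F.ν.symm (ev f.1 (fun s => w (s + 1)))))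
          fun x t ht => ?_
        simp only [Function.update_apply, LinearMap.mulRight_apply]; grind
      · rcases le_or_gt j m with hjm | hjm
        · obtain ⟨L, hL⟩ := ev_lin f.1 (fun s => w (s + 1)) (s := j - 1) (by omega)
            (fun x s => Function.update w j x (s + 1)) LinearMap.id
            (fun x t _ => by simp only [Function.update_apply, LinearMap.id_apply]; grind)
          refine ev_lin _ (fun t =>
            if t = 0 then w 0 * F.ν.symm (ev f.1 (fun s => w (s + 1))) else w (m + t)) (s := 0)
            (by omega) _ (((LinearMap.mulLeft k (w 0)).comp F.ν.symm.toLinearMap).comp L)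
            fun x t ht => ?_
          simp only [Function.update_apply, LinearMap.mulLeft_apply, LinearMap.comp_apply,
            AlgEquiv.toLinearMap_apply]
          grind
        · refine ev_lin _ (fun t =>
            if t = 0 then w 0 * F.ν.symm (ev f.1 (fun s => w (s + 1))) else w (m + t))
            (s := j - m) (by omega) _ LinearMap.id fun x t ht => ?_
          have e : ev f.1 (fun s => Function.update w j x (s + 1)) = ev f.1 (fun s => w (s + 1)) :=
            ev_congr _ fun t _ => Function.update_of_ne (by omega) _ _
          simp only [Function.update_apply, LinearMap.id_apply]; grind)
    (fun w l h0 hl hw => by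
      rcases le_or_gt l m with hlm | hlm
      · have e : ev f.1 (fun s => w (s + 1)) = 0 :=
          Cochain.ev_eq_zero f (l - 1) (by omega) (by simpa [show l - 1 + 1 = l by omega] using hw)
        exact MultilinearMap.map_coord_zero _ (0 : Fin (q + 1)) (by simp [e])
      · exact gen_eq_zero (l - m) (by omega) (by omega)
          (by simpa [show l - m ≠ 0 by omega, show m + (l - m) = l by omega] using hw))

/-- `f ⋆ α = f(a_{p-m+1}, …, a_p) a_0 ⊗ a_1 ⊗ ⋯ ⊗ a_{p-m}` for `α = a_0 ⊗ a_1 ⊗ ⋯ ⊗ a_p`,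
`m ≤ p`. -/
noncomputable def capLeft {p m q : ℕ} (h : p = m + q) (f : Cochain k A m) :
    Chain k A p →ₗ[k] Chain k A q :=
  Chain.map (fun w => ev (gen k A q) (fun t =>
      if t = 0 then ev f.1 (fun s => w (q + 1 + s)) * w 0 else w t))
    (fun w j hj => by
      rcases Nat.eq_zero_or_pos j with rfl | hj0
      · refine ev_lin _ (fun t =>
          if t = 0 then ev f.1 (fun s => w (q + 1 + s)) * w 0 else w t) (s := 0)
          (by omega) _ (LinearMap.mulLeft k (ev f.1 (fun s => w (q + 1 + s))))
          fun x t ht => ?_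
        have e : ev f.1 (fun s => Function.update w 0 x (q + 1 + s))
            = ev f.1 (fun s => w (q + 1 + s)) :=
          ev_congr _ fun t _ => Function.update_of_ne (by omega) _ _
        simp only [Function.update_apply, LinearMap.mulLeft_apply]; grind
      · rcases le_or_gt j q with hjq | hjq
        · refine ev_lin _ (fun t =>
            if t = 0 then ev f.1 (fun s => w (q + 1 + s)) * w 0 else w t) (s := j)
            (by omega) _ LinearMap.id fun x t ht => ?_
          have e : ev f.1 (fun s => Function.update w j x (q + 1 + s))
              = ev f.1 (fun s => w (q + 1 + s)) :=
            ev_congr _ fun t _ => Function.update_of_ne (by omega) _ _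
          simp only [Function.update_apply, LinearMap.id_apply]; grind
        · obtain ⟨L, hL⟩ := ev_lin f.1 (fun s => w (q + 1 + s)) (s := j - (q + 1)) (by omega)
            (fun x s => Function.update w j x (q + 1 + s)) LinearMap.id
            (fun x t _ => by simp only [Function.update_apply, LinearMap.id_apply]; grind)
          refine ev_lin _ (fun t =>
            if t = 0 then ev f.1 (fun s => w (q + 1 + s)) * w 0 else w t) (s := 0)
            (by omega) _ ((LinearMap.mulRight k (w 0)).comp L) fun x t ht => ?_
          simp only [Function.update_apply, LinearMap.mulRight_apply, LinearMap.comp_apply]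
          grind)
    (fun w l h0 hl hw => by
      rcases le_or_gt l q with hlq | hlq
      · exact gen_eq_zero l h0 hlq (by simpa [h0.ne'] using hw)
      · have e : ev f.1 (fun s => w (q + 1 + s)) = 0 :=
          Cochain.ev_eq_zero f (l - (q + 1)) (by omega)
            (by simpa [show q + 1 + (l - (q + 1)) = l by omega] using hw)
        exact MultilinearMap.map_coord_zero _ (0 : Fin (q + 1)) (by simp [e]))

/-- `(f ⋆ α)(b_1, …, b_n) = ∑ f(b_1, …, b_n, u_i ν(a_0), a_1, …, a_p) v_i` for
`α = a_0 ⊗ a_1 ⊗ ⋯ ⊗ a_p` and `f ∈ C^m(A, A)`, `m = p + 1 + n`. -/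
noncomputable def FrobeniusData.insertLeft {p m n : ℕ} (h : m = p + 1 + n) (f : Cochain k A m) :
    Chain k A p →ₗ[k] Cochain k A n :=
  Chain.map (fun a => Cochain.mk (fun b => ∑ i, ev f.1 (fun t =>
        if t < n then b t else if t = n then F.u i * F.ν (a 0) else a (t - n)) * F.v i)
      (LinearInEach.sum _ fun i _ => LinearInEach.comp (LinearMap.mulRight k (F.v i))
        fun b j hj => ev_lin f.1 (fun t =>
          if t < n then b t else if t = n then F.u i * F.ν (a 0) else a (t - n)) (s := j)
          (by omega) _ LinearMap.id fun x t ht => by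
            simp only [Function.update_apply, LinearMap.id_apply]; grind)
      (fun b t ht hb => Finset.sum_eq_zero fun i _ => by
        rw [Cochain.ev_eq_zero f t (by omega) (by simpa [ht] using hb), zero_mul]))
    (LinearInEach.of_cochain fun b => by
      refine LinearInEach.sum _ fun i _ => LinearInEach.comp (LinearMap.mulRight k (F.v i)) ?_
      intro a j hj
      rcases Nat.eq_zero_or_pos j with rfl | hj0
      · refine ev_lin f.1 (fun t =>
          if t < n then seq b t else if t = n then F.u i * F.ν (a 0) else a (t - n)) (s := n)
          (by omega) _ ((LinearMap.mulLeft k (F.u i)).comp F.ν.toLinearMap) fun x t ht => ?_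
        simp only [Function.update_apply, LinearMap.comp_apply, LinearMap.mulLeft_apply,
          AlgEquiv.toLinearMap_apply]
        grind
      · refine ev_lin f.1 (fun t =>
          if t < n then seq b t else if t = n then F.u i * F.ν (a 0) else a (t - n)) (s := n + j)
          (by omega) _ LinearMap.id fun x t ht => ?_
        simp only [Function.update_apply, LinearMap.id_apply]
        grind)
    (fun a l h0 hl ha => by
      ext b
      refine Finset.sum_eq_zero fun i _ => ?_
      rw [Cochain.ev_eq_zero f (n + l) (by omega) (by
        simpa [show ¬ n + l < n by omega, show n + l ≠ n by omega, h0.ne'] using ha), zero_mul])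

/-- `(α ⋆ f)(b_1, …, b_n) = ∑ u_i ν(a_0) f(a_1, …, a_p, v_i, b_1, …, b_n)` for
`α = a_0 ⊗ a_1 ⊗ ⋯ ⊗ a_p` and `f ∈ C^m(A, A)`, `m = p + 1 + n`. -/
noncomputable def FrobeniusData.insertRight {p m n : ℕ} (h : m = p + 1 + n) (f : Cochain k A m) :
    Chain k A p →ₗ[k] Cochain k A n :=
  Chain.map (fun a => Cochain.mk (fun b => ∑ i, F.u i * F.ν (a 0) * ev f.1 (fun t =>
        if t < p then a (t + 1) else if t = p then F.v i else b (t - (p + 1))))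
      (LinearInEach.sum _ fun i _ => LinearInEach.comp (LinearMap.mulLeft k (F.u i * F.ν (a 0)))
        fun b j hj => ev_lin f.1 (fun t =>
          if t < p then a (t + 1) else if t = p then F.v i else b (t - (p + 1)))
          (s := p + 1 + j) (by omega) _ LinearMap.id fun x t ht => by
            simp only [Function.update_apply, LinearMap.id_apply]; grind)
      (fun b t ht hb => Finset.sum_eq_zero fun i _ => by
        rw [Cochain.ev_eq_zero f (p + 1 + t) (by omega) (by
          simpa [show ¬ p + 1 + t < p by omega, show p + 1 + t ≠ p by omega] using hb),
          mul_zero]))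
    (LinearInEach.of_cochain fun b => by
      refine LinearInEach.sum _ fun i _ => ?_
      intro a j hj
      rcases Nat.eq_zero_or_pos j with rfl | hj0
      · exact ⟨((LinearMap.mulRight k (ev f.1 (fun t => if t < p then a (t + 1) else
          if t = p then F.v i else seq b (t - (p + 1))))).comp (LinearMap.mulLeft k (F.u i))).comp
            F.ν.toLinearMap, fun x => by simp⟩
      · obtain ⟨L, hL⟩ := ev_lin f.1 (fun t => if t < p then a (t + 1) else
            if t = p then F.v i else seq b (t - (p + 1))) (s := j - 1) (by omega)
          (fun x t => if t < p then Function.update a j x (t + 1) else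
            if t = p then F.v i else seq b (t - (p + 1))) LinearMap.id (fun x t ht => by
              simp only [Function.update_apply, LinearMap.id_apply]; grind)
        exact ⟨(LinearMap.mulLeft k (F.u i * F.ν (a 0))).comp L, fun x => by
          simp [hL, Function.update_of_ne hj0.ne, mul_assoc]⟩)
    (fun a l h0 hl ha => by
      ext b
      refine Finset.sum_eq_zero fun i _ => ?_
      rw [Cochain.ev_eq_zero f (l - 1) (by omega) (by
        simpa [show l - 1 < p by omega, show l - 1 + 1 = l by omega] using ha), mul_zero])

/-- `α ⋆ β = ∑ v_i b_0 ⊗ b_1 ⊗ ⋯ ⊗ b_q ⊗ u_i ν(a_0) ⊗ a_1 ⊗ ⋯ ⊗ a_p` for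
`α = a_0 ⊗ a_1 ⊗ ⋯ ⊗ a_p` and `β = b_0 ⊗ b_1 ⊗ ⋯ ⊗ b_q`. -/
noncomputable def FrobeniusData.chainMul {p q r : ℕ} (h : p + q + 1 = r) :
    Chain k A p →ₗ[k] Chain k A q →ₗ[k] Chain k A r :=
  Chain.map (fun a => Chain.map (fun b => ∑ i, ev (gen k A r) (fun t =>
        if t = 0 then F.v i * b 0 else if t ≤ q then b t
        else if t = q + 1 then F.u i * F.ν (a 0) else a (t - (q + 1))))
      (LinearInEach.sum _ fun i _ => fun b j hj => by
        rcases Nat.eq_zero_or_pos j with rfl | hj0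
        · refine ev_lin _ (fun t => if t = 0 then F.v i * b 0 else if t ≤ q then b t
            else if t = q + 1 then F.u i * F.ν (a 0) else a (t - (q + 1))) (s := 0) (by omega) _
            (LinearMap.mulLeft k (F.v i)) fun x t ht => ?_
          simp only [Function.update_apply, LinearMap.mulLeft_apply]; grind
        · refine ev_lin _ (fun t => if t = 0 then F.v i * b 0 else if t ≤ q then b t
            else if t = q + 1 then F.u i * F.ν (a 0) else a (t - (q + 1))) (s := j) (by omega) _
            LinearMap.id fun x t ht => ?_
          simp only [Function.update_apply, LinearMap.id_apply]; grind)
      (fun b l h0 hl hb => Finset.sum_eq_zero fun i _ =>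
        gen_eq_zero l h0 (by omega) (by simpa [h0.ne', hl] using hb)))
    (LinearInEach.of_hom fun b => by
      simp only [Chain.map_gen]
      refine LinearInEach.sum _ fun i _ => fun a j hj => ?_
      rcases Nat.eq_zero_or_pos j with rfl | hj0
      · refine ev_lin _ (fun t => if t = 0 then F.v i * seq b 0 else if t ≤ q then seq b t
          else if t = q + 1 then F.u i * F.ν (a 0) else a (t - (q + 1))) (s := q + 1) (by omega) _
          ((LinearMap.mulLeft k (F.u i)).comp F.ν.toLinearMap) fun x t ht => ?_
        simp only [Function.update_apply, LinearMap.comp_apply, LinearMap.mulLeft_apply,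
          AlgEquiv.toLinearMap_apply]
        grind
      · refine ev_lin _ (fun t => if t = 0 then F.v i * seq b 0 else if t ≤ q then seq b t
          else if t = q + 1 then F.u i * F.ν (a 0) else a (t - (q + 1))) (s := q + 1 + j)
          (by omega) _ LinearMap.id fun x t ht => ?_
        simp only [Function.update_apply, LinearMap.id_apply]; grind)
    (fun a l h0 hl ha => by
      refine Chain.hom_ext fun b => ?_
      simp only [Chain.map_gen]
      refine Finset.sum_eq_zero fun i _ => gen_eq_zero (q + 1 + l) (by omega) (by omega) ?_
      simpa [show ¬ q + 1 + l ≤ q by omega, show l ≠ 0 by omega] using ha)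

/-- The `⋆`-product `D^m ⊗ D^n → D^r`, `r = m + n`, of the complete cochain complex. -/
noncomputable def FrobeniusData.star : {m n r : ℤ} → m + n = r →
    CplxType k A m → CplxType k A n → CplxType k A r
  | Int.ofNat m, Int.ofNat n, Int.ofNat r, h => fun f g =>
    cup (m := m) (n := n) (s := r) (by simp only [Int.ofNat_eq_natCast] at h; omega) f g
  | Int.negSucc p, Int.ofNat m, Int.negSucc q, h => fun α f =>
    F.capRight (p := p) (m := m) (q := q)
      (by simp only [Int.ofNat_eq_natCast, Int.negSucc_eq] at h; omega) f α
  | Int.ofNat m, Int.negSucc p, Int.negSucc q, h => fun f α =>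
    capLeft (p := p) (m := m) (q := q)
      (by simp only [Int.ofNat_eq_natCast, Int.negSucc_eq] at h; omega) f α
  | Int.ofNat m, Int.negSucc p, Int.ofNat n, h => fun f α =>
    F.insertLeft (p := p) (m := m) (n := n)
      (by simp only [Int.ofNat_eq_natCast, Int.negSucc_eq] at h; omega) f α
  | Int.negSucc p, Int.ofNat m, Int.ofNat n, h => fun α f =>
    F.insertRight (p := p) (m := m) (n := n)
      (by simp only [Int.ofNat_eq_natCast, Int.negSucc_eq] at h; omega) f α
  | Int.negSucc p, Int.negSucc q, Int.negSucc r, h => fun α β =>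
    F.chainMul (p := p) (q := q) (r := r) (by simp only [Int.negSucc_eq] at h; omega) α β
  | Int.ofNat _, Int.ofNat _, Int.negSucc _, h =>
    absurd h (by simp only [Int.ofNat_eq_natCast, Int.negSucc_eq]; omega)
  | Int.negSucc _, Int.negSucc _, Int.ofNat _, h =>
    absurd h (by simp only [Int.ofNat_eq_natCast, Int.negSucc_eq]; omega)

/-- The differential `d^n : D^n → D^{n+1}` of the complete cochain complex. -/
noncomputable def FrobeniusData.d : (n : ℤ) → CplxType k A n →ₗ[k] CplxType k A (n + 1)
  | Int.ofNat r => δ r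
  | Int.negSucc 0 => F.norm
  | Int.negSucc (p + 1) => bdry F.ν.symm p

/-- Cocycles of degree `n`. -/
noncomputable def FrobeniusData.cocycles (n : ℤ) : Submodule k (CplxType k A n) :=
  LinearMap.ker (F.d n)

/-- The image of a family of subspaces `V` of the complex under the differential, in degree `n`. -/
noncomputable def FrobeniusData.dImage (V : ∀ n : ℤ, Submodule k (CplxType k A n)) :
    (n : ℤ) → Submodule k (CplxType k A n)
  | Int.ofNat 0 => (V (Int.negSucc 0)).map F.norm
  | Int.ofNat (r + 1) => (V (Int.ofNat r)).map (δ r)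
  | Int.negSucc p => (V (Int.negSucc (p + 1))).map (bdry F.ν.symm p)

/-- Coboundaries of degree `n`. -/
noncomputable def FrobeniusData.coboundaries (n : ℤ) : Submodule k (CplxType k A n) :=
  F.dImage (fun _ => ⊤) n

/-- The complete cohomology group `ĤH^n(A)`. -/
abbrev FrobeniusData.HH (n : ℤ) : Type u :=
  F.cocycles n ⧸ (F.coboundaries n).submoduleOf (F.cocycles n)

/-- The class of a cocycle in `ĤH^n(A)`. -/
noncomputable def FrobeniusData.cls {n : ℤ} (z : CplxType k A n) (hz : z ∈ F.cocycles n) :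
    F.HH n :=
  Submodule.Quotient.mk ⟨z, hz⟩

/-- The complete cohomology `ĤH^•(A) = ⨁_n ĤH^n(A)`. -/
abbrev FrobeniusData.Cohomology : Type u := ⨁ n : ℤ, F.HH n

/-- The class of a cocycle of degree `n` in `ĤH^•(A)`. -/
noncomputable def FrobeniusData.tot {n : ℤ} (z : CplxType k A n) (hz : z ∈ F.cocycles n) :
    F.Cohomology :=
  DirectSum.lof k ℤ F.HH n (F.cls z hz)

/-- `mul` is the product induced on `ĤH^•(A)` by the `⋆`-product of cocycles (in particular this
product is well-defined). -/
def FrobeniusData.IsStarProduct (mul : F.Cohomology →ₗ[k] F.Cohomology →ₗ[k] F.Cohomology) :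
    Prop :=
  ∀ (m n : ℤ) (x : CplxType k A m) (y : CplxType k A n) (hx : x ∈ F.cocycles m)
    (hy : y ∈ F.cocycles n), ∃ hxy : F.star (rfl : m + n = m + n) x y ∈ F.cocycles (m + n),
      mul (F.tot x hx) (F.tot y hy) = F.tot _ hxy

/-- The weight one part `D^n_{(1)}` of the complex. In degree `r ≥ 0`: the cochains `f` that map
`Ā_{μ_1} ⊗ ⋯ ⊗ Ā_{μ_r}` to `A_{μ_1 ⋯ μ_r}`; in degree `-p-1`: the sum of all
`A_{μ_0} ⊗ Ā_{μ_1} ⊗ ⋯ ⊗ Ā_{μ_p}` with `μ_0 ⋯ μ_p = 1`; here `A_μ` is the eigenspace of `ν` for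
the eigenvalue `μ`. -/
noncomputable def FrobeniusData.weightOne : (n : ℤ) → Submodule k (CplxType k A n)
  | Int.ofNat r =>
    ({ carrier := {f | ∀ (c : Fin r → k) (a : Fin r → A), (∀ t, F.ν (a t) = c t • a t) →
          F.ν (f.1 a) = (∏ t, c t) • f.1 a}
       zero_mem' := by intro c a _; simp
       add_mem' := by
         intro f g hf hg c a h
         simp [hf c a h, hg c a h]
       smul_mem' := by
         intro x f hf c a h
         simp [hf c a h, smul_comm x] } : Submodule k (Cochain k A r))
  | Int.negSucc p =>
    (Submodule.span k {x | ∃ (c : Fin (p + 1) → k) (a : Fin (p + 1) → A),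
      (∀ t, F.ν (a t) = c t • a t) ∧ ∏ t, c t = 1 ∧ x = gen k A p a} :
        Submodule k (Chain k A p))

/-- Cocycles of weight one. -/
noncomputable def FrobeniusData.cocyclesOne (n : ℤ) : Submodule k (CplxType k A n) :=
  F.cocycles n ⊓ F.weightOne n

/-- Coboundaries of weight one cochains. -/
noncomputable def FrobeniusData.coboundariesOne (n : ℤ) : Submodule k (CplxType k A n) :=
  F.dImage F.weightOne n

theorem FrobeniusData.coboundariesOne_le (n : ℤ) : F.coboundariesOne n ≤ F.coboundaries n := by
  unfold FrobeniusData.coboundariesOne FrobeniusData.coboundaries FrobeniusData.dImage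
  split <;> exact Submodule.map_mono le_top

/-- `ĤH^n_{(1)}(A)`, the cohomology of the weight one subcomplex. -/
abbrev FrobeniusData.HHOne (n : ℤ) : Type u :=
  F.cocyclesOne n ⧸ (F.coboundariesOne n).submoduleOf (F.cocyclesOne n)

/-- The canonical map `ĤH^n_{(1)}(A) → ĤH^n(A)`. -/
noncomputable def FrobeniusData.oneToHH (n : ℤ) : F.HHOne n →ₗ[k] F.HH n :=
  Submodule.mapQ _ _ (Submodule.inclusion inf_le_left)
    (fun _ hx => F.coboundariesOne_le n hx)

/-- The tuple of the `i`-th term of the twisted Connes operator: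
`(1, a_i, …, a_p, a_0, σ(a_1), …, σ(a_{i-1}))`. -/
def connesTerm (σ : A ≃ₐ[k] A) (p i : ℕ) (w : ℕ → A) : ℕ → A := fun t =>
  if t = 0 then 1 else if t < p + 2 - i then w (i + t - 1)
  else if t = p + 2 - i then w 0 else σ (w (t - (p + 2 - i)))

/-- The twisted Connes operator `B^σ_p : C_p(A, A_σ) → C_{p+1}(A, A_σ)`,
`a_0 ⊗ ⋯ ⊗ a_p ↦ ∑_{i=1}^{p+1} (-1)^{ip} 1 ⊗ a_i ⊗ ⋯ ⊗ a_p ⊗ a_0 ⊗ σ(a_1) ⊗ ⋯ ⊗ σ(a_{i-1})`. -/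
noncomputable def connes (σ : A ≃ₐ[k] A) (p : ℕ) : Chain k A p →ₗ[k] Chain k A (p + 1) :=
  Chain.map (fun w => ∑ i ∈ Finset.Icc 1 (p + 1),
      ((-1 : k) ^ (i * p)) • ev (gen k A (p + 1)) (connesTerm σ p i w))
    (LinearInEach.sum _ fun i hi => LinearInEach.smul _ fun w j hj => by
      rw [Finset.mem_Icc] at hi
      rcases Nat.eq_zero_or_pos j with rfl | hj0
      · refine ev_lin _ (connesTerm σ p i w) (s := p + 2 - i) (by omega) _ LinearMap.id
          fun x t ht => ?_
        simp only [connesTerm, Function.update_apply, LinearMap.id_apply]; grind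
      · rcases lt_or_ge j i with hji | hji
        · refine ev_lin _ (connesTerm σ p i w) (s := p + 2 - i + j) (by omega) _ σ.toLinearMap
            fun x t ht => ?_
          simp only [connesTerm, Function.update_apply, AlgEquiv.toLinearMap_apply]; grind
        · refine ev_lin _ (connesTerm σ p i w) (s := j - i + 1) (by omega) _ LinearMap.id
            fun x t ht => ?_
          simp only [connesTerm, Function.update_apply, LinearMap.id_apply]; grind)
    (fun w l h0 hl hw => Finset.sum_eq_zero fun i hi => by
      rw [Finset.mem_Icc] at hi
      rcases lt_or_ge l i with hli | hli
      · rw [gen_eq_zero (p + 2 - i + l) (by omega) (by omega), smul_zero]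
        simp only [connesTerm]
        rw [if_neg (by omega), if_neg (by omega), if_neg (by omega),
          show p + 2 - i + l - (p + 2 - i) = l by omega, hw, map_one]
      · rw [gen_eq_zero (l - i + 1) (by omega) (by omega), smul_zero]
        simp only [connesTerm]
        rw [if_neg (by omega), if_pos (by omega), show i + (l - i + 1) - 1 = l by omega, hw])

/-- `(a_i, …, a_s, b, ν(a_1), …, ν(a_{i-1}))`, where `a_j` is the entry `w (j-1)`. -/
def deltaTerm (ν : A ≃ₐ[k] A) (s i : ℕ) (b : A) (w : ℕ → A) : ℕ → A := fun t =>
  if t < s + 1 - i then w (i - 1 + t) else if t = s + 1 - i then b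
  else ν (w (t - (s + 2 - i)))

/-- `∑_{i=1}^{s+1} (-1)^{is} ⟨f(a_i, …, a_s, b, ν(a_1), …, ν(a_{i-1})), 1⟩`. -/
noncomputable def FrobeniusData.deltaForm (s : ℕ) (f : Cochain k A (s + 1)) (b : A)
    (w : ℕ → A) : k :=
  ∑ i ∈ Finset.Icc 1 (s + 1), ((-1 : k) ^ (i * s)) • F.form (ev f.1 (deltaTerm F.ν s i b w)) 1

theorem FrobeniusData.deltaForm_lin (s : ℕ) (f : Cochain k A (s + 1)) (b : A) :
    LinearInEach s (F.deltaForm s f b) k :=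
  LinearInEach.sum _ fun i hi => LinearInEach.smul _
    (LinearInEach.comp (F.form.flip 1) fun w j hj => by
      rw [Finset.mem_Icc] at hi
      rcases lt_or_ge (j + 1) i with hji | hji
      · refine ev_lin _ (deltaTerm F.ν s i b w) (s := s + 2 - i + j) (by omega) _
          F.ν.toLinearMap fun x t ht => ?_
        simp only [deltaTerm, Function.update_apply, AlgEquiv.toLinearMap_apply]; grind
      · refine ev_lin _ (deltaTerm F.ν s i b w) (s := j - (i - 1)) (by omega) _
          LinearMap.id fun x t ht => ?_
        simp only [deltaTerm, Function.update_apply, LinearMap.id_apply]; grind)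

theorem FrobeniusData.deltaForm_eq_zero (s : ℕ) (f : Cochain k A (s + 1)) (b : A) (w : ℕ → A)
    (t : ℕ) (ht : t < s) (hw : w t = 1) : F.deltaForm s f b w = 0 := by
  refine Finset.sum_eq_zero fun i hi => ?_
  rw [Finset.mem_Icc] at hi
  rcases lt_or_ge (t + 1) i with hti | hti
  · rw [Cochain.ev_eq_zero f (s + 2 - i + t) (by omega)]
    · simp
    · simp only [deltaTerm]
      rw [if_neg (by omega), if_neg (by omega),
        show s + 2 - i + t - (s + 2 - i) = t by omega, hw, map_one]
  · rw [Cochain.ev_eq_zero f (t - (i - 1)) (by omega)]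
    · simp
    · simp only [deltaTerm]
      rw [if_pos (by omega), show i - 1 + (t - (i - 1)) = t by omega, hw]

/-- `Δ^ν : C^{s+1}(A, A) → C^s(A, A)`, the dual of the twisted Connes operator: the operator with
`⟨Δ^ν(f)(a_1, …, a_s), b⟩ = ∑_{i=1}^{s+1} (-1)^{is} ⟨f(a_i, …, a_s, b, ν(a_1), …, ν(a_{i-1})), 1⟩`
for all `b`, see `FrobeniusData.form_delta`. -/
noncomputable def FrobeniusData.delta (s : ℕ) : Cochain k A (s + 1) →ₗ[k] Cochain k A s where
  toFun f := Cochain.mk (fun w => ∑ l, F.deltaForm s f (F.u l) w • F.v l)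
    (LinearInEach.sum _ fun l _ => LinearInEach.comp (LinearMap.toSpanSingleton k A (F.v l))
      (F.deltaForm_lin s f (F.u l)))
    (fun w t ht hw => Finset.sum_eq_zero fun l _ => by
      rw [F.deltaForm_eq_zero s f _ w t ht hw, zero_smul])
  map_add' f g := by
    ext a
    simp [Cochain.mk, ev, FrobeniusData.deltaForm, Finset.sum_add_distrib, mul_add, add_smul]
  map_smul' c f := by
    ext a
    simp only [Cochain.mk, ev, FrobeniusData.deltaForm, mkMulti_apply, Submodule.coe_smul,
      smul_apply, map_smul, LinearMap.smul_apply, RingHom.id_apply, smul_comm _ c]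
    rw [Finset.smul_sum]
    refine Finset.sum_congr rfl fun x _ => ?_
    rw [← Finset.smul_sum, smul_assoc]

theorem FrobeniusData.form_delta (s : ℕ) (f : Cochain k A (s + 1)) (a : Fin s → A) (b : A) :
    F.form ((F.delta s f).1 a) b = ∑ i ∈ Finset.Icc 1 (s + 1),
      ((-1 : k) ^ (i * s)) • F.form (ev f.1 (deltaTerm F.ν s i b (seq a))) 1 := by
  have hlin : ∀ i ∈ Finset.Icc 1 (s + 1), ∃ L : A →ₗ[k] A,
      ∀ b, ev f.1 (deltaTerm F.ν s i b (seq a)) = L b := fun i hi => by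
    rw [Finset.mem_Icc] at hi
    refine ev_lin _ (deltaTerm F.ν s i 0 (seq a)) (s := s + 1 - i) (by omega) _ LinearMap.id
      fun x t ht => ?_
    simp only [deltaTerm, LinearMap.id_apply]; grind
  choose! L hL using hlin
  let R : A →ₗ[k] k := ∑ i ∈ Finset.Icc 1 (s + 1), ((-1 : k) ^ (i * s)) • (F.form.flip 1).comp (L i)
  have hR : ∀ b, R b = F.deltaForm s f b (seq a) := by
    intro b
    simp only [R, LinearMap.sum_apply, LinearMap.smul_apply, LinearMap.comp_apply,
      LinearMap.flip_apply, FrobeniusData.deltaForm]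
    exact Finset.sum_congr rfl fun i hi => by rw [hL i hi]
  have key : F.form ((F.delta s f).1 a) = R := by
    refine F.u.ext fun j => ?_
    simp [FrobeniusData.delta, Cochain.mk, F.form_dual, hR]
  rw [key, hR, FrobeniusData.deltaForm]

/-- The operator `Δ̂` on the complete cochain complex, `D^{s+1} → D^s`: equal to `Δ^ν` on `D^r` for
`r ≥ 1`, to `0` for `r = 0`, and to `(-1)^r B^{ν⁻¹}_{-r-1}` for `r ≤ -1`. -/
noncomputable def FrobeniusData.bv : (s : ℤ) → CplxType k A (s + 1) →ₗ[k] CplxType k A s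
  | Int.ofNat s => F.delta s
  | Int.negSucc 0 => (0 : Cochain k A 0 →ₗ[k] Chain k A 0)
  | Int.negSucc (p + 1) => ((-1 : k) ^ (p + 1)) • connes F.ν.symm p

/-- `Δ` is the operator induced on `ĤH^•(A)` by `Δ̂`: the canonical maps
`ĤH^n_{(1)}(A) → ĤH^n(A)` are bijective, `Δ̂` maps cocycles of weight one to cocycles of
weight one, and `Δ` sends the class of a cocycle `z` of weight one to the class of `Δ̂ z`. -/
def FrobeniusData.IsBVOperator (Δ : F.Cohomology →ₗ[k] F.Cohomology) : Prop :=
  (∀ n : ℤ, Function.Bijective (F.oneToHH n)) ∧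
  (∀ (s : ℤ) (z : CplxType k A (s + 1)), z ∈ F.cocyclesOne (s + 1) →
    F.bv s z ∈ F.cocyclesOne s) ∧
  ∀ (s : ℤ) (z : CplxType k A (s + 1)) (hz : z ∈ F.cocycles (s + 1)),
    z ∈ F.weightOne (s + 1) → ∃ hz' : F.bv s z ∈ F.cocycles s,
      Δ (F.tot z hz) = F.tot (F.bv s z) hz'

/-- The bracket `{x, y}` of classes `x`, `y` of degrees `m`, `n` attached to a product and an
operator `Δ`: `(-1)^{mn+m+n} ((-1)^{m+1} Δ(x y) + (-1)^m Δ(x) y + x Δ(y))`. -/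
def bvBracket {H : Type*} [AddCommGroup H] [Module k H] (mul : H →ₗ[k] H →ₗ[k] H)
    (Δ : H →ₗ[k] H) (m n : ℤ) (x y : H) : H :=
  (-1 : k) ^ (m * n + m + n) • ((-1 : k) ^ (m + 1) • Δ (mul x y) + (-1 : k) ^ m • mul (Δ x) y
    + mul x (Δ y))

end Frobenius

section PathAlgebra

/-- The relations of the path algebra of a finite quiver with vertices `V`, arrows `E`, among
the vertices `e_v` and the arrows. Paths are written from left to right: an arrow
`a : s(a) → t(a)` satisfies `e_{s(a)} a = a = a e_{t(a)}`. -/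
inductive PathRel (k : Type u) [Field k] {V E : Type} [Fintype V] (src tgt : E → V) :
    FreeAlgebra k (V ⊕ E) → FreeAlgebra k (V ⊕ E) → Prop
  | idem (v : V) : PathRel k src tgt
      (FreeAlgebra.ι k (Sum.inl v) * FreeAlgebra.ι k (Sum.inl v)) (FreeAlgebra.ι k (Sum.inl v))
  | orth (v w : V) : v ≠ w → PathRel k src tgt
      (FreeAlgebra.ι k (Sum.inl v) * FreeAlgebra.ι k (Sum.inl w)) 0
  | one : PathRel k src tgt (∑ v, FreeAlgebra.ι k (Sum.inl v)) 1
  | source (a : E) : PathRel k src tgt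
      (FreeAlgebra.ι k (Sum.inl (src a)) * FreeAlgebra.ι k (Sum.inr a))
      (FreeAlgebra.ι k (Sum.inr a))
  | target (a : E) : PathRel k src tgt
      (FreeAlgebra.ι k (Sum.inr a) * FreeAlgebra.ι k (Sum.inl (tgt a)))
      (FreeAlgebra.ι k (Sum.inr a))

/-- The path algebra `kQ` of a finite quiver `Q`. -/
abbrev PathAlgebra (k : Type u) [Field k] {V E : Type} [Fintype V] (src tgt : E → V) : Type u :=
  RingQuot (PathRel k src tgt)

/-- The generators of the path algebra: the trivial paths and the arrows. -/
noncomputable def pathGen (k : Type u) [Field k] {V E : Type} [Fintype V] (src tgt : E → V)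
    (x : V ⊕ E) : PathAlgebra k src tgt :=
  RingQuot.mkAlgHom k (PathRel k src tgt) (FreeAlgebra.ι k x)

/-- The arrow ideal `R_Q` of `kQ`. -/
noncomputable def arrowIdeal (k : Type u) [Field k] {V E : Type} [Fintype V]
    (src tgt : E → V) : Ideal (PathAlgebra k src tgt) :=
  (TwoSidedIdeal.span (Set.range fun a : E => pathGen k src tgt (Sum.inr a))).asIdeal

instance (k : Type u) [Field k] {V E : Type} [Fintype V] (src tgt : E → V) :
    (arrowIdeal k src tgt).IsTwoSided := by
  unfold arrowIdeal; infer_instance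

end PathAlgebra

section ThreeCycle

/-- The algebra `A = kQ / R_Q²` for the quiver `Q` with three vertices and arrows
`α_i : i → i + 1` (`i` modulo 3), in coordinates: `x = ∑ x.1 i • e_i + ∑ x.2 i • α_i`.
See `ThreeCycle.equivQuotient` for the comparison with the quotient of the path algebra. -/
def ThreeCycle (k : Type u) : Type u := (Fin 3 → k) × (Fin 3 → k)

namespace ThreeCycle

variable {k : Type u} [Field k]

noncomputable instance : AddCommGroup (ThreeCycle k) :=
  inferInstanceAs (AddCommGroup ((Fin 3 → k) × (Fin 3 → k)))

noncomputable instance : Module k (ThreeCycle k) :=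
  inferInstanceAs (Module k ((Fin 3 → k) × (Fin 3 → k)))

@[ext] theorem ext {k : Type u} {x y : ThreeCycle k} (h1 : ∀ i, x.1 i = y.1 i) (h2 : ∀ i, x.2 i = y.2 i) :
    x = y := Prod.ext (funext h1) (funext h2)

/-- `e_i e_i = e_i`, `e_i α_i = α_i = α_i e_{i+1}`, and all other products of the basis elements
vanish. -/
instance : Mul (ThreeCycle k) :=
  ⟨fun x y => (fun i => x.1 i * y.1 i, fun i => x.1 i * y.2 i + x.2 i * y.1 (i + 1))⟩

instance : One (ThreeCycle k) := ⟨(fun _ => 1, fun _ => 0)⟩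

@[simp] theorem add_fst (x y : ThreeCycle k) (i : Fin 3) : (x + y).1 i = x.1 i + y.1 i := rfl
@[simp] theorem add_snd (x y : ThreeCycle k) (i : Fin 3) : (x + y).2 i = x.2 i + y.2 i := rfl
@[simp] theorem zero_fst (i : Fin 3) : (0 : ThreeCycle k).1 i = 0 := rfl
@[simp] theorem zero_snd (i : Fin 3) : (0 : ThreeCycle k).2 i = 0 := rfl
@[simp] theorem smul_fst (c : k) (x : ThreeCycle k) (i : Fin 3) : (c • x).1 i = c * x.1 i := rfl
@[simp] theorem smul_snd (c : k) (x : ThreeCycle k) (i : Fin 3) : (c • x).2 i = c * x.2 i := rfl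
@[simp] theorem mul_fst (x y : ThreeCycle k) (i : Fin 3) : (x * y).1 i = x.1 i * y.1 i := rfl
@[simp] theorem mul_snd (x y : ThreeCycle k) (i : Fin 3) :
    (x * y).2 i = x.1 i * y.2 i + x.2 i * y.1 (i + 1) := rfl
@[simp] theorem one_fst (i : Fin 3) : (1 : ThreeCycle k).1 i = 1 := rfl
@[simp] theorem one_snd (i : Fin 3) : (1 : ThreeCycle k).2 i = 0 := rfl

noncomputable instance : Ring (ThreeCycle k) where
  __ := (inferInstance : AddCommGroup (ThreeCycle k))
  mul_assoc x y z := by ext i <;> simp <;> ring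
  one_mul x := by ext i <;> simp
  mul_one x := by ext i <;> simp
  zero_mul x := by ext i <;> simp
  mul_zero x := by ext i <;> simp
  left_distrib x y z := by ext i <;> simp <;> ring
  right_distrib x y z := by ext i <;> simp <;> ring

noncomputable instance : Algebra k (ThreeCycle k) :=
  Algebra.ofModule (fun c x y => by ext i <;> simp <;> ring)
    (fun c x y => by ext i <;> simp <;> ring)

variable (k) in
/-- The idempotent `e_i`. -/
def e (i : Fin 3) : ThreeCycle k := (Pi.single i 1, 0)

variable (k) in
/-- The arrow `α_i : i → i + 1`. -/
def arr (i : Fin 3) : ThreeCycle k := (0, Pi.single i 1)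

@[simp] theorem e_fst (i j : Fin 3) : (e k i).1 j = if j = i then 1 else 0 :=
  Pi.single_apply i 1 j
@[simp] theorem e_snd (i j : Fin 3) : (e k i).2 j = 0 := rfl
@[simp] theorem arr_fst (i j : Fin 3) : (arr k i).1 j = 0 := rfl
@[simp] theorem arr_snd (i j : Fin 3) : (arr k i).2 j = if j = i then 1 else 0 :=
  Pi.single_apply i 1 j

variable (k) in
/-- The basis `e_1, e_2, e_3, α_1, α_2, α_3`. -/
noncomputable def basisU : Module.Basis (Fin 3 ⊕ Fin 3) k (ThreeCycle k) :=
  Module.Basis.ofEquivFun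
    { toFun := fun x => Sum.elim x.1 x.2
      invFun := fun f => (fun i => f (Sum.inl i), fun i => f (Sum.inr i))
      map_add' := fun x y => by ext (i | i) <;> simp
      map_smul' := fun c x => by ext (i | i) <;> simp
      left_inv := fun x => rfl
      right_inv := fun f => by ext (i | i) <;> rfl }

theorem basisU_inl (i : Fin 3) : basisU k (Sum.inl i) = e k i := by
  rw [basisU, Module.Basis.coe_ofEquivFun]
  ext j
  · change (Pi.single (Sum.inl i) (1 : k) : Fin 3 ⊕ Fin 3 → k) (Sum.inl j) = _
    simp [Pi.single_apply]
  · change (Pi.single (Sum.inl i) (1 : k) : Fin 3 ⊕ Fin 3 → k) (Sum.inr j) = _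
    simp

theorem basisU_inr (i : Fin 3) : basisU k (Sum.inr i) = arr k i := by
  rw [basisU, Module.Basis.coe_ofEquivFun]
  ext j
  · change (Pi.single (Sum.inr i) (1 : k) : Fin 3 ⊕ Fin 3 → k) (Sum.inl j) = _
    simp
  · change (Pi.single (Sum.inr i) (1 : k) : Fin 3 ⊕ Fin 3 → k) (Sum.inr j) = _
    simp [Pi.single_apply]

variable (k) in
/-- The dual basis `α_3, α_1, α_2, e_1, e_2, e_3`. -/
noncomputable def basisV : Module.Basis (Fin 3 ⊕ Fin 3) k (ThreeCycle k) :=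
  (basisU k).reindex ((Equiv.sumComm (Fin 3) (Fin 3)).trans
    (Equiv.sumCongr (Equiv.addRight 1) (Equiv.refl (Fin 3))))

theorem basisV_inl (i : Fin 3) : basisV k (Sum.inl i) = arr k (i - 1) := by
  simp [basisV, ← basisU_inr, sub_eq_add_neg]

theorem basisV_inr (i : Fin 3) : basisV k (Sum.inr i) = e k i := by
  simp [basisV, ← basisU_inl]

variable (k) in
/-- The linear form with value `0` on `e_i` and `1` on `α_i`. -/
noncomputable def tr : ThreeCycle k →ₗ[k] k where
  toFun x := ∑ i, x.2 i
  map_add' x y := by simp [Finset.sum_add_distrib]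
  map_smul' c x := by simp [Finset.mul_sum]

theorem tr_apply (x : ThreeCycle k) : tr k x = ∑ i, x.2 i := rfl

variable (k) in
/-- The rotation `e_i ↦ e_{i+1}`, `α_i ↦ α_{i+1}`. -/
noncomputable def rot : ThreeCycle k ≃ₐ[k] ThreeCycle k :=
  AlgEquiv.ofLinearEquiv
    { toFun := fun x => (fun i => x.1 (i - 1), fun i => x.2 (i - 1))
      invFun := fun x => (fun i => x.1 (i + 1), fun i => x.2 (i + 1))
      map_add' := fun x y => rfl
      map_smul' := fun c x => rfl
      left_inv := fun x => Prod.ext (funext fun i => congrArg x.1 (add_sub_cancel_right i 1))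
        (funext fun i => congrArg x.2 (add_sub_cancel_right i 1))
      right_inv := fun x => Prod.ext (funext fun i => congrArg x.1 (sub_add_cancel i 1))
        (funext fun i => congrArg x.2 (sub_add_cancel i 1)) }
    rfl
    (fun x y => Prod.ext rfl (funext fun i => by
      change x.1 (i - 1) * y.2 (i - 1) + x.2 (i - 1) * y.1 (i - 1 + 1)
        = x.1 (i - 1) * y.2 (i - 1) + x.2 (i - 1) * y.1 (i + 1 - 1)
      rw [sub_add_cancel, add_sub_cancel_right]))

theorem rot_fst (x : ThreeCycle k) (i : Fin 3) : (rot k x).1 i = x.1 (i - 1) := rfl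
theorem rot_snd (x : ThreeCycle k) (i : Fin 3) : (rot k x).2 i = x.2 (i - 1) := rfl

theorem rot_e (i : Fin 3) : rot k (e k i) = e k (i + 1) := by
  ext j <;> simp [rot_fst, rot_snd, sub_eq_iff_eq_add]

theorem rot_arr (i : Fin 3) : rot k (arr k i) = arr k (i + 1) := by
  ext j <;> simp [rot_fst, rot_snd, sub_eq_iff_eq_add]

variable (k) in
/-- `A` as a Frobenius algebra, `⟨a, b⟩ = tr(ab)`. -/
noncomputable def frobenius : FrobeniusData k (ThreeCycle k) (Fin 3 ⊕ Fin 3) where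
  form := (LinearMap.mul k (ThreeCycle k)).compr₂ (tr k)
  form_assoc a b c := by simp [mul_assoc]
  u := basisU k
  v := basisV k
  form_dual := by
    rintro (i | i) (j | j) <;>
      simp only [basisU_inl, basisU_inr, basisV_inl, basisV_inr, LinearMap.compr₂_apply,
        LinearMap.mul_apply', tr_apply, mul_snd, e_fst, e_snd, arr_fst, arr_snd] <;>
      fin_cases i <;> fin_cases j <;> simp [Fin.sum_univ_three] <;> decide
  ν := rot k
  form_ν a b := by
    simp only [LinearMap.compr₂_apply, LinearMap.mul_apply', tr_apply, mul_snd, rot_fst, rot_snd,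
      Fin.sum_univ_three]
    have h : (2 : Fin 3) + 1 = 0 ∧ (1 : Fin 3) + 1 = 2 ∧ (0 : Fin 3) - 1 = 2 ∧
      (2 : Fin 3) - 1 = 1 := by decide
    simp only [h, sub_self, zero_add]
    ring

/-- The source of the arrow `α_i` is `i`. -/
def src : Fin 3 → Fin 3 := id

/-- The target of the arrow `α_i` is `i + 1`. -/
def tgt : Fin 3 → Fin 3 := fun i => i + 1

variable (k) in
/-- The images of the generators of `kQ` in `A`. -/
def genImage : Fin 3 ⊕ Fin 3 → ThreeCycle k := Sum.elim (e k) (arr k)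

theorem e_mul_e (i j : Fin 3) : e k i * e k j = if i = j then e k i else 0 := by
  split_ifs with h
  · subst h; ext l <;> simp
  · ext l
    · simp only [mul_fst, e_fst, zero_fst]; grind
    · simp

theorem arr_mul_arr (i j : Fin 3) : arr k i * arr k j = 0 := by
  ext l <;> simp

theorem e_mul_arr (i : Fin 3) : e k i * arr k i = arr k i := by
  ext l <;> simp

theorem arr_mul_e (i : Fin 3) : arr k i * e k (i + 1) = arr k i := by
  ext l <;> simp

theorem sum_e : ∑ i, e k i = 1 := by
  rw [Fin.sum_univ_three]
  ext l <;> fin_cases l <;> simp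

variable (k) in
/-- The map `kQ → A`. -/
noncomputable def fromPath : PathAlgebra k src tgt →ₐ[k] ThreeCycle k :=
  RingQuot.liftAlgHom k ⟨FreeAlgebra.lift k (genImage k), by
    intro x y h
    induction h with
    | idem v => simp [genImage, e_mul_e]
    | orth v w h => simp [genImage, e_mul_e, h]
    | one => simp [genImage, sum_e]
    | source a => simp [genImage, src, e_mul_arr]
    | target a => simp [genImage, tgt, arr_mul_e]⟩

theorem fromPath_gen (x : Fin 3 ⊕ Fin 3) : fromPath k (pathGen k src tgt x) = genImage k x := by
  simp [fromPath, pathGen]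

theorem fromPath_arrowIdeal (x : PathAlgebra k src tgt) (hx : x ∈ arrowIdeal k src tgt)
    (i : Fin 3) : (fromPath k x).1 i = 0 := by
  let pr : ThreeCycle k →+* (Fin 3 → k) :=
    { toFun := fun x => x.1, map_one' := rfl, map_mul' := fun _ _ => rfl, map_zero' := rfl,
      map_add' := fun _ _ => rfl }
  have h : TwoSidedIdeal.span (Set.range fun a : Fin 3 => pathGen k src tgt (Sum.inr a)) ≤
      TwoSidedIdeal.ker (pr.comp (fromPath k).toRingHom) := by
    rw [TwoSidedIdeal.span_le]
    rintro _ ⟨a, rfl⟩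
    refine (TwoSidedIdeal.mem_ker _).2 ?_
    change (fromPath k (pathGen k src tgt (Sum.inr a))).1 = 0
    rw [fromPath_gen]
    rfl
  have h' := h (TwoSidedIdeal.mem_asIdeal.1 hx)
  exact congrFun ((TwoSidedIdeal.mem_ker _).1 h') i

variable (k) in
/-- The map `kQ / R_Q² → A`. -/
noncomputable def fromQuotient :
    (PathAlgebra k src tgt ⧸ arrowIdeal k src tgt ^ 2) →ₐ[k] ThreeCycle k :=
  Ideal.Quotient.liftₐ _ (fromPath k) (by
    intro a ha
    rw [Submodule.pow_succ, Submodule.pow_one] at ha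
    refine Submodule.mul_induction_on ha (fun x hx y hy => ?_) (fun x y hx hy => ?_)
    · rw [map_mul]
      ext i <;> simp [fromPath_arrowIdeal x hx, fromPath_arrowIdeal y hy]
    · rw [map_add, hx, hy, add_zero])

variable (k) in
/-- The classes of the generators of `kQ` in `kQ / R_Q²`. -/
noncomputable def cl (x : Fin 3 ⊕ Fin 3) : PathAlgebra k src tgt ⧸ arrowIdeal k src tgt ^ 2 :=
  Ideal.Quotient.mkₐ k _ (pathGen k src tgt x)

theorem fromQuotient_cl (x : Fin 3 ⊕ Fin 3) : fromQuotient k (cl k x) = genImage k x := by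
  rw [← fromPath_gen]; rfl

theorem cl_rel {x y : FreeAlgebra k (Fin 3 ⊕ Fin 3)} (h : PathRel k src tgt x y) :
    FreeAlgebra.lift k (cl k) x = FreeAlgebra.lift k (cl k) y := by
  have e : FreeAlgebra.lift k (cl k) = (Ideal.Quotient.mkₐ k (arrowIdeal k src tgt ^ 2)).comp
      (RingQuot.mkAlgHom k (PathRel k src tgt)) := by
    ext x; simp [cl, pathGen]
  rw [e, AlgHom.comp_apply, AlgHom.comp_apply, RingQuot.mkAlgHom_rel k h]

theorem cl_arr_mul_arr (i j : Fin 3) : cl k (Sum.inr i) * cl k (Sum.inr j) = 0 := by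
  rw [cl, cl, ← map_mul]
  refine Ideal.Quotient.eq_zero_iff_mem.2 ?_
  rw [Submodule.pow_succ, Submodule.pow_one]
  exact Submodule.mul_mem_mul (TwoSidedIdeal.mem_asIdeal.2 (TwoSidedIdeal.subset_span ⟨i, rfl⟩))
    (TwoSidedIdeal.mem_asIdeal.2 (TwoSidedIdeal.subset_span ⟨j, rfl⟩))

theorem cl_e_mul_e (i j : Fin 3) : cl k (Sum.inl i) * cl k (Sum.inl j) =
    if i = j then cl k (Sum.inl i) else 0 := by
  split_ifs with h
  · subst h; simpa using cl_rel (PathRel.idem (src := src) (tgt := tgt) (k := k) i)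
  · simpa using cl_rel (PathRel.orth (src := src) (tgt := tgt) (k := k) i j h)

theorem cl_e_mul_arr (i j : Fin 3) : cl k (Sum.inl i) * cl k (Sum.inr j) =
    if i = j then cl k (Sum.inr j) else 0 := by
  have h : cl k (Sum.inl j) * cl k (Sum.inr j) = cl k (Sum.inr j) := by
    have h := cl_rel (PathRel.source (src := src) (tgt := tgt) (k := k) j)
    rw [map_mul, FreeAlgebra.lift_ι_apply, FreeAlgebra.lift_ι_apply] at h
    exact h
  rw [← h, ← mul_assoc, cl_e_mul_e]
  split_ifs with h'
  · rw [h']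
  · rw [zero_mul]

theorem cl_arr_mul_e (i j : Fin 3) : cl k (Sum.inr i) * cl k (Sum.inl j) =
    if i + 1 = j then cl k (Sum.inr i) else 0 := by
  have h : cl k (Sum.inr i) * cl k (Sum.inl (i + 1)) = cl k (Sum.inr i) := by
    simpa [tgt] using cl_rel (PathRel.target (src := src) (tgt := tgt) (k := k) i)
  rw [← h, mul_assoc, cl_e_mul_e]
  split_ifs with h'
  · rfl
  · rw [mul_zero]

theorem sum_cl : ∑ i, cl k (Sum.inl i) = 1 := by
  simpa using cl_rel (PathRel.one (src := src) (tgt := tgt) (k := k))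

variable (k) in
/-- The map `A → kQ / R_Q²`. -/
noncomputable def toQuotient :
    ThreeCycle k →ₐ[k] (PathAlgebra k src tgt ⧸ arrowIdeal k src tgt ^ 2) :=
  AlgHom.ofLinearMap
    { toFun := fun x => ∑ i, x.1 i • cl k (Sum.inl i) + ∑ i, x.2 i • cl k (Sum.inr i)
      map_add' := fun x y => by
        simp only [add_fst, add_snd, add_smul, Finset.sum_add_distrib]; abel
      map_smul' := fun c x => by
        simp only [smul_fst, smul_snd, mul_smul, Finset.smul_sum, smul_add, RingHom.id_apply] }
    (by simp [sum_cl])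
    (fun x y => by
      have h : (2 : Fin 3) + 1 = 0 ∧ (1 : Fin 3) + 1 = 2 := by decide
      simp only [LinearMap.coe_mk, AddHom.coe_mk, mul_fst, mul_snd, Fin.sum_univ_three, add_mul,
        mul_add, smul_mul_assoc, mul_smul_comm, cl_e_mul_e, cl_e_mul_arr, cl_arr_mul_e,
        cl_arr_mul_arr, h, zero_add]
      simp
      module)

theorem toQuotient_genImage (x : Fin 3 ⊕ Fin 3) : toQuotient k (genImage k x) = cl k x := by
  rcases x with i | i <;> simp [toQuotient, genImage]

variable (k) in
/-- `A` is the quotient `kQ / R_Q²` of the path algebra of the 3-cycle by the square of the arrow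
ideal. -/
noncomputable def equivQuotient :
    (PathAlgebra k src tgt ⧸ arrowIdeal k src tgt ^ 2) ≃ₐ[k] ThreeCycle k :=
  AlgEquiv.ofAlgHom (fromQuotient k) (toQuotient k)
    (AlgHom.toLinearMap_injective ((basisU k).ext fun x => by
      have h : basisU k x = genImage k x := by
        rcases x with i | i
        · exact basisU_inl i
        · exact basisU_inr i
      change fromQuotient k (toQuotient k (basisU k x)) = basisU k x
      rw [h, toQuotient_genImage, fromQuotient_cl]))
    (by
      refine Ideal.Quotient.algHom_ext _ ?_
      refine RingQuot.ringQuot_ext' _ _ _ (FreeAlgebra.hom_ext (funext fun x => ?_))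
      change toQuotient k (fromQuotient k (cl k x)) = cl k x
      rw [fromQuotient_cl, toQuotient_genImage])

variable (k) in
/-- The graded commutative ring `k[α, β, α⁻¹] / (β²)`, as the dual numbers over the Laurent
polynomials in `α`. As `β² = 0` and `|α|` is even, graded commutative
and commutative mean the same here. -/
abbrev Target : Type u := DualNumber k[T;T⁻¹]

variable (k) in
/-- The monomial `α^n`. -/
noncomputable def α (n : ℤ) : Target k := TrivSqZeroExt.inl (LaurentPolynomial.T n)

variable (k) in
/-- The element `β`. -/
noncomputable def β : Target k := DualNumber.eps

variable (k) in
/-- The homogeneous component of degree `n` for `|α| = 6` and `|β| = 1`, spanned by the monomials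
`α^l` with `6 l = n` and `α^l β` with `6 l + 1 = n`. -/
noncomputable def graded (n : ℤ) : Submodule k (Target k) :=
  Submodule.span k ({x | ∃ l : ℤ, 6 * l = n ∧ x = α k l} ∪
    {x | ∃ l : ℤ, 6 * l + 1 = n ∧ x = α k l * β k})

end ThreeCycle

end ThreeCycle

end CompleteHochschild

namespace CompleteHochschild
universe u

/-! ### Evaluation of chains and cochains on sequences, and alternating sums -/

section Evaluation

variable {k A : Type u} [Field k] [Ring A] [Algebra k A]
variable {N : Type*} [AddCommGroup N] [Module k N]

/-! For this algebra ∑ u_i a v_i = 0 (`casimir_eq_zero`): each summand would be a multiple of a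
closed path containing an arrow, and A has none. So the complete complex falls apart into the
Hochschild cochains and the chains with coefficients in A_{ν⁻¹}. The Frobenius form identifies
C^r(A, A) with the dual of C_r(A, A_ν); this makes δ the transpose of ∂ and Δ^ν the transpose of the
Connes operator (`pair_δ`, `pair_delta`). Everything additive thus becomes a question on the
homology of A twisted by a rotation σ of the quiver by s steps, with s = 1 for cochains and s = 2
for chains.

An explicit homotopy contracts the chains to the closed words x ⊗ α_i ⊗ ⋯ ⊗ α_{i+p-1} with x in
e_{i+p} A e_{i+s} (`bdry_homotopy_succ`, `reduce_ev`). Modulo 3, x is an idempotent if p ≡ s and an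
arrow if p + 1 ≡ s. The only differential left sends the idempotent word at i in degree p + 1 to the
arrow word at i + 1 plus (-1)^(p+1) times the arrow word at i (`bdry_cyc_e`). On a three-dimensional
space this is either shift + 1, which is invertible because 2 ≠ 0, or shift - 1, whose kernel and
cokernel are lines (`reduce_mem`). In terms of the degree n of the complete complex, a line survives
exactly for n ≡ 0 and n ≡ 1 modulo 6, for positive and negative n alike (`coord_rep`,
`coord_eq_zero`, `sub_coord_smul_rep_mem`).

The surviving lines are spanned by sums over all starting vertices, with coefficients e_i if n ≡ 0
and α_i / 3 if n ≡ 1. As e_i and α_i / 3 multiply like 1 and β, all six kinds of star product send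
representatives to representatives as far as the coordinates can see (`cup_fam`, `capLeft_fam`,
`capRight_fam`, `insertLeft_fam`, `insertRight_fam`, `chainMul_fam`, collected in `coord_star_rep`).
This gives the ring. The product descends to cohomology because it satisfies a Leibniz rule with
non-zero scalars (`star_leibniz`), which follows from moving elements across ∑ u_i ⊗ v_i.

The BV operator rests on the homotopy formula ∂B + B∂ = σ - 1 for the twisted Connes operator
(`bdry_connes_succ`). By it ν acts trivially on cohomology, and on ν-invariants B anticommutes with
∂. Since ν³ = 1, 3 ≠ 0 and k contains a root of ζ² + ζ + 1, weight one means ν-invariant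
(`mem_weightOne`), and averaging over ν identifies the two cohomologies (`oneToHH_bijective`). On
the representative with coefficients α_i / 3, B produces p + 1 rotations of a closed path for each
of three starting vertices, each with weight 1/9 against the dual cocycle. Hence the factor (p +
1)/3 (`cocycle_connes_cycle`), which with the sign in negative degrees is n/3 for every n ≡ 1 modulo
6 (`coord_bv_rep`). The brackets are then arithmetic with signs. -/

theorem seq_restrict {n : ℕ} (w : ℕ → A) {t : ℕ} (ht : t < n) :
    seq (fun s : Fin n => w s) t = w t := by
  simp [seq, ht]

theorem ev_seq {r : ℕ} (f : MultilinearMap k (fun _ : Fin r => A) N) (a : Fin r → A) :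
    ev f (seq a) = f a := by
  unfold ev; congr 1; funext t; exact seq_val a t

/-- Testing on infinite sequences instead of tuples turns every later identity between words of
different lengths into a pointwise identity of functions on `ℕ`, without casts between `Fin` types.
-/
theorem Chain.hom_ext_ev {p : ℕ} {S T : Chain k A p →ₗ[k] N}
    (h : ∀ w, S (ev (gen k A p) w) = T (ev (gen k A p) w)) : S = T :=
  Chain.hom_ext fun a => by simpa [ev_seq] using h (seq a)

theorem Cochain.ext_ev {r : ℕ} {f g : Cochain k A r} (h : ∀ w, ev f.1 w = ev g.1 w) : f = g := by
  ext a
  simpa [ev_seq] using h (seq a)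

theorem ev_eq_zero_of_entry {r : ℕ} (f : MultilinearMap k (fun _ : Fin r => A) N) {w : ℕ → A}
    (s : ℕ) (hs : s < r) (h : w s = 0) : ev f w = 0 :=
  f.map_coord_zero (⟨s, hs⟩ : Fin r) h

/-- The map was built from sequences extended by zero, so it agrees with `G` on an arbitrary
sequence only if `G` reads no entry beyond the first `p + 1`; this is the role of `hc`. -/
theorem Chain.map_ev {p : ℕ} (G : (ℕ → A) → N) (hG : LinearInEach (p + 1) G k)
    (h1 : ∀ (w : ℕ → A) (l : ℕ), 0 < l → l ≤ p → w l = 1 → G w = 0)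
    (hc : ∀ w w' : ℕ → A, (∀ t < p + 1, w t = w' t) → G w = G w') (w : ℕ → A) :
    Chain.map G hG h1 (ev (gen k A p) w) = G w := by
  unfold ev
  rw [Chain.map_gen]
  exact hc _ _ fun t ht => seq_restrict w ht

theorem Cochain.mk_ev {r : ℕ} (G : (ℕ → A) → A) (hG : LinearInEach r G k)
    (h1 : ∀ (w : ℕ → A) (t : ℕ), t < r → w t = 1 → G w = 0)
    (hc : ∀ w w' : ℕ → A, (∀ t < r, w t = w' t) → G w = G w') (w : ℕ → A) :
    ev (Cochain.mk (k := k) G hG h1).1 w = G w := by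
  unfold ev
  exact hc _ _ fun t ht => seq_restrict w ht

/-- The sum with alternating signs of the first `n` terms of a sequence. -/
def altSum (k : Type*) [Field k] [Module k N] (n : ℕ) (c : ℕ → N) : N :=
  ∑ i ∈ Finset.range n, ((-1 : k) ^ i) • c i

theorem altSum_congr {n : ℕ} {c c' : ℕ → N} (h : ∀ i < n, c i = c' i) :
    altSum k n c = altSum k n c' :=
  Finset.sum_congr rfl fun i hi => by rw [h i (by simpa using hi)]

theorem map_altSum {N' : Type*} [AddCommGroup N'] [Module k N'] (T : N →ₗ[k] N') (n : ℕ)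
    (c : ℕ → N) : T (altSum k n c) = altSum k n fun i => T (c i) := by
  simp [altSum]

theorem altSum_succ (n : ℕ) (c : ℕ → N) :
    altSum k (n + 1) c = altSum k n c + (-1 : k) ^ n • c n :=
  Finset.sum_range_succ _ _

theorem altSum_succ' (n : ℕ) (c : ℕ → N) :
    altSum k (n + 1) c = c 0 - altSum k n fun i => c (i + 1) := by
  simp only [altSum, Finset.sum_range_succ', pow_zero, one_smul, pow_succ, mul_neg, mul_one,
    neg_smul, Finset.sum_neg_distrib]
  abel

theorem altSum_add (a b : ℕ) (c : ℕ → N) :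
    altSum k (a + b) c = altSum k a c + (-1 : k) ^ a • altSum k b fun i => c (a + i) := by
  simp only [altSum, Finset.sum_range_add, Finset.smul_sum, smul_smul, pow_add]

/-- Two alternating sums are joined to one; the last term of the first sum cancels against the
first term of the second. -/
theorem altSum_join {a b : ℕ} {c d s : ℕ → N} (h : c a = d 0) (hc : ∀ i < a, s i = c i)
    (hd : ∀ i < b, s (a + i) = d (i + 1)) :
    altSum k (a + b) s = altSum k (a + 1) c - (-1 : k) ^ a • altSum k (b + 1) d := by
  rw [altSum_add, altSum_succ, altSum_succ', altSum_congr hc, altSum_congr hd, h, smul_sub]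
  abel

theorem bdry_ev (σ : A ≃ₐ[k] A) (p : ℕ) (w : ℕ → A) :
    bdry σ p (ev (gen k A (p + 1)) w) =
      altSum k (p + 2) fun i => ev (gen k A p) (face σ p i w) := by
  refine Chain.map_ev _ _ _ (fun w w' h => Finset.sum_congr rfl fun i hi => ?_) w
  rw [Finset.mem_range] at hi
  congr 1
  refine ev_congr _ fun t ht => ?_
  simp only [face]
  split_ifs <;> simp only [merge] <;> grind

theorem δ_ev {r : ℕ} (f : Cochain k A r) (w : ℕ → A) :
    ev (δ r f).1 w = altSum k (r + 2) fun i => coface f i w := by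
  refine Cochain.mk_ev _ _ (coface_cancel f)
    (fun w w' h => Finset.sum_congr rfl fun i hi => ?_) w
  rw [Finset.mem_range] at hi
  congr 1
  simp only [coface]
  split_ifs
  · rw [h 0 (by omega), ev_congr f.1 fun t ht => h (t + 1) (by omega)]
  · rw [h r (by omega), ev_congr f.1 fun t ht => h t (by omega)]
  · refine ev_congr _ fun t ht => ?_
    simp only [merge]; grind

theorem connes_ev (σ : A ≃ₐ[k] A) (p : ℕ) (w : ℕ → A) :
    connes σ p (ev (gen k A p) w) = ∑ i ∈ Finset.Icc 1 (p + 1),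
      ((-1 : k) ^ (i * p)) • ev (gen k A (p + 1)) (connesTerm σ p i w) := by
  refine Chain.map_ev _ _ _ (fun w w' h => Finset.sum_congr rfl fun i hi => ?_) w
  rw [Finset.mem_Icc] at hi
  congr 1
  refine ev_congr _ fun t ht => ?_
  simp only [connesTerm]; grind

theorem cup_ev {m n s : ℕ} (h : m + n = s) (f : Cochain k A m) (g : Cochain k A n)
    (w : ℕ → A) : ev (cup h f g).1 w = ev f.1 w * ev g.1 (fun t => w (m + t)) := by
  refine Cochain.mk_ev _ _ _ (fun w w' hw => ?_) w
  rw [ev_congr f.1 fun t ht => hw t (by omega), ev_congr g.1 fun t ht => hw (m + t) (by omega)]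

theorem capLeft_ev {p m q : ℕ} (h : p = m + q) (f : Cochain k A m) (w : ℕ → A) :
    capLeft h f (ev (gen k A p) w) = ev (gen k A q) (fun t =>
      if t = 0 then ev f.1 (fun s => w (q + 1 + s)) * w 0 else w t) := by
  refine Chain.map_ev _ _ _ (fun w w' hw => ev_congr _ fun t ht => ?_) w
  rw [ev_congr f.1 fun t ht => hw (q + 1 + t) (by omega), hw 0 (by omega), hw t (by omega)]

theorem ofScalar_ev (a : A) (w : ℕ → A) : ev (ofScalar k A a).1 w = a := rfl

end Evaluation

/-! ### Dual bases: evaluation formulas and moving elements across ∑ u_i ⊗ v_i -/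

section FrobeniusEvaluation

variable {k A : Type u} [Field k] [Ring A] [Algebra k A]
  {ι : Type*} [Fintype ι] [DecidableEq ι] (F : FrobeniusData k A ι)
variable {N : Type*} [AddCommGroup N] [Module k N]

namespace FrobeniusData

theorem norm_ev (w v : ℕ → A) :
    ev (F.norm (ev (gen k A 0) w)).1 v = ∑ i, F.u i * w 0 * F.v i := by
  rw [FrobeniusData.norm, LinearMap.comp_apply, ofScalar_ev]
  refine Chain.map_ev (fun w => ∑ i, F.u i * w 0 * F.v i) _ _ (fun w w' h => ?_) w
  rw [h 0 (by omega)]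

theorem capRight_ev {p m q : ℕ} (h : p = m + q) (f : Cochain k A m) (w : ℕ → A) :
    F.capRight h f (ev (gen k A p) w) = ev (gen k A q) (fun t =>
      if t = 0 then w 0 * F.ν.symm (ev f.1 (fun s => w (s + 1))) else w (m + t)) := by
  refine Chain.map_ev _ _ _ (fun w w' hw => ev_congr _ fun t ht => ?_) w
  rw [ev_congr f.1 fun t ht => hw (t + 1) (by omega), hw 0 (by omega)]
  split_ifs
  · rfl
  · exact hw _ (by omega)

theorem insertLeft_ev {p m n : ℕ} (h : m = p + 1 + n) (f : Cochain k A m) (a b : ℕ → A) :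
    ev (F.insertLeft h f (ev (gen k A p) a)).1 b = ∑ i, ev f.1 (fun t =>
        if t < n then b t else if t = n then F.u i * F.ν (a 0) else a (t - n)) * F.v i := by
  rw [FrobeniusData.insertLeft, Chain.map_ev]
  · refine Cochain.mk_ev _ _ _ (fun w w' hw => Finset.sum_congr rfl fun i _ => ?_) b
    rw [ev_congr f.1 fun t ht => ?_]
    grind
  · intro w w' hw
    refine Cochain.ext_ev fun b => ?_
    refine congrArg (fun x : MultilinearMap k _ A => x _) ?_
    ext b
    refine Finset.sum_congr rfl fun i _ => ?_
    rw [ev_congr f.1 fun t ht => ?_]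
    grind

theorem insertRight_ev {p m n : ℕ} (h : m = p + 1 + n) (f : Cochain k A m) (a b : ℕ → A) :
    ev (F.insertRight h f (ev (gen k A p) a)).1 b = ∑ i, F.u i * F.ν (a 0) * ev f.1 (fun t =>
        if t < p then a (t + 1) else if t = p then F.v i else b (t - (p + 1))) := by
  rw [FrobeniusData.insertRight, Chain.map_ev]
  · refine Cochain.mk_ev _ _ _ (fun w w' hw => Finset.sum_congr rfl fun i _ => ?_) b
    rw [ev_congr f.1 fun t ht => ?_]
    grind
  · intro w w' hw
    refine Cochain.ext_ev fun b => ?_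
    refine congrArg (fun x : MultilinearMap k _ A => x _) ?_
    ext b
    refine Finset.sum_congr rfl fun i _ => ?_
    rw [hw 0 (by omega), ev_congr f.1 fun t ht => ?_]
    grind

theorem chainMul_ev {p q r : ℕ} (h : p + q + 1 = r) (a b : ℕ → A) :
    F.chainMul h (ev (gen k A p) a) (ev (gen k A q) b) = ∑ i, ev (gen k A r) (fun t =>
        if t = 0 then F.v i * b 0 else if t ≤ q then b t
        else if t = q + 1 then F.u i * F.ν (a 0) else a (t - (q + 1))) := by
  rw [FrobeniusData.chainMul, Chain.map_ev]
  · refine Chain.map_ev _ _ _ (fun w w' hw => Finset.sum_congr rfl fun i _ => ?_) b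
    refine ev_congr _ fun t ht => ?_
    grind
  · intro w w' hw
    refine Chain.hom_ext fun b => ?_
    rw [Chain.map_gen, Chain.map_gen]
    refine Finset.sum_congr rfl fun i _ => ev_congr _ fun t ht => ?_
    grind

theorem form_u (x : A) : ∑ j, F.form x (F.u j) • F.v j = x := by
  have h : (F.v.constr k fun i => ∑ j, F.form (F.v i) (F.u j) • F.v j) = LinearMap.id :=
    F.v.ext fun i => by simp [F.form_dual]
  conv_rhs => rw [← LinearMap.id_apply (R := k) x, ← h]
  have : (∑ j, (F.form.flip (F.u j)).smulRight (F.v j)) =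
      (F.v.constr k fun i => ∑ j, F.form (F.v i) (F.u j) • F.v j) :=
    F.v.ext fun i => by simp
  rw [← this]; simp

theorem form_v (x : A) : ∑ i, F.form (F.v i) x • F.u i = x := by
  have : (∑ j, (F.form (F.v j)).smulRight (F.u j)) = LinearMap.id :=
    F.u.ext fun i => by simp [F.form_dual]
  simpa using LinearMap.congr_fun this x

theorem eq_of_form {x y : A} (h : ∀ z, F.form x z = F.form y z) : x = y := by
  rw [← F.form_u x, ← F.form_u y]; simp [h]

theorem eq_of_form' {x y : A} (h : ∀ z, F.form z x = F.form z y) : x = y := by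
  rw [← F.form_v x, ← F.form_v y]; simp [h]

theorem form_ν_ν (a b : A) : F.form (F.ν a) (F.ν b) = F.form a b := by
  rw [← F.form_ν, ← F.form_ν]

/-- `G` is bilinear. -/
def Bilin (k : Type*) [Field k] [Algebra k A] [Module k N] (G : A → A → N) : Prop :=
  (∀ y, ∃ L : A →ₗ[k] N, ∀ x, G x y = L x) ∧ ∀ x, ∃ L : A →ₗ[k] N, ∀ y, G x y = L y

/-- Expand `S u_i` in the basis `u` and `T v_i` in the basis `v`: both sides become a double sum
with the same matrix ⟨v_j, S u_i⟩ = ⟨T v_j, u_i⟩. Every identity that slides an algebra element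
through the dual bases is an instance. -/
theorem sum_dual {G : A → A → N} (hG : Bilin k G) (S T : A →ₗ[k] A)
    (h : ∀ x y, F.form x (S y) = F.form (T x) y) :
    ∑ i, G (S (F.u i)) (F.v i) = ∑ i, G (F.u i) (T (F.v i)) := by
  obtain ⟨h1, h2⟩ := hG
  choose L hL using h1
  choose M hM using h2
  have e1 : ∀ i, G (S (F.u i)) (F.v i) =
      ∑ j, F.form (F.v j) (S (F.u i)) • G (F.u j) (F.v i) := fun i => by
    conv_lhs => rw [hL, ← F.form_v (S (F.u i)), map_sum]
    simp [hL]
  have e2 : ∀ i, G (F.u i) (T (F.v i)) =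
      ∑ j, F.form (T (F.v i)) (F.u j) • G (F.u i) (F.v j) := fun i => by
    conv_lhs => rw [hM, ← F.form_u (T (F.v i)), map_sum]
    simp [hM]
  simp only [e1, e2, h]
  exact Finset.sum_comm

/-- `∑ a u_i ⊗ v_i = ∑ u_i ⊗ v_i a`. -/
theorem sum_mul_left {G : A → A → N} (hG : Bilin k G) (a : A) :
    ∑ i, G (a * F.u i) (F.v i) = ∑ i, G (F.u i) (F.v i * a) :=
  F.sum_dual hG (LinearMap.mulLeft k a) (LinearMap.mulRight k a) fun x y => by
    simp [F.form_assoc]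

/-- `∑ u_i ν(a) ⊗ v_i = ∑ u_i ⊗ a v_i`. -/
theorem sum_mul_right {G : A → A → N} (hG : Bilin k G) (a : A) :
    ∑ i, G (F.u i * F.ν a) (F.v i) = ∑ i, G (F.u i) (a * F.v i) :=
  F.sum_dual hG (LinearMap.mulRight k (F.ν a)) (LinearMap.mulLeft k a) fun x y => by
    simp only [LinearMap.mulRight_apply, LinearMap.mulLeft_apply]
    rw [← F.form_assoc, ← F.form_ν, F.form_assoc]

/-- `∑ v_i ⊗ u_i = ∑ ν⁻¹(u_i) ⊗ v_i`. -/
theorem sum_swap {G : A → A → N} (hG : Bilin k G) :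
    ∑ i, G (F.v i) (F.u i) = ∑ i, G (F.ν.symm (F.u i)) (F.v i) := by
  obtain ⟨h1, h2⟩ := hG
  choose L hL using h1
  choose M hM using h2
  have e1 : ∀ i, G (F.v i) (F.u i) =
      ∑ j, F.form (F.u i) (F.u j) • G (F.v i) (F.v j) := fun i => by
    conv_lhs => rw [hM, ← F.form_u (F.u i), map_sum]
    simp [hM]
  have e2 : ∀ i, G (F.ν.symm (F.u i)) (F.v i) =
      ∑ j, F.form (F.ν.symm (F.u i)) (F.u j) • G (F.v j) (F.v i) := fun i => by
    conv_lhs => rw [hL, ← F.form_u (F.ν.symm (F.u i)), map_sum]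
    simp [hL]
  have e3 : ∀ x y, F.form (F.ν.symm x) y = F.form y x := fun x y => by
    rw [F.form_ν, AlgEquiv.apply_symm_apply]
  simp only [e1, e2, e3]
  exact Finset.sum_comm

end FrobeniusData

end FrobeniusEvaluation

end CompleteHochschild

namespace CompleteHochschild
universe u

/-! ### Leibniz rules for the cup product and the left cap product -/

section Leibniz

variable {k A : Type u} [Field k] [Ring A] [Algebra k A]
variable {N : Type*} [AddCommGroup N] [Module k N]

/-- Multilinearity in the zeroth slot. A cap product with δ f has the whole alternating sum in that
slot; pulling it out makes both sides of a Leibniz rule alternating sums of single words. -/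
theorem ev_altSum_entry {q : ℕ} (f : MultilinearMap k (fun _ : Fin (q + 1) => A) N)
    (T : A →ₗ[k] A) (w : ℕ → A) (n : ℕ) (c : ℕ → A) :
    ev f (fun t => if t = 0 then T (altSum k n c) else w t) =
      altSum k n fun i => ev f (fun t => if t = 0 then T (c i) else w t) := by
  obtain ⟨L, hL⟩ := ev_lin f w (s := 0) (by omega) (fun x t => if t = 0 then T x else w t) T
    (fun x t _ => rfl)
  rw [hL, map_altSum]
  exact altSum_congr fun i _ => (hL _).symm

theorem coface_zero {r : ℕ} (f : Cochain k A r) (w : ℕ → A) :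
    coface f 0 w = w 0 * ev f.1 (fun t => w (t + 1)) := by simp [coface]

theorem coface_last {r : ℕ} (f : Cochain k A r) (w : ℕ → A) :
    coface f (r + 1) w = ev f.1 w * w r := by simp [coface]

theorem coface_mid {r i : ℕ} (f : Cochain k A r) (w : ℕ → A) (hi : i < r) :
    coface f (i + 1) w = ev f.1 (merge i w) := by
  simp [coface, hi.ne]

theorem face_zero (σ : A ≃ₐ[k] A) (p : ℕ) (w : ℕ → A) :
    face σ p 0 w = fun t => if t = 0 then w 0 * σ (w 1) else w (t + 1) := by simp [face]

theorem face_last (σ : A ≃ₐ[k] A) (p : ℕ) (w : ℕ → A) :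
    face σ p (p + 1) w = fun t => if t = 0 then w (p + 1) * w 0 else w t := by simp [face]

theorem face_mid (σ : A ≃ₐ[k] A) {p i : ℕ} (w : ℕ → A) (h0 : 0 < i) (hi : i < p + 1) :
    face σ p i w = merge i w := by simp [face, hi.ne, h0.ne']

/-- The cofaces of the product are those of f followed by those of g. The two superfluous terms, the
last coface of f and the zeroth coface of g, are both f(a_1, …, a_m) a_{m+1} g(a_{m+2}, …) and
cancel; the bookkeeping is `altSum_join`. -/
theorem δ_cup {m n s : ℕ} (h : m + n = s) (f : Cochain k A m) (g : Cochain k A n) :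
    δ s (cup h f g) = cup (by omega) (δ m f) g
      + (-1 : k) ^ m • cup (by omega) f (δ n g) := by
  subst h
  refine Cochain.ext_ev fun w => ?_
  have key := altSum_join (k := k) (a := m + 1) (b := n + 1)
    (c := fun i => coface f i w * ev g.1 (fun t => w (m + 1 + t)))
    (d := fun i => ev f.1 w * coface g i (fun t => w (m + t)))
    (s := fun i => coface (cup rfl f g) i w) ?_ ?_ ?_
  · have e1 : ev (cup (by omega : m + 1 + n = m + n + 1) (δ m f) g
        + (-1 : k) ^ m • cup (by omega) f (δ n g)).1 w
        = ev (cup (by omega : m + 1 + n = m + n + 1) (δ m f) g).1 w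
        + (-1 : k) ^ m • ev (cup (by omega : m + (n + 1) = m + n + 1) f (δ n g)).1 w := rfl
    rw [e1, δ_ev, cup_ev, cup_ev, δ_ev, δ_ev, show m + n + 2 = m + 1 + (n + 1) by omega, key]
    rw [← LinearMap.mulRight_apply (R := k) (ev g.1 fun t => w (m + 1 + t)), map_altSum,
      ← LinearMap.mulLeft_apply (R := k) (ev f.1 w), map_altSum, pow_succ]
    simp
  · simp only [coface_last, coface_zero, mul_assoc]
    simp [add_assoc, add_comm 1]
  · intro i hi
    rcases Nat.eq_zero_or_pos i with rfl | h0
    · simp only [coface_zero, cup_ev, mul_assoc]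
      simp [add_assoc, add_comm 1]
    · obtain ⟨i, rfl⟩ : ∃ j, i = j + 1 := ⟨i - 1, by omega⟩
      rw [coface_mid _ _ (by omega), coface_mid _ _ (by omega), cup_ev]
      congr 1
      refine ev_congr _ fun t ht => ?_
      simp only [merge]; grind
  · intro i hi
    rw [show m + 1 + i = m + i + 1 by omega]
    rcases eq_or_ne i n with rfl | hne
    · simp only [coface_last, cup_ev, mul_assoc]
    · rw [coface_mid _ _ (by omega), coface_mid _ _ (by omega), cup_ev]
      congr 1
      · refine ev_congr _ fun t ht => ?_
        simp only [merge]; grind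
      · refine ev_congr _ fun t ht => ?_
        simp only [merge]; grind

/-- Faces up to index q do not touch the arguments of f, the later ones act as cofaces of f. At the
seam the last face of the capped chain and the zeroth coface of f both have the coefficient a_{q+1}
f(a_{q+2}, …) a_0, and they cancel. -/
theorem capLeft_bdry (σ : A ≃ₐ[k] A) {p m q : ℕ} (h : p = m + q) (f : Cochain k A m)
    (x : Chain k A (p + 1)) :
    capLeft h f (bdry σ p x) = bdry σ q (capLeft (by omega) f x)
      - (-1 : k) ^ (q + 1) • capLeft (by omega) (δ m f) x := by
  subst h
  refine LinearMap.congr_fun (f := (capLeft rfl f).comp (bdry σ (m + q)))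
    (g := (bdry σ q).comp (capLeft (by omega) f)
      - (-1 : k) ^ (q + 1) • capLeft (by omega) (δ m f)) (Chain.hom_ext_ev fun w => ?_) x
  simp only [LinearMap.comp_apply, LinearMap.sub_apply, LinearMap.smul_apply, bdry_ev, map_altSum,
    capLeft_ev, δ_ev]
  have e := ev_altSum_entry (gen k A q) (LinearMap.mulRight k (w 0)) w (m + 2)
    fun i => coface f i fun t => w (q + 1 + t)
  simp only [LinearMap.mulRight_apply] at e
  rw [e, show m + q + 2 = q + 1 + (m + 1) by omega]
  refine altSum_join ?_ ?_ ?_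
  · refine ev_congr _ fun t ht => ?_
    rw [face_last, coface_zero]
    by_cases h0 : t = 0
    · simp [h0, mul_assoc, add_comm, add_left_comm]
    · simp [h0]
  · intro i hi
    have e1 : ev f.1 (fun s => face σ (m + q) i w (q + 1 + s)) =
        ev f.1 (fun s => w (q + 1 + 1 + s)) := ev_congr _ fun t ht => by
      simp only [face]; split_ifs <;> simp only [merge] <;> grind
    refine ev_congr _ fun t ht => ?_
    rw [e1]
    simp only [face]; split_ifs <;> simp only [merge] <;> grind
  · intro i hi
    have e1 : ev f.1 (fun s => face σ (m + q) (q + 1 + i) w (q + 1 + s)) *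
        face σ (m + q) (q + 1 + i) w 0 =
        coface f (i + 1) (fun t => w (q + 1 + t)) * w 0 := by
      rcases eq_or_ne i m with rfl | hne
      · rw [coface_last, show q + 1 + i = i + q + 1 by omega, face_last]
        simp [mul_assoc]
      · rw [coface_mid _ _ (by omega), face_mid _ _ (by omega) (by omega)]
        congr 1
        · refine ev_congr _ fun t ht => ?_
          simp only [merge]; grind
        · simp [merge]
    refine ev_congr _ fun t ht => ?_
    rw [e1]
    simp only [face]; split_ifs <;> simp only [merge] <;> grind

end Leibniz
end CompleteHochschild

namespace CompleteHochschild
universe u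

/-! ### Leibniz rules for the right cap product and for inserting a chain from the left -/

section FrobeniusLeibniz

variable {k A : Type u} [Field k] [Ring A] [Algebra k A]
  {ι : Type*} [Fintype ι] [DecidableEq ι] (F : FrobeniusData k A ι)
variable {N : Type*} [AddCommGroup N] [Module k N]

theorem sum_altSum {κ : Type*} (s : Finset κ) (n : ℕ) (c : κ → ℕ → N) :
    ∑ j ∈ s, altSum k n (c j) = altSum k n fun i => ∑ j ∈ s, c j i := by
  simp only [altSum, Finset.smul_sum]
  exact Finset.sum_comm

theorem altSum_mul (n : ℕ) (c : ℕ → A) (a : A) :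
    altSum k n c * a = altSum k n fun i => c i * a := by
  rw [← LinearMap.mulRight_apply (R := k), map_altSum]; rfl

theorem mul_altSum (n : ℕ) (c : ℕ → A) (a : A) :
    a * altSum k n c = altSum k n fun i => a * c i := by
  rw [← LinearMap.mulLeft_apply (R := k), map_altSum]; rfl

theorem altSum_ev {r n : ℕ} (c : ℕ → Cochain k A r) (w : ℕ → A) :
    ev (altSum k n c).1 w = altSum k n fun i => ev (c i).1 w := by
  simp [altSum, ev]

theorem map_altSum_ev {p r : ℕ} (T : Chain k A p →ₗ[k] Cochain k A r) (n : ℕ)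
    (c : ℕ → Chain k A p) (w : ℕ → A) :
    ev (T (altSum k n c)).1 w = altSum k n fun i => ev (T (c i)).1 w := by
  rw [map_altSum (N' := Cochain k A r) T, altSum_ev]

theorem ev_sum {r : ℕ} {κ : Type*} (s : Finset κ) (c : κ → Cochain k A r) (w : ℕ → A) :
    ev (∑ i ∈ s, c i).1 w = ∑ i ∈ s, ev (c i).1 w := by
  simp [ev]

theorem ev_add {r : ℕ} (f g : Cochain k A r) (w : ℕ → A) :
    ev (f + g).1 w = ev f.1 w + ev g.1 w := rfl

theorem ev_sub {r : ℕ} (f g : Cochain k A r) (w : ℕ → A) :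
    ev (f - g).1 w = ev f.1 w - ev g.1 w := by simp [ev]

theorem ev_smul {r : ℕ} (c : k) (f : Cochain k A r) (w : ℕ → A) :
    ev (c • f).1 w = c • ev f.1 w := rfl

/-- The chains with property `P` form a subspace, and the quotient by it receives zero from every
generator. -/
theorem Chain.induction_ev {p : ℕ} {P : Chain k A p → Prop}
    (hev : ∀ w, P (ev (gen k A p) w)) (hadd : ∀ x y, P x → P y → P (x + y))
    (hsmul : ∀ (c : k) x, P x → P (c • x)) (x : Chain k A p) : P x := by
  let V : Submodule k (Chain k A p) :=
    { carrier := {x | P x}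
      add_mem' := fun hx hy => hadd _ _ hx hy
      zero_mem' := by simpa using hsmul 0 _ (hev 0)
      smul_mem' := hsmul }
  have h : V.mkQ = 0 := Chain.hom_ext_ev fun w => by
    rw [LinearMap.zero_apply]
    exact (Submodule.Quotient.mk_eq_zero _).2 (hev w)
  exact (Submodule.Quotient.mk_eq_zero V).1 (LinearMap.congr_fun h x)

theorem cup_add_right {m n s : ℕ} (h : m + n = s) (f : Cochain k A m) (g g' : Cochain k A n) :
    cup h f (g + g') = cup h f g + cup h f g' :=
  Cochain.ext_ev fun w => by simp only [ev_add, cup_ev, mul_add]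

theorem cup_add_left {m n s : ℕ} (h : m + n = s) (f f' : Cochain k A m) (g : Cochain k A n) :
    cup h (f + f') g = cup h f g + cup h f' g :=
  Cochain.ext_ev fun w => by simp only [ev_add, cup_ev, add_mul]

theorem cup_smul_right {m n s : ℕ} (h : m + n = s) (c : k) (f : Cochain k A m)
    (g : Cochain k A n) : cup h f (c • g) = c • cup h f g :=
  Cochain.ext_ev fun w => by simp only [ev_smul, cup_ev, mul_smul_comm]

theorem cup_smul_left {m n s : ℕ} (h : m + n = s) (c : k) (f : Cochain k A m)
    (g : Cochain k A n) : cup h (c • f) g = c • cup h f g :=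
  Cochain.ext_ev fun w => by simp only [ev_smul, cup_ev, smul_mul_assoc]

theorem capLeft_add {p m q : ℕ} (h : p = m + q) (f f' : Cochain k A m) (x : Chain k A p) :
    capLeft h (f + f') x = capLeft h f x + capLeft h f' x := by
  refine LinearMap.congr_fun (g := capLeft h f + capLeft h f') (Chain.hom_ext_ev fun w => ?_) x
  obtain ⟨L, hL⟩ := ev_lin (gen k A q) w (s := 0) (by omega)
    (fun x t => if t = 0 then x * w 0 else w t) (LinearMap.mulRight k (w 0)) (fun x t _ => rfl)
  simp only [capLeft_ev, LinearMap.add_apply, ev_add, hL, map_add]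

theorem capLeft_smul {p m q : ℕ} (h : p = m + q) (c : k) (f : Cochain k A m)
    (x : Chain k A p) : capLeft h (c • f) x = c • capLeft h f x := by
  refine LinearMap.congr_fun (g := c • capLeft h f) (Chain.hom_ext_ev fun w => ?_) x
  obtain ⟨L, hL⟩ := ev_lin (gen k A q) w (s := 0) (by omega)
    (fun x t => if t = 0 then x * w 0 else w t) (LinearMap.mulRight k (w 0)) (fun x t _ => rfl)
  simp only [capLeft_ev, LinearMap.smul_apply, ev_smul, hL, map_smul]

namespace FrobeniusData

theorem capRight_add {p m q : ℕ} (h : p = m + q) (f f' : Cochain k A m) (x : Chain k A p) :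
    F.capRight h (f + f') x = F.capRight h f x + F.capRight h f' x := by
  refine LinearMap.congr_fun (g := F.capRight h f + F.capRight h f')
    (Chain.hom_ext_ev fun w => ?_) x
  obtain ⟨L, hL⟩ := ev_lin (gen k A q) (fun t => w (m + t)) (s := 0) (by omega)
    (fun x t => if t = 0 then w 0 * F.ν.symm x else w (m + t))
    ((LinearMap.mulLeft k (w 0)).comp F.ν.symm.toLinearMap) (fun x t _ => rfl)
  simp only [F.capRight_ev, LinearMap.add_apply, ev_add, hL, map_add (F := A →ₗ[k] _)]

theorem capRight_smul {p m q : ℕ} (h : p = m + q) (c : k) (f : Cochain k A m)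
    (x : Chain k A p) : F.capRight h (c • f) x = c • F.capRight h f x := by
  refine LinearMap.congr_fun (g := c • F.capRight h f) (Chain.hom_ext_ev fun w => ?_) x
  obtain ⟨L, hL⟩ := ev_lin (gen k A q) (fun t => w (m + t)) (s := 0) (by omega)
    (fun x t => if t = 0 then w 0 * F.ν.symm x else w (m + t))
    ((LinearMap.mulLeft k (w 0)).comp F.ν.symm.toLinearMap) (fun x t _ => rfl)
  simp only [F.capRight_ev, LinearMap.smul_apply, ev_smul, hL, map_smul (F := A →ₗ[k] _)]

theorem insertLeft_add {p m n : ℕ} (h : m = p + 1 + n) (f f' : Cochain k A m)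
    (x : Chain k A p) : F.insertLeft h (f + f') x = F.insertLeft h f x + F.insertLeft h f' x := by
  refine LinearMap.congr_fun (g := F.insertLeft h f + F.insertLeft h f')
    (Chain.hom_ext_ev (N := Cochain k A _) fun w => Cochain.ext_ev fun c => ?_) x
  simp only [LinearMap.add_apply, ev_add, F.insertLeft_ev, add_mul, Finset.sum_add_distrib]

theorem insertLeft_smul {p m n : ℕ} (h : m = p + 1 + n) (c : k) (f : Cochain k A m)
    (x : Chain k A p) : F.insertLeft h (c • f) x = c • F.insertLeft h f x := by
  refine LinearMap.congr_fun (g := c • F.insertLeft h f)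
    (Chain.hom_ext_ev (N := Cochain k A _) fun w => Cochain.ext_ev fun c => ?_) x
  simp only [LinearMap.smul_apply, ev_smul, F.insertLeft_ev, smul_mul_assoc, Finset.smul_sum]

theorem insertRight_add {p m n : ℕ} (h : m = p + 1 + n) (f f' : Cochain k A m)
    (x : Chain k A p) :
    F.insertRight h (f + f') x = F.insertRight h f x + F.insertRight h f' x := by
  refine LinearMap.congr_fun (g := F.insertRight h f + F.insertRight h f')
    (Chain.hom_ext_ev (N := Cochain k A _) fun w => Cochain.ext_ev fun c => ?_) x
  simp only [LinearMap.add_apply, ev_add, F.insertRight_ev, mul_add, Finset.sum_add_distrib]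

theorem insertRight_smul {p m n : ℕ} (h : m = p + 1 + n) (c : k) (f : Cochain k A m)
    (x : Chain k A p) : F.insertRight h (c • f) x = c • F.insertRight h f x := by
  refine LinearMap.congr_fun (g := c • F.insertRight h f)
    (Chain.hom_ext_ev (N := Cochain k A _) fun w => Cochain.ext_ev fun c => ?_) x
  simp only [LinearMap.smul_apply, ev_smul, F.insertRight_ev, mul_smul_comm, Finset.smul_sum]

theorem bilin_mul_right {H : A → A} (h : ∃ L : A →ₗ[k] A, ∀ x, H x = L x) :
    Bilin k fun x y => H x * y := by
  obtain ⟨L, hL⟩ := h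
  exact ⟨fun y => ⟨(LinearMap.mulRight k y).comp L, fun x => by simp [hL]⟩,
    fun x => ⟨LinearMap.mulLeft k (H x), fun y => rfl⟩⟩

theorem bilin_mul_left (c : A) {H : A → A} (h : ∃ L : A →ₗ[k] A, ∀ x, H x = L x) :
    Bilin k fun x y => x * c * H y := by
  obtain ⟨L, hL⟩ := h
  exact ⟨fun y => ⟨(LinearMap.mulRight k (H y)).comp (LinearMap.mulRight k c), fun x => rfl⟩,
    fun x => ⟨(LinearMap.mulLeft k (x * c)).comp L, fun y => by simp [hL, mul_assoc]⟩⟩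

/-- `∑ u_i a v_i`. -/
noncomputable def casimir (a : A) : A := ∑ i, F.u i * a * F.v i

theorem mul_casimir (a b : A) : a * F.casimir b = F.casimir b * a := by
  have := F.sum_mul_left (N := A) (G := fun x y => x * b * y)
    (bilin_mul_left b ⟨LinearMap.id, fun _ => rfl⟩) a
  simp only [casimir, Finset.mul_sum, Finset.sum_mul]
  simpa only [mul_assoc] using this

/-- An instance of `sum_mul_right`: the factor ν(a) loses its twist when it passes through the dual
bases to the other side of b. For b = 1 it shows that the norm does not distinguish a from ν(a). -/
theorem sum_mul_ν_mul (a b : A) :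
    ∑ i, F.u i * F.ν a * b * F.v i = ∑ i, F.u i * b * a * F.v i := by
  have := F.sum_mul_right (N := A) (G := fun x y => x * b * y)
    (bilin_mul_left b ⟨LinearMap.id, fun _ => rfl⟩) a
  simpa only [mul_assoc] using this

theorem casimir_ν (a : A) : ∑ i, F.u i * F.ν a * F.v i = F.casimir a := by
  simpa [casimir] using F.sum_mul_ν_mul a 1

/-- The form is not symmetric, so exchanging the roles of the dual bases costs a twist (`sum_swap`);
it turns the sum into one in which ν⁻¹ can be pulled out. -/
theorem sum_v_mul_u (b : A) : ∑ i, F.v i * b * F.ν.symm (F.u i) = F.ν.symm (F.casimir b) := by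
  rw [F.sum_swap (N := A) (G := fun x y => x * b * F.ν.symm y)
    (bilin_mul_left b ⟨F.ν.symm.toLinearMap, fun _ => rfl⟩), ← F.casimir_ν]
  simp

theorem norm_ev' (w v : ℕ → A) : ev (F.norm (ev (gen k A 0) w)).1 v = F.casimir (w 0) :=
  F.norm_ev w v

/-- Mirror image of `capLeft_bdry`. Now f eats the front arguments, so the cofaces of f come first,
and the seam is the coincidence of the last coface of f with the zeroth face of the capped chain.
The latter multiplies by ν⁻¹(a_{m+1}), in agreement with the ν⁻¹ applied to f. -/
theorem capRight_bdry {p m q : ℕ} (h : p = m + q) (f : Cochain k A m)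
    (x : Chain k A (p + 1)) :
    F.capRight h f (bdry F.ν.symm p x) = F.capRight (by omega) (δ m f) x
      - (-1 : k) ^ (m + 1) • bdry F.ν.symm q (F.capRight (by omega) f x) := by
  subst h
  refine LinearMap.congr_fun (f := (F.capRight rfl f).comp (bdry F.ν.symm (m + q)))
    (g := F.capRight (by omega) (δ m f)
      - (-1 : k) ^ (m + 1) • (bdry F.ν.symm q).comp (F.capRight (by omega) f))
    (Chain.hom_ext_ev fun w => ?_) x
  simp only [LinearMap.comp_apply, LinearMap.sub_apply, LinearMap.smul_apply, bdry_ev, map_altSum,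
    F.capRight_ev, δ_ev]
  have e := ev_altSum_entry (gen k A q) ((LinearMap.mulLeft k (w 0)).comp F.ν.symm.toLinearMap)
    (fun t => w (m + 1 + t)) (m + 2) fun i => coface f i fun t => w (t + 1)
  simp only [LinearMap.comp_apply, LinearMap.mulLeft_apply, AlgEquiv.toLinearMap_apply] at e
  rw [e, show m + q + 2 = m + 1 + (q + 1) by omega]
  refine altSum_join ?_ ?_ ?_
  · refine ev_congr _ fun t ht => ?_
    rw [face_zero, coface_last]
    by_cases h0 : t = 0
    · simp [h0, mul_assoc]
    · simp [h0, add_comm, add_left_comm]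
  · intro i hi
    have e1 : face F.ν.symm (m + q) i w 0 *
        F.ν.symm (ev f.1 fun s => face F.ν.symm (m + q) i w (s + 1)) =
        w 0 * F.ν.symm (coface f i fun t => w (t + 1)) := by
      rcases Nat.eq_zero_or_pos i with rfl | h0
      · rw [coface_zero, face_zero]
        simp [mul_assoc]
      · obtain ⟨i, rfl⟩ : ∃ j, i = j + 1 := ⟨i - 1, by omega⟩
        rw [coface_mid _ _ (by omega), face_mid _ _ (by omega) (by omega)]
        congr 2
        refine ev_congr _ fun t ht => ?_
        simp only [merge]; grind
    refine ev_congr _ fun t ht => ?_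
    rw [e1]
    simp only [face]; split_ifs <;> simp only [merge] <;> grind
  · intro i hi
    have e1 : ev f.1 (fun s => face F.ν.symm (m + q) (m + 1 + i) w (s + 1)) =
        ev f.1 (fun s => w (s + 1)) := ev_congr _ fun t ht => by
      simp only [face]; split_ifs <;> simp only [merge] <;> grind
    refine ev_congr _ fun t ht => ?_
    rw [e1]
    simp only [face]; split_ifs <;> simp only [merge] <;> grind

theorem linear_insert {m : ℕ} (f : Cochain k A m) (W : ℕ → A) (n : ℕ) (hn : n < m) (c : A) :
    ∃ L : A →ₗ[k] A, ∀ x, ev f.1 (fun t => if t = n then x * c else W t) = L x :=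
  ev_lin f.1 W hn (fun x t => if t = n then x * c else W t) (LinearMap.mulRight k c)
    (fun _ _ _ => rfl)

/-- The zeroth coface takes u_i ν(a_0) out of f, and `sum_mul_ν_mul` moves a_0 behind the value of
f: this is the norm of the capped chain. The remaining cofaces are the faces of the chain; in the
last one a_{p+1} stands in front of v_i and has to pass to the side of u_i by `sum_mul_right`. -/
theorem insertLeft_norm {p : ℕ} (f : Cochain k A (p + 1)) (x : Chain k A (p + 1)) :
    F.insertLeft (n := 0) (by omega) (δ (p + 1) f) x =
      F.norm (capLeft (p := p + 1) (m := p + 1) (q := 0) (by omega) f x)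
      - F.insertLeft (n := 0) (by omega) f (bdry F.ν.symm p x) := by
  induction x using Chain.induction_ev with
  | hadd x y hx hy => simp only [map_add, hx, hy]; abel
  | hsmul c x hx => simp only [map_smul, hx]; module
  | hev w =>
    refine Cochain.ext_ev fun c => ?_
    simp only [ev_sub, bdry_ev, map_altSum_ev, capLeft_ev, F.insertLeft_ev, δ_ev, F.norm_ev,
      altSum_mul, sum_altSum]
    rw [altSum_succ']
    congr 1
    · simp only [coface_zero]
      simp only [Nat.not_lt_zero, if_false, if_true, Nat.add_eq_zero_iff, one_ne_zero, and_false,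
        Nat.sub_zero, F.sum_mul_ν_mul]
      simp [mul_assoc, add_comm]
    · refine altSum_congr fun i hi => ?_
      rcases Nat.eq_zero_or_pos i with rfl | h0
      · refine Finset.sum_congr rfl fun j _ => ?_
        have e : F.u j * F.ν (w 0 * F.ν.symm (w 1)) = F.u j * F.ν (w 0) * w 1 := by
          simp [mul_assoc]
        rw [coface_mid _ _ (by omega), face_zero]
        congr 1
        refine ev_congr _ fun t ht => ?_
        simp only [merge]
        grind
      rcases eq_or_ne i (p + 1) with rfl | hne
      · simp only [coface_last, face_last, mul_assoc]
        have := F.sum_mul_right (N := A) (bilin_mul_right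
          (linear_insert f w 0 (by omega) (F.ν (w 0)))) (w (p + 1))
        simp only [Nat.not_lt_zero, if_false, Nat.sub_zero]
        simp only [mul_assoc] at this
        refine (Eq.trans ?_ this.symm).trans ?_
        · refine Finset.sum_congr rfl fun j _ => ?_
          congr 2
        · refine Finset.sum_congr rfl fun j _ => ?_
          congr 1
          refine ev_congr _ fun t ht => ?_
          simp
          grind
      · refine Finset.sum_congr rfl fun j _ => ?_
        rw [coface_mid _ _ (by omega), face_mid _ _ (by omega) (by omega)]
        congr 1
        refine ev_congr _ fun t ht => ?_
        simp only [merge]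
        grind

theorem δ_zero_ev (f : Cochain k A 0) (w : ℕ → A) :
    ev (δ 0 f).1 w = w 0 * ev f.1 w - ev f.1 w * w 0 := by
  have e : coface f 1 w = ev f.1 w * w 0 := coface_last f w
  rw [δ_ev, altSum_succ', altSum_succ']
  simp only [coface_zero, e]
  rw [ev_congr f.1 (w' := w) fun t ht => by omega]
  simp [altSum]

theorem insertLeft_norm_zero (f : Cochain k A 0) (x : Chain k A 0) :
    F.insertLeft (n := 0) (by omega) (δ 0 f) x = F.norm (capLeft (by omega) f x)
      - cup (by omega) f (F.norm x) := by
  induction x using Chain.induction_ev with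
  | hadd x y hx hy => simp only [map_add, hx, hy, cup_add_right]; abel
  | hsmul c x hx => simp only [map_smul, hx, cup_smul_right]; module
  | hev w =>
    refine Cochain.ext_ev fun c => ?_
    simp only [ev_sub, cup_ev, capLeft_ev, F.insertLeft_ev, δ_zero_ev, F.norm_ev]
    have e : ∀ w', ev f.1 w' = ev f.1 c := fun w' => ev_congr _ fun t ht => by omega
    simp only [e, sub_mul, Finset.sum_sub_distrib, Nat.lt_irrefl, if_false, if_true,
      F.sum_mul_ν_mul, Finset.mul_sum]
    congr 1
    · simp only [mul_assoc]
    · have := F.sum_mul_right (N := A) (G := fun x y => ev f.1 c * x * y)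
        (bilin_mul_right ⟨LinearMap.mulLeft k _, fun _ => rfl⟩) (w 0)
      simpa [mul_assoc] using this

theorem linear_insertLeft {m : ℕ} (f : Cochain k A m) (b a : ℕ → A) (n : ℕ) (hn : n < m)
    (c : A) : ∃ L : A →ₗ[k] A, ∀ x, ev f.1 (fun t => if t < n then b t else
      if t = n then x * c else a (t - n)) = L x := by
  refine ev_lin f.1 (fun t => if t < n then b t else a (t - n)) hn (fun x t => if t < n then b t
    else if t = n then x * c else a (t - n)) (LinearMap.mulRight k c) (fun x t _ => ?_)
  simp only [LinearMap.mulRight_apply]; grind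

/-- The first n + 2 cofaces act on the free variables. Among them the one merging the last free
variable with u_i becomes right multiplication of the value after `sum_mul_left`. The other p + 2
cofaces act on the chain and give its boundary, the cyclic one after `sum_mul_right`. No term is
left over, so the alternating sum is simply cut in two. -/
theorem insertLeft_δ {p m n : ℕ} (h : m = p + 1 + 1 + n) (f : Cochain k A m)
    (x : Chain k A (p + 1)) :
    F.insertLeft (n := n + 1) (by omega) (δ m f) x = δ n (F.insertLeft h f x)
      + (-1 : k) ^ n • F.insertLeft (by omega) f (bdry F.ν.symm p x) := by
  subst h
  refine LinearMap.congr_fun (f := F.insertLeft (n := n + 1) (by omega) (δ _ f))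
    (g := (δ n).comp (F.insertLeft rfl f)
      + (-1 : k) ^ n • (F.insertLeft (n := n + 1) (by omega) f).comp (bdry F.ν.symm p))
    (Chain.hom_ext_ev (N := Cochain k A _) fun w => Cochain.ext_ev fun c => ?_) x
  simp only [LinearMap.comp_apply, LinearMap.add_apply, LinearMap.smul_apply, ev_add, ev_smul,
    bdry_ev, map_altSum_ev, F.insertLeft_ev, δ_ev, altSum_mul, sum_altSum]
  rw [show p + 1 + 1 + n + 2 = n + 2 + (p + 2) by omega, altSum_add,
    show (-1 : k) ^ (n + 2) = (-1) ^ n by simp [pow_add]]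
  congr 1
  · refine altSum_congr fun i hi => ?_
    rcases Nat.eq_zero_or_pos i with rfl | h0
    · simp only [coface_zero, F.insertLeft_ev, Finset.mul_sum]
      refine Finset.sum_congr rfl fun j _ => ?_
      rw [← mul_assoc]
      congr 2
      refine ev_congr _ fun t ht => ?_
      grind
    obtain ⟨i, rfl⟩ : ∃ j, i = j + 1 := ⟨i - 1, by omega⟩
    rcases eq_or_ne i n with rfl | hne
    · simp only [coface_last, F.insertLeft_ev, Finset.sum_mul]
      have := F.sum_mul_left (N := A) (bilin_mul_right (linear_insertLeft f c w i (by omega) (F.ν (w 0))))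
        (c i)
      simp only [mul_assoc] at this ⊢
      rw [← this]
      refine Finset.sum_congr rfl fun j _ => ?_
      rw [coface_mid _ _ (by omega)]
      congr 1
      refine ev_congr _ fun t ht => ?_
      simp only [merge]; grind
    · rw [coface_mid _ _ (by omega), F.insertLeft_ev]
      refine Finset.sum_congr rfl fun j _ => ?_
      rw [coface_mid _ _ (by omega)]
      congr 1
      refine ev_congr _ fun t ht => ?_
      simp only [merge]; grind
  · congr 1
    refine altSum_congr fun i hi => ?_
    rw [show n + 2 + i = n + 1 + i + 1 by omega]
    rcases Nat.eq_zero_or_pos i with rfl | h0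
    · refine Finset.sum_congr rfl fun j _ => ?_
      have e : F.u j * F.ν (w 0 * F.ν.symm (w 1)) = F.u j * F.ν (w 0) * w 1 := by
        simp [mul_assoc]
      rw [coface_mid _ _ (by omega), face_zero]
      congr 1
      refine ev_congr _ fun t ht => ?_
      simp only [merge]
      grind
    rcases eq_or_ne i (p + 1) with rfl | hne
    · have := F.sum_mul_right (N := A) (bilin_mul_right
        (linear_insertLeft f c w (n + 1) (by omega) (F.ν (w 0)))) (w (p + 1))
      rw [show n + 1 + (p + 1) = p + 1 + 1 + n by omega]
      simp only [coface_last, face_last, mul_assoc] at this ⊢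
      refine (Eq.trans ?_ this.symm).trans ?_
      · refine Finset.sum_congr rfl fun j _ => ?_
        congr 2
        grind
      · refine Finset.sum_congr rfl fun j _ => ?_
        congr 1
        refine ev_congr _ fun t ht => ?_
        simp only [if_true, map_mul]
        grind
    · refine Finset.sum_congr rfl fun j _ => ?_
      rw [coface_mid _ _ (by omega), face_mid _ _ (by omega) (by omega)]
      congr 1
      refine ev_congr _ fun t ht => ?_
      simp only [merge]
      grind

end FrobeniusData

end FrobeniusLeibniz
end CompleteHochschild

namespace CompleteHochschild
universe u

/-! ### Leibniz rules for inserting a chain from the right, and chains of degree zero -/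

section FrobeniusLeibniz

variable {k A : Type u} [Field k] [Ring A] [Algebra k A]
  {ι : Type*} [Fintype ι] [DecidableEq ι] (F : FrobeniusData k A ι)

namespace FrobeniusData

/-- A chain of degree zero has no boundary inside the chains. The single coface beyond the first n +
2 has u_i ν(a_0) outside of f and yields the cup product with the norm, which is the differential of
the complete complex in this degree. -/
theorem insertLeft_δ_zero {m n : ℕ} (h : m = 0 + 1 + n) (f : Cochain k A m) (x : Chain k A 0) :
    F.insertLeft (n := n + 1) (by omega) (δ m f) x = δ n (F.insertLeft h f x)
      + (-1 : k) ^ n • cup (by omega) f (F.norm x) := by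
  subst h
  induction x using Chain.induction_ev with
  | hadd x y hx hy => simp only [map_add, hx, hy, cup_add_right]; module
  | hsmul c x hx => simp only [map_smul, hx, cup_smul_right]; module
  | hev w =>
    refine Cochain.ext_ev fun c => ?_
    simp only [ev_add, ev_smul, cup_ev, F.insertLeft_ev, δ_ev, F.norm_ev, altSum_mul, sum_altSum]
    rw [show 0 + 1 + n + 2 = n + 2 + 1 by omega, altSum_succ,
      show (-1 : k) ^ (n + 2) = (-1) ^ n by simp [pow_add]]
    congr 1
    · refine altSum_congr fun i hi => ?_
      rcases Nat.eq_zero_or_pos i with rfl | h0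
      · simp only [coface_zero, F.insertLeft_ev, Finset.mul_sum]
        refine Finset.sum_congr rfl fun j _ => ?_
        rw [← mul_assoc]
        congr 2
        refine ev_congr _ fun t ht => ?_
        grind
      obtain ⟨i, rfl⟩ : ∃ j, i = j + 1 := ⟨i - 1, by omega⟩
      rcases eq_or_ne i n with rfl | hne
      · simp only [coface_last, F.insertLeft_ev, Finset.sum_mul]
        have := F.sum_mul_left (N := A)
          (bilin_mul_right (linear_insertLeft f c w i (by omega) (F.ν (w 0)))) (c i)
        simp only [mul_assoc] at this ⊢
        rw [← this]
        refine Finset.sum_congr rfl fun j _ => ?_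
        rw [coface_mid _ _ (by omega)]
        congr 1
        refine ev_congr _ fun t ht => ?_
        simp only [merge]; grind
      · rw [coface_mid _ _ (by omega), F.insertLeft_ev]
        refine Finset.sum_congr rfl fun j _ => ?_
        rw [coface_mid _ _ (by omega)]
        congr 1
        refine ev_congr _ fun t ht => ?_
        simp only [merge]; grind
    · congr 1
      rw [show n + 2 = 0 + 1 + n + 1 by omega]
      have e : ∀ W : ℕ → A, (∀ t < 0 + 1 + n, W t = c t) → ev f.1 W = ev f.1 c :=
        fun W hW => ev_congr _ hW
      have := F.sum_mul_right (N := A) (G := fun x y => ev f.1 c * x * y)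
        (bilin_mul_right ⟨LinearMap.mulLeft k _, fun _ => rfl⟩) (w 0)
      simp only [coface_last, Finset.mul_sum]
      simp only [mul_assoc] at this ⊢
      rw [← this]
      refine Finset.sum_congr rfl fun j _ => ?_
      rw [e _ fun t ht => by grind, if_neg (by omega), if_pos (by omega), mul_assoc]

theorem linear_insertRight {m : ℕ} (f : Cochain k A m) (b a : ℕ → A) (n : ℕ) (hn : n < m) :
    ∃ L : A →ₗ[k] A, ∀ x, ev f.1 (fun t => if t < n then b (t + 1) else
      if t = n then x else a (t - (n + 1))) = L x := by
  refine ev_lin f.1 (fun t => if t < n then b (t + 1) else a (t - (n + 1))) hn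
    (fun x t => if t < n then b (t + 1)
    else if t = n then x else a (t - (n + 1))) LinearMap.id (fun x t _ => ?_)
  simp only [LinearMap.id_apply]; grind

theorem insertRight_norm {p : ℕ} (f : Cochain k A (p + 1)) (x : Chain k A (p + 1)) :
    F.insertRight (n := 0) (by omega) (δ (p + 1) f) x =
      F.insertRight (n := 0) (by omega) f (bdry F.ν.symm p x)
      + (-1 : k) ^ p • F.norm (F.capRight (p := p + 1) (m := p + 1) (q := 0) (by omega) f x) := by
  induction x using Chain.induction_ev with
  | hadd x y hx hy => simp only [map_add, hx, hy]; module
  | hsmul c x hx => simp only [map_smul, hx]; module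
  | hev w =>
    refine Cochain.ext_ev fun c => ?_
    simp only [ev_add, ev_smul, bdry_ev, map_altSum_ev, F.capRight_ev, F.insertRight_ev, δ_ev,
      F.norm_ev, mul_altSum, sum_altSum]
    rw [altSum_succ, show (-1 : k) ^ (p + 2) = (-1) ^ p by simp [pow_add]]
    congr 1
    · refine altSum_congr fun i hi => ?_
      rcases Nat.eq_zero_or_pos i with rfl | h0
      · refine Finset.sum_congr rfl fun j _ => ?_
        rw [coface_zero, face_zero, ← mul_assoc]
        simp only [Nat.succ_pos, if_true, map_mul, AlgEquiv.apply_symm_apply, ← mul_assoc]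
        congr 1
        refine ev_congr _ fun t ht => ?_
        simp only [Nat.add_eq_zero_iff, one_ne_zero, and_false, if_false]
        grind
      rcases eq_or_ne i (p + 1) with rfl | hne
      · have := F.sum_mul_right (N := A) (bilin_mul_left (F.ν (w 0))
          (linear_insertRight f w c p (by omega))) (w (p + 1))
        simp only [face_last, map_mul, if_true, mul_assoc] at this ⊢
        refine (Eq.trans ?_ this.symm).trans ?_
        · refine Finset.sum_congr rfl fun j _ => ?_
          rw [coface_mid _ _ (by omega)]
          congr 2
          refine ev_congr _ fun t ht => ?_
          simp only [merge]; grind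
        · refine Finset.sum_congr rfl fun j _ => ?_
          congr 3
      · refine Finset.sum_congr rfl fun j _ => ?_
        obtain ⟨i, rfl⟩ : ∃ j, i = j + 1 := ⟨i - 1, by omega⟩
        rw [coface_mid _ _ (by omega), face_mid _ _ (by omega) (by omega)]
        congr 1
        refine ev_congr _ fun t ht => ?_
        simp only [merge]
        grind
    · congr 1
      simp only [coface_last]
      have := F.sum_mul_ν_mul
        (w 0 * F.ν.symm (ev f.1 fun t => w (t + 1))) 1
      simp only [mul_one, map_mul, AlgEquiv.apply_symm_apply] at this
      simp only [if_true]
      rw [← this]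
      refine Finset.sum_congr rfl fun j _ => ?_
      rw [ev_congr f.1 (w' := fun t => w (t + 1)) fun t ht => by grind]
      simp [mul_assoc]

theorem insertRight_norm_zero (f : Cochain k A 0) (x : Chain k A 0) :
    F.insertRight (n := 0) (by omega) (δ 0 f) x = cup (by omega) (F.norm x) f
      - F.norm (F.capRight (p := 0) (m := 0) (q := 0) (by omega) f x) := by
  induction x using Chain.induction_ev with
  | hadd x y hx hy => simp only [map_add, hx, hy, cup_add_left]; abel
  | hsmul c x hx => simp only [map_smul, hx, cup_smul_left]; module
  | hev w =>
    refine Cochain.ext_ev fun c => ?_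
    simp only [ev_sub, cup_ev, F.capRight_ev, F.insertRight_ev, δ_zero_ev, F.norm_ev]
    have e : ∀ w', ev f.1 w' = ev f.1 c := fun w' => ev_congr _ fun t ht => by omega
    simp only [e, mul_sub, Finset.sum_sub_distrib, Nat.lt_irrefl, if_false, if_true,
      Finset.sum_mul]
    congr 1
    · have := F.sum_mul_right (N := A) (G := fun x y => x * y * ev f.1 c)
        ⟨fun y => ⟨(LinearMap.mulRight k (ev f.1 c)).comp (LinearMap.mulRight k y), fun x => rfl⟩,
          fun x => ⟨(LinearMap.mulRight k (ev f.1 c)).comp (LinearMap.mulLeft k x), fun x => rfl⟩⟩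
        (w 0)
      simpa [mul_assoc] using this
    · have := F.sum_mul_ν_mul (w 0 * F.ν.symm (ev f.1 c)) 1
      simpa [mul_assoc] using this

/-- As in `insertLeft_δ`, in the opposite order: the first p + 2 cofaces produce the boundary of the
chain and the last n + 2 produce δ of the result. The coface merging v_i with the first free
variable is moved to the left of the product by `sum_mul_left`. -/
theorem insertRight_δ {p m n : ℕ} (h : m = p + 1 + 1 + n) (f : Cochain k A m)
    (x : Chain k A (p + 1)) :
    F.insertRight (n := n + 1) (by omega) (δ m f) x =
      F.insertRight (by omega) f (bdry F.ν.symm p x)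
      + (-1 : k) ^ p • δ n (F.insertRight h f x) := by
  subst h
  induction x using Chain.induction_ev with
  | hadd x y hx hy => simp only [map_add, hx, hy]; module
  | hsmul c x hx => simp only [map_smul, hx]; module
  | hev w =>
    refine Cochain.ext_ev fun c => ?_
    simp only [ev_add, ev_smul, bdry_ev, map_altSum_ev, F.insertRight_ev, δ_ev, mul_altSum,
      sum_altSum]
    rw [show p + 1 + 1 + n + 2 = p + 2 + (n + 2) by omega, altSum_add,
      show (-1 : k) ^ (p + 2) = (-1) ^ p by simp [pow_add]]
    congr 1
    · refine altSum_congr fun i hi => ?_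
      rcases Nat.eq_zero_or_pos i with rfl | h0
      · refine Finset.sum_congr rfl fun j _ => ?_
        rw [coface_zero, face_zero, ← mul_assoc]
        simp only [Nat.succ_pos, if_true, map_mul, AlgEquiv.apply_symm_apply, ← mul_assoc]
        congr 1
        refine ev_congr _ fun t ht => ?_
        simp only [Nat.add_eq_zero_iff, one_ne_zero, and_false, if_false]
        grind
      rcases eq_or_ne i (p + 1) with rfl | hne
      · have := F.sum_mul_right (N := A) (bilin_mul_left (F.ν (w 0))
          (linear_insertRight f w c p (by omega))) (w (p + 1))
        simp only [face_last, map_mul, if_true, mul_assoc] at this ⊢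
        refine (Eq.trans ?_ this.symm).trans ?_
        · refine Finset.sum_congr rfl fun j _ => ?_
          rw [coface_mid _ _ (by omega)]
          congr 2
          refine ev_congr _ fun t ht => ?_
          simp only [merge]; grind
        · refine Finset.sum_congr rfl fun j _ => ?_
          congr 3
      · refine Finset.sum_congr rfl fun j _ => ?_
        obtain ⟨i, rfl⟩ : ∃ j, i = j + 1 := ⟨i - 1, by omega⟩
        rw [coface_mid _ _ (by omega), face_mid _ _ (by omega) (by omega)]
        congr 1
        refine ev_congr _ fun t ht => ?_
        simp only [merge]
        grind
    · congr 1
      refine altSum_congr fun i hi => ?_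
      rw [show p + 2 + i = p + 1 + i + 1 by omega]
      rcases Nat.eq_zero_or_pos i with rfl | h0
      · have := F.sum_mul_left (N := A) (bilin_mul_left (F.ν (w 0))
          (linear_insertRight f w (fun t => c (t + 1)) (p + 1) (by omega))) (c 0)
        simp only [coface_zero, F.insertRight_ev, Finset.mul_sum, mul_assoc] at this ⊢
        rw [this]
        refine Finset.sum_congr rfl fun j _ => ?_
        rw [coface_mid _ _ (by omega)]
        congr 2
        refine ev_congr _ fun t ht => ?_
        simp only [merge]; grind
      obtain ⟨i, rfl⟩ : ∃ j, i = j + 1 := ⟨i - 1, by omega⟩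
      rcases eq_or_ne i n with rfl | hne
      · rw [show p + 1 + (i + 1) + 1 = p + 1 + 1 + i + 1 by omega]
        simp only [coface_last, F.insertRight_ev, Finset.sum_mul, mul_assoc]
        refine Finset.sum_congr rfl fun j _ => ?_
        congr 3
        grind
      · rw [coface_mid _ _ (by omega), F.insertRight_ev]
        refine Finset.sum_congr rfl fun j _ => ?_
        rw [coface_mid _ _ (by omega)]
        congr 1
        refine ev_congr _ fun t ht => ?_
        simp only [merge]; grind

theorem insertRight_δ_zero {m n : ℕ} (h : m = 0 + 1 + n) (f : Cochain k A m) (x : Chain k A 0) :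
    F.insertRight (n := n + 1) (by omega) (δ m f) x = cup (by omega) (F.norm x) f
      - δ n (F.insertRight h f x) := by
  subst h
  induction x using Chain.induction_ev with
  | hadd x y hx hy => simp only [map_add, hx, hy, cup_add_left]; abel
  | hsmul c x hx => simp only [map_smul, hx, cup_smul_left]; module
  | hev w =>
    refine Cochain.ext_ev fun c => ?_
    simp only [ev_sub, cup_ev, F.insertRight_ev, δ_ev, F.norm_ev, mul_altSum, sum_altSum]
    rw [show 0 + 1 + n + 2 = n + 2 + 1 by omega, altSum_succ']
    congr 1
    · have := F.sum_mul_right (N := A) (G := fun x y => x * y * ev f.1 c)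
        ⟨fun y => ⟨(LinearMap.mulRight k (ev f.1 c)).comp (LinearMap.mulRight k y), fun x => rfl⟩,
          fun x => ⟨(LinearMap.mulRight k (ev f.1 c)).comp (LinearMap.mulLeft k x), fun x => rfl⟩⟩
        (w 0)
      simp only [mul_assoc] at this
      simp only [Finset.sum_mul, mul_assoc, zero_add, ← this]
      refine Finset.sum_congr rfl fun j _ => ?_
      simp [coface_zero]
    · refine altSum_congr fun i hi => ?_
      rcases Nat.eq_zero_or_pos i with rfl | h0
      · have := F.sum_mul_left (N := A) (bilin_mul_left (F.ν (w 0))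
          (linear_insertRight f w (fun t => c (t + 1)) 0 (by omega))) (c 0)
        simp only [coface_zero, F.insertRight_ev, Finset.mul_sum, mul_assoc] at this ⊢
        rw [this]
        refine Finset.sum_congr rfl fun j _ => ?_
        rw [coface_mid _ _ (by omega)]
        congr 2
        refine ev_congr _ fun t ht => ?_
        simp only [merge]; grind
      obtain ⟨i, rfl⟩ : ∃ j, i = j + 1 := ⟨i - 1, by omega⟩
      rcases eq_or_ne i n with rfl | hne
      · rw [show i + 1 + 1 = 0 + 1 + i + 1 by omega]
        simp only [coface_last, F.insertRight_ev, Finset.sum_mul, mul_assoc]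
        refine Finset.sum_congr rfl fun j _ => ?_
        congr 3
        grind
      · rw [coface_mid _ _ (by omega), F.insertRight_ev]
        refine Finset.sum_congr rfl fun j _ => ?_
        rw [coface_mid _ _ (by omega)]
        congr 1
        refine ev_congr _ fun t ht => ?_
        simp only [merge]; grind

end FrobeniusData

end FrobeniusLeibniz
end CompleteHochschild

namespace CompleteHochschild
universe u

/-! ### Leibniz rules for the product of two chains -/

section FrobeniusLeibniz

variable {k A : Type u} [Field k] [Ring A] [Algebra k A]
  {ι : Type*} [Fintype ι] [DecidableEq ι] (F : FrobeniusData k A ι)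

namespace FrobeniusData

/-- The word of the `⋆`-product of two chains. -/
def starWord (q : ℕ) (a b : ℕ → A) (x y : A) : ℕ → A := fun t =>
  if t = 0 then y * b 0 else if t ≤ q then b t
    else if t = q + 1 then x * F.ν (a 0) else a (t - (q + 1))

theorem bilin_starWord {r q : ℕ} (h : q + 1 ≤ r) (a b : ℕ → A) :
    Bilin k fun x y => ev (gen k A r) (F.starWord q a b x y) := by
  constructor
  · intro y
    refine ev_lin _ (F.starWord q a b 0 y) (s := q + 1) (by omega) (fun x => F.starWord q a b x y)
      (LinearMap.mulRight k (F.ν (a 0))) (fun x t _ => ?_)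
    simp only [starWord, LinearMap.mulRight_apply]; grind
  · intro x
    refine ev_lin _ (F.starWord q a b x 0) (s := 0) (by omega) (F.starWord q a b x)
      (LinearMap.mulRight k (b 0)) (fun x t _ => ?_)
    simp only [starWord, LinearMap.mulRight_apply]; grind

theorem chainMul_ev' {p q r : ℕ} (h : p + q + 1 = r) (a b : ℕ → A) :
    F.chainMul h (ev (gen k A p) a) (ev (gen k A q) b) =
      ∑ i, ev (gen k A r) (F.starWord q a b (F.u i) (F.v i)) := F.chainMul_ev h a b

theorem chainMul_altSum_left {p q r n : ℕ} (h : p + q + 1 = r) (c : ℕ → Chain k A p)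
    (y : Chain k A q) :
    F.chainMul h (altSum k n c) y = altSum k n fun i => F.chainMul h (c i) y := by
  simp [altSum]

/-- The word consists of the block of y followed by the block of x. Faces inside a block are faces
of that factor. The cyclic face of y appears as b_{q+1} multiplied into u_i and is carried over to
v_i by `sum_mul_left`; the cyclic face of x appears as a_{p+1} multiplied onto v_i and is carried
over to u_i by `sum_mul_right`. -/
theorem bdry_chainMul {p q r : ℕ} (h : p + 1 + q + 1 = r) (x : Chain k A (p + 1))
    (y : Chain k A (q + 1)) :
    bdry F.ν.symm r (F.chainMul (by omega) x y) = F.chainMul h x (bdry F.ν.symm q y)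
      + (-1 : k) ^ q • F.chainMul (by omega) (bdry F.ν.symm p x) y := by
  subst h
  induction x using Chain.induction_ev with
  | hadd x y hx hy => simp only [map_add, LinearMap.add_apply, hx, hy]; module
  | hsmul c x hx => simp only [map_smul, LinearMap.smul_apply, hx]; module
  | hev a =>
  induction y using Chain.induction_ev with
  | hadd x y hx hy => simp only [map_add, hx, hy]; module
  | hsmul c x hx => simp only [map_smul, hx]; module
  | hev b =>
    simp only [bdry_ev, F.chainMul_altSum_left]
    simp only [bdry_ev, F.chainMul_ev', map_sum, map_altSum, sum_altSum]
    rw [show p + 1 + q + 1 + 2 = q + 2 + (p + 2) by omega, altSum_add,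
      show (-1 : k) ^ (q + 2) = (-1) ^ q by simp [pow_add]]
    congr 1
    · refine altSum_congr fun i hi => ?_
      rcases Nat.eq_zero_or_pos i with rfl | h0
      · refine Finset.sum_congr rfl fun j _ => ev_congr _ fun t ht => ?_
        simp only [face_zero, starWord]
        grind
      rcases eq_or_ne i (q + 1) with rfl | hne
      · have := F.sum_mul_left (F.bilin_starWord (k := k) (r := p + 1 + q + 1) (q := q) (by omega)
          a b) (b (q + 1))
        refine (Eq.trans ?_ this).trans ?_
        · refine Finset.sum_congr rfl fun j _ => ev_congr _ fun t ht => ?_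
          rw [face_mid _ _ (by omega) (by omega)]
          simp only [starWord, merge, mul_assoc]
          grind
        · refine Finset.sum_congr rfl fun j _ => ev_congr _ fun t ht => ?_
          simp only [face_last, starWord, mul_assoc]
          grind
      · refine Finset.sum_congr rfl fun j _ => ev_congr _ fun t ht => ?_
        rw [face_mid _ _ (by omega) (by omega), face_mid _ _ (by omega) (by omega)]
        simp only [starWord, merge]
        grind
    · congr 1
      refine altSum_congr fun i hi => ?_
      rcases Nat.eq_zero_or_pos i with rfl | h0
      · refine Finset.sum_congr rfl fun j _ => ev_congr _ fun t ht => ?_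
        have e : F.u j * F.ν (a 0 * F.ν.symm (a 1)) = F.u j * F.ν (a 0) * a 1 := by
          simp [mul_assoc]
        rw [face_mid _ _ (by omega) (by omega)]
        simp only [face_zero, starWord, merge]
        grind
      rcases eq_or_ne i (p + 1) with rfl | hne
      · have := F.sum_mul_right (F.bilin_starWord (k := k) (r := p + 1 + q + 1) (q := q + 1)
          (by omega) a b) (a (p + 1))
        rw [show q + 2 + (p + 1) = p + 1 + q + 1 + 1 by omega]
        refine (Eq.trans ?_ this.symm).trans ?_
        · refine Finset.sum_congr rfl fun j _ => ev_congr _ fun t ht => ?_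
          simp only [face_last, starWord, mul_assoc]
          grind
        · refine Finset.sum_congr rfl fun j _ => ev_congr _ fun t ht => ?_
          simp only [face_last, starWord, mul_assoc, map_mul, if_true]
          grind
      · refine Finset.sum_congr rfl fun j _ => ev_congr _ fun t ht => ?_
        rw [face_mid _ _ (by omega) (by omega), face_mid _ _ (by omega) (by omega)]
        simp only [starWord, merge]
        grind

theorem capLeft_norm_ev {p : ℕ} (w : ℕ → A) (y : ℕ → A) :
    capLeft (p := p) (m := 0) (q := p) (by omega) (F.norm (ev (gen k A 0) w)) (ev (gen k A p) y) =
      ev (gen k A p) (fun t => if t = 0 then F.casimir (w 0) * y 0 else y t) := by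
  simp only [capLeft_ev, F.norm_ev']

theorem capRight_norm_ev {p : ℕ} (w : ℕ → A) (y : ℕ → A) :
    F.capRight (p := p) (m := 0) (q := p) (by omega) (F.norm (ev (gen k A 0) w))
      (ev (gen k A p) y) =
      ev (gen k A p) (fun t => if t = 0 then y 0 * F.ν.symm (F.casimir (w 0)) else y t) := by
  simp only [F.capRight_ev, F.norm_ev', zero_add]

theorem linear_entry_zero {r : ℕ} (w : ℕ → A) (T : A →ₗ[k] A) :
    ∃ L : A →ₗ[k] Chain k A r, ∀ x, ev (gen k A r) (fun t => if t = 0 then T x else w t) = L x :=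
  ev_lin _ w (s := 0) (by omega) _ T (fun x t _ => rfl)

/-- If the block of y has length one, the zeroth face closes up the dual bases around b_0
(`sum_v_mul_u`). The resulting central element may be written on the right of a_0, where the right
cap product with the norm puts it. -/
theorem bdry_chainMul_face_zero {p : ℕ} (a b : ℕ → A) :
    ∑ i, ev (gen k A p) (face F.ν.symm p 0 (F.starWord 0 a b (F.u i) (F.v i))) =
      ev (gen k A p) (fun t => if t = 0 then a 0 * F.ν.symm (F.casimir (b 0)) else a t) := by
  obtain ⟨L, hL⟩ := linear_entry_zero (k := k) (r := p) a LinearMap.id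
  simp only [LinearMap.id_apply] at hL
  have e : ∀ i, ev (gen k A p) (face F.ν.symm p 0 (F.starWord 0 a b (F.u i) (F.v i))) =
      ev (gen k A p) (fun t => if t = 0 then F.v i * b 0 * F.ν.symm (F.u i) * a 0 else a t) :=
    fun i => ev_congr _ fun t ht => by
      have e' : F.v i * b 0 * F.ν.symm (F.u i * F.ν (a 0)) =
          F.v i * b 0 * F.ν.symm (F.u i) * a 0 := by simp [mul_assoc]
      simp only [face_zero, starWord]
      grind
  simp only [e, hL, ← map_sum, ← Finset.sum_mul, F.sum_v_mul_u]
  congr 1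
  apply F.ν.injective
  simp [F.mul_casimir]

theorem bdry_chainMul_face_last {q : ℕ} (a b : ℕ → A) :
    ∑ i, ev (gen k A q) (face F.ν.symm q (q + 1) (F.starWord q a b (F.u i) (F.v i))) =
      ev (gen k A q) (fun t => if t = 0 then F.casimir (a 0) * b 0 else b t) := by
  obtain ⟨L, hL⟩ := linear_entry_zero (k := k) (r := q) b LinearMap.id
  simp only [LinearMap.id_apply] at hL
  have e : ∀ i, ev (gen k A q) (face F.ν.symm q (q + 1) (F.starWord q a b (F.u i) (F.v i))) =
      ev (gen k A q) (fun t => if t = 0 then F.u i * F.ν (a 0) * F.v i * b 0 else b t) :=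
    fun i => ev_congr _ fun t ht => by
      have e' : F.u i * F.ν (a 0) * (F.v i * b 0) = F.u i * F.ν (a 0) * F.v i * b 0 := by
        simp [mul_assoc]
      simp only [face_last, starWord]
      grind
  simp only [e, hL, ← map_sum, ← Finset.sum_mul, F.casimir_ν]

theorem bdry_chainMul_zero_zero (x y : Chain k A 0) :
    bdry F.ν.symm 0 (F.chainMul (r := 1) (by omega) x y) =
      F.capRight (p := 0) (m := 0) (q := 0) (by omega) (F.norm y) x
      - capLeft (p := 0) (m := 0) (q := 0) (by omega) (F.norm x) y := by
  induction x using Chain.induction_ev with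
  | hadd x y hx hy => simp only [map_add, LinearMap.add_apply, capLeft_add, hx, hy]; module
  | hsmul c x hx => simp only [map_smul, LinearMap.smul_apply, capLeft_smul, hx]; module
  | hev a =>
  induction y using Chain.induction_ev with
  | hadd x y hx hy => simp only [map_add, F.capRight_add, hx, hy]; module
  | hsmul c x hx => simp only [map_smul, F.capRight_smul, hx]; module
  | hev b =>
    simp only [F.chainMul_ev', map_sum, bdry_ev, sum_altSum, F.capLeft_norm_ev,
      F.capRight_norm_ev]
    rw [altSum_succ', altSum_succ', F.bdry_chainMul_face_zero]
    have := F.bdry_chainMul_face_last (k := k) (q := 0) a b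
    simp only [zero_add] at this ⊢
    rw [this]
    simp [altSum]

/-- For y of degree zero the block of y contributes a single face, which is the cap product with the
norm of y; this replaces the product with a boundary of y. -/
theorem bdry_chainMul_zero_right {p : ℕ} (x : Chain k A (p + 1)) (y : Chain k A 0) :
    bdry F.ν.symm (p + 1) (F.chainMul (by omega) x y) =
      F.capRight (p := p + 1) (m := 0) (q := p + 1) (by omega) (F.norm y) x
      - F.chainMul (by omega) (bdry F.ν.symm p x) y := by
  induction x using Chain.induction_ev with
  | hadd x y hx hy => simp only [map_add, LinearMap.add_apply, hx, hy]; module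
  | hsmul c x hx => simp only [map_smul, LinearMap.smul_apply, hx]; module
  | hev a =>
  induction y using Chain.induction_ev with
  | hadd x y hx hy => simp only [map_add, F.capRight_add, hx, hy]; module
  | hsmul c x hx => simp only [map_smul, F.capRight_smul, hx]; module
  | hev b =>
    simp only [F.chainMul_ev', map_sum, bdry_ev, sum_altSum, F.capRight_norm_ev,
      F.chainMul_altSum_left]
    rw [show p + 1 + 2 = p + 2 + 1 by omega, altSum_succ', F.bdry_chainMul_face_zero]
    congr 1
    refine altSum_congr fun i hi => ?_
    rcases Nat.eq_zero_or_pos i with rfl | h0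
    · refine Finset.sum_congr rfl fun j _ => ev_congr _ fun t ht => ?_
      have e : F.u j * F.ν (a 0 * F.ν.symm (a 1)) = F.u j * F.ν (a 0) * a 1 := by
        simp [mul_assoc]
      rw [face_mid _ _ (by omega) (by omega)]
      simp only [face_zero, starWord, merge]
      grind
    rcases eq_or_ne i (p + 1) with rfl | hne
    · have := F.sum_mul_right (F.bilin_starWord (k := k) (r := p + 1) (q := 0)
        (by omega) a b) (a (p + 1))
      refine (Eq.trans ?_ this.symm).trans ?_
      · refine Finset.sum_congr rfl fun j _ => ev_congr _ fun t ht => ?_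
        simp only [face_last, starWord, mul_assoc]
        grind
      · refine Finset.sum_congr rfl fun j _ => ev_congr _ fun t ht => ?_
        simp only [face_last, starWord, mul_assoc, map_mul, if_true]
        grind
    · refine Finset.sum_congr rfl fun j _ => ev_congr _ fun t ht => ?_
      rw [face_mid _ _ (by omega) (by omega), face_mid _ _ (by omega) (by omega)]
      simp only [starWord, merge]
      grind

theorem bdry_chainMul_zero_left {q : ℕ} (x : Chain k A 0) (y : Chain k A (q + 1)) :
    bdry F.ν.symm (q + 1) (F.chainMul (by omega) x y) =
      F.chainMul (by omega) x (bdry F.ν.symm q y)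
      + (-1 : k) ^ q • capLeft (p := q + 1) (m := 0) (q := q + 1) (by omega) (F.norm x) y := by
  induction x using Chain.induction_ev with
  | hadd x y hx hy => simp only [map_add, LinearMap.add_apply, capLeft_add, hx, hy]; module
  | hsmul c x hx => simp only [map_smul, LinearMap.smul_apply, capLeft_smul, hx]; module
  | hev a =>
  induction y using Chain.induction_ev with
  | hadd x y hx hy => simp only [map_add, hx, hy]; module
  | hsmul c x hx => simp only [map_smul, hx]; module
  | hev b =>
    simp only [F.chainMul_ev', map_sum, bdry_ev, sum_altSum, F.capLeft_norm_ev, map_altSum]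
    rw [show q + 1 + 2 = q + 2 + 1 by omega, altSum_succ,
      show (-1 : k) ^ (q + 2) = (-1) ^ q by simp [pow_add]]
    congr 1
    · refine altSum_congr fun i hi => ?_
      rcases Nat.eq_zero_or_pos i with rfl | h0
      · refine Finset.sum_congr rfl fun j _ => ev_congr _ fun t ht => ?_
        simp only [face_zero, starWord]
        grind
      rcases eq_or_ne i (q + 1) with rfl | hne
      · have := F.sum_mul_left (F.bilin_starWord (k := k) (r := q + 1) (q := q) (by omega)
          a b) (b (q + 1))
        refine (Eq.trans ?_ this).trans ?_
        · refine Finset.sum_congr rfl fun j _ => ev_congr _ fun t ht => ?_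
          rw [face_mid _ _ (by omega) (by omega)]
          simp only [starWord, merge, mul_assoc]
          grind
        · refine Finset.sum_congr rfl fun j _ => ev_congr _ fun t ht => ?_
          simp only [face_last, starWord, mul_assoc]
          grind
      · refine Finset.sum_congr rfl fun j _ => ev_congr _ fun t ht => ?_
        rw [face_mid _ _ (by omega) (by omega), face_mid _ _ (by omega) (by omega)]
        simp only [starWord, merge]
        grind
    · rw [← F.bdry_chainMul_face_last]

end FrobeniusData

end FrobeniusLeibniz
end CompleteHochschild

namespace CompleteHochschild
universe u

/-! ### The star product on the complete cohomology -/

section StarProduct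

variable {k A : Type u} [Field k] [Ring A] [Algebra k A]
  {ι : Type*} [Fintype ι] [DecidableEq ι] (F : FrobeniusData k A ι)

namespace FrobeniusData

theorem star_add_left : ∀ {m n r : ℤ} (h : m + n = r) (x x' : CplxType k A m)
    (y : CplxType k A n), F.star h (x + x') y = F.star h x y + F.star h x' y
  | Int.ofNat _, Int.ofNat _, Int.ofNat _, h, f, f', g => cup_add_left (Int.ofNat.inj h) f f' g
  | Int.negSucc _, Int.ofNat _, Int.negSucc _, _, x, x', f => map_add (F.capRight _ f) x x'
  | Int.ofNat _, Int.negSucc _, Int.negSucc _, _, f, f', x => capLeft_add _ f f' x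
  | Int.ofNat _, Int.negSucc _, Int.ofNat _, _, f, f', x => F.insertLeft_add _ f f' x
  | Int.negSucc _, Int.ofNat _, Int.ofNat _, _, x, x', f => map_add (F.insertRight _ f) x x'
  | Int.negSucc _, Int.negSucc _, Int.negSucc _, _, x, x', y =>
    LinearMap.map_add₂ (F.chainMul _) x x' y
  | Int.ofNat _, Int.ofNat _, Int.negSucc _, h, _, _, _ =>
    absurd h (by simp only [Int.ofNat_eq_natCast, Int.negSucc_eq]; omega)
  | Int.negSucc _, Int.negSucc _, Int.ofNat _, h, _, _, _ =>
    absurd h (by simp only [Int.ofNat_eq_natCast, Int.negSucc_eq]; omega)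

theorem star_add_right : ∀ {m n r : ℤ} (h : m + n = r) (x : CplxType k A m)
    (y y' : CplxType k A n), F.star h x (y + y') = F.star h x y + F.star h x y'
  | Int.ofNat _, Int.ofNat _, Int.ofNat _, h, f, g, g' => cup_add_right (Int.ofNat.inj h) f g g'
  | Int.negSucc _, Int.ofNat _, Int.negSucc _, _, x, f, f' => F.capRight_add _ f f' x
  | Int.ofNat _, Int.negSucc _, Int.negSucc _, _, f, x, x' => map_add (capLeft _ f) x x'
  | Int.ofNat _, Int.negSucc _, Int.ofNat _, _, f, x, x' => map_add (F.insertLeft _ f) x x'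
  | Int.negSucc _, Int.ofNat _, Int.ofNat _, _, x, f, f' => F.insertRight_add _ f f' x
  | Int.negSucc _, Int.negSucc _, Int.negSucc _, _, x, y, y' => map_add (F.chainMul _ x) y y'
  | Int.ofNat _, Int.ofNat _, Int.negSucc _, h, _, _, _ =>
    absurd h (by simp only [Int.ofNat_eq_natCast, Int.negSucc_eq]; omega)
  | Int.negSucc _, Int.negSucc _, Int.ofNat _, h, _, _, _ =>
    absurd h (by simp only [Int.ofNat_eq_natCast, Int.negSucc_eq]; omega)

theorem star_smul_left : ∀ {m n r : ℤ} (h : m + n = r) (c : k) (x : CplxType k A m)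
    (y : CplxType k A n), F.star h (c • x) y = c • F.star h x y
  | Int.ofNat _, Int.ofNat _, Int.ofNat _, h, c, f, g => cup_smul_left (Int.ofNat.inj h) c f g
  | Int.negSucc _, Int.ofNat _, Int.negSucc _, _, c, x, f => map_smul (F.capRight _ f) c x
  | Int.ofNat _, Int.negSucc _, Int.negSucc _, _, c, f, x => capLeft_smul _ c f x
  | Int.ofNat _, Int.negSucc _, Int.ofNat _, _, c, f, x => F.insertLeft_smul _ c f x
  | Int.negSucc _, Int.ofNat _, Int.ofNat _, _, c, x, f => map_smul (F.insertRight _ f) c x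
  | Int.negSucc _, Int.negSucc _, Int.negSucc _, _, c, x, y =>
    LinearMap.map_smul₂ (F.chainMul _) c x y
  | Int.ofNat _, Int.ofNat _, Int.negSucc _, h, _, _, _ =>
    absurd h (by simp only [Int.ofNat_eq_natCast, Int.negSucc_eq]; omega)
  | Int.negSucc _, Int.negSucc _, Int.ofNat _, h, _, _, _ =>
    absurd h (by simp only [Int.ofNat_eq_natCast, Int.negSucc_eq]; omega)

theorem star_smul_right : ∀ {m n r : ℤ} (h : m + n = r) (c : k) (x : CplxType k A m)
    (y : CplxType k A n), F.star h x (c • y) = c • F.star h x y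
  | Int.ofNat _, Int.ofNat _, Int.ofNat _, h, c, f, g => cup_smul_right (Int.ofNat.inj h) c f g
  | Int.negSucc _, Int.ofNat _, Int.negSucc _, _, c, x, f => F.capRight_smul _ c f x
  | Int.ofNat _, Int.negSucc _, Int.negSucc _, _, c, f, x => map_smul (capLeft _ f) c x
  | Int.ofNat _, Int.negSucc _, Int.ofNat _, _, c, f, x => map_smul (F.insertLeft _ f) c x
  | Int.negSucc _, Int.ofNat _, Int.ofNat _, _, c, x, f => F.insertRight_smul _ c f x
  | Int.negSucc _, Int.negSucc _, Int.negSucc _, _, c, x, y => map_smul (F.chainMul _ x) c y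
  | Int.ofNat _, Int.ofNat _, Int.negSucc _, h, _, _, _ =>
    absurd h (by simp only [Int.ofNat_eq_natCast, Int.negSucc_eq]; omega)
  | Int.negSucc _, Int.negSucc _, Int.ofNat _, h, _, _, _ =>
    absurd h (by simp only [Int.ofNat_eq_natCast, Int.negSucc_eq]; omega)

theorem star_leibniz_cochain : ∀ {m n r : ℕ} (h : (Int.ofNat m) + Int.ofNat n = Int.ofNat r)
    (x : CplxType k A (Int.ofNat m)) (y : CplxType k A (Int.ofNat n)),
    F.d (Int.ofNat r) (F.star h x y) =
      F.star (m := Int.ofNat (m + 1)) (n := Int.ofNat n) (r := Int.ofNat (r + 1))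
        (by simp at h ⊢; omega) (F.d (Int.ofNat m) x) y +
      (-1 : k) ^ m • F.star (m := Int.ofNat m) (n := Int.ofNat (n + 1)) (r := Int.ofNat (r + 1))
        (by simp at h ⊢; omega) x (F.d (Int.ofNat n) y) := by
  intro m n r h x y
  exact δ_cup (by simp at h; omega) (f := x) (g := y)

theorem unit_sign (n : ℕ) : ((-1 : k) ^ n) ≠ 0 := by simp

/-- The `⋆`-product satisfies the Leibniz rule up to signs. -/
theorem star_leibniz : ∀ {m n r : ℤ} (h : m + n = r) (x : CplxType k A m) (y : CplxType k A n),
    ∃ ε₁ ε₂ : k, ε₁ ≠ 0 ∧ ε₂ ≠ 0 ∧ F.d r (F.star h x y) =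
      ε₁ • F.star (m := m + 1) (n := n) (r := r + 1) (by omega) (F.d m x) y +
      ε₂ • F.star (m := m) (n := n + 1) (r := r + 1) (by omega) x (F.d n y)
  | Int.ofNat m, Int.ofNat n, Int.ofNat r, h, f, g =>
    ⟨1, (-1) ^ m, one_ne_zero, unit_sign m, by rw [one_smul]; exact F.star_leibniz_cochain h f g⟩
  | Int.ofNat m, Int.negSucc p, Int.negSucc (q + 1), h, f, x => by
    obtain ⟨p, rfl⟩ : ∃ p', p = p' + 1 := ⟨p - 1, by
      simp only [Int.ofNat_eq_natCast, Int.negSucc_eq] at h; omega⟩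
    refine ⟨(-1) ^ (q + 1), 1, unit_sign _, one_ne_zero, ?_⟩
    have hp : p = m + q := by simp only [Int.ofNat_eq_natCast, Int.negSucc_eq] at h; omega
    have := capLeft_bdry F.ν.symm hp f x
    rw [one_smul]
    exact (by rw [this]; abel : bdry F.ν.symm q (capLeft (p := p + 1) (by omega) f x) =
      (-1 : k) ^ (q + 1) • capLeft (p := p + 1) (by omega) (δ m f) x
        + capLeft hp f (bdry F.ν.symm p x))
  -- `Int.negSucc 0` is degree -1, where the differential is the norm; the cases with this index are
  -- the transitions between chains and cochains.
  | Int.ofNat m, Int.negSucc (p + 1), Int.negSucc 0, h, f, x => by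
    obtain rfl : m = p + 1 := by
      simp only [Int.ofNat_eq_natCast, Int.negSucc_eq] at h; omega
    refine ⟨1, 1, one_ne_zero, one_ne_zero, ?_⟩
    have := F.insertLeft_norm f x
    rw [one_smul, one_smul]
    exact (by rw [this]; abel : F.norm (capLeft (p := p + 1) (q := 0) (by omega) f x) =
      F.insertLeft (n := 0) (by omega) (δ (p + 1) f) x
        + F.insertLeft (n := 0) (by omega) f (bdry F.ν.symm p x))
  | Int.ofNat m, Int.negSucc 0, Int.negSucc 0, h, f, x => by
    obtain rfl : m = 0 := by
      simp only [Int.ofNat_eq_natCast, Int.negSucc_eq] at h; omega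
    refine ⟨1, 1, one_ne_zero, one_ne_zero, ?_⟩
    have := F.insertLeft_norm_zero f x
    rw [one_smul, one_smul]
    exact (by rw [this]; abel : F.norm (capLeft (p := 0) (q := 0) (by omega) f x) =
      F.insertLeft (n := 0) (by omega) (δ 0 f) x + cup (by omega) f (F.norm x))
  | Int.ofNat m, Int.negSucc (p + 1), Int.ofNat n, h, f, x => by
    have hm : m = p + 1 + 1 + n := by
      simp only [Int.ofNat_eq_natCast, Int.negSucc_eq] at h; omega
    refine ⟨1, -(-1) ^ n, one_ne_zero, neg_ne_zero.2 (unit_sign _), ?_⟩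
    have := F.insertLeft_δ hm f x
    rw [one_smul]
    exact (by rw [this]; module : δ n (F.insertLeft hm f x) =
      F.insertLeft (n := n + 1) (by omega) (δ m f) x +
      (-(-1 : k) ^ n) • F.insertLeft (n := n + 1) (by omega) f (bdry F.ν.symm p x))
  | Int.ofNat m, Int.negSucc 0, Int.ofNat n, h, f, x => by
    have hm : m = 0 + 1 + n := by
      simp only [Int.ofNat_eq_natCast, Int.negSucc_eq] at h; omega
    refine ⟨1, -(-1) ^ n, one_ne_zero, neg_ne_zero.2 (unit_sign _), ?_⟩
    have := F.insertLeft_δ_zero hm f x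
    rw [one_smul]
    exact (by rw [this]; module : δ n (F.insertLeft hm f x) =
      F.insertLeft (n := n + 1) (by omega) (δ m f) x +
      (-(-1 : k) ^ n) • cup (by omega) f (F.norm x))
  | Int.negSucc p, Int.ofNat m, Int.negSucc (q + 1), h, x, f => by
    obtain ⟨p, rfl⟩ : ∃ p', p = p' + 1 := ⟨p - 1, by
      simp only [Int.ofNat_eq_natCast, Int.negSucc_eq] at h; omega⟩
    refine ⟨(-1) ^ m, -(-1) ^ m, unit_sign _, neg_ne_zero.2 (unit_sign _), ?_⟩
    have hp : p = m + q := by simp only [Int.ofNat_eq_natCast, Int.negSucc_eq] at h; omega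
    have := F.capRight_bdry hp f x
    exact (by
      rw [this, smul_sub, smul_smul, pow_succ, mul_neg, mul_neg, mul_one, ← mul_pow]
      simp : bdry F.ν.symm q (F.capRight (p := p + 1) (by omega) f x) =
      (-1 : k) ^ m • F.capRight hp f (bdry F.ν.symm p x)
        + (-(-1 : k) ^ m) • F.capRight (p := p + 1) (by omega) (δ m f) x)
  | Int.negSucc (p + 1), Int.ofNat m, Int.negSucc 0, h, x, f => by
    obtain rfl : m = p + 1 := by
      simp only [Int.ofNat_eq_natCast, Int.negSucc_eq] at h; omega
    refine ⟨-(-1) ^ p, (-1) ^ p, neg_ne_zero.2 (unit_sign _), unit_sign _, ?_⟩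
    have := F.insertRight_norm f x
    exact (by
      rw [this, smul_add (M := k) (A := Cochain k A 0),
        smul_smul (M := k) (α := Cochain k A 0), ← mul_pow, neg_mul_neg, one_mul, one_pow]
      module : F.norm (F.capRight (p := p + 1) (q := 0) (by omega) f x) =
      (-(-1 : k) ^ p) • F.insertRight (n := 0) (by omega) f (bdry F.ν.symm p x)
        + (-1 : k) ^ p • F.insertRight (n := 0) (by omega) (δ (p + 1) f) x)
  | Int.negSucc 0, Int.ofNat m, Int.negSucc 0, h, x, f => by
    obtain rfl : m = 0 := by
      simp only [Int.ofNat_eq_natCast, Int.negSucc_eq] at h; omega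
    refine ⟨1, -1, one_ne_zero, neg_ne_zero.2 one_ne_zero, ?_⟩
    have := F.insertRight_norm_zero f x
    exact (by rw [this]; module : F.norm (F.capRight (p := 0) (q := 0) (by omega) f x) =
      (1 : k) • cup (by omega) (F.norm x) f
      + (-1 : k) • F.insertRight (n := 0) (by omega) (δ 0 f) x)
  | Int.negSucc (p + 1), Int.ofNat m, Int.ofNat n, h, x, f => by
    have hm : m = p + 1 + 1 + n := by
      simp only [Int.ofNat_eq_natCast, Int.negSucc_eq] at h; omega
    refine ⟨-(-1) ^ p, (-1) ^ p, neg_ne_zero.2 (unit_sign _), unit_sign _, ?_⟩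
    have := F.insertRight_δ hm f x
    exact (by
      rw [this, smul_add (M := k) (A := Cochain k A (n + 1)),
        smul_smul (M := k) (α := Cochain k A (n + 1)), ← mul_pow, neg_mul_neg, one_mul, one_pow]
      module : δ n (F.insertRight hm f x) =
      (-(-1 : k) ^ p) • F.insertRight (n := n + 1) (by omega) f (bdry F.ν.symm p x)
        + (-1 : k) ^ p • F.insertRight (n := n + 1) (by omega) (δ m f) x)
  | Int.negSucc 0, Int.ofNat m, Int.ofNat n, h, x, f => by
    have hm : m = 0 + 1 + n := by
      simp only [Int.ofNat_eq_natCast, Int.negSucc_eq] at h; omega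
    refine ⟨1, -1, one_ne_zero, neg_ne_zero.2 one_ne_zero, ?_⟩
    have := F.insertRight_δ_zero hm f x
    exact (by rw [this]; module : δ n (F.insertRight hm f x) =
      (1 : k) • cup (by omega) (F.norm x) f
      + (-1 : k) • F.insertRight (n := n + 1) (by omega) (δ m f) x)
  | Int.negSucc (p + 1), Int.negSucc (q + 1), Int.negSucc r, h, x, y => by
    obtain ⟨r, rfl⟩ : ∃ r', r = r' + 1 := ⟨r - 1, by
      simp only [Int.negSucc_eq] at h; omega⟩
    have hr : p + 1 + q + 1 = r := by simp only [Int.negSucc_eq] at h; omega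
    refine ⟨(-1) ^ q, 1, unit_sign _, one_ne_zero, ?_⟩
    have := F.bdry_chainMul hr x y
    exact (by rw [this]; module : bdry F.ν.symm r (F.chainMul (by omega) x y) =
      (-1 : k) ^ q • F.chainMul (by omega) (bdry F.ν.symm p x) y +
      (1 : k) • F.chainMul hr x (bdry F.ν.symm q y))
  | Int.negSucc (p + 1), Int.negSucc 0, Int.negSucc r, h, x, y => by
    obtain rfl : r = p + 2 := by simp only [Int.negSucc_eq] at h; omega
    refine ⟨-1, 1, neg_ne_zero.2 one_ne_zero, one_ne_zero, ?_⟩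
    have := F.bdry_chainMul_zero_right x y
    exact (by rw [this]; module : bdry F.ν.symm (p + 1) (F.chainMul (by omega) x y) =
      (-1 : k) • F.chainMul (by omega) (bdry F.ν.symm p x) y +
      (1 : k) • F.capRight (p := p + 1) (m := 0) (q := p + 1) (by omega) (F.norm y) x)
  | Int.negSucc 0, Int.negSucc (q + 1), Int.negSucc r, h, x, y => by
    obtain rfl : r = q + 2 := by simp only [Int.negSucc_eq] at h; omega
    refine ⟨(-1) ^ q, 1, unit_sign _, one_ne_zero, ?_⟩
    have := F.bdry_chainMul_zero_left x y
    exact (by rw [this]; module : bdry F.ν.symm (q + 1) (F.chainMul (by omega) x y) =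
      (-1 : k) ^ q • capLeft (p := q + 1) (m := 0) (q := q + 1) (by omega) (F.norm x) y +
      (1 : k) • F.chainMul (by omega) x (bdry F.ν.symm q y))
  | Int.negSucc 0, Int.negSucc 0, Int.negSucc r, h, x, y => by
    obtain rfl : r = 1 := by simp only [Int.negSucc_eq] at h; omega
    refine ⟨-1, 1, neg_ne_zero.2 one_ne_zero, one_ne_zero, ?_⟩
    have := F.bdry_chainMul_zero_zero x y
    exact (by rw [this]; module : bdry F.ν.symm 0 (F.chainMul (by omega) x y) =
      (-1 : k) • capLeft (p := 0) (m := 0) (q := 0) (by omega) (F.norm x) y +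
      (1 : k) • F.capRight (p := 0) (m := 0) (q := 0) (by omega) (F.norm y) x)
  | Int.ofNat _, Int.ofNat _, Int.negSucc _, h, _, _ =>
    absurd h (by simp only [Int.ofNat_eq_natCast, Int.negSucc_eq]; omega)
  | Int.negSucc _, Int.negSucc _, Int.ofNat _, h, _, _ =>
    absurd h (by simp only [Int.ofNat_eq_natCast, Int.negSucc_eq]; omega)

theorem d_mem_coboundaries : ∀ (n : ℤ) (w : CplxType k A n), F.d n w ∈ F.coboundaries (n + 1)
  | Int.ofNat _, w => ⟨w, trivial, rfl⟩
  | Int.negSucc 0, w => ⟨w, trivial, rfl⟩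
  | Int.negSucc (_ + 1), w => ⟨w, trivial, rfl⟩

/-- Coboundaries of degree n are defined by cases on n, whereas d lands in degree m + 1. This
principle hides the cases: a property of all d w, in all degrees at once, holds for all
coboundaries. -/
theorem coboundary_induction {P : ∀ n : ℤ, CplxType k A n → Prop}
    (h : ∀ m w, P (m + 1) (F.d m w)) : ∀ (n : ℤ) (z : CplxType k A n),
    z ∈ F.coboundaries n → P n z
  | Int.ofNat 0, _, ⟨w, _, hw⟩ => hw ▸ h (Int.negSucc 0) w
  | Int.ofNat (r + 1), _, ⟨w, _, hw⟩ => hw ▸ h (Int.ofNat r) w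
  | Int.negSucc p, _, ⟨w, _, hw⟩ => hw ▸ h (Int.negSucc (p + 1)) w

theorem star_zero_left {m n r : ℤ} (h : m + n = r) (y : CplxType k A n) :
    F.star h (0 : CplxType k A m) y = 0 := by
  simpa using F.star_smul_left h 0 0 y

theorem star_zero_right {m n r : ℤ} (h : m + n = r) (x : CplxType k A m) :
    F.star h x (0 : CplxType k A n) = 0 := by
  simpa using F.star_smul_right h 0 x 0

theorem star_mem_cocycles {m n r : ℤ} (h : m + n = r) {x : CplxType k A m} {y : CplxType k A n}
    (hx : x ∈ F.cocycles m) (hy : y ∈ F.cocycles n) : F.star h x y ∈ F.cocycles r := by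
  obtain ⟨ε₁, ε₂, -, -, e⟩ := F.star_leibniz h x y
  rw [cocycles, LinearMap.mem_ker] at hx hy ⊢
  rw [e, hx, hy, star_zero_left, star_zero_right, smul_zero, smul_zero, add_zero]

/-- If x = d w and d y = 0, the Leibniz rule says that d(w ⋆ y) is a non-zero multiple of x ⋆ y. The
exact scalar is irrelevant, which is why `star_leibniz` only records that it does not vanish. -/
theorem star_coboundary_left {m n r : ℤ} (h : m + n = r) {x : CplxType k A m}
    {y : CplxType k A n} (hx : x ∈ F.coboundaries m) (hy : y ∈ F.cocycles n) :
    F.star h x y ∈ F.coboundaries r := by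
  refine F.coboundary_induction
    (P := fun m x => ∀ r (h : m + n = r), F.star h x y ∈ F.coboundaries r)
    (fun m w r h => ?_) m x hx r h
  obtain ⟨s, rfl⟩ : ∃ s, r = s + 1 := ⟨r - 1, by omega⟩
  obtain ⟨ε₁, ε₂, h1, -, e⟩ := F.star_leibniz (show m + n = s by omega) w y
  rw [cocycles, LinearMap.mem_ker] at hy
  rw [hy, star_zero_right, smul_zero, add_zero] at e
  exact ((F.coboundaries (s + 1)).smul_mem_iff h1).1 (e ▸ F.d_mem_coboundaries s _)

theorem star_coboundary_right {m n r : ℤ} (h : m + n = r) {x : CplxType k A m}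
    {y : CplxType k A n} (hx : x ∈ F.cocycles m) (hy : y ∈ F.coboundaries n) :
    F.star h x y ∈ F.coboundaries r := by
  refine F.coboundary_induction
    (P := fun n y => ∀ r (h : m + n = r), F.star h x y ∈ F.coboundaries r)
    (fun n w r h => ?_) n y hy r h
  obtain ⟨s, rfl⟩ : ∃ s, r = s + 1 := ⟨r - 1, by omega⟩
  obtain ⟨ε₁, ε₂, -, h2, e⟩ := F.star_leibniz (show m + n = s by omega) x w
  rw [cocycles, LinearMap.mem_ker] at hx
  rw [hx, star_zero_left, smul_zero, zero_add] at e
  exact ((F.coboundaries (s + 1)).smul_mem_iff h2).1 (e ▸ F.d_mem_coboundaries s _)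

theorem cls_eq_iff {n : ℤ} {x y : CplxType k A n} (hx : x ∈ F.cocycles n)
    (hy : y ∈ F.cocycles n) : F.cls x hx = F.cls y hy ↔ x - y ∈ F.coboundaries n :=
  Submodule.Quotient.eq _

/-- The product `ĤH^m × ĤH^n → ĤH^{m+n}`. -/
noncomputable def mulHH (m n : ℤ) : F.HH m →ₗ[k] F.HH n →ₗ[k] F.HH (m + n) :=
  let M : F.cocycles m →ₗ[k] F.cocycles n →ₗ[k] F.HH (m + n) :=
    LinearMap.mk₂ k (fun x y => F.cls (F.star rfl x.1 y.1) (F.star_mem_cocycles rfl x.2 y.2))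
      (fun x x' y => (F.cls_eq_iff _ (add_mem (F.star_mem_cocycles rfl x.2 y.2)
        (F.star_mem_cocycles rfl x'.2 y.2))).2 (by
          rw [Submodule.coe_add, star_add_left, sub_self]; exact zero_mem _))
      (fun c x y => (F.cls_eq_iff _ (Submodule.smul_mem _ c
        (F.star_mem_cocycles rfl x.2 y.2))).2 (by
          rw [Submodule.coe_smul, star_smul_left, sub_self]; exact zero_mem _))
      (fun x y y' => (F.cls_eq_iff _ (add_mem (F.star_mem_cocycles rfl x.2 y.2)
        (F.star_mem_cocycles rfl x.2 y'.2))).2 (by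
          rw [Submodule.coe_add, star_add_right, sub_self]; exact zero_mem _))
      (fun c x y => (F.cls_eq_iff _ (Submodule.smul_mem _ c
        (F.star_mem_cocycles rfl x.2 y.2))).2 (by
          rw [Submodule.coe_smul, star_smul_right, sub_self]; exact zero_mem _))
  Submodule.liftQ _
    { toFun := fun x => Submodule.liftQ _ (M x) fun y hy =>
        (Submodule.Quotient.mk_eq_zero _).2 (F.star_coboundary_right rfl x.2 hy)
      map_add' := fun x x' => by
        refine Submodule.linearMap_qext _ (LinearMap.ext fun y => ?_)
        exact LinearMap.map_add₂ M x x' y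
      map_smul' := fun c x => by
        refine Submodule.linearMap_qext _ (LinearMap.ext fun y => ?_)
        exact LinearMap.map_smul₂ M c x y }
    fun x hx => by
      refine Submodule.linearMap_qext _ (LinearMap.ext fun y => ?_)
      exact (Submodule.Quotient.mk_eq_zero _).2 (F.star_coboundary_left rfl hx y.2)

/-- The product of the complete cohomology. -/
noncomputable def mulTot : F.Cohomology →ₗ[k] F.Cohomology →ₗ[k] F.Cohomology :=
  DirectSum.toModule k ℤ _ fun m => LinearMap.flip (DirectSum.toModule k ℤ _ fun n =>
    LinearMap.flip ((F.mulHH m n).compr₂ (DirectSum.lof k ℤ F.HH (m + n))))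

theorem isStarProduct_mulTot : F.IsStarProduct F.mulTot := by
  intro m n x y hx hy
  refine ⟨F.star_mem_cocycles rfl hx hy, ?_⟩
  simp only [mulTot, tot, DirectSum.toModule_lof, LinearMap.flip_apply, LinearMap.compr₂_apply]
  rfl

end FrobeniusData

end StarProduct
end CompleteHochschild

namespace CompleteHochschild
universe u

/-! ### The homotopy formula for the twisted Connes operator -/

section Connes

variable {k A : Type u} [Field k] [Ring A] [Algebra k A]

/-- The action of an automorphism on all the factors of a chain. -/
noncomputable def twist (σ : A ≃ₐ[k] A) (p : ℕ) : Chain k A p →ₗ[k] Chain k A p :=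
  Chain.map (fun w => ev (gen k A p) fun t => σ (w t))
    (fun w j hj => ev_lin _ (fun t => σ (w t)) hj _ σ.toLinearMap fun x t _ => by
      simp only [Function.update_apply, AlgEquiv.toLinearMap_apply]; grind)
    (fun w l h0 hl hw => gen_eq_zero l h0 hl (by rw [hw, map_one]))

theorem twist_ev (σ : A ≃ₐ[k] A) (p : ℕ) (w : ℕ → A) :
    twist σ p (ev (gen k A p) w) = ev (gen k A p) fun t => σ (w t) :=
  Chain.map_ev _ _ _ (fun w w' h => ev_congr _ fun t ht => by rw [h t ht]) w

theorem sum_Icc_one {N : Type*} [AddCommGroup N] (n : ℕ) (f : ℕ → N) :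
    ∑ i ∈ Finset.Icc 1 n, f i = ∑ i ∈ Finset.range n, f (i + 1) := by
  induction n with
  | zero => rfl
  | succ n ih => rw [Finset.sum_Icc_succ_top (by omega), ih, Finset.sum_range_succ]

/-- Both faces absorb the leading 1. The zeroth face twists the entry a_{i+1} while moving it to the
front; the next rotation has already twisted it at the end, from where the last face moves it to the
front. -/
theorem connes_face_zero (σ : A ≃ₐ[k] A) {p i : ℕ} (hi : i < p) (w : ℕ → A) :
    ev (gen k A p) (face σ p 0 (connesTerm σ p (i + 1) w)) =
      ev (gen k A p) (face σ p (p + 1) (connesTerm σ p (i + 1 + 1) w)) := by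
  refine ev_congr _ fun t ht => ?_
  simp only [face_zero, face_last, connesTerm]
  grind

/-- By `connes_face_zero` the outer faces of consecutive rotations coincide and the signs make the
sum telescope. The last face of the first rotation is the original word, the zeroth face of the last
rotation is the word with σ applied everywhere. -/
theorem connes_ends (σ : A ≃ₐ[k] A) (p : ℕ) (w : ℕ → A) :
    ∑ i ∈ Finset.range (p + 1), ((-1 : k) ^ ((i + 1) * p)) •
      (ev (gen k A p) (face σ p 0 (connesTerm σ p (i + 1) w)) + (-1 : k) ^ (p + 1) •
        ev (gen k A p) (face σ p (p + 1) (connesTerm σ p (i + 1) w))) =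
      twist σ p (ev (gen k A p) w) - ev (gen k A p) w := by
  -- `E i` is the common value of the zeroth face of rotation i and the last face of rotation i + 1;
  -- at i = 0 only the latter exists.
  let E : ℕ → Chain k A p := fun i =>
    if i = 0 then ev (gen k A p) w
    else ev (gen k A p) (face σ p 0 (connesTerm σ p i w))
  have h1 : ∀ i ∈ Finset.range (p + 1), ((-1 : k) ^ ((i + 1) * p)) •
      (ev (gen k A p) (face σ p 0 (connesTerm σ p (i + 1) w)) + (-1 : k) ^ (p + 1) •
        ev (gen k A p) (face σ p (p + 1) (connesTerm σ p (i + 1) w))) =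
      (-1 : k) ^ ((i + 1) * p) • E (i + 1) - (-1 : k) ^ (i * p) • E i := fun i hi => by
    have e : E i = ev (gen k A p) (face σ p (p + 1) (connesTerm σ p (i + 1) w)) := by
      rcases Nat.eq_zero_or_pos i with rfl | h0
      · refine ev_congr _ fun t ht => ?_
        simp only [face_last, connesTerm]
        grind
      · obtain ⟨i, rfl⟩ : ∃ j, i = j + 1 := ⟨i - 1, by omega⟩
        exact connes_face_zero σ (by simp at hi; omega) w
    have s : (-1 : k) ^ ((i + 1) * p) * (-1) ^ (p + 1) = -(-1) ^ (i * p) := by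
      rw [add_mul, one_mul, pow_add, pow_succ, mul_assoc, ← mul_assoc ((-1) ^ p), ← mul_pow]
      simp
    rw [smul_add, smul_smul, s, e, neg_smul, ← sub_eq_add_neg]
    rfl
  rw [Finset.sum_congr rfl h1, Finset.sum_range_sub fun i => (-1 : k) ^ (i * p) • E i]
  have s : (-1 : k) ^ ((p + 1) * p) = 1 := by
    rw [mul_comm]; exact (Nat.even_mul_succ_self p).neg_one_pow
  rw [s, one_smul, zero_mul, pow_zero, one_smul, twist_ev]
  congr 1
  refine ev_congr _ fun t ht => ?_
  simp only [face_zero, connesTerm]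
  grind

theorem bdry_connes_zero (σ : A ≃ₐ[k] A) (x : Chain k A 0) :
    bdry σ 0 (connes σ 0 x) = twist σ 0 x - x := by
  refine LinearMap.congr_fun (f := (bdry σ 0).comp (connes σ 0))
    (g := twist σ 0 - LinearMap.id) (Chain.hom_ext_ev fun w => ?_) x
  simp only [LinearMap.comp_apply, LinearMap.sub_apply, LinearMap.id_apply, connes_ev, map_sum,
    map_smul, bdry_ev]
  rw [← connes_ends]
  simp [altSum, Finset.sum_range_succ]

/-- Multiplying two neighbours and then rotating is the same as rotating and then multiplying them
at their new place. If the merged pair lies among the rotated, twisted entries, the longer word has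
to be rotated by one more step, whence the two cases. -/
theorem connes_merge (σ : A ≃ₐ[k] A) {q i l : ℕ} (hi : 1 ≤ i) (hi' : i ≤ q + 1) (hl : l ≤ q + 1)
    (w : ℕ → A) : ev (gen k A (q + 1)) (connesTerm σ q i (face σ q l w)) =
      ev (gen k A (q + 1)) (if i ≤ l then merge (l - i + 1) (connesTerm σ (q + 1) i w)
        else merge (q + 1 - i + l + 1) (connesTerm σ (q + 1) (i + 1) w)) := by
  refine ev_congr _ fun t ht => ?_
  rcases Nat.eq_zero_or_pos l with rfl | h0
  · rw [if_neg (by omega)]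
    simp only [face_zero, connesTerm, merge]
    have e := map_mul σ (w 0) (σ (w 1))
    grind
  rcases eq_or_ne l (q + 1) with rfl | hne
  · rw [if_pos (by omega)]
    simp only [face_last, connesTerm, merge]
    grind
  · rw [face_mid _ _ (by omega) (by omega)]
    split_ifs
    · simp only [connesTerm, merge]
      grind
    · have e := map_mul σ (w l) (w (l + 1))
      obtain ⟨i, rfl⟩ : ∃ j, i = j + 1 := ⟨i - 1, by omega⟩
      obtain ⟨r, rfl⟩ : ∃ j, q = i + j := ⟨q - i, by omega⟩
      simp only [connesTerm, merge, show i + r + 2 - (i + 1) = r + 1 by omega,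
        show i + r + 1 - (i + 1) = r by omega, show i + r + 1 + 2 - (i + 1 + 1) = r + 1 by omega]
      have e' : r < t → t - r = t - (r + 1) + 1 := by omega
      grind

/-- The outer faces of B give σ - 1 by `connes_ends`. The inner faces of B and the terms of B∂ are
both indexed by q + 1 times q + 2 pairs, are matched by `connes_merge`, and cancel. -/
theorem bdry_connes_succ (σ : A ≃ₐ[k] A) (q : ℕ) (x : Chain k A (q + 1)) :
    bdry σ (q + 1) (connes σ (q + 1) x) + connes σ q (bdry σ q x) = twist σ (q + 1) x - x := by
  refine LinearMap.congr_fun (f := (bdry σ (q + 1)).comp (connes σ (q + 1)) +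
      (connes σ q).comp (bdry σ q))
    (g := twist σ (q + 1) - LinearMap.id) (Chain.hom_ext_ev fun w => ?_) x
  simp only [LinearMap.comp_apply, LinearMap.add_apply, LinearMap.sub_apply, LinearMap.id_apply,
    connes_ev, map_sum, map_smul, map_altSum, bdry_ev]
  rw [← connes_ends]
  have h1 : ∀ i, (altSum k (q + 1 + 2) fun l =>
      ev (gen k A (q + 1)) (face σ (q + 1) l (connesTerm σ (q + 1) i w))) =
      ev (gen k A (q + 1)) (face σ (q + 1) 0 (connesTerm σ (q + 1) i w)) + (-1 : k) ^ (q + 2) •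
        ev (gen k A (q + 1)) (face σ (q + 1) (q + 2) (connesTerm σ (q + 1) i w)) -
      altSum k (q + 1) fun j => ev (gen k A (q + 1)) (merge (j + 1) (connesTerm σ (q + 1) i w)) :=
    fun i => by
      rw [show q + 1 + 2 = q + 2 + 1 by omega, altSum_succ, altSum_succ',
        altSum_congr (k := k) (n := q + 1) fun j hj => by
          rw [face_mid (p := q + 1) (i := j + 1) σ _ (by omega) (by omega)]]
      abel
  simp only [h1, smul_sub, Finset.sum_sub_distrib, sum_Icc_one]
  rw [sub_add_eq_add_sub, add_sub_assoc, add_eq_left, sub_eq_zero]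
  simp only [altSum, Finset.smul_sum, smul_smul]
  rw [← Finset.sum_product', ← Finset.sum_product']
  -- The pairs (face, rotation - 1) of B∂ go to pairs (rotation - 1, inner face - 1) of ∂B; the two
  -- branches are those of `connes_merge`.
  refine Finset.sum_nbij'
    (fun x => if x.2 + 1 ≤ x.1 then (x.2, x.1 - x.2 - 1) else (x.2 + 1, q - x.2 + x.1))
    (fun x => if x.1 + x.2 ≤ q then (x.1 + x.2 + 1, x.1) else (x.2 - (q + 1 - x.1), x.1 - 1))
    ?_ ?_ ?_ ?_ ?_
  · rintro ⟨l, i⟩ h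
    simp only [Finset.mem_product, Finset.mem_range] at h ⊢
    split_ifs <;> simp only <;> omega
  · rintro ⟨i, j⟩ h
    simp only [Finset.mem_product, Finset.mem_range] at h ⊢
    split_ifs <;> simp only <;> omega
  · rintro ⟨l, i⟩ h
    simp only [Finset.mem_product, Finset.mem_range] at h
    by_cases hl : i + 1 ≤ l
    · simp only [if_pos hl]
      rw [if_pos (by omega), Prod.mk.injEq]
      omega
    · simp only [if_neg hl]
      rw [if_neg (by omega), Prod.mk.injEq]
      omega
  · rintro ⟨i, j⟩ h
    simp only [Finset.mem_product, Finset.mem_range] at h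
    by_cases hl : i + j ≤ q
    · simp only [if_pos hl]
      rw [if_pos (by omega), Prod.mk.injEq]
      omega
    · simp only [if_neg hl]
      rw [if_neg (by omega), Prod.mk.injEq]
      omega
  · rintro ⟨l, i⟩ h
    simp only [Finset.mem_product, Finset.mem_range] at h ⊢
    rw [connes_merge σ (by omega) (by omega) (by omega)]
    split_ifs with hl
    · obtain ⟨j, rfl⟩ : ∃ j, l = i + 1 + j := ⟨l - (i + 1), by omega⟩
      simp only [show i + 1 + j - i - 1 = j by omega, show i + 1 + j - (i + 1) = j by omega]
      congr 1
      rw [← pow_add, ← pow_add]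
      exact neg_one_pow_congr (by simp only [Nat.even_add, Nat.even_mul, Nat.not_even_one]; tauto)
    · obtain ⟨j, rfl⟩ : ∃ j, q = i + j := ⟨q - i, by omega⟩
      simp only [show i + j - i = j by omega, show i + j + 1 - (i + 1) = j by omega]
      congr 1
      rw [← pow_add, ← pow_add]
      exact neg_one_pow_congr (by simp only [Nat.even_add, Nat.even_mul, Nat.not_even_one]; tauto)

end Connes
end CompleteHochschild

namespace CompleteHochschild
universe u

/-! ### Cochains as the dual of twisted chains -/

section Duality

variable {k A : Type u} [Field k] [Ring A] [Algebra k A]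
  {ι : Type*} [Fintype ι] [DecidableEq ι] (F : FrobeniusData k A ι)

theorem twist_bdry (σ τ : A ≃ₐ[k] A) (h : ∀ a, τ (σ a) = σ (τ a)) (p : ℕ)
    (x : Chain k A (p + 1)) : twist τ p (bdry σ p x) = bdry σ p (twist τ (p + 1) x) := by
  refine LinearMap.congr_fun (f := (twist τ p).comp (bdry σ p))
    (g := (bdry σ p).comp (twist τ (p + 1))) (Chain.hom_ext_ev fun w => ?_) x
  simp only [LinearMap.comp_apply, bdry_ev, twist_ev, map_altSum]
  refine altSum_congr fun i hi => ev_congr _ fun t ht => ?_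
  simp only [face]
  split_ifs with h0 h1
  · dsimp only
    split_ifs <;> simp [h]
  · dsimp only
    split_ifs <;> simp
  · simp only [merge]
    split_ifs <;> simp

theorem twist_connes (σ τ : A ≃ₐ[k] A) (h : ∀ a, τ (σ a) = σ (τ a)) (p : ℕ)
    (x : Chain k A p) : twist τ (p + 1) (connes σ p x) = connes σ p (twist τ p x) := by
  refine LinearMap.congr_fun (f := (twist τ (p + 1)).comp (connes σ p))
    (g := (connes σ p).comp (twist τ p)) (Chain.hom_ext_ev fun w => ?_) x
  simp only [LinearMap.comp_apply, connes_ev, twist_ev, map_sum, map_smul]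
  refine Finset.sum_congr rfl fun i hi => ?_
  congr 1
  refine ev_congr _ fun t ht => ?_
  simp only [connesTerm]
  split_ifs <;> simp [h]

theorem twist_twist (σ τ : A ≃ₐ[k] A) (p : ℕ) (x : Chain k A p) :
    twist σ p (twist τ p x) = twist (τ.trans σ) p x := by
  refine LinearMap.congr_fun (f := (twist σ p).comp (twist τ p))
    (g := twist (τ.trans σ) p) (Chain.hom_ext_ev fun w => ?_) x
  simp only [LinearMap.comp_apply, twist_ev]
  rfl

theorem twist_refl (p : ℕ) (x : Chain k A p) : twist (AlgEquiv.refl : A ≃ₐ[k] A) p x = x := by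
  refine LinearMap.congr_fun (f := twist (AlgEquiv.refl : A ≃ₐ[k] A) p) (g := LinearMap.id)
    (Chain.hom_ext_ev fun w => ?_) x
  simp only [LinearMap.id_apply, twist_ev]
  rfl

namespace FrobeniusData

theorem pair_lin {r : ℕ} (f : Cochain k A r) :
    LinearInEach (r + 1) (fun w => F.form (ev f.1 fun t => w (t + 1)) (w 0)) k := fun w j hj => by
  rcases Nat.eq_zero_or_pos j with rfl | h0
  · exact ⟨F.form (ev f.1 fun t => w (t + 1)), fun x => by simp⟩
  · obtain ⟨L, hL⟩ := ev_lin f.1 (fun t => w (t + 1)) (s := j - 1) (by omega)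
      (fun x t => Function.update w j x (t + 1)) LinearMap.id
      (fun x t _ => by simp only [Function.update_apply, LinearMap.id_apply]; grind)
    exact ⟨(F.form.flip (w 0)).comp L, fun x => by simp [hL, Function.update_of_ne h0.ne]⟩

theorem pair_vanish {r : ℕ} (f : Cochain k A r) (w : ℕ → A) (l : ℕ) (h0 : 0 < l) (hl : l ≤ r)
    (hw : w l = 1) : F.form (ev f.1 fun t => w (t + 1)) (w 0) = 0 := by
  rw [Cochain.ev_eq_zero f (l - 1) (by omega) (by simpa [show l - 1 + 1 = l by omega] using hw),
    map_zero, LinearMap.zero_apply]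

/-- The pairing `(f, a_0 ⊗ ⋯ ⊗ a_r) ↦ ⟨f(a_1, …, a_r), a_0⟩`. -/
noncomputable def pair (r : ℕ) : Cochain k A r →ₗ[k] Chain k A r →ₗ[k] k where
  toFun f := Chain.map _ (F.pair_lin f) (F.pair_vanish f)
  map_add' f g := Chain.hom_ext fun a => by
    rw [LinearMap.add_apply, Chain.map_gen, Chain.map_gen, Chain.map_gen, ev_add, map_add,
      LinearMap.add_apply]
  map_smul' c f := Chain.hom_ext fun a => by
    rw [LinearMap.smul_apply, Chain.map_gen, Chain.map_gen, ev_smul, map_smul,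
      LinearMap.smul_apply]
    rfl

theorem pair_ev {r : ℕ} (f : Cochain k A r) (w : ℕ → A) :
    F.pair r f (ev (gen k A r) w) = F.form (ev f.1 fun t => w (t + 1)) (w 0) := by
  refine Chain.map_ev _ _ (F.pair_vanish f) (fun w w' h => ?_) w
  rw [ev_congr f.1 fun t ht => h (t + 1) (by omega), h 0 (by omega)]

theorem pair_inj {r : ℕ} {f g : Cochain k A r} (h : ∀ x, F.pair r f x = F.pair r g x) : f = g :=
  Cochain.ext_ev fun w => F.eq_of_form fun z => by
    have := h (ev (gen k A r) fun t => if t = 0 then z else w (t - 1))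
    simpa [F.pair_ev] using this

/-- The values of f are prescribed by their pairings with the basis u, so f(w) = ∑ G(u_i ⊗ w) v_i.
Together with `pair_inj` this identifies cochains with linear forms on chains, in any dimension. -/
theorem pair_surj {r : ℕ} (G : Chain k A r →ₗ[k] k) : ∃ f, F.pair r f = G := by
  let W : A → (ℕ → A) → ℕ → A := fun a w t => if t = 0 then a else w (t - 1)
  refine ⟨Cochain.mk (fun w => ∑ i, G (ev (gen k A r) (W (F.u i) w)) • F.v i)
    (LinearInEach.sum _ fun i _ => LinearInEach.comp (LinearMap.toSpanSingleton k A (F.v i))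
      (LinearInEach.comp G fun w j hj => ev_lin _ (W (F.u i) w) (s := j + 1) (by omega) _
        LinearMap.id fun x t _ => by
          simp only [W, Function.update_apply, LinearMap.id_apply]; grind))
    (fun w t ht hw => Finset.sum_eq_zero fun i _ => by
      rw [gen_eq_zero (t + 1) (by omega) (by omega) (by simpa [W] using hw), map_zero,
        zero_smul]), Chain.hom_ext_ev fun w => ?_⟩
  rw [F.pair_ev, Cochain.mk_ev _ _ _ (fun w w' h => Finset.sum_congr rfl fun i _ => by
    rw [ev_congr (gen k A r) fun t ht => ?_]; simp only [W]; grind)]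
  obtain ⟨L, hL⟩ := ev_lin (gen k A r) w (s := 0) (by omega)
    (fun a => W a fun t => w (t + 1)) LinearMap.id fun x t _ => by
      simp only [W, LinearMap.id_apply]; grind
  have e : ev (gen k A r) w = ev (gen k A r) (W (w 0) fun t => w (t + 1)) :=
    ev_congr _ fun t _ => by simp only [W]; grind
  conv_rhs => rw [e, hL, ← F.form_v (w 0)]
  simp [hL, mul_comm]

/-- The terms correspond one by one. Only the zeroth uses the Nakayama automorphism: ⟨a_1 f, a_0⟩ =
⟨f, a_0 ν(a_1)⟩, which is why the dual of the cochains has coefficients in A_ν. -/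
theorem pair_δ {r : ℕ} (f : Cochain k A r) (x : Chain k A (r + 1)) :
    F.pair (r + 1) (δ r f) x = F.pair r f (bdry F.ν r x) := by
  refine LinearMap.congr_fun (f := F.pair (r + 1) (δ r f))
    (g := (F.pair r f).comp (bdry F.ν r)) (Chain.hom_ext_ev fun w => ?_) x
  rw [LinearMap.comp_apply, bdry_ev, map_altSum, F.pair_ev, δ_ev,
    ← LinearMap.flip_apply (f := F.form), map_altSum]
  refine altSum_congr fun i hi => ?_
  rw [F.pair_ev, LinearMap.flip_apply]
  rcases Nat.eq_zero_or_pos i with rfl | h0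
  · rw [coface_zero, face_zero]
    simp only [if_true, Nat.add_eq_zero_iff, one_ne_zero, and_false, if_false]
    rw [F.form_assoc, F.form_ν, F.form_assoc]
  rcases eq_or_ne i (r + 1) with rfl | hne
  · rw [coface_last, face_last]
    simp [F.form_assoc]
  · obtain ⟨i, rfl⟩ : ∃ j, i = j + 1 := ⟨i - 1, by omega⟩
    rw [coface_mid _ _ (by omega), face_mid _ _ (by omega) (by omega)]
    congr 2
    refine ev_congr _ fun t ht => ?_
    simp only [merge]; grind

theorem pair_delta {s : ℕ} (f : Cochain k A (s + 1)) (x : Chain k A s) :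
    F.pair s (F.delta s f) x = F.pair (s + 1) f (connes F.ν s x) := by
  refine LinearMap.congr_fun (f := F.pair s (F.delta s f))
    (g := (F.pair (s + 1) f).comp (connes F.ν s)) (Chain.hom_ext_ev fun w => ?_) x
  rw [LinearMap.comp_apply, connes_ev, map_sum, F.pair_ev]
  refine (F.form_delta s f _ _).trans (Finset.sum_congr rfl fun i hi => ?_)
  rw [Finset.mem_Icc] at hi
  rw [map_smul, F.pair_ev]
  congr 2
  · congr 1
    refine ev_congr _ fun t ht => ?_
    simp only [deltaTerm, connesTerm, seq]
    grind

/-- The action of the Nakayama automorphism on cochains. -/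
noncomputable def cotwist (r : ℕ) : Cochain k A r →ₗ[k] Cochain k A r where
  toFun f := Cochain.mk (fun w => F.ν (ev f.1 fun t => F.ν.symm (w t)))
    (LinearInEach.comp F.ν.toLinearMap fun w j hj => ev_lin _ (fun t => F.ν.symm (w t)) hj _
      F.ν.symm.toLinearMap fun x t _ => by
        simp only [Function.update_apply, AlgEquiv.toLinearMap_apply]; grind)
    (fun w t ht hw => by rw [Cochain.ev_eq_zero f t ht (by rw [hw, map_one]), map_zero])
  map_add' f g := by
    ext a
    exact map_add F.ν _ _
  map_smul' c f := by
    ext a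
    exact map_smul F.ν c _

theorem cotwist_ev {r : ℕ} (f : Cochain k A r) (w : ℕ → A) :
    ev (F.cotwist r f).1 w = F.ν (ev f.1 fun t => F.ν.symm (w t)) :=
  Cochain.mk_ev _ _ (fun w t ht hw => by
    rw [Cochain.ev_eq_zero f t ht (by rw [hw, map_one]), map_zero])
    (fun w w' h => by rw [ev_congr f.1 fun t ht => by rw [h t ht]]) w

theorem pair_cotwist {r : ℕ} (f : Cochain k A r) (x : Chain k A r) :
    F.pair r (F.cotwist r f) (twist F.ν r x) = F.pair r f x := by
  refine LinearMap.congr_fun (f := (F.pair r (F.cotwist r f)).comp (twist F.ν r))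
    (g := F.pair r f) (Chain.hom_ext_ev fun w => ?_) x
  simp [twist_ev, F.pair_ev, F.cotwist_ev, F.form_ν_ν]

theorem exists_twist {r : ℕ} (x : Chain k A r) : ∃ y, twist F.ν r y = x :=
  ⟨twist F.ν.symm r x, by
    rw [twist_twist, AlgEquiv.symm_trans_self, twist_refl]⟩

/-- The action of the Nakayama automorphism on the complete complex. -/
noncomputable def act : (n : ℤ) → CplxType k A n →ₗ[k] CplxType k A n
  | Int.ofNat r => F.cotwist r
  | Int.negSucc p => twist F.ν p

theorem δ_cotwist {r : ℕ} (f : Cochain k A r) : δ r (F.cotwist r f) = F.cotwist (r + 1) (δ r f) := by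
  refine F.pair_inj fun x => ?_
  obtain ⟨x, rfl⟩ := F.exists_twist x
  rw [F.pair_cotwist, F.pair_δ, F.pair_δ, ← twist_bdry _ _ fun _ => rfl, F.pair_cotwist]

theorem delta_cotwist {r : ℕ} (f : Cochain k A (r + 1)) :
    F.delta r (F.cotwist (r + 1) f) = F.cotwist r (F.delta r f) := by
  refine F.pair_inj fun x => ?_
  obtain ⟨x, rfl⟩ := F.exists_twist x
  rw [F.pair_cotwist, F.pair_delta, F.pair_delta, ← twist_connes _ _ fun _ => rfl, F.pair_cotwist]

/-- For a central element c one has ⟨z, c⟩ = ⟨c, z⟩ = ⟨z, ν(c)⟩, and the form is non-degenerate. -/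
theorem ν_casimir (a : A) : F.ν (F.casimir a) = F.casimir a := by
  refine F.eq_of_form' fun z => ?_
  have h1 := F.form_assoc 1 (F.casimir a) z
  have h2 := F.form_assoc 1 z (F.casimir a)
  rw [one_mul] at h1 h2
  rw [← F.form_ν, h1, h2, F.mul_casimir]

theorem norm_twist (x : Chain k A 0) : F.norm (twist F.ν 0 x) = F.cotwist 0 (F.norm x) := by
  induction x using Chain.induction_ev with
  | hadd x y hx hy => simp only [map_add, hx, hy]
  | hsmul c x hx => simp only [map_smul, hx]
  | hev w =>
    refine Cochain.ext_ev fun c => ?_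
    rw [twist_ev, F.cotwist_ev, F.norm_ev', F.norm_ev', F.ν_casimir]
    exact F.casimir_ν _

end FrobeniusData

end Duality
end CompleteHochschild

namespace CompleteHochschild
universe u

/-! ### The Nakayama action on the complex and its triviality on cohomology -/

section WeightOne

variable {k A : Type u} [Field k] [Ring A] [Algebra k A]
  {ι : Type*} [Fintype ι] [DecidableEq ι] (F : FrobeniusData k A ι)

namespace FrobeniusData

theorem act_d : ∀ (n : ℤ) (x : CplxType k A n), F.act (n + 1) (F.d n x) = F.d n (F.act n x)
  | Int.ofNat _, x => (F.δ_cotwist x).symm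
  | Int.negSucc 0, x => (F.norm_twist x).symm
  | Int.negSucc (p + 1), x => twist_bdry F.ν.symm F.ν (fun a => by simp) p x

theorem twist_smul_connes (p : ℕ) (c : k) (x : Chain k A p) :
    twist F.ν (p + 1) ((c • connes F.ν.symm p) x) = (c • connes F.ν.symm p) (twist F.ν p x) := by
  rw [LinearMap.smul_apply, map_smul, twist_connes F.ν.symm F.ν (fun a => by simp),
    LinearMap.smul_apply]

theorem act_bv : ∀ (s : ℤ) (x : CplxType k A (s + 1)),
    F.act s (F.bv s x) = F.bv s (F.act (s + 1) x)
  | Int.ofNat _, x => (F.delta_cotwist x).symm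
  | Int.negSucc 0, _ => map_zero (twist F.ν 0)
  | Int.negSucc (p + 1), x => F.twist_smul_connes p _ x

theorem act_mem_cocycles {n : ℤ} {x : CplxType k A n} (hx : x ∈ F.cocycles n) :
    F.act n x ∈ F.cocycles n := by
  rw [cocycles, LinearMap.mem_ker] at hx ⊢
  rw [← F.act_d, hx, map_zero]

theorem pair_bdry_eq_zero {r : ℕ} {f : Cochain k A r} (hf : δ r f = 0) (x : Chain k A (r + 1)) :
    F.pair r f (bdry F.ν r x) = 0 := by
  rw [← F.pair_δ, hf, map_zero, LinearMap.zero_apply]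

theorem pair_twist_of_fixed {r : ℕ} {f : Cochain k A r} (hf : F.cotwist r f = f)
    (x : Chain k A r) : F.pair r f (twist F.ν r x) = F.pair r f x := by
  rw [← F.pair_cotwist f x, hf]

theorem pair_sub {r : ℕ} (f g : Cochain k A r) (x : Chain k A r) :
    F.pair r (f - g) x = F.pair r f x - F.pair r g x := by
  have h := map_add (F.pair r) (f - g) g
  have e : f - g + g = f := sub_add_cancel f g
  rw [e] at h
  rw [h, LinearMap.add_apply, add_sub_cancel_right]

/-- Transpose of ∂B + B∂ = ν - 1: the term with ∂B drops out because the ν-translate of f is again a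
cocycle, and pairing the translate with ν x gives back the pairing of f with x. -/
theorem δ_delta_cotwist {s : ℕ} {f : Cochain k A (s + 1)} (hf : δ (s + 1) f = 0) :
    δ s (F.delta s (F.cotwist (s + 1) f)) = f - F.cotwist (s + 1) f := by
  have hf' : δ (s + 1) (F.cotwist (s + 1) f) = 0 := by rw [F.δ_cotwist, hf, map_zero]
  refine F.pair_inj fun x => ?_
  rw [F.pair_δ, F.pair_delta, eq_sub_of_add_eq' (bdry_connes_succ F.ν s x), map_sub, map_sub,
    F.pair_bdry_eq_zero hf', F.pair_cotwist, F.pair_sub, sub_zero]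

theorem δ_delta_of_fixed {s : ℕ} {f : Cochain k A (s + 1)} (hf : δ (s + 1) f = 0)
    (hT : F.cotwist (s + 1) f = f) : δ s (F.delta s f) = 0 := by
  have h := F.δ_delta_cotwist hf
  rw [hT] at h
  exact h.trans (sub_self f)

theorem delta_δ_zero {f : Cochain k A 0} (hf : F.cotwist 0 f = f) : F.delta 0 (δ 0 f) = 0 := by
  refine F.pair_inj fun x => ?_
  rw [F.pair_delta, F.pair_δ, bdry_connes_zero, map_sub, F.pair_twist_of_fixed hf, sub_self,
    map_zero, LinearMap.zero_apply]

/-- On ν-invariant cochains the transposed homotopy formula says that Δ and δ anticommute. The sign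
is put inside δ so that the right side is visibly a coboundary. -/
theorem delta_δ_succ {s : ℕ} {f : Cochain k A (s + 1)} (hf : F.cotwist (s + 1) f = f) :
    F.delta (s + 1) (δ (s + 1) f) = δ s (F.delta s ((-1 : k) • f)) := by
  refine F.pair_inj fun x => ?_
  rw [F.pair_delta, F.pair_δ, eq_sub_of_add_eq (bdry_connes_succ F.ν s x), map_sub, map_sub,
    F.pair_twist_of_fixed hf, sub_self, zero_sub, F.pair_δ, F.pair_delta, map_smul,
    LinearMap.smul_apply, neg_one_smul]

/-- A cocycle pairs to zero with ∂B x = ν x - x. In degree zero the coboundaries come from the norm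
and not from a δ, so equality on the nose is what is needed, and it holds. -/
theorem cotwist_zero_of_cocycle {f : Cochain k A 0} (hf : δ 0 f = 0) : F.cotwist 0 f = f := by
  refine F.pair_inj fun x => ?_
  obtain ⟨x, rfl⟩ := F.exists_twist x
  have h := F.pair_bdry_eq_zero hf (connes F.ν 0 x)
  rw [bdry_connes_zero, map_sub, sub_eq_zero] at h
  rw [F.pair_cotwist, h]

theorem twist_symm_twist (p : ℕ) (x : Chain k A p) : twist F.ν.symm p (twist F.ν p x) = x := by
  rw [twist_twist, AlgEquiv.self_trans_symm, twist_refl]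

theorem cotwist_sub_eq_δ {s : ℕ} {f : Cochain k A (s + 1)} (hf : δ (s + 1) f = 0) :
    ∃ g, δ s g = F.cotwist (s + 1) f - f := by
  refine ⟨(-1 : k) • F.delta s (F.cotwist (s + 1) f), ?_⟩
  rw [map_smul, F.δ_delta_cotwist hf]
  module

theorem twist_sub_eq_bdry_zero (x : Chain k A 0) :
    ∃ y, bdry F.ν.symm 0 y = twist F.ν 0 x - x :=
  -- The chains carry the twist ν⁻¹, so the homotopy formula produces ν⁻¹ - 1; applying it to ν x
  -- and changing the sign gives ν - 1.
  ⟨-connes F.ν.symm 0 (twist F.ν 0 x), by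
    rw [map_neg, bdry_connes_zero, twist_symm_twist, neg_sub]⟩

theorem twist_sub_eq_bdry_succ {q : ℕ} {x : Chain k A (q + 1)} (hx : bdry F.ν.symm q x = 0) :
    ∃ y, bdry F.ν.symm (q + 1) y = twist F.ν (q + 1) x - x := by
  refine ⟨-connes F.ν.symm (q + 1) (twist F.ν (q + 1) x), ?_⟩
  rw [map_neg, eq_sub_of_add_eq (bdry_connes_succ F.ν.symm q (twist F.ν (q + 1) x)),
    twist_symm_twist, ← twist_bdry F.ν.symm F.ν (fun a => by simp), hx, map_zero, map_zero,
    sub_zero, neg_sub]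

/-- The Nakayama automorphism acts trivially on the complete cohomology. -/
theorem act_sub_mem : ∀ {n : ℤ} {x : CplxType k A n}, x ∈ F.cocycles n →
    F.act n x - x ∈ F.coboundaries n
  | Int.ofNat 0, x, hx => by
    have : F.act (Int.ofNat 0) x - x = 0 := sub_eq_zero.2 (F.cotwist_zero_of_cocycle hx)
    rw [this]
    exact zero_mem _
  | Int.ofNat (_ + 1), _, hx =>
    have ⟨g, hg⟩ := F.cotwist_sub_eq_δ hx
    ⟨g, trivial, hg⟩
  | Int.negSucc 0, x, _ =>
    have ⟨y, hy⟩ := F.twist_sub_eq_bdry_zero x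
    ⟨y, trivial, hy⟩
  | Int.negSucc (_ + 1), _, hx =>
    have ⟨y, hy⟩ := F.twist_sub_eq_bdry_succ hx
    ⟨y, trivial, hy⟩

theorem twist_symm_of_fixed {p : ℕ} {x : Chain k A p} (hx : twist F.ν p x = x) :
    twist F.ν.symm p x = x := by
  conv_lhs => rw [← hx]
  exact F.twist_symm_twist p x

theorem bdry_smul_connes_zero (c : k) {x : Chain k A 0} (hT : twist F.ν 0 x = x) :
    bdry F.ν.symm 0 ((c • connes F.ν.symm 0) x) = 0 := by
  rw [LinearMap.smul_apply, map_smul, bdry_connes_zero, F.twist_symm_of_fixed hT, sub_self,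
    smul_zero]

theorem bdry_smul_connes_succ (c : k) {q : ℕ} {x : Chain k A (q + 1)}
    (hT : twist F.ν (q + 1) x = x) : bdry F.ν.symm (q + 1) ((c • connes F.ν.symm (q + 1)) x) =
      -(c • connes F.ν.symm q) (bdry F.ν.symm q x) := by
  rw [LinearMap.smul_apply, map_smul, eq_sub_of_add_eq (bdry_connes_succ F.ν.symm q x),
    F.twist_symm_of_fixed hT, sub_self, zero_sub, smul_neg, LinearMap.smul_apply]

theorem bdry_smul_connes_of_cycle (c : k) {q : ℕ} {x : Chain k A (q + 1)}
    (hT : twist F.ν (q + 1) x = x) (hx : bdry F.ν.symm q x = 0) :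
    bdry F.ν.symm (q + 1) ((c • connes F.ν.symm (q + 1)) x) = 0 := by
  rw [F.bdry_smul_connes_succ c hT, hx, map_zero, neg_zero]

theorem smul_connes_bdry_mem (c : k) {q : ℕ} {x : Chain k A (q + 1)}
    (hT : twist F.ν (q + 1) x = x) :
    ∃ y, bdry F.ν.symm (q + 1) y = (c • connes F.ν.symm q) (bdry F.ν.symm q x) :=
  ⟨-(c • connes F.ν.symm (q + 1)) x, by rw [map_neg, F.bdry_smul_connes_succ c hT, neg_neg]⟩

theorem bv_mem_cocycles : ∀ {s : ℤ} {x : CplxType k A (s + 1)}, x ∈ F.cocycles (s + 1) →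
    F.act (s + 1) x = x → F.bv s x ∈ F.cocycles s
  | Int.ofNat _, _, hx, hT => F.δ_delta_of_fixed hx hT
  | Int.negSucc 0, _, _, _ => zero_mem _
  | Int.negSucc 1, _, _, hT => F.bdry_smul_connes_zero _ hT
  | Int.negSucc (_ + 2), _, hx, hT => F.bdry_smul_connes_of_cycle _ hT hx

/-- This makes the operator well defined on classes of weight one. For degrees at least 1 and at
most -2 it is the anticommutation on invariants. For x of degree 0 the composite is the transpose of
∂B = ν - 1, hence zero. For x of degree -1 the operator vanishes by definition on degree 0. -/
theorem bv_d_mem_coboundaries : ∀ {s : ℤ} {x : CplxType k A s}, F.act s x = x →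
    F.bv s (F.d s x) ∈ F.coboundaries s
  | Int.ofNat 0, x, hT => by
    have h : F.bv (Int.ofNat 0) (F.d (Int.ofNat 0) x) = 0 := F.delta_δ_zero hT
    rw [h]
    exact zero_mem _
  | Int.ofNat (s + 1), x, hT => ⟨_, trivial, (F.delta_δ_succ (f := x) hT).symm⟩
  | Int.negSucc 0, x, _ => zero_mem _
  | Int.negSucc (p + 1), x, hT =>
    have ⟨y, hy⟩ := F.smul_connes_bdry_mem ((-1) ^ (p + 1)) hT
    ⟨y, trivial, hy⟩

end FrobeniusData

end WeightOne
end CompleteHochschild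

namespace CompleteHochschild
universe u

/-! ### Averaging over the Nakayama automorphism, and the BV operator on cohomology -/

section BVOperator

variable {k A : Type u} [Field k] [Ring A] [Algebra k A]
  {ι : Type*} [Fintype ι] [DecidableEq ι] (F : FrobeniusData k A ι)

namespace FrobeniusData

/-- The Nakayama automorphism has order dividing three, and `k` contains a primitive third root of
unity. -/
structure OrderThree (ζ : k) : Prop where
  ν_ν_ν : ∀ a, F.ν (F.ν (F.ν a)) = a
  three_ne_zero : (3 : k) ≠ 0
  root : ζ ^ 2 + ζ + 1 = 0

variable {F} {ζ : k}

namespace OrderThree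

theorem cube (h : F.OrderThree ζ) : ζ ^ 3 = 1 := by linear_combination (ζ - 1) * h.root

/-- For η³ = 1 the vector x + η² ν x + η ν² x is an eigenvector with eigenvalue η. The sum of these
over η = 1, ζ, ζ² is 3 x because 1 + ζ + ζ² = 0. -/
theorem span_eigenvectors (h : F.OrderThree ζ) :
    ⊤ ≤ Submodule.span k {x : A | ∃ c : k, F.ν x = c • x} := by
  intro x _
  have key : ∀ η : k, η ^ 3 = 1 →
      x + η ^ 2 • F.ν x + η • F.ν (F.ν x) ∈ Submodule.span k {x : A | ∃ c : k, F.ν x = c • x} :=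
    fun η hη => Submodule.subset_span ⟨η, by
      simp only [map_add, map_smul, h.ν_ν_ν, smul_add, smul_smul]
      rw [← pow_succ', hη, ← pow_two, one_smul]
      abel⟩
  have h1 := add_mem (add_mem (key 1 (one_pow 3)) (key ζ h.cube))
    (key (ζ ^ 2) (by rw [← pow_mul, mul_comm, pow_mul, h.cube, one_pow]))
  have h2 : x = (3 : k)⁻¹ • ((x + (1 : k) ^ 2 • F.ν x + (1 : k) • F.ν (F.ν x)) +
      (x + ζ ^ 2 • F.ν x + ζ • F.ν (F.ν x)) +
      (x + (ζ ^ 2) ^ 2 • F.ν x + ζ ^ 2 • F.ν (F.ν x))) := by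
    have e : (ζ ^ 2) ^ 2 = ζ := by linear_combination ζ * h.cube
    have e' : (x + (1 : k) ^ 2 • F.ν x + (1 : k) • F.ν (F.ν x)) +
      (x + ζ ^ 2 • F.ν x + ζ • F.ν (F.ν x)) +
      (x + (ζ ^ 2) ^ 2 • F.ν x + ζ ^ 2 • F.ν (F.ν x)) =
      (3 : k) • x + (ζ ^ 2 + ζ + 1) • (F.ν x + F.ν (F.ν x)) := by
      rw [e]; module
    rw [e', h.root, zero_smul, add_zero, smul_smul, inv_mul_cancel₀ h.three_ne_zero, one_smul]
  rw [h2]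
  exact Submodule.smul_mem _ _ h1

theorem exists_eigenbasis (h : F.OrderThree ζ) :
    ∃ (κ : Type u) (b : Module.Basis κ k A) (c : κ → k), ∀ i, F.ν (b i) = c i • b i := by
  let b := Module.Basis.ofSpan h.span_eigenvectors
  have hb : ∀ i, ∃ c : k, F.ν (b i) = c • b i := fun i =>
    Module.Basis.ofSpan_subset h.span_eigenvectors ⟨i, rfl⟩
  choose c hc using hb
  exact ⟨_, b, c, hc⟩

theorem cotwist_cotwist_cotwist (h : F.OrderThree ζ) {r : ℕ} (f : Cochain k A r) :
    F.cotwist r (F.cotwist r (F.cotwist r f)) = f := by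
  have hs : ∀ a, F.ν.symm (F.ν.symm (F.ν.symm a)) = a := fun a => by
    conv_lhs => rw [← h.ν_ν_ν a]
    simp
  refine Cochain.ext_ev fun w => ?_
  rw [cotwist_ev, cotwist_ev, cotwist_ev, h.ν_ν_ν]
  exact ev_congr _ fun t _ => hs _

theorem act_act_act (h : F.OrderThree ζ) : ∀ (n : ℤ) (x : CplxType k A n),
    F.act n (F.act n (F.act n x)) = x
  | Int.ofNat _, x => h.cotwist_cotwist_cotwist x
  | Int.negSucc p, x => by
    refine LinearMap.congr_fun (f := (twist F.ν p).comp ((twist F.ν p).comp (twist F.ν p)))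
      (g := LinearMap.id) (Chain.hom_ext_ev fun w => ?_) x
    simp only [LinearMap.comp_apply, LinearMap.id_apply, twist_ev, h.ν_ν_ν]

variable (F) in
/-- The average over the powers of the Nakayama automorphism. -/
noncomputable def _root_.CompleteHochschild.FrobeniusData.avg (n : ℤ) :
    CplxType k A n →ₗ[k] CplxType k A n :=
  (3 : k)⁻¹ • (LinearMap.id + F.act n + (F.act n).comp (F.act n))

theorem avg_apply (n : ℤ) (x : CplxType k A n) :
    F.avg n x = (3 : k)⁻¹ • (x + F.act n x + F.act n (F.act n x)) := rfl

theorem avg_d (n : ℤ) (x : CplxType k A n) : F.avg (n + 1) (F.d n x) = F.d n (F.avg n x) := by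
  simp only [avg_apply, F.act_d, map_add, map_smul]

theorem avg_of_fixed (h : F.OrderThree ζ) {n : ℤ} {x : CplxType k A n} (hx : F.act n x = x) :
    F.avg n x = x := by
  have h3 : x + x + x = (3 : k) • x := by module
  rw [avg_apply, hx, hx, h3, smul_smul, inv_mul_cancel₀ h.three_ne_zero, one_smul]

theorem act_avg (h : F.OrderThree ζ) (n : ℤ) (x : CplxType k A n) :
    F.act n (F.avg n x) = F.avg n x := by
  rw [avg_apply, map_smul, map_add, map_add, h.act_act_act]
  congr 1
  abel

/-- Preserving weights is equivariance tested on eigenvectors, and by multilinearity an eigenbasis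
of A suffices. -/
theorem mem_weightOne_cochain (h : F.OrderThree ζ) {r : ℕ} {f : Cochain k A r} :
    (∀ (c : Fin r → k) (a : Fin r → A), (∀ t, F.ν (a t) = c t • a t) →
      F.ν (f.1 a) = (∏ t, c t) • f.1 a) ↔ F.cotwist r f = f := by
  have hT : F.cotwist r f = f ↔ ∀ a : Fin r → A, F.ν (f.1 a) = f.1 fun t => F.ν (a t) := by
    constructor
    · intro hf a
      conv_rhs => rw [← hf]
      have e := F.cotwist_ev f fun t => F.ν (seq a t)
      simp only [AlgEquiv.symm_apply_apply] at e
      rw [ev_seq] at e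
      rw [← e, ev]
      simp only [seq_val]
    · intro hf
      refine Cochain.ext_ev fun w => ?_
      rw [F.cotwist_ev, ev, hf]
      simp [ev]
  rw [hT]
  constructor
  · intro hf
    obtain ⟨κ, b, c, hb⟩ := h.exists_eigenbasis
    have e : F.ν.toLinearMap.compMultilinearMap f.1 = f.1.compLinearMap fun _ => F.ν.toLinearMap :=
      Module.Basis.ext_multilinear (fun _ => b) fun v => by
        change F.ν (f.1 fun t => b (v t)) = f.1 fun t => F.ν (b (v t))
        simp only [hb]
        rw [MultilinearMap.map_smul_univ, hf (fun t => c (v t)) _ fun t => hb _]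
    exact fun a => congrArg (fun g => g a) e
  · intro hf c a ha
    rw [hf a]
    simp only [ha]
    rw [MultilinearMap.map_smul_univ]

/-- A tensor of eigenvectors is scaled by ν with the product of its eigenvalues, so tensors of
weight one are fixed. Conversely a fixed chain is its own average, and the average of any chain lies
in the span. -/
theorem mem_weightOne_chain (h : F.OrderThree ζ) {p : ℕ} {x : Chain k A p} :
    x ∈ Submodule.span k {x | ∃ (c : Fin (p + 1) → k) (a : Fin (p + 1) → A),
      (∀ t, F.ν (a t) = c t • a t) ∧ ∏ t, c t = 1 ∧ x = gen k A p a} ↔ twist F.ν p x = x := by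
  have hgen : ∀ (c : Fin (p + 1) → k) (a : Fin (p + 1) → A), (∀ t, F.ν (a t) = c t • a t) →
      twist F.ν p (gen k A p a) = (∏ t, c t) • gen k A p a := fun c a ha => by
    rw [← ev_seq (gen k A p) a, twist_ev, ev_seq, ← MultilinearMap.map_smul_univ]
    refine congrArg (gen k A p) (funext fun t => ?_)
    rw [← ha, ← seq_val a t]
  constructor
  · intro hx
    induction hx using Submodule.span_induction with
    | mem x hx =>
      obtain ⟨c, a, ha, hc, rfl⟩ := hx
      rw [hgen c a ha, hc, one_smul]
    | zero => exact map_zero _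
    | add x y _ _ hx hy => rw [map_add, hx, hy]
    | smul r x _ hx => rw [map_smul, hx]
  · intro hx
    set W := Submodule.span k {x | ∃ (c : Fin (p + 1) → k) (a : Fin (p + 1) → A),
      (∀ t, F.ν (a t) = c t • a t) ∧ ∏ t, c t = 1 ∧ x = gen k A p a} with hW
    obtain ⟨κ, b, c, hb⟩ := h.exists_eigenbasis
    have hc : ∀ i, c i ^ 3 = 1 := fun i => by
      have e := h.ν_ν_ν (b i)
      simp only [hb, map_smul, smul_smul] at e
      have e' : (c i * c i * c i - 1) • b i = 0 := by rw [sub_smul, one_smul, e, sub_self]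
      rcases smul_eq_zero.1 e' with e' | e'
      · linear_combination e'
      · exact absurd e' (b.ne_zero i)
    -- It is enough to test tensors of eigenvectors. Let C be the product of the eigenvalues, so C³
    -- = 1: either C = 1 and the tensor lies in W, or 1 + C + C² = 0 and its three translates add up
    -- to zero.
    have key : W.mkQ.comp (LinearMap.id + twist F.ν p + (twist F.ν p).comp (twist F.ν p)) = 0 := by
      refine Chain.hom_ext fun a => ?_
      have e : (W.mkQ.comp (LinearMap.id + twist F.ν p +
          (twist F.ν p).comp (twist F.ν p))).compMultilinearMap (gen k A p) = 0 :=
        Module.Basis.ext_multilinear (fun _ => b) fun v => by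
          change W.mkQ (gen k A p (fun t => b (v t)) + twist F.ν p (gen k A p fun t => b (v t)) +
            twist F.ν p (twist F.ν p (gen k A p fun t => b (v t)))) = 0
          have hv := hgen (fun t => c (v t)) (fun t => b (v t)) fun t => hb _
          have hC : (∏ t, c (v t)) ^ 3 = 1 := by
            rw [← Finset.prod_pow]; exact Finset.prod_eq_one fun t _ => hc _
          by_cases h1 : ∏ t, c (v t) = 1
          · rw [h1, one_smul] at hv
            rw [hv, hv]
            refine (Submodule.Quotient.mk_eq_zero _).2 ?_
            have hm : gen k A p (fun t => b (v t)) ∈ W :=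
              Submodule.subset_span ⟨_, _, fun t => hb _, h1, rfl⟩
            exact add_mem (add_mem hm hm) hm
          · have h2 : 1 + (∏ t, c (v t)) + (∏ t, c (v t)) * (∏ t, c (v t)) = 0 := by
              refine (mul_eq_zero.1 ?_).resolve_left (sub_ne_zero.2 h1)
              linear_combination hC
            rw [hv, map_smul, hv, smul_smul]
            have e : gen k A p (fun t => b (v t)) + (∏ t, c (v t)) • gen k A p (fun t => b (v t)) +
              ((∏ t, c (v t)) * (∏ t, c (v t))) • gen k A p (fun t => b (v t)) =
              (1 + (∏ t, c (v t)) + (∏ t, c (v t)) * (∏ t, c (v t))) •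
                gen k A p (fun t => b (v t)) := by module
            rw [e, h2, zero_smul, map_zero]
      exact congrArg (fun g => g a) e
    have h1 : W.mkQ (x + twist F.ν p x + twist F.ν p (twist F.ν p x)) = 0 :=
      LinearMap.congr_fun key x
    have h2 : x = (3 : k)⁻¹ • (x + twist F.ν p x + twist F.ν p (twist F.ν p x)) := by
      rw [hx, hx, show x + x + x = (3 : k) • x by module, smul_smul,
        inv_mul_cancel₀ h.three_ne_zero, one_smul]
    rw [h2]
    exact Submodule.smul_mem _ _ ((Submodule.Quotient.mk_eq_zero _).1 h1)

theorem mem_weightOne (h : F.OrderThree ζ) : ∀ {n : ℤ} {x : CplxType k A n},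
    x ∈ F.weightOne n ↔ F.act n x = x
  | Int.ofNat _, _ => h.mem_weightOne_cochain
  | Int.negSucc _, _ => h.mem_weightOne_chain

theorem avg_mem_weightOne (h : F.OrderThree ζ) (n : ℤ) (x : CplxType k A n) :
    F.avg n x ∈ F.weightOne n :=
  h.mem_weightOne.2 (h.act_avg n x)

theorem d_mem_coboundariesOne : ∀ (n : ℤ) {w : CplxType k A n}, w ∈ F.weightOne n →
    F.d n w ∈ F.coboundariesOne (n + 1)
  | Int.ofNat _, w, hw => ⟨w, hw, rfl⟩
  | Int.negSucc 0, w, hw => ⟨w, hw, rfl⟩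
  | Int.negSucc (_ + 1), w, hw => ⟨w, hw, rfl⟩

theorem exists_of_mem_coboundariesOne : ∀ (n : ℤ) {x : CplxType k A (n + 1)},
    x ∈ F.coboundariesOne (n + 1) → ∃ w ∈ F.weightOne n, F.d n w = x
  | Int.ofNat _, _, ⟨w, hw, e⟩ => ⟨w, hw, e⟩
  | Int.negSucc 0, _, ⟨w, hw, e⟩ => ⟨w, hw, e⟩
  | Int.negSucc (_ + 1), _, ⟨w, hw, e⟩ => ⟨w, hw, e⟩

theorem avg_mem_coboundariesOne (h : F.OrderThree ζ) {n : ℤ} {x : CplxType k A n}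
    (hx : x ∈ F.coboundaries n) : F.avg n x ∈ F.coboundariesOne n :=
  F.coboundary_induction (P := fun n x => F.avg n x ∈ F.coboundariesOne n)
    (fun m w => by
      rw [avg_d]
      exact d_mem_coboundariesOne m (h.avg_mem_weightOne m w)) n x hx

/-- The difference is a third of (ν² x - ν x) + 2 (ν x - x), and ν acts trivially on the classes of
x and of ν x. -/
theorem avg_sub_mem (h : F.OrderThree ζ) {n : ℤ} {x : CplxType k A n} (hx : x ∈ F.cocycles n) :
    F.avg n x - x ∈ F.coboundaries n := by
  have e : F.avg n x - x = (3 : k)⁻¹ • ((F.act n (F.act n x) - F.act n x) +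
      ((2 : k) • (F.act n x - x))) := by
    have h3 : x = (3 : k)⁻¹ • (3 : k) • x := by
      rw [smul_smul, inv_mul_cancel₀ h.three_ne_zero, one_smul]
    conv_lhs => rw [avg_apply]; rhs; rw [h3]
    rw [← smul_sub]
    congr 1
    module
  rw [e]
  exact Submodule.smul_mem _ _ (add_mem (F.act_sub_mem (F.act_mem_cocycles hx))
    (Submodule.smul_mem _ _ (F.act_sub_mem hx)))

theorem avg_mem_cocycles {n : ℤ} {x : CplxType k A n} (hx : x ∈ F.cocycles n) :
    F.avg n x ∈ F.cocycles n :=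
  Submodule.smul_mem _ _ (add_mem (add_mem hx (F.act_mem_cocycles hx))
    (F.act_mem_cocycles (F.act_mem_cocycles hx)))

/-- Averaging commutes with d and has values of weight one. If an invariant cocycle is a coboundary,
its average, which is itself, bounds the averaged cochain; and every cocycle is cohomologous to its
average. -/
theorem oneToHH_bijective (h : F.OrderThree ζ) (n : ℤ) : Function.Bijective (F.oneToHH n) := by
  constructor
  · rw [← LinearMap.ker_eq_bot, Submodule.eq_bot_iff]
    intro x hx
    induction x using Submodule.Quotient.induction_on with
    | H x =>
    have hx' : x.1 ∈ F.coboundaries n :=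
      (Submodule.Quotient.mk_eq_zero ((F.coboundaries n).submoduleOf (F.cocycles n))).1 hx
    refine (Submodule.Quotient.mk_eq_zero _).2 ?_
    have := h.avg_mem_coboundariesOne hx'
    rwa [h.avg_of_fixed (h.mem_weightOne.1 x.2.2)] at this
  · intro y
    induction y using Submodule.Quotient.induction_on with
    | H y =>
    refine ⟨Submodule.Quotient.mk ⟨F.avg n y.1, avg_mem_cocycles y.2, h.avg_mem_weightOne n _⟩, ?_⟩
    exact (F.cls_eq_iff (avg_mem_cocycles y.2) y.2).2 (h.avg_sub_mem y.2)

theorem bv_mem_cocyclesOne (h : F.OrderThree ζ) (s : ℤ) {z : CplxType k A (s + 1)}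
    (hz : z ∈ F.cocyclesOne (s + 1)) : F.bv s z ∈ F.cocyclesOne s := by
  have hT := h.mem_weightOne.1 hz.2
  refine ⟨F.bv_mem_cocycles hz.1 hT, h.mem_weightOne.2 ?_⟩
  rw [F.act_bv, hT]

/-- The map induced by `Δ̂` on the cohomology of the weight one subcomplex. -/
noncomputable def bvOne (h : F.OrderThree ζ) (s : ℤ) : F.HHOne (s + 1) →ₗ[k] F.HH s :=
  Submodule.mapQ _ _ (LinearMap.codRestrict (F.cocycles s)
      ((F.bv s).comp (F.cocyclesOne (s + 1)).subtype) fun z => (h.bv_mem_cocyclesOne s z.2).1)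
    (by
      rintro ⟨x, hx⟩ hx'
      obtain ⟨w, hw, rfl⟩ := exists_of_mem_coboundariesOne s (x := x) hx'
      exact F.bv_d_mem_coboundaries (h.mem_weightOne.1 hw))

/-- The BV differential in one degree. -/
noncomputable def bvHH (h : F.OrderThree ζ) (s : ℤ) : F.HH (s + 1) →ₗ[k] F.HH s :=
  (h.bvOne s).comp (LinearEquiv.ofBijective _ (h.oneToHH_bijective (s + 1))).symm.toLinearMap

theorem bvHH_cls (h : F.OrderThree ζ) {s : ℤ} {z : CplxType k A (s + 1)}
    (hz : z ∈ F.cocycles (s + 1)) (hz' : z ∈ F.weightOne (s + 1)) :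
    h.bvHH s (F.cls z hz) = F.cls (F.bv s z) (h.bv_mem_cocyclesOne s ⟨hz, hz'⟩).1 := by
  have e : F.cls z hz = LinearEquiv.ofBijective _ (h.oneToHH_bijective (s + 1))
    (Submodule.Quotient.mk ⟨z, hz, hz'⟩) := rfl
  rw [bvHH, LinearMap.comp_apply, LinearEquiv.coe_coe, e, LinearEquiv.symm_apply_apply]
  rfl

/-- The BV differential, with a free index for the degree. -/
noncomputable def bvHH' (h : F.OrderThree ζ) (s n : ℤ) (e : s + 1 = n) : F.HH n →ₗ[k] F.HH s :=
  e ▸ h.bvHH s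

/-- The BV differential on the complete cohomology. -/
noncomputable def bvTot (h : F.OrderThree ζ) : F.Cohomology →ₗ[k] F.Cohomology :=
  DirectSum.toModule k ℤ _ fun n =>
    (DirectSum.lof k ℤ F.HH (n - 1)).comp (h.bvHH' (n - 1) n (sub_add_cancel n 1))

theorem bvTot_lof (h : F.OrderThree ζ) (s : ℤ) (x : F.HH (s + 1)) :
    h.bvTot (DirectSum.lof k ℤ F.HH (s + 1) x) = DirectSum.lof k ℤ F.HH s (h.bvHH s x) := by
  rw [bvTot, DirectSum.toModule_lof, LinearMap.comp_apply]
  -- The degree s + 1 - 1 in the definition is not s by computation; generalising it allows the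
  -- transport to be removed by substitution.
  have key : ∀ (s' : ℤ) (e : s' + 1 = s + 1),
      DirectSum.lof k ℤ F.HH s' (h.bvHH' s' (s + 1) e x) =
        DirectSum.lof k ℤ F.HH s (h.bvHH s x) := fun s' e => by
    obtain rfl : s' = s := add_right_cancel e
    rfl
  exact key _ _

theorem isBVOperator_bvTot (h : F.OrderThree ζ) : F.IsBVOperator h.bvTot :=
  ⟨h.oneToHH_bijective, fun s _ hz => h.bv_mem_cocyclesOne s hz, fun s z hz hz' =>
    ⟨(h.bv_mem_cocyclesOne s ⟨hz, hz'⟩).1, by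
      rw [tot, bvTot_lof, h.bvHH_cls hz hz']; rfl⟩⟩

end OrderThree

end FrobeniusData

end BVOperator
end CompleteHochschild

namespace CompleteHochschild
universe u

namespace ThreeCycle
-- Path coefficients of tensors, and faces of words that contain a path
section PathCoefficients
open scoped Fin.CommRing Fin.NatCast
variable {k : Type u} [Field k]

/-- The coefficient of the path `α_i ⊗ α_{i+1} ⊗ ⋯ ⊗ α_{i+m-1}` in `u_0 ⊗ ⋯ ⊗ u_{m-1}`. -/
def coeff (m : ℕ) (i : Fin 3) (u : ℕ → ThreeCycle k) : k :=
  ∏ t ∈ Finset.range m, (u t).2 (i + (t : Fin 3))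

theorem coeff_zero (i : Fin 3) (u : ℕ → ThreeCycle k) : coeff 0 i u = 1 := rfl

theorem coeff_congr {m : ℕ} {i : Fin 3} {u v : ℕ → ThreeCycle k} (h : ∀ t < m, u t = v t) :
    coeff m i u = coeff m i v :=
  Finset.prod_congr rfl fun t ht => by rw [h t (Finset.mem_range.1 ht)]

theorem coeff_succ (m : ℕ) (i : Fin 3) (u : ℕ → ThreeCycle k) :
    coeff (m + 1) i u = coeff m i u * (u m).2 (i + (m : Fin 3)) :=
  Finset.prod_range_succ _ _

theorem coeff_succ' (m : ℕ) (i : Fin 3) (u : ℕ → ThreeCycle k) :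
    coeff (m + 1) i u = (u 0).2 i * coeff m (i + 1) fun t => u (t + 1) := by
  rw [coeff, Finset.prod_range_succ', mul_comm, coeff]
  simp only [Nat.cast_zero, add_zero, Nat.cast_add, Nat.cast_one, add_assoc, add_comm (1 : Fin 3)]

theorem coeff_add (m n : ℕ) (i : Fin 3) (u : ℕ → ThreeCycle k) :
    coeff (m + n) i u = coeff m i u * coeff n (i + (m : Fin 3)) fun t => u (m + t) := by
  rw [coeff, Finset.prod_range_add]
  simp only [coeff, Nat.cast_add, add_assoc]

theorem coeff_eq_zero {m t : ℕ} (ht : t < m) {i : Fin 3} {u : ℕ → ThreeCycle k}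
    (h : (u t).2 (i + (t : Fin 3)) = 0) : coeff m i u = 0 :=
  Finset.prod_eq_zero (Finset.mem_range.2 ht) h

theorem coeff_lin (m a : ℕ) (i : Fin 3) (w : ℕ → ThreeCycle k) (j : ℕ) :
    ∃ L : ThreeCycle k →ₗ[k] k, a ≤ j → j < a + m →
      ∀ x, coeff m i (fun t => Function.update w j x (a + t)) = L x := by
  refine ⟨(∏ t ∈ (Finset.range m).erase (j - a), (w (a + t)).2 (i + (t : Fin 3))) •
    { toFun := fun x => x.2 (i + ((j - a : ℕ) : Fin 3))
      map_add' := fun x y => rfl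
      map_smul' := fun c x => rfl }, fun h1 h2 x => ?_⟩
  rw [coeff, ← Finset.prod_erase_mul _ _ (Finset.mem_range.2 (show j - a < m by omega))]
  simp only [LinearMap.smul_apply, LinearMap.coe_mk, AddHom.coe_mk, smul_eq_mul]
  congr 1
  · refine Finset.prod_congr rfl fun t ht => ?_
    rw [Function.update_of_ne]
    have := Finset.ne_of_mem_erase ht
    omega
  · rw [show a + (j - a) = j by omega, Function.update_self]
    rfl

/-- The arrow coordinate of a product u_l u_{l+1} is a sum of two terms, with the idempotent part
taken from the left or from the right factor. Consecutive merges share one of these terms, so the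
alternating sum telescopes and only the idempotent parts of the first and of the last entry remain.
-/
theorem altSum_coeff_merge (m : ℕ) (i : Fin 3) (u : ℕ → ThreeCycle k) :
    altSum k m (fun l => coeff m i (merge l u)) =
      (u 0).1 i * coeff m i (fun t => u (t + 1)) -
        (-1) ^ m * (coeff m i u * (u m).1 (i + (m : Fin 3))) := by
  induction m generalizing i u with
  | zero => simp [altSum, coeff]
  | succ m ih =>
    have e : ∀ l, coeff (m + 1) i (merge (l + 1) u) =
        (u 0).2 i * coeff m (i + 1) (merge l fun t => u (t + 1)) := fun l => by
      rw [coeff_succ']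
      congr 1
      · refine congrArg (coeff m (i + 1)) (funext fun t => ?_)
        simp only [merge]
        grind
    have e0 : coeff (m + 1) i (merge 0 u) = ((u 0).1 i * (u 1).2 i + (u 0).2 i * (u 1).1 (i + 1)) *
        coeff m (i + 1) fun t => u (t + 2) := by
      rw [coeff_succ']
      rfl
    rw [altSum_succ', e0]
    simp only [e]
    have := ih (i + 1) fun t => u (t + 1)
    rw [show altSum k m (fun l => (u 0).2 i * coeff m (i + 1) (merge l fun t => u (t + 1))) =
      (u 0).2 i * altSum k m (fun l => coeff m (i + 1) (merge l fun t => u (t + 1))) from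
      (map_altSum (LinearMap.mulLeft k ((u 0).2 i)) m _).symm, this, coeff_succ' m i fun t => u (t + 1),
      coeff_succ' m i u, pow_succ]
    push_cast
    rw [show i + ((m : Fin 3) + 1) = i + 1 + m by ring]
    ring

theorem e_mul_e_self (i : Fin 3) : e k i * e k i = e k i := by rw [e_mul_e, if_pos rfl]

theorem mul_e (x : ThreeCycle k) (i : Fin 3) :
    x * e k i = x.1 i • e k i + x.2 (i - 1) • arr k (i - 1) := by
  ext j
  · by_cases h : j = i <;> simp [h]
  · by_cases h : j = i - 1
    · simp [h]
    · simp [h, show j + 1 ≠ i from fun h' => h (eq_sub_of_add_eq h')]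

theorem e_mul (x : ThreeCycle k) (i : Fin 3) :
    e k i * x = x.1 i • e k i + x.2 i • arr k i := by
  ext j <;> by_cases h : j = i <;> simp [h]

variable (k) in
/-- The arrow at position `n` of the path starting at `i`. -/
def path (i : Fin 3) (n : ℕ) : ThreeCycle k := arr k (i + (n : Fin 3))

theorem path_zero (i : Fin 3) : path k i 0 = arr k i := by
  rw [path, Nat.cast_zero, add_zero]

theorem path_succ (i : Fin 3) (n : ℕ) : path k i (n + 1) = path k (i + 1) n := by
  rw [path, path, Nat.cast_add, Nat.cast_one, add_assoc, add_comm 1]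

theorem path_mul_path (i j : Fin 3) (m n : ℕ) : path k i m * path k j n = 0 := arr_mul_arr _ _

theorem path_mul_e (i : Fin 3) (m : ℕ) :
    path k i m * e k (i + ((m + 1 : ℕ) : Fin 3)) = path k i m := by
  rw [path, Nat.cast_add, ← add_assoc, Nat.cast_one, arr_mul_e]

theorem e_mul_path_zero (i : Fin 3) : e k i * path k i 0 = path k i 0 := by
  rw [path_zero, e_mul_arr]

variable (k) in
/-- The word `(x, w_1, …, w_j, e_i, α_i, α_{i+1}, …)`. -/
def insertWord (j : ℕ) (i : Fin 3) (x : ThreeCycle k) (w : ℕ → ThreeCycle k) : ℕ → ThreeCycle k :=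
  fun t => if t = 0 then x else if t ≤ j then w t else if t = j + 1 then e k i
    else path k i (t - j - 2)

variable (k) in
/-- The word `(x, w_1, …, w_j, α_i, α_{i+1}, …)`. -/
def tailWord (j : ℕ) (i : Fin 3) (x : ThreeCycle k) (w : ℕ → ThreeCycle k) : ℕ → ThreeCycle k :=
  fun t => if t = 0 then x else if t ≤ j then w t else path k i (t - j - 1)

/-- Shape of a boundary in which only the faces up to j + 1 and the very last one survive. The sign
of the last one is (-1)^(j+m+2), shortened to (-1)^(j+m). -/
theorem altSum_split {N : Type*} [AddCommGroup N] [Module k N] (j m : ℕ) (c : ℕ → N)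
    (h : ∀ l < m, c (j + 2 + l) = 0) : altSum k (j + m + 3) c = altSum k j c +
      (-1 : k) ^ j • c j + (-1 : k) ^ (j + 1) • c (j + 1) + (-1 : k) ^ (j + m) • c (j + m + 2) := by
  rw [altSum_succ, show j + m + 2 = j + 2 + m by omega, altSum_add, altSum_succ, altSum_succ,
    altSum_congr (k := k) (N := N) (c := fun l => c (j + 2 + l)) (c' := fun _ => 0) h]
  have e : altSum k m (fun _ => (0 : N)) = 0 := by simp [altSum]
  rw [e, smul_zero, add_zero, show j + 2 + m = j + m + 2 by omega, pow_succ _ (j + m + 1),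
    pow_succ _ (j + m)]
  simp

/-- Faces that multiply two consecutive arrows of the path vanish. Face j + 1 absorbs the inserted
e_i into α_i, and the last face multiplies the final arrow onto the zeroth entry, where the
idempotent at the end of the path is absorbed. With an empty path the last two coincide, which is
treated in `bdry_insertWord_last`. -/
theorem bdry_insertWord (σ : ThreeCycle k ≃ₐ[k] ThreeCycle k) {p j m : ℕ} (h : p = j + (m + 1))
    (i : Fin 3) (w : ℕ → ThreeCycle k) :
    bdry σ p (ev (gen k _ (p + 1)) (insertWord k j i (e k (i + ((m + 1 : ℕ) : Fin 3)) * w 0) w)) =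
      altSum k j (fun l => ev (gen k _ p)
        (face σ p l (insertWord k j i (e k (i + ((m + 1 : ℕ) : Fin 3)) * w 0) w))) +
      (-1 : k) ^ j • ev (gen k _ p)
        (face σ p j (insertWord k j i (e k (i + ((m + 1 : ℕ) : Fin 3)) * w 0) w)) -
      (-1 : k) ^ j • ev (gen k _ p)
        (tailWord k j i (e k (i + ((m + 1 : ℕ) : Fin 3)) * w 0) w) +
      (-1 : k) ^ (j + m) • ev (gen k _ p)
        (insertWord k j i (path k i m * w 0) w) := by
  subst h
  rw [bdry_ev, show j + (m + 1) + 2 = j + m + 3 by omega, altSum_split]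
  · have h1 : ev (gen k _ (j + (m + 1))) (face σ (j + (m + 1)) (j + 1)
        (insertWord k j i (e k (i + ((m + 1 : ℕ) : Fin 3)) * w 0) w)) = ev (gen k _ (j + (m + 1)))
        (tailWord k j i (e k (i + ((m + 1 : ℕ) : Fin 3)) * w 0) w) := by
      refine ev_congr _ fun t ht => ?_
      rw [face_mid _ _ (by omega) (by omega)]
      simp only [merge, insertWord, tailWord]
      have e1 := e_mul_path_zero (k := k) i
      have e4 : t - j - 1 = t + 1 - j - 2 := by omega
      grind
    have h2 : ev (gen k _ (j + (m + 1))) (face σ (j + (m + 1)) (j + m + 2)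
        (insertWord k j i (e k (i + ((m + 1 : ℕ) : Fin 3)) * w 0) w)) = ev (gen k _ (j + (m + 1)))
        (insertWord k j i (path k i m * w 0) w) := by
      refine ev_congr _ fun t ht => ?_
      rw [show j + m + 2 = j + (m + 1) + 1 by omega, face_last]
      simp only [insertWord]
      have e2 : path k i m * (e k (i + ((m + 1 : ℕ) : Fin 3)) * w 0) = path k i m * w 0 := by
        rw [← mul_assoc, path_mul_e]
      have e3 : j + (m + 1) + 1 - j - 2 = m := by omega
      grind
    rw [h1, h2, pow_succ, mul_neg_one, neg_smul, ← sub_eq_add_neg]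
  · intro l hl
    rw [face_mid _ _ (by omega) (by omega)]
    refine ev_eq_zero_of_entry _ (j + 2 + l) (by omega) ?_
    simp only [merge, insertWord]
    rw [if_neg (by omega), if_pos trivial, if_neg (by omega), if_neg (by omega), if_neg (by omega),
      if_neg (by omega), if_neg (by omega), if_neg (by omega), path_mul_path]

theorem bdry_insertWord_last (σ : ThreeCycle k ≃ₐ[k] ThreeCycle k) (p : ℕ)
    (i : Fin 3) (w : ℕ → ThreeCycle k) :
    bdry σ p (ev (gen k _ (p + 1)) (insertWord k p i (e k i * w 0) w)) =
      altSum k p (fun l => ev (gen k _ p) (face σ p l (insertWord k p i (e k i * w 0) w))) +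
      (-1 : k) ^ p • ev (gen k _ p) (face σ p p (insertWord k p i (e k i * w 0) w)) -
      (-1 : k) ^ p • ev (gen k _ p) (tailWord k p i (e k i * w 0) w) := by
  have h : ev (gen k _ p) (face σ p (p + 1) (insertWord k p i (e k i * w 0) w)) =
      ev (gen k _ p) (tailWord k p i (e k i * w 0) w) := by
    refine ev_congr _ fun t ht => ?_
    rw [face_last]
    simp only [insertWord, tailWord]
    have e2 : e k i * (e k i * w 0) = e k i * w 0 := by rw [← mul_assoc, e_mul_e_self]
    grind
  rw [bdry_ev, altSum_succ, altSum_succ, h, pow_succ, mul_neg_one, neg_smul, ← sub_eq_add_neg]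

end PathCoefficients
end ThreeCycle

end CompleteHochschild

namespace CompleteHochschild
universe u

namespace ThreeCycle
-- The homotopy that contracts chains to closed paths
section Homotopy
open scoped Fin.CommRing Fin.NatCast
variable {k : Type u} [Field k]

theorem insertWord_linear {p : ℕ} (j : ℕ) (i : Fin 3) (w : ℕ → ThreeCycle k) :
    ∃ L : ThreeCycle k →ₗ[k] Chain k (ThreeCycle k) p,
      ∀ x, ev (gen k _ p) (insertWord k j i x w) = L x :=
  ev_lin _ (insertWord k j i 0 w) (s := 0) (by omega) _ LinearMap.id fun x t _ => by
    simp only [insertWord, LinearMap.id_apply]; grind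

theorem altSum_smul_const {N : Type*} [AddCommGroup N] [Module k N] (n : ℕ) (c : ℕ → k) (x : N) :
    altSum k n (fun l => c l • x) = altSum k n c • x := by
  simp only [altSum, Finset.sum_smul, smul_eq_mul, mul_smul]

theorem altSum_comm {N : Type*} [AddCommGroup N] [Module k N] (m n : ℕ) (c : ℕ → ℕ → N) :
    altSum k m (fun i => altSum k n fun j => c i j) =
      altSum k n fun j => altSum k m fun i => c i j := by
  simp only [altSum, Finset.smul_sum]
  rw [Finset.sum_comm]
  exact Finset.sum_congr rfl fun _ _ => Finset.sum_congr rfl fun _ _ => smul_comm _ _ _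

theorem altSum_add_succ {N : Type*} [AddCommGroup N] [Module k N] {n a b : ℕ} (h : n = a + (b + 1))
    (c : ℕ → N) : altSum k n c = altSum k a c + (-1 : k) ^ a •
      (altSum k b (fun l => c (a + l)) + (-1 : k) ^ b • c (a + b)) := by
  rw [h, altSum_add, altSum_succ]

/-- This is the part of h∂ with insertion after position j. The boundary of w falls into three
groups of faces, according to whether they act before the insertion, on the tail, or cyclically. -/
theorem altSum_face_insertWord (σ : ThreeCycle k ≃ₐ[k] ThreeCycle k) {q j m : ℕ} (h : q = j + m)
    (i : Fin 3) (w : ℕ → ThreeCycle k) :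
    altSum k (q + 2) (fun l => coeff m i (fun t => face σ q l w (j + 1 + t)) •
      ev (gen k _ (q + 1)) (insertWord k j i (e k (i + (m : Fin 3)) * face σ q l w 0)
        (face σ q l w))) =
      altSum k (j + 1) (fun l => coeff m i (fun t => w (j + 2 + t)) • ev (gen k _ (q + 1))
        (face σ (q + 1) l (insertWord k (j + 1) i (e k (i + (m : Fin 3)) * w 0) w))) -
      (-1 : k) ^ j • ((w (j + 1)).1 i * coeff m i (fun t => w (j + 2 + t))) •
        ev (gen k _ (q + 1)) (insertWord k j i (e k (i + (m : Fin 3)) * w 0) w) +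
      (-1 : k) ^ (q + 1) • coeff (m + 1) i (fun t => w (j + 1 + t)) •
        ev (gen k _ (q + 1)) (insertWord k j i (path k i m * w 0) w) := by
  subst h
  -- Faces in front of the insertion commute with it, but shift the place of insertion from j + 1 to
  -- j.
  have h1 : ∀ l < j + 1, (coeff m i (fun t => face σ (j + m) l w (j + 1 + t)) •
      ev (gen k _ (j + m + 1)) (insertWord k j i (e k (i + (m : Fin 3)) * face σ (j + m) l w 0)
        (face σ (j + m) l w))) = coeff m i (fun t => w (j + 2 + t)) • ev (gen k _ (j + m + 1))
        (face σ (j + m + 1) l (insertWord k (j + 1) i (e k (i + (m : Fin 3)) * w 0) w)) :=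
    fun l hl => by
    rcases Nat.eq_zero_or_pos l with rfl | h0
    · rw [face_zero, face_zero]
      congr 1
      · refine coeff_congr fun t ht => ?_
        grind
      · refine ev_congr _ fun t ht => ?_
        simp only [insertWord]
        have e1 : t - j - 2 = t + 1 - (j + 1) - 2 := by omega
        have e2 := mul_assoc (e k (i + (m : Fin 3))) (w 0) (σ (w 1))
        grind
    · rw [face_mid _ _ (by omega) (by omega), face_mid _ _ (by omega) (by omega)]
      congr 1
      · refine coeff_congr fun t ht => ?_
        simp only [merge]
        grind
      · refine ev_congr _ fun t ht => ?_
        simp only [insertWord, merge]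
        have e1 : t - j - 2 = t + 1 - (j + 1) - 2 := by omega
        grind
  -- Faces in the tail change only the coefficient, not the word; their sum is computed by
  -- `altSum_coeff_merge`.
  have h2 : ∀ l < m, (coeff m i (fun t => face σ (j + m) (j + 1 + l) w (j + 1 + t)) •
      ev (gen k _ (j + m + 1)) (insertWord k j i
        (e k (i + (m : Fin 3)) * face σ (j + m) (j + 1 + l) w 0)
        (face σ (j + m) (j + 1 + l) w))) = coeff m i (merge l fun t => w (j + 1 + t)) •
      ev (gen k _ (j + m + 1)) (insertWord k j i (e k (i + (m : Fin 3)) * w 0) w) := fun l hl => by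
    rw [face_mid _ _ (by omega) (by omega)]
    congr 1
    · refine coeff_congr fun t ht => ?_
      simp only [merge]
      grind
    · refine ev_congr _ fun t ht => ?_
      simp only [insertWord, merge]
      grind
  -- In the cyclic face the last entry is decomposed into its idempotent and its arrow part. The
  -- idempotent part cancels the end term of the telescoping sum, the arrow part lengthens the path.
  have h3 : (coeff m i (fun t => face σ (j + m) (j + 1 + m) w (j + 1 + t)) •
      ev (gen k _ (j + m + 1)) (insertWord k j i
        (e k (i + (m : Fin 3)) * face σ (j + m) (j + 1 + m) w 0)
        (face σ (j + m) (j + 1 + m) w))) = coeff m i (fun t => w (j + 1 + t)) •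
      ((w (j + 1 + m)).1 (i + (m : Fin 3)) •
        ev (gen k _ (j + m + 1)) (insertWord k j i (e k (i + (m : Fin 3)) * w 0) w) +
      (w (j + 1 + m)).2 (i + (m : Fin 3)) •
        ev (gen k _ (j + m + 1)) (insertWord k j i (path k i m * w 0) w)) := by
    obtain ⟨L, hL⟩ := insertWord_linear (p := j + m + 1) j i w
    have e1 : e k (i + (m : Fin 3)) * (w (j + 1 + m) * w 0) =
        (w (j + 1 + m)).1 (i + (m : Fin 3)) • (e k (i + (m : Fin 3)) * w 0) +
        (w (j + 1 + m)).2 (i + (m : Fin 3)) • (path k i m * w 0) := by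
      rw [← mul_assoc, e_mul, add_mul, smul_mul_assoc, smul_mul_assoc, path]
    rw [hL, hL, ← map_smul, ← map_smul, ← map_add, ← e1, ← hL, show j + 1 + m = j + m + 1 by omega,
      face_last]
    congr 1
    · refine coeff_congr fun t ht => ?_
      grind
    · refine ev_congr _ fun t ht => ?_
      simp only [insertWord]
      grind
  rw [altSum_add_succ (show j + m + 2 = j + 1 + (m + 1) by omega), altSum_congr h1,
    altSum_congr h2, h3, altSum_smul_const, altSum_coeff_merge, coeff_succ, pow_succ, pow_add,
    pow_succ]
  simp only [show ∀ t, j + 1 + (t + 1) = j + 2 + t from fun t => by omega, add_zero]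
  module

/-- The face multiplies w_{j+1} by the inserted e_i, leaving a multiple of e_i and a multiple of
α_{i-1}. The second lengthens the path to one starting at i - 1, so the sum over vertices is
reindexed. -/
theorem sum_face_insertWord (σ : ThreeCycle k ≃ₐ[k] ThreeCycle k) {q j m : ℕ} (h : q = j + m)
    (w : ℕ → ThreeCycle k) :
    ∑ i, coeff m i (fun t => w (j + 2 + t)) • ev (gen k _ (q + 1))
        (face σ (q + 1) (j + 1) (insertWord k (j + 1) i (e k (i + (m : Fin 3)) * w 0) w)) =
      ∑ i, ((w (j + 1)).1 i * coeff m i (fun t => w (j + 2 + t))) •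
        ev (gen k _ (q + 1)) (insertWord k j i (e k (i + (m : Fin 3)) * w 0) w) +
      ∑ i, coeff (m + 1) i (fun t => w (j + 1 + t)) •
        ev (gen k _ (q + 1)) (tailWord k j i (e k (i + ((m + 1 : ℕ) : Fin 3)) * w 0) w) := by
  subst h
  rw [← (Equiv.subRight (1 : Fin 3)).sum_comp fun i => coeff (m + 1) i (fun t => w (j + 1 + t)) •
        ev (gen k _ (j + m + 1)) (tailWord k j i (e k (i + ((m + 1 : ℕ) : Fin 3)) * w 0) w),
    ← Finset.sum_add_distrib]
  refine Finset.sum_congr rfl fun i _ => ?_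
  obtain ⟨L, hL⟩ := ev_lin (gen k _ (j + m + 1))
    (insertWord k j i (e k (i + (m : Fin 3)) * w 0) w) (s := j + 1) (by omega)
    (fun x t => if t = j + 1 then x else insertWord k j i (e k (i + (m : Fin 3)) * w 0) w t)
    LinearMap.id (fun x t _ => rfl)
  have e1 : ev (gen k _ (j + m + 1)) (face σ (j + m + 1) (j + 1)
      (insertWord k (j + 1) i (e k (i + (m : Fin 3)) * w 0) w)) = L (w (j + 1) * e k i) := by
    rw [← hL, face_mid _ _ (by omega) (by omega)]
    refine ev_congr _ fun t ht => ?_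
    simp only [insertWord, merge]
    have e1 : t - j - 2 = t + 1 - (j + 1) - 2 := by omega
    grind
  have e2 : ev (gen k _ (j + m + 1)) (insertWord k j i (e k (i + (m : Fin 3)) * w 0) w) =
      L (e k i) := by
    rw [← hL]
    refine ev_congr _ fun t ht => ?_
    simp only [insertWord]
    grind
  have e3 : ev (gen k _ (j + m + 1))
      (tailWord k j (i - 1) (e k (i - 1 + ((m + 1 : ℕ) : Fin 3)) * w 0) w) =
      L (arr k (i - 1)) := by
    rw [← hL]
    refine ev_congr _ fun t ht => ?_
    simp only [insertWord, tailWord]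
    have e1 : i - 1 + ((m + 1 : ℕ) : Fin 3) = i + (m : Fin 3) := by push_cast; ring
    have e2 : path k (i - 1) (j + 1 - j - 1) = arr k (i - 1) := by
      rw [show j + 1 - j - 1 = 0 by omega, path_zero]
    have e3 : j + 1 < t → path k (i - 1) (t - j - 1) = path k i (t - j - 2) := fun h => by
      rw [show t - j - 1 = t - j - 2 + 1 by omega, path_succ, sub_add_cancel]
    grind
  rw [Equiv.subRight_apply, e1, e2, e3, mul_e, map_add, map_smul, map_smul, coeff_succ',
    sub_add_cancel]
  simp only [show ∀ t, j + 1 + (t + 1) = j + 2 + t from fun t => by omega, add_zero]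
  module

/-- The value of the contracting homotopy on `w_0 ⊗ ⋯ ⊗ w_p`. -/
noncomputable def homotopyFun (p : ℕ) (w : ℕ → ThreeCycle k) : Chain k (ThreeCycle k) (p + 1) :=
  altSum k (p + 1) fun j => ∑ i : Fin 3, coeff (p - j) i (fun t => w (j + 1 + t)) •
    ev (gen k (ThreeCycle k) (p + 1)) (insertWord k j i (e k (i + ((p - j : ℕ) : Fin 3)) * w 0) w)

/-- In the j-th summand an entry beyond j occurs only in the path coefficient, and an entry up to j
only in the word. The same dichotomy makes it vanish on units: a unit has no arrow part, and in the
word it is degenerate. -/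
theorem homotopyFun_lin (p : ℕ) : LinearInEach (p + 1) (homotopyFun (k := k) p) k := by
  unfold homotopyFun altSum
  exact LinearInEach.sum _ fun j hj => LinearInEach.smul _ <| LinearInEach.sum _ fun i _ w s hs => by
    rw [Finset.mem_range] at hj
    rcases lt_or_ge j s with h | h
    · obtain ⟨L, hL⟩ := coeff_lin (p - j) (j + 1) i w s
      refine ⟨L.smulRight (ev (gen k _ (p + 1))
        (insertWord k j i (e k (i + ((p - j : ℕ) : Fin 3)) * w 0) w)), fun x => ?_⟩
      rw [LinearMap.smulRight_apply, hL (by omega) (by omega), Function.update_of_ne (by omega)]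
      congr 1
      refine ev_congr _ fun t ht => ?_
      simp only [insertWord, Function.update_apply]
      grind
    · have hc : ∀ x, coeff (p - j) i (fun t => Function.update w s x (j + 1 + t)) =
          coeff (p - j) i (fun t => w (j + 1 + t)) := fun x => coeff_congr fun t ht =>
        Function.update_of_ne (by omega) _ _
      simp only [hc]
      obtain ⟨L, hL⟩ : ∃ L : ThreeCycle k →ₗ[k] Chain k (ThreeCycle k) (p + 1), ∀ x,
          ev (gen k _ (p + 1)) (insertWord k j i (e k (i + ((p - j : ℕ) : Fin 3)) *
            Function.update w s x 0) (Function.update w s x)) = L x := by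
        rcases Nat.eq_zero_or_pos s with rfl | h0
        · refine ev_lin _ (insertWord k j i 0 w) (s := 0) (by omega) _
            (LinearMap.mulLeft k (e k (i + ((p - j : ℕ) : Fin 3)))) fun x t _ => ?_
          simp only [insertWord, Function.update_apply, LinearMap.mulLeft_apply]
          grind
        · refine ev_lin _ (insertWord k j i (e k (i + ((p - j : ℕ) : Fin 3)) * w 0) w) (s := s)
            (by omega) _ LinearMap.id fun x t _ => ?_
          simp only [insertWord, Function.update_apply, LinearMap.id_apply]
          grind
      exact ⟨coeff (p - j) i (fun t => w (j + 1 + t)) • L, fun x => by rw [hL, LinearMap.smul_apply]⟩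

theorem homotopyFun_vanish (p : ℕ) (w : ℕ → ThreeCycle k) (l : ℕ) (h0 : 0 < l) (hl : l ≤ p)
    (hw : w l = 1) : homotopyFun p w = 0 := by
  unfold homotopyFun altSum
  refine Finset.sum_eq_zero fun j hj => ?_
  dsimp only
  rw [Finset.sum_eq_zero, smul_zero]
  intro i _
  rcases lt_or_ge j l with h | h
  · rw [coeff_eq_zero (t := l - j - 1) (by omega), zero_smul]
    rw [show j + 1 + (l - j - 1) = l by omega, hw]
    rfl
  · rw [gen_eq_zero l h0 (by omega), smul_zero]
    simp only [insertWord]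
    grind

/-- A homotopy which contracts the Hochschild chain complexes of `A` to the cyclic paths. -/
noncomputable def homotopy (p : ℕ) :
    Chain k (ThreeCycle k) p →ₗ[k] Chain k (ThreeCycle k) (p + 1) :=
  Chain.map (homotopyFun p) (homotopyFun_lin p) (homotopyFun_vanish p)

theorem homotopy_ev (p : ℕ) (w : ℕ → ThreeCycle k) :
    homotopy p (ev (gen k _ p) w) = altSum k (p + 1) fun j =>
      ∑ i, coeff (p - j) i (fun t => w (j + 1 + t)) •
        ev (gen k _ (p + 1)) (insertWord k j i (e k (i + ((p - j : ℕ) : Fin 3)) * w 0) w) := by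
  refine Chain.map_ev _ _ (homotopyFun_vanish p) (fun w w' h => ?_) w
  unfold homotopyFun altSum
  refine Finset.sum_congr rfl fun j hj => ?_
  rw [Finset.mem_range] at hj
  congr 1
  refine Finset.sum_congr rfl fun i _ => ?_
  congr 1
  · exact coeff_congr fun t ht => h _ (by omega)
  · refine ev_congr _ fun t ht => ?_
    simp only [insertWord]
    grind

theorem tailWord_linear (p : ℕ) (i : Fin 3) : ∃ L : ThreeCycle k →ₗ[k] Chain k (ThreeCycle k) p,
    ∀ x, ev (gen k _ p) (tailWord k 0 i x 0) = L x :=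
  ev_lin _ (tailWord k 0 i 0 0) (s := 0) (by omega) _ LinearMap.id fun x t _ => by
    simp only [tailWord, LinearMap.id_apply]; grind

/-- The cyclic path `x ⊗ α_i ⊗ ⋯ ⊗ α_{i+p-1}`. -/
noncomputable def cyc (p : ℕ) (i : Fin 3) : ThreeCycle k →ₗ[k] Chain k (ThreeCycle k) p where
  toFun x := ev (gen k _ p) (tailWord k 0 i x 0)
  map_add' x y := by
    obtain ⟨L, hL⟩ := tailWord_linear (k := k) p i
    rw [hL, hL, hL, map_add]
  map_smul' c x := by
    obtain ⟨L, hL⟩ := tailWord_linear (k := k) p i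
    rw [hL, hL, map_smul, RingHom.id_apply]

theorem cyc_apply (p : ℕ) (i : Fin 3) (x : ThreeCycle k) :
    cyc p i x = ev (gen k _ p) (tailWord k 0 i x 0) := rfl

theorem face_zero_insertWord (σ : ThreeCycle k ≃ₐ[k] ThreeCycle k) (p : ℕ) (i : Fin 3)
    (x : ThreeCycle k) (w : ℕ → ThreeCycle k) :
    ev (gen k _ p) (face σ p 0 (insertWord k 0 i x w)) = cyc p i (x * σ (e k i)) := by
  rw [cyc_apply]
  refine ev_congr (k := k) _ fun t ht => ?_
  rw [face_zero]
  simp only [insertWord, tailWord]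
  have e1 : t + 1 - 0 - 2 = t - 0 - 1 := by omega
  grind

theorem sum_tailWord (p : ℕ) (w : ℕ → ThreeCycle k) :
    ∑ i, ev (gen k _ p) (tailWord k p i (e k i * w 0) w) = ev (gen k _ p) w := by
  obtain ⟨L, hL⟩ := ev_lin (gen k _ p) w (s := 0) (by omega)
    (fun x t => if t = 0 then x else w t) LinearMap.id (fun x t _ => rfl)
  have e1 : ∀ i, ev (gen k _ p) (tailWord k p i (e k i * w 0) w) = L (e k i * w 0) := fun i => by
    rw [← hL]
    refine ev_congr _ fun t ht => ?_
    simp only [tailWord]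
    grind
  simp only [e1]
  rw [← map_sum, ← Finset.sum_mul, sum_e, one_mul, ← hL]
  refine ev_congr _ fun t ht => ?_
  grind

theorem bdry_homotopy_zero (σ : ThreeCycle k ≃ₐ[k] ThreeCycle k) (w : ℕ → ThreeCycle k) :
    bdry σ 0 (homotopy 0 (ev (gen k _ 0) w)) =
      ∑ i, cyc 0 i (e k i * w 0 * σ (e k i)) - ev (gen k _ 0) w := by
  rw [homotopy_ev]
  simp only [altSum, zero_add, Finset.sum_range_one, pow_zero, one_smul, map_sum, map_smul]
  simp only [Nat.sub_self, coeff_zero, one_smul, Nat.cast_zero, add_zero, bdry_insertWord_last]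
  simp only [altSum, Finset.sum_range_zero, pow_zero, one_smul, zero_add, face_zero_insertWord,
    Finset.sum_sub_distrib, sum_tailWord]

/-- For each j the terms of ∂h and h∂ are collected by type: Q the faces before the insertion, M the
face multiplying the inserted idempotent from the left, T the face absorbing it into the path, Y the
cyclic face, X the idempotent part left over from h∂. The relation M_{j+1} = X_j + T_j makes the
total telescope in j. One end is M_0, the closed path part of w; the other is -w. -/
theorem bdry_homotopy_succ (σ : ThreeCycle k ≃ₐ[k] ThreeCycle k) (q : ℕ)
    (w : ℕ → ThreeCycle k) :
    bdry σ (q + 1) (homotopy (q + 1) (ev (gen k _ (q + 1)) w)) +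
      homotopy q (bdry σ q (ev (gen k _ (q + 1)) w)) =
      ∑ i, coeff (q + 1) i (fun t => w (t + 1)) •
        cyc (q + 1) i (e k (i + ((q + 1 : ℕ) : Fin 3)) * w 0 * σ (e k i)) -
      ev (gen k _ (q + 1)) w := by
  let C : ℕ → Fin 3 → k := fun j i => coeff (q + 1 - j) i fun t => w (j + 1 + t)
  let W : ℕ → Fin 3 → ℕ → ThreeCycle k := fun j i =>
    insertWord k j i (e k (i + ((q + 1 - j : ℕ) : Fin 3)) * w 0) w
  let Q : ℕ → Chain k (ThreeCycle k) (q + 1) := fun j => ∑ i, C j i •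
    altSum k j fun l => ev (gen k _ (q + 1)) (face σ (q + 1) l (W j i))
  let M : ℕ → Chain k (ThreeCycle k) (q + 1) := fun j => ∑ i, C j i •
    ev (gen k _ (q + 1)) (face σ (q + 1) j (W j i))
  let T : ℕ → Chain k (ThreeCycle k) (q + 1) := fun j => ∑ i, C j i • ev (gen k _ (q + 1))
    (tailWord k j i (e k (i + ((q + 1 - j : ℕ) : Fin 3)) * w 0) w)
  let Y : ℕ → Chain k (ThreeCycle k) (q + 1) := fun j => ∑ i, C j i • ev (gen k _ (q + 1))
    (insertWord k j i (path k i (q - j) * w 0) w)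
  let X : ℕ → Chain k (ThreeCycle k) (q + 1) := fun j => ∑ i,
    ((w (j + 1)).1 i * C (j + 1) i) • ev (gen k _ (q + 1))
      (insertWord k j i (e k (i + ((q - j : ℕ) : Fin 3)) * w 0) w)
  have b1 : ∀ j < q + 1, (∑ i, C j i • bdry σ (q + 1) (ev (gen k _ (q + 1 + 1)) (W j i))) =
      Q j + (-1 : k) ^ j • M j - (-1 : k) ^ j • T j + (-1 : k) ^ q • Y j := fun j hj => by
    simp only [Q, M, T, Y, Finset.smul_sum, ← Finset.sum_add_distrib, ← Finset.sum_sub_distrib]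
    refine Finset.sum_congr rfl fun i _ => ?_
    have := bdry_insertWord σ (p := q + 1) (j := j) (m := q - j) (by omega) i w
    rw [show q - j + 1 = q + 1 - j by omega, show j + (q - j) = q by omega] at this
    rw [this]
    module
  -- For j = q + 1 the path is empty, so there is no separate cyclic face, and the T-term is w
  -- itself because the idempotents e_i sum to 1.
  have b1' : (∑ i, C (q + 1) i • bdry σ (q + 1) (ev (gen k _ (q + 1 + 1)) (W (q + 1) i))) =
      Q (q + 1) + (-1 : k) ^ (q + 1) • M (q + 1) - (-1 : k) ^ (q + 1) • ev (gen k _ (q + 1)) w := by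
    rw [← sum_tailWord (q + 1) w]
    simp only [Q, M, Finset.smul_sum, ← Finset.sum_add_distrib, ← Finset.sum_sub_distrib]
    refine Finset.sum_congr rfl fun i _ => ?_
    have := bdry_insertWord_last σ (q + 1) i w
    have e0 : C (q + 1) i = 1 := by simp only [C, Nat.sub_self]; rfl
    have e1 : W (q + 1) i = insertWord k (q + 1) i (e k i * w 0) w := by
      simp only [W, Nat.sub_self, Nat.cast_zero, add_zero]
    rw [e1, this, e0]
    module
  have b2 : ∀ j < q + 1, altSum k (q + 2) (fun l => ∑ i,
      coeff (q - j) i (fun t => face σ q l w (j + 1 + t)) •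
      ev (gen k _ (q + 1)) (insertWord k j i (e k (i + ((q - j : ℕ) : Fin 3)) * face σ q l w 0)
        (face σ q l w))) = Q (j + 1) - (-1 : k) ^ j • X j - (-1 : k) ^ q • Y j := fun j hj => by
    simp only [← sum_altSum]
    simp only [Q, X, Y, Finset.smul_sum, ← Finset.sum_sub_distrib]
    refine Finset.sum_congr rfl fun i _ => ?_
    have e1 : q + 1 - (j + 1) = q - j := by omega
    have e2 : q + 1 - j = q - j + 1 := by omega
    rw [altSum_face_insertWord σ (by omega)]
    simp only [C, W, e1, e2]
    simp only [altSum, Finset.smul_sum]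
    simp only [smul_comm _ (coeff (q - j) i fun t => w (j + 1 + 1 + t))]
    rw [pow_succ]
    module
  have b3 : ∀ j < q + 1, M (j + 1) = X j + T j := fun j hj => by
    have := sum_face_insertWord σ (q := q) (j := j) (m := q - j) (by omega) w
    rw [show q - j + 1 = q + 1 - j by omega] at this
    simp only [M, X, T, C, W, show q + 1 - (j + 1) = q - j by omega]
    exact this
  have b0 : M 0 = ∑ i, coeff (q + 1) i (fun t => w (t + 1)) •
        cyc (q + 1) i (e k (i + ((q + 1 : ℕ) : Fin 3)) * w 0 * σ (e k i)) := by
    simp only [M, W, face_zero_insertWord, C, zero_add, Nat.sub_zero, add_comm 1]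
  have l1 : bdry σ (q + 1) (homotopy (q + 1) (ev (gen k _ (q + 1)) w)) =
      altSum k (q + 1 + 1) fun j =>
        ∑ i, C j i • bdry σ (q + 1) (ev (gen k _ (q + 1 + 1)) (W j i)) := by
    rw [homotopy_ev, map_altSum]
    simp only [map_sum, map_smul]
    rfl
  have l2 : homotopy q (bdry σ q (ev (gen k _ (q + 1)) w)) = altSum k (q + 1) fun j =>
      altSum k (q + 2) (fun l => ∑ i, coeff (q - j) i (fun t => face σ q l w (j + 1 + t)) •
      ev (gen k _ (q + 1)) (insertWord k j i (e k (i + ((q - j : ℕ) : Fin 3)) * face σ q l w 0)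
        (face σ q l w))) := by
    rw [bdry_ev, map_altSum]
    simp only [homotopy_ev]
    exact altSum_comm _ _ _
  rw [l1, l2, altSum_succ, b1', altSum_congr b1, altSum_congr b2, ← b0]
  -- The Y-terms of ∂h and h∂ cancel, and X and T combine to M with index j + 1, which leaves a
  -- difference of consecutive values of (-1)^j Q_j + M_j.
  have key : ∀ j ∈ Finset.range (q + 1), (-1 : k) ^ j • (Q j + (-1 : k) ^ j • M j -
      (-1 : k) ^ j • T j + (-1 : k) ^ q • Y j) + (-1 : k) ^ j • (Q (j + 1) - (-1 : k) ^ j • X j -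
      (-1 : k) ^ q • Y j) = ((-1 : k) ^ j • Q j + M j) -
      ((-1 : k) ^ (j + 1) • Q (j + 1) + M (j + 1)) := fun j hj => by
    have s : (-1 : k) ^ j * (-1) ^ j = 1 := by rw [← mul_pow]; simp
    rw [b3 j (Finset.mem_range.1 hj)]
    simp only [smul_add, smul_sub, smul_smul, s, one_smul, pow_succ]
    module
  have tel : altSum k (q + 1) (fun j => Q j + (-1 : k) ^ j • M j -
      (-1 : k) ^ j • T j + (-1 : k) ^ q • Y j) + altSum k (q + 1) (fun j => Q (j + 1) -
      (-1 : k) ^ j • X j - (-1 : k) ^ q • Y j) = M 0 - ((-1 : k) ^ (q + 1) • Q (q + 1) +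
      M (q + 1)) := by
    rw [altSum, altSum, ← Finset.sum_add_distrib, Finset.sum_congr rfl key,
      Finset.sum_range_sub' fun j => (-1 : k) ^ j • Q j + M j]
    have : Q 0 = 0 := Finset.sum_eq_zero fun i _ => by simp [altSum]
    rw [this, smul_zero, zero_add]
  have s : (-1 : k) ^ (q + 1) * (-1) ^ (q + 1) = 1 := by rw [← mul_pow]; simp
  rw [add_right_comm, tel]
  simp only [smul_add, smul_sub, smul_smul, s, one_smul]
  abel

end Homotopy
end ThreeCycle

end CompleteHochschild

namespace CompleteHochschild
universe u

namespace ThreeCycle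
-- Closed path coordinates and the differential on closed paths
section Homology
open scoped Fin.CommRing Fin.NatCast
variable {k : Type u} [Field k]

variable (k) in
/-- The coordinate of `e_i`. -/
def fstL (i : Fin 3) : ThreeCycle k →ₗ[k] k where
  toFun x := x.1 i
  map_add' _ _ := rfl
  map_smul' _ _ := rfl

variable (k) in
/-- The coordinate of `α_i`. -/
def sndL (i : Fin 3) : ThreeCycle k →ₗ[k] k where
  toFun x := x.2 i
  map_add' _ _ := rfl
  map_smul' _ _ := rfl

theorem fstL_apply (i : Fin 3) (x : ThreeCycle k) : fstL k i x = x.1 i := rfl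

theorem sndL_apply (i : Fin 3) (x : ThreeCycle k) : sndL k i x = x.2 i := rfl

theorem pathFun_lin (p : ℕ) (i : Fin 3) (ψ : ThreeCycle k →ₗ[k] k) : LinearInEach (p + 1)
    (fun w : ℕ → ThreeCycle k => coeff p i (fun t => w (1 + t)) * ψ (w 0)) k := fun w j hj => by
  rcases Nat.eq_zero_or_pos j with rfl | h0
  · refine ⟨coeff p i (fun t => w (1 + t)) • ψ, fun x => ?_⟩
    dsimp only
    rw [Function.update_self, LinearMap.smul_apply, smul_eq_mul]
    congr 1
    exact coeff_congr fun t _ => Function.update_of_ne (by omega) _ _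
  · obtain ⟨L, hL⟩ := coeff_lin p 1 i w j
    refine ⟨ψ (w 0) • L, fun x => ?_⟩
    dsimp only
    rw [hL h0 (by omega), Function.update_of_ne h0.ne, LinearMap.smul_apply, smul_eq_mul, mul_comm]

theorem pathFun_vanish (p : ℕ) (i : Fin 3) (ψ : ThreeCycle k →ₗ[k] k) (w : ℕ → ThreeCycle k)
    (l : ℕ) (h0 : 0 < l) (hl : l ≤ p) (hw : w l = 1) :
    coeff p i (fun t => w (1 + t)) * ψ (w 0) = 0 := by
  rw [coeff_eq_zero (t := l - 1) (by omega), zero_mul]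
  rw [show 1 + (l - 1) = l by omega, hw]
  rfl

/-- The linear form `w_0 ⊗ ⋯ ⊗ w_p ↦ c ψ(w_0)`, where `c` is the coefficient in
`w_1 ⊗ ⋯ ⊗ w_p` of the path that starts at `i`. -/
noncomputable def pathFun (p : ℕ) (i : Fin 3) (ψ : ThreeCycle k →ₗ[k] k) :
    Chain k (ThreeCycle k) p →ₗ[k] k :=
  Chain.map _ (pathFun_lin p i ψ) (pathFun_vanish p i ψ)

theorem pathFun_ev (p : ℕ) (i : Fin 3) (ψ : ThreeCycle k →ₗ[k] k) (w : ℕ → ThreeCycle k) :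
    pathFun p i ψ (ev (gen k _ p) w) = coeff p i (fun t => w (1 + t)) * ψ (w 0) :=
  Chain.map_ev _ _ (pathFun_vanish p i ψ) (fun w w' h => by
    rw [h 0 (by omega), coeff_congr fun t ht => h (1 + t) (by omega)]) w

/-- Only a path of positive length determines its starting vertex; the empty path has coefficient 1
for every i. -/
theorem coeff_path {p : ℕ} (hp : 0 < p) (i j : Fin 3) :
    coeff p i (path k j) = if i = j then 1 else 0 := by
  split_ifs with h
  · subst h
    exact Finset.prod_eq_one fun t _ => by rw [path, arr_snd, if_pos rfl]
  · refine coeff_eq_zero hp ?_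
    rw [path, arr_snd, if_neg]
    simpa using h

theorem pathFun_cyc {p : ℕ} (hp : 0 < p) (i j : Fin 3) (ψ : ThreeCycle k →ₗ[k] k)
    (x : ThreeCycle k) : pathFun p i ψ (cyc p j x) = if i = j then ψ x else 0 := by
  rw [cyc_apply, pathFun_ev, coeff_congr (v := path k j) fun t ht => by
    simp only [tailWord]
    rw [if_neg (by omega), if_neg (by omega), show 1 + t - 0 - 1 = t by omega], coeff_path hp]
  simp [tailWord]

/-- The inner faces are summed by `altSum_coeff_merge`, so only idempotent parts at both ends
survive, next to the two outer faces. -/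
theorem pathFun_bdry (σ : ThreeCycle k ≃ₐ[k] ThreeCycle k) (p : ℕ) (i : Fin 3)
    (ψ : ThreeCycle k →ₗ[k] k) (w : ℕ → ThreeCycle k) :
    pathFun p i ψ (bdry σ p (ev (gen k _ (p + 1)) w)) =
      coeff p i (fun t => w (2 + t)) * (ψ (w 0 * σ (w 1)) - (w 1).1 i * ψ (w 0)) +
      (-1) ^ p * (coeff p i (fun t => w (1 + t)) *
        ((w (p + 1)).1 (i + (p : Fin 3)) * ψ (w 0) - ψ (w (p + 1) * w 0))) := by
  have h1 : ∀ l < p, pathFun p i ψ (ev (gen k _ p) (face σ p (l + 1) w)) =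
      coeff p i (merge l fun t => w (1 + t)) • ψ (w 0) := fun l hl => by
    rw [face_mid _ _ (by omega) (by omega), pathFun_ev, smul_eq_mul]
    congr 1
    refine coeff_congr fun t ht => ?_
    simp only [merge]
    grind
  rw [bdry_ev, map_altSum, altSum_succ, altSum_succ', altSum_congr h1, altSum_smul_const,
    altSum_coeff_merge, face_zero, face_last, pathFun_ev, pathFun_ev]
  have e1 : coeff p i (fun t => (fun t => if t = 0 then w 0 * σ (w 1) else w (t + 1)) (1 + t)) =
      coeff p i fun t => w (2 + t) := coeff_congr fun t ht => by grind
  have e2 : coeff p i (fun t => (fun t => if t = 0 then w (p + 1) * w 0 else w t) (1 + t)) =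
      coeff p i fun t => w (1 + t) := coeff_congr fun t ht => by grind
  rw [e1, e2]
  simp only [if_pos, smul_eq_mul, add_zero, add_comm 1 p, pow_succ]
  simp only [show ∀ t, 1 + (t + 1) = 2 + t from fun t => by omega]
  ring

/-- `σ` is the rotation of the quiver by `s` steps. -/
structure IsRotation (σ : ThreeCycle k ≃ₐ[k] ThreeCycle k) (s : Fin 3) : Prop where
  fst : ∀ x i, (σ x).1 i = x.1 (i - s)
  snd : ∀ x i, (σ x).2 i = x.2 (i - s)

namespace IsRotation

variable {σ : ThreeCycle k ≃ₐ[k] ThreeCycle k} {s : Fin 3}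

theorem apply_e (h : IsRotation σ s) (i : Fin 3) : σ (e k i) = e k (i + s) := by
  ext j
  · simp only [h.fst, e_fst, sub_eq_iff_eq_add]
  · simp only [h.snd, e_snd]

theorem apply_arr (h : IsRotation σ s) (i : Fin 3) : σ (arr k i) = arr k (i + s) := by
  ext j
  · simp only [h.fst, arr_fst]
  · simp only [h.snd, arr_snd, sub_eq_iff_eq_add]

/-- The coordinate of an idempotent is multiplicative, and p ≡ s makes the twist fit the path, so
each bracket in `pathFun_bdry` vanishes. -/
theorem fst_bdry (h : IsRotation σ s) {p : ℕ} (hp : (p : Fin 3) = s) (i : Fin 3)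
    (x : Chain k (ThreeCycle k) (p + 1)) :
    pathFun p i (fstL k (i + (p : Fin 3))) (bdry σ p x) = 0 := by
  refine LinearMap.congr_fun (f := (pathFun p i (fstL k (i + (p : Fin 3)))).comp (bdry σ p))
    (g := 0) (Chain.hom_ext_ev fun w => ?_) x
  rw [LinearMap.comp_apply, pathFun_bdry, LinearMap.zero_apply]
  simp only [fstL_apply, mul_fst, h.fst, hp, add_sub_cancel_right]
  ring

/-- The arrow coordinate is a derivation relative to the idempotent coordinates; its idempotent
terms cancel in `pathFun_bdry` and the arrow terms lengthen the path at either end. It serves twice: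
summed over i it gives a cocycle, and for a cycle x it gives linear relations between the
coordinates of x. -/
theorem snd_bdry (h : IsRotation σ s) {p : ℕ} (hp : ((p + 1 : ℕ) : Fin 3) = s) (i : Fin 3)
    (x : Chain k (ThreeCycle k) (p + 1)) :
    pathFun p i (sndL k (i + (p : Fin 3))) (bdry σ p x) =
      pathFun (p + 1) (i - 1) (fstL k (i - 1 + ((p + 1 : ℕ) : Fin 3))) x +
      (-1) ^ (p + 1) * pathFun (p + 1) i (fstL k (i + ((p + 1 : ℕ) : Fin 3))) x := by
  refine LinearMap.congr_fun (f := (pathFun p i (sndL k (i + (p : Fin 3)))).comp (bdry σ p))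
    (g := pathFun (p + 1) (i - 1) (fstL k (i - 1 + ((p + 1 : ℕ) : Fin 3))) +
      ((-1 : k) ^ (p + 1)) • pathFun (p + 1) i (fstL k (i + ((p + 1 : ℕ) : Fin 3))))
    (Chain.hom_ext_ev fun w => ?_) x
  rw [LinearMap.comp_apply, pathFun_bdry, LinearMap.add_apply, LinearMap.smul_apply, pathFun_ev,
    pathFun_ev, coeff_succ', coeff_succ, sub_add_cancel]
  have e1 : i + (p : Fin 3) - s = i - 1 := by rw [← hp]; push_cast; ring
  have e2 : i + (p : Fin 3) + 1 - s = i := by rw [← hp]; push_cast; ring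
  have e3 : i - 1 + ((p + 1 : ℕ) : Fin 3) = i + (p : Fin 3) := by push_cast; ring
  have e4 : i + ((p + 1 : ℕ) : Fin 3) = i + (p : Fin 3) + 1 := by push_cast; ring
  simp only [fstL_apply, sndL_apply, mul_snd, h.fst, h.snd, e1, e2, e3, e4, smul_eq_mul,
    show ∀ t, 1 + (t + 1) = 2 + t from fun t => by omega, add_zero, add_comm 1 p, pow_succ]
  ring

/-- All inner faces multiply two arrows and vanish. The zeroth face moves the first arrow, twisted
by s ≡ p + 1 steps, to the front; the last face moves the final arrow there. -/
theorem bdry_cyc_e (h : IsRotation σ s) {p : ℕ} (hp : ((p + 1 : ℕ) : Fin 3) = s) (i : Fin 3) :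
    bdry σ p (cyc (p + 1) i (e k (i + ((p + 1 : ℕ) : Fin 3)))) =
      cyc p (i + 1) (arr k (i + 1 + (p : Fin 3))) +
        (-1 : k) ^ (p + 1) • cyc p i (arr k (i + (p : Fin 3))) := by
  have h1 : ∀ l < p, ev (gen k _ p) (face σ p (l + 1) (tailWord k 0 i
      (e k (i + ((p + 1 : ℕ) : Fin 3))) 0)) = 0 := fun l hl => by
    refine ev_eq_zero_of_entry _ (l + 1) (by omega) ?_
    rw [face_mid _ _ (by omega) (by omega)]
    simp only [merge, tailWord]
    rw [if_neg (by omega), if_pos trivial, if_neg (by omega), if_neg (by omega), if_neg (by omega),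
      if_neg (by omega), path_mul_path]
  have h2 : altSum k p (fun l => ev (gen k _ p) (face σ p (l + 1) (tailWord k 0 i
      (e k (i + ((p + 1 : ℕ) : Fin 3))) 0))) = 0 := by
    rw [altSum_congr h1]
    exact Finset.sum_eq_zero fun i _ => smul_zero _
  rw [cyc_apply, bdry_ev, altSum_succ, altSum_succ', h2, sub_zero]
  congr 1
  · rw [cyc_apply]
    refine ev_congr _ fun t ht => ?_
    rw [face_zero]
    simp only [tailWord]
    have e1 : e k (i + ((p + 1 : ℕ) : Fin 3)) * σ (path k i 0) = arr k (i + 1 + (p : Fin 3)) := by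
      rw [path_zero, h.apply_arr, hp, e_mul_arr, ← hp]
      congr 1; push_cast; ring
    have e2 : 0 < t → path k i (t + 1 - 0 - 1) = path k (i + 1) (t - 0 - 1) := fun h => by
      rw [show t + 1 - 0 - 1 = t - 0 - 1 + 1 by omega, path_succ]
    have e3 : 0 + 1 - 0 - 1 = 0 := rfl
    grind
  · congr 1
    rw [cyc_apply]
    refine ev_congr _ fun t ht => ?_
    rw [face_last]
    simp only [tailWord]
    have e1 : path k i (p + 1 - 0 - 1) * e k (i + ((p + 1 : ℕ) : Fin 3)) =
        arr k (i + (p : Fin 3)) := by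
      rw [show p + 1 - 0 - 1 = p by omega, path_mul_e, path]
    grind

theorem _root_.CompleteHochschild.ThreeCycle.arr_mul_e_eq (a b : Fin 3) :
    arr k a * e k b = if a + 1 = b then arr k a else 0 := by
  split_ifs with h
  · rw [← h, arr_mul_e]
  · rw [mul_e]
    simp [sub_eq_iff_eq_add, Ne.symm h]

theorem _root_.CompleteHochschild.ThreeCycle.e_mul_mul_e (a b : Fin 3) (x : ThreeCycle k) :
    e k a * x * e k b = (if a = b then x.1 a • e k a else 0) +
      (if a + 1 = b then x.2 a • arr k a else 0) := by
  rw [e_mul, add_mul, smul_mul_assoc, smul_mul_assoc, e_mul_e, arr_mul_e_eq, smul_ite, smul_ite,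
    smul_zero, smul_zero]

/-- The part of a chain in the cyclic paths. -/
noncomputable def _root_.CompleteHochschild.ThreeCycle.reduce (s : Fin 3) (p : ℕ) :
    Chain k (ThreeCycle k) p →ₗ[k] Chain k (ThreeCycle k) p :=
  if (p : Fin 3) = s then
    ∑ i, (pathFun p i (fstL k (i + (p : Fin 3)))).smulRight (cyc p i (e k (i + (p : Fin 3))))
  else if ((p + 1 : ℕ) : Fin 3) = s then
    ∑ i, (pathFun p i (sndL k (i + (p : Fin 3)))).smulRight (cyc p i (arr k (i + (p : Fin 3))))
  else 0

/-- The coefficient lies in e_{i+p} A e_{i+s}, which is spanned by an idempotent if p ≡ s, by an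
arrow if p + 1 ≡ s, and is zero otherwise; the first two cases exclude each other modulo 3. -/
theorem reduce_ev (h : IsRotation σ s) (p : ℕ) (w : ℕ → ThreeCycle k) :
    reduce s p (ev (gen k _ p) w) = ∑ i, coeff p i (fun t => w (t + 1)) •
        cyc p i (e k (i + (p : Fin 3)) * w 0 * σ (e k i)) := by
  have e1 : ∀ i, cyc p i (e k (i + (p : Fin 3)) * w 0 * σ (e k i)) =
      (if (p : Fin 3) = s then (w 0).1 (i + (p : Fin 3)) • cyc p i (e k (i + (p : Fin 3))) else 0) +
      (if ((p + 1 : ℕ) : Fin 3) = s then (w 0).2 (i + (p : Fin 3)) •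
        cyc p i (arr k (i + (p : Fin 3))) else 0) := fun i => by
    simp only [h.apply_e, e_mul_mul_e, add_assoc, add_right_inj, Nat.cast_add, Nat.cast_one,
      map_add]
    congr 1
    · split_ifs <;> simp
    · split_ifs <;> simp
  have hs : (1 : Fin 3) ≠ 0 := by decide
  simp only [e1, reduce]
  split_ifs with h1 h2 h2
  · rw [← h1] at h2
    exact absurd h2 (by simpa using hs)
  · simp only [LinearMap.sum_apply, LinearMap.smulRight_apply, pathFun_ev, fstL_apply, add_zero,
      mul_smul, add_comm 1]
  · simp only [LinearMap.sum_apply, LinearMap.smulRight_apply, pathFun_ev, sndL_apply, zero_add,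
      mul_smul, add_comm 1]
  · simp

theorem bdry_homotopy_zero (h : IsRotation σ s) (x : Chain k (ThreeCycle k) 0) :
    bdry σ 0 (homotopy 0 x) = reduce s 0 x - x := by
  refine LinearMap.congr_fun (f := (bdry σ 0).comp (homotopy 0)) (g := reduce s 0 - LinearMap.id)
    (Chain.hom_ext_ev fun w => ?_) x
  rw [LinearMap.comp_apply, LinearMap.sub_apply, LinearMap.id_apply, h.reduce_ev,
    ThreeCycle.bdry_homotopy_zero]
  simp [coeff_zero]

theorem bdry_homotopy_succ (h : IsRotation σ s) (q : ℕ) (x : Chain k (ThreeCycle k) (q + 1)) :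
    bdry σ (q + 1) (homotopy (q + 1) x) + homotopy q (bdry σ q x) = reduce s (q + 1) x - x := by
  refine LinearMap.congr_fun (f := (bdry σ (q + 1)).comp (homotopy (q + 1)) +
    (homotopy q).comp (bdry σ q)) (g := reduce s (q + 1) - LinearMap.id)
    (Chain.hom_ext_ev fun w => ?_) x
  rw [LinearMap.add_apply, LinearMap.comp_apply, LinearMap.comp_apply, LinearMap.sub_apply,
    LinearMap.id_apply, h.reduce_ev, ThreeCycle.bdry_homotopy_succ]

end IsRotation

end Homology
end ThreeCycle

end CompleteHochschild

namespace CompleteHochschild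
universe u

namespace ThreeCycle
-- The homology of the twisted complexes, its generators and the Connes operator on them
section Cycles
open scoped Fin.CommRing Fin.NatCast
variable {k : Type u} [Field k]

variable (k) in
/-- The linear map `w ↦ ∑ i, f i (w)` of a family of forms on the paths starting at `i`. -/
noncomputable def chainFun (p : ℕ) (ψ : Fin 3 → ThreeCycle k →ₗ[k] k) :
    Chain k (ThreeCycle k) p →ₗ[k] k := ∑ i, pathFun p i (ψ i)

variable (k) in
/-- The chain `∑ i, y_i ⊗ α_i ⊗ ⋯ ⊗ α_{i+p-1}`. -/
noncomputable def chainOf (p : ℕ) (y : Fin 3 → ThreeCycle k) : Chain k (ThreeCycle k) p :=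
  ∑ i, cyc p i (y i)

theorem chainFun_apply (p : ℕ) (ψ : Fin 3 → ThreeCycle k →ₗ[k] k) (x : Chain k (ThreeCycle k) p) :
    chainFun k p ψ x = ∑ i, pathFun p i (ψ i) x := LinearMap.sum_apply _ _ _

variable (k) in
/-- The cycle that spans the homology in degree `p`, for the rotation by `s` steps. -/
noncomputable def cycle (s : Fin 3) (p : ℕ) : Chain k (ThreeCycle k) p :=
  if (p : Fin 3) = s ∧ Odd p then chainOf k p fun i => e k (i + (p : Fin 3))
  else if ((p + 1 : ℕ) : Fin 3) = s ∧ Even p then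
    chainOf k p fun i => (3 : k)⁻¹ • arr k (i + (p : Fin 3))
  else 0

variable (k) in
/-- The form which is dual to `cycle`. -/
noncomputable def cocycle (s : Fin 3) (p : ℕ) : Chain k (ThreeCycle k) p →ₗ[k] k :=
  if (p : Fin 3) = s ∧ Odd p then chainFun k p fun i => (3 : k)⁻¹ • fstL k (i + (p : Fin 3))
  else if ((p + 1 : ℕ) : Fin 3) = s ∧ Even p then chainFun k p fun i => sndL k (i + (p : Fin 3))
  else 0

theorem pathFun_smul (p : ℕ) (i : Fin 3) (c : k) (ψ : ThreeCycle k →ₗ[k] k)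
    (x : Chain k (ThreeCycle k) p) : pathFun p i (c • ψ) x = c * pathFun p i ψ x := by
  refine LinearMap.congr_fun (f := pathFun p i (c • ψ)) (g := c • pathFun p i ψ)
    (Chain.hom_ext_ev fun w => ?_) x
  rw [LinearMap.smul_apply, pathFun_ev, pathFun_ev, LinearMap.smul_apply, smul_eq_mul, smul_eq_mul]
  ring

theorem chainOf_smul (p : ℕ) (c : k) (y : Fin 3 → ThreeCycle k) :
    chainOf k p (fun i => c • y i) = c • chainOf k p y := by
  simp only [chainOf, map_smul, Finset.smul_sum]

theorem natCast_succ_ne (p : ℕ) : ((p + 1 : ℕ) : Fin 3) ≠ (p : Fin 3) := by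
  have hs : (1 : Fin 3) ≠ 0 := by decide
  push_cast
  simpa using hs

theorem pathFun_snd_cyc (p : ℕ) (i j : Fin 3) :
    pathFun p i (sndL k (i + (p : Fin 3))) (cyc p j (arr k (j + (p : Fin 3)))) =
      if i = j then 1 else 0 := by
  rcases Nat.eq_zero_or_pos p with rfl | hp
  · rw [cyc_apply, pathFun_ev, coeff_zero, one_mul, sndL_apply]
    simp [tailWord]
  · rw [pathFun_cyc hp, sndL_apply, arr_snd]
    by_cases h : i = j <;> simp [h]

theorem cocycle_cycle_fst (h3 : (3 : k) ≠ 0) {s : Fin 3} {p : ℕ} (h : (p : Fin 3) = s ∧ Odd p) :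
    cocycle k s p (cycle k s p) = 1 := by
  have hp : 0 < p := h.2.pos
  rw [cocycle, cycle, if_pos h, if_pos h, chainFun_apply]
  simp only [chainOf, map_sum, pathFun_cyc hp, LinearMap.smul_apply, fstL_apply, e_fst]
  simp [h3]

theorem cocycle_cycle_snd (h3 : (3 : k) ≠ 0) {s : Fin 3} {p : ℕ}
    (h : ((p + 1 : ℕ) : Fin 3) = s ∧ Even p) : cocycle k s p (cycle k s p) = 1 := by
  have h' : ¬ ((p : Fin 3) = s ∧ Odd p) := fun h' => natCast_succ_ne p (h.1.trans h'.1.symm)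
  rw [cocycle, cycle, if_neg h', if_neg h', if_pos h, if_pos h, chainFun_apply]
  simp only [chainOf, map_sum, map_smul, pathFun_snd_cyc]
  simp [h3]

theorem bdry_cyc_arr (σ : ThreeCycle k ≃ₐ[k] ThreeCycle k) {s : Fin 3} (h : IsRotation σ s) (p : ℕ)
    (i j : Fin 3) : bdry σ p (cyc (p + 1) i (arr k j)) = 0 := by
  rw [cyc_apply, bdry_ev]
  refine Finset.sum_eq_zero fun l hl => ?_
  rw [Finset.mem_range] at hl
  have e1 : ∀ n, arr k j * σ (path k i n) = 0 := fun n => by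
    rw [path, h.apply_arr, arr_mul_arr]
  have e2 : ∀ n, path k i n * arr k j = 0 := fun n => arr_mul_arr _ _
  have e3 : ∀ m n, path k i m * path k i n = 0 := path_mul_path i i
  dsimp only
  rcases Nat.eq_zero_or_pos l with rfl | h0
  · rw [ev_eq_zero_of_entry _ 0 (by omega), smul_zero]
    simp only [face_zero, tailWord]
    grind
  rcases eq_or_ne l (p + 1) with rfl | hne
  · rw [ev_eq_zero_of_entry _ 0 (by omega), smul_zero]
    simp only [face_last, tailWord]
    grind
  · rw [ev_eq_zero_of_entry _ l (by omega), smul_zero]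
    rw [face_mid _ _ (by omega) (by omega)]
    simp only [merge, tailWord]
    grind

theorem twist_cyc {σ : ThreeCycle k ≃ₐ[k] ThreeCycle k} {s : Fin 3} (h : IsRotation σ s) (p : ℕ)
    (i : Fin 3) (x : ThreeCycle k) : twist σ p (cyc p i x) = cyc p (i + s) (σ x) := by
  rw [cyc_apply, cyc_apply, twist_ev]
  refine ev_congr _ fun t ht => ?_
  have e : σ (path k i (t - 0 - 1)) = path k (i + s) (t - 0 - 1) := by
    rw [path, path, h.apply_arr, add_right_comm]
  simp only [tailWord]
  grind

theorem twist_chainOf {σ : ThreeCycle k ≃ₐ[k] ThreeCycle k} {s : Fin 3} (h : IsRotation σ s) (p : ℕ)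
    {y : Fin 3 → ThreeCycle k} (hy : ∀ i, σ (y i) = y (i + s)) :
    twist σ p (chainOf k p y) = chainOf k p y := by
  simp only [chainOf, map_sum, twist_cyc h, hy]
  exact Equiv.sum_comp (Equiv.addRight s) fun i => cyc p i (y i)

theorem twist_cycle {σ : ThreeCycle k ≃ₐ[k] ThreeCycle k} {s : Fin 3} (h : IsRotation σ s)
    (s' : Fin 3) (p : ℕ) : twist σ p (cycle k s' p) = cycle k s' p := by
  unfold cycle
  split_ifs
  · exact twist_chainOf h p fun i => by rw [h.apply_e, add_right_comm]
  · exact twist_chainOf h p fun i => by rw [map_smul, h.apply_arr, add_right_comm]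
  · exact map_zero _

namespace IsRotation

variable {σ : ThreeCycle k ≃ₐ[k] ThreeCycle k} {s : Fin 3}

/-- In the idempotent case the degree is odd, so `bdry_cyc_e` is a difference of neighbours and sums
to zero round the quiver. In the arrow case every face contains a product of two arrows. -/
theorem bdry_cycle (h : IsRotation σ s) (p : ℕ) : bdry σ p (cycle k s (p + 1)) = 0 := by
  unfold cycle
  split_ifs with h1 h2
  · simp only [chainOf, map_sum, h.bdry_cyc_e h1.1, Finset.sum_add_distrib]
    have e := Equiv.sum_comp (Equiv.addRight (1 : Fin 3)) fun i => cyc p i (arr k (i + (p : Fin 3)))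
    simp only [Equiv.coe_addRight] at e
    rw [e, ← Finset.smul_sum, h1.2.neg_one_pow, neg_one_smul, add_neg_cancel]
  · simp only [chainOf, map_sum, map_smul, bdry_cyc_arr σ h, smul_zero, Finset.sum_const_zero]
  · exact map_zero _

theorem cocycle_bdry (h : IsRotation σ s) (p : ℕ) (x : Chain k (ThreeCycle k) (p + 1)) :
    cocycle k s p (bdry σ p x) = 0 := by
  unfold cocycle
  split_ifs with h1 h2
  · simp only [chainFun_apply, pathFun_smul, h.fst_bdry h1.1, mul_zero, Finset.sum_const_zero]
  · simp only [chainFun_apply, h.snd_bdry h2.1, Finset.sum_add_distrib]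
    have e := Equiv.sum_comp (Equiv.subRight (1 : Fin 3)) fun i =>
      pathFun (p + 1) i (fstL k (i + ((p + 1 : ℕ) : Fin 3))) x
    simp only [Equiv.subRight_apply] at e
    rw [e, ← Finset.mul_sum,
      (h2.2.add_one).neg_one_pow]
    ring
  · rfl

/-- Linear algebra of shift ± 1 on three vertices. The hypothesis is what `snd_bdry` says of a cycle
of positive degree; stating it only for p ≡ s makes it empty in degree zero when s ≠ 0. -/
theorem reduce_mem (h : IsRotation σ s) (h2 : (2 : k) ≠ 0) (h3 : (3 : k) ≠ 0) (p : ℕ)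
    (z : Chain k (ThreeCycle k) p)
    (hz : (p : Fin 3) = s → ∀ i, pathFun p (i - 1) (fstL k (i - 1 + (p : Fin 3))) z +
      (-1) ^ p * pathFun p i (fstL k (i + (p : Fin 3))) z = 0) :
    ∃ c : k, reduce s p z - c • cycle k s p ∈ LinearMap.range (bdry σ p) := by
  have hf : (2 : Fin 3) + 1 = 0 ∧ (1 : Fin 3) + 1 = 2 ∧ (0 : Fin 3) - 1 = 2 ∧
      (2 : Fin 3) - 1 = 1 := by decide
  by_cases h1 : (p : Fin 3) = s
  · have hz := hz h1
    have r0 := hz 0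
    have r1 := hz 1
    have r2 := hz 2
    rw [hf.2.2.1] at r0
    rw [sub_self] at r1
    rw [hf.2.2.2] at r2
    rcases Nat.even_or_odd p with hp | hp
    · rw [hp.neg_one_pow] at r0 r1 r2
      refine ⟨0, ?_⟩
      -- Neighbouring coordinates are negatives of each other; after three steps round the quiver a
      -- coordinate equals its own negative.
      have a0 : pathFun p 0 (fstL k (0 + (p : Fin 3))) z = 0 :=
        (mul_eq_zero.1 (by linear_combination r0 + r1 - r2 :
          2 * pathFun p 0 (fstL k (0 + (p : Fin 3))) z = 0)).resolve_left h2
      have a1 : pathFun p 1 (fstL k (1 + (p : Fin 3))) z = 0 := by linear_combination r1 - a0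
      have a2 : pathFun p 2 (fstL k (2 + (p : Fin 3))) z = 0 := by linear_combination r0 - a0
      rw [reduce, if_pos h1, Fin.sum_univ_three]
      simp only [LinearMap.add_apply, LinearMap.smulRight_apply, a0, a1, a2, zero_smul, add_zero,
        sub_zero]
      exact zero_mem _
    · rw [hp.neg_one_pow] at r0 r1 r2
      refine ⟨pathFun p 0 (fstL k (0 + (p : Fin 3))) z, ?_⟩
      -- For odd p neighbouring coordinates are equal, so the reduced chain is a multiple of the sum
      -- over all vertices.
      have a1 : pathFun p 1 (fstL k (1 + (p : Fin 3))) z =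
        pathFun p 0 (fstL k (0 + (p : Fin 3))) z := by linear_combination -r1
      have a2 : pathFun p 2 (fstL k (2 + (p : Fin 3))) z =
        pathFun p 0 (fstL k (0 + (p : Fin 3))) z := by linear_combination r0
      rw [reduce, if_pos h1, Fin.sum_univ_three, cycle, if_pos ⟨h1, hp⟩, chainOf,
        Fin.sum_univ_three]
      simp only [LinearMap.add_apply, LinearMap.smulRight_apply, a1, a2, ← smul_add, sub_self]
      exact zero_mem _
  · by_cases h1' : ((p + 1 : ℕ) : Fin 3) = s
    · have b0 := h.bdry_cyc_e h1' 0
      have b1 := h.bdry_cyc_e h1' 1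
      have b2 := h.bdry_cyc_e h1' 2
      rw [show (0 : Fin 3) + 1 = 1 from rfl] at b0
      rw [hf.2.1] at b1
      rw [hf.1] at b2
      have hred : reduce s p z = ∑ i, pathFun p i (sndL k (i + (p : Fin 3))) z •
          cyc p i (arr k (i + (p : Fin 3))) := by
        rw [reduce, if_neg h1, if_pos h1', LinearMap.sum_apply]
        rfl
      rw [Fin.sum_univ_three] at hred
      generalize pathFun p 0 (sndL k (0 + (p : Fin 3))) z = y0 at hred
      generalize pathFun p 1 (sndL k (1 + (p : Fin 3))) z = y1 at hred
      generalize pathFun p 2 (sndL k (2 + (p : Fin 3))) z = y2 at hred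
      rcases Nat.even_or_odd p with hp | hp
      · rw [hp.add_one.neg_one_pow, neg_one_smul, ← sub_eq_add_neg] at b0 b1 b2
        refine ⟨y0 + y1 + y2, ?_⟩
        rw [cycle, if_neg fun h => h1 h.1, if_pos ⟨h1', hp⟩, chainOf_smul, chainOf,
          Fin.sum_univ_three, hred, sub_eq_iff_eq_add.1 b1.symm,
          sub_eq_iff_eq_add.1 b0.symm]
        generalize cyc p 0 (arr k (0 + (p : Fin 3))) = Y
        generalize cyc (p + 1) 0 (e k (0 + ((p + 1 : ℕ) : Fin 3))) = X0
        generalize cyc (p + 1) 1 (e k (1 + ((p + 1 : ℕ) : Fin 3))) = X1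
        -- The arrow words at 1 and 2 are Y + ∂X0 and Y + ∂X0 + ∂X1. So the chain is (y0 + y1 + y2)
        -- Y plus the first two boundaries, and the sum of the three arrow words is 3 Y + ∂(2 X0 +
        -- X1).
        refine ⟨(y1 + y2) • X0 + y2 • X1 - (y0 + y1 + y2) • (3 : k)⁻¹ • ((2 : k) • X0 + X1), ?_⟩
        have e : Y = (3 : k)⁻¹ • (3 : k) • Y := by
          rw [smul_smul, inv_mul_cancel₀ h3, one_smul]
        have e' : (y0 + y1 + y2) • (3 : k)⁻¹ • (Y + (bdry σ p X0 + Y) +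
            (bdry σ p X1 + (bdry σ p X0 + Y))) =
            (y0 + y1 + y2) • ((3 : k)⁻¹ • (3 : k) • Y + (3 : k)⁻¹ • ((2 : k) • bdry σ p X0 +
              bdry σ p X1)) := by module
        rw [e', ← e]
        simp only [map_add, map_sub, map_smul]
        module
      · rw [hp.add_one.neg_one_pow, one_smul] at b0 b1 b2
        refine ⟨0, ?_⟩
        rw [zero_smul, sub_zero, hred]
        -- Here boundaries are sums of neighbours, and the alternating sum of the three boundaries
        -- is twice one arrow word.
        have m0 : cyc p 0 (arr k (0 + (p : Fin 3))) ∈ LinearMap.range (bdry σ p) := by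
          have e : cyc p 0 (arr k (0 + (p : Fin 3))) = (2 : k)⁻¹ •
            (bdry σ p (cyc (p + 1) 0 (e k (0 + ((p + 1 : ℕ) : Fin 3)))) -
              bdry σ p (cyc (p + 1) 1 (e k (1 + ((p + 1 : ℕ) : Fin 3)))) +
              bdry σ p (cyc (p + 1) 2 (e k (2 + ((p + 1 : ℕ) : Fin 3))))) := by
            rw [b0, b1, b2]
            rw [eq_inv_smul_iff₀ h2]
            module
          rw [e]
          exact Submodule.smul_mem _ _ (add_mem (sub_mem ⟨_, rfl⟩ ⟨_, rfl⟩) ⟨_, rfl⟩)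
        have m1 : cyc p 1 (arr k (1 + (p : Fin 3))) ∈ LinearMap.range (bdry σ p) := by
          rw [eq_sub_of_add_eq b0.symm]
          exact sub_mem ⟨_, rfl⟩ m0
        have m2 : cyc p 2 (arr k (2 + (p : Fin 3))) ∈ LinearMap.range (bdry σ p) := by
          rw [eq_sub_of_add_eq b1.symm]
          exact sub_mem ⟨_, rfl⟩ m1
        exact add_mem (add_mem (Submodule.smul_mem _ _ m0) (Submodule.smul_mem _ _ m1))
          (Submodule.smul_mem _ _ m2)
    · refine ⟨0, ?_⟩
      rw [reduce, if_neg h1, if_neg h1', zero_smul, sub_zero]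
      exact zero_mem _

theorem exists_eq_zero (h : IsRotation σ s) (h2 : (2 : k) ≠ 0) (h3 : (3 : k) ≠ 0) (hs : s ≠ 0)
    (z : Chain k (ThreeCycle k) 0) :
    ∃ c : k, z - c • cycle k s 0 ∈ LinearMap.range (bdry σ 0) := by
  obtain ⟨c, hc⟩ := h.reduce_mem h2 h3 0 z fun h0 => absurd h0.symm hs
  refine ⟨c, ?_⟩
  have e : z - c • cycle k s 0 = (reduce s 0 z - c • cycle k s 0) - bdry σ 0 (homotopy 0 z) := by
    rw [h.bdry_homotopy_zero]
    abel
  rw [e]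
  exact sub_mem hc ⟨_, rfl⟩

theorem exists_eq_succ (h : IsRotation σ s) (h2 : (2 : k) ≠ 0) (h3 : (3 : k) ≠ 0) {p : ℕ}
    {z : Chain k (ThreeCycle k) (p + 1)} (hz : bdry σ p z = 0) :
    ∃ c : k, z - c • cycle k s (p + 1) ∈ LinearMap.range (bdry σ (p + 1)) := by
  obtain ⟨c, hc⟩ := h.reduce_mem h2 h3 (p + 1) z fun h0 i => by
    rw [← h.snd_bdry h0, hz, map_zero]
  refine ⟨c, ?_⟩
  have e : z - c • cycle k s (p + 1) = (reduce s (p + 1) z - c • cycle k s (p + 1)) -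
      bdry σ (p + 1) (homotopy (p + 1) z) := by
    have := h.bdry_homotopy_succ p z
    rw [hz, map_zero, add_zero] at this
    rw [this]
    abel
  rw [e]
  exact sub_mem hc ⟨_, rfl⟩

/-- The closed word runs through p + 1 ≡ s arrows, and the twist shifts by s, so every rotation is
again an unbroken path. All signs are positive as p is even. -/
theorem connes_cyc (h : IsRotation σ s) {p : ℕ} (hp : ((p + 1 : ℕ) : Fin 3) = s) (he : Even p)
    (j : Fin 3) : connes σ p (cyc p j (arr k (j + (p : Fin 3)))) =
      ∑ i ∈ Finset.range (p + 1), cyc (p + 1) (j + (i : Fin 3)) 1 := by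
  rw [cyc_apply, connes_ev, sum_Icc_one]
  refine Finset.sum_congr rfl fun i hi => ?_
  rw [Finset.mem_range] at hi
  rw [(he.mul_left (i + 1)).neg_one_pow, one_smul, cyc_apply]
  refine ev_congr _ fun t ht => ?_
  have e1 : 0 < t → t < p + 2 - (i + 1) →
      path k j (i + 1 + t - 1 - 0 - 1) = path k (j + (i : Fin 3)) (t - 0 - 1) := fun h0 h1 => by
    rw [show i + 1 + t - 1 - 0 - 1 = i + (t - 0 - 1) by omega, path, path, Nat.cast_add, add_assoc]
  have e2 : 0 < t → t = p + 2 - (i + 1) →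
      arr k (j + (p : Fin 3)) = path k (j + (i : Fin 3)) (t - 0 - 1) := fun h0 h1 => by
    rw [path, add_assoc, ← Nat.cast_add, show i + (t - 0 - 1) = p by omega]
  have e3 : p + 2 - (i + 1) < t → σ (path k j (t - (p + 2 - (i + 1)) - 0 - 1)) =
      path k (j + (i : Fin 3)) (t - 0 - 1) := fun h1 => by
    rw [path, path, h.apply_arr, ← hp, add_assoc, add_assoc, ← Nat.cast_add, ← Nat.cast_add,
      show t - (p + 2 - (i + 1)) - 0 - 1 + (p + 1) = i + (t - 0 - 1) by omega]
  simp only [connesTerm, tailWord]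
  grind

/-- Three starting vertices with p + 1 rotations each give 3 (p + 1) words, each with factor 1/3
from the cycle and 1/3 from the cocycle. -/
theorem cocycle_connes_cycle (h : IsRotation σ s) (h3 : (3 : k) ≠ 0) {p : ℕ}
    (hp : ((p + 1 : ℕ) : Fin 3) = s) (he : Even p) :
    cocycle k s (p + 1) (connes σ p (cycle k s p)) = ((p : k) + 1) / 3 := by
  have h1 : ¬ ((p : Fin 3) = s ∧ Odd p) := fun h' => natCast_succ_ne p (hp.trans h'.1.symm)
  rw [cycle, if_neg h1, if_pos ⟨hp, he⟩, cocycle, if_pos ⟨hp, he.add_one⟩, chainFun_apply,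
    chainOf_smul]
  simp only [chainOf, map_smul, map_sum, h.connes_cyc hp he,
    pathFun_cyc (Nat.succ_pos p), smul_eq_mul]
  simp only [LinearMap.smul_apply, fstL_apply, one_fst, smul_eq_mul, mul_one]
  have e : ∀ j : Fin 3, ∑ i : Fin 3, ∑ x ∈ Finset.range (p + 1),
      (if i = j + (x : Fin 3) then (3 : k)⁻¹ else 0) = (p + 1) * 3⁻¹ := fun j => by
    rw [Finset.sum_comm]
    simp
  simp only [← Finset.mul_sum]
  rw [Finset.sum_comm]
  simp only [e]
  simp
  field_simp

end IsRotation

end Cycles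
end ThreeCycle

end CompleteHochschild

namespace CompleteHochschild
universe u

namespace ThreeCycle
-- Star products of the standard families of chains and cochains
section Families
open scoped Fin.CommRing Fin.NatCast
variable {k : Type u} [Field k]

variable (k) in
/-- The elements `e_i` for `c = 0` and `α_i / 3` for `c = 1`. -/
noncomputable def fam (c : ℕ) (i : Fin 3) : ThreeCycle k :=
  if c = 0 then e k i else if c = 1 then (3 : k)⁻¹ • arr k i else 0

theorem fam_zero (i : Fin 3) : fam k 0 i = e k i := rfl

/-- The index c is the exponent of β, and the member at i runs from vertex i to vertex i + c.
Composable members multiply by adding exponents, and the zero members for c ≥ 2 encode β² = 0. -/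
theorem fam_mul (c c' : ℕ) (i j : Fin 3) :
    fam k c i * fam k c' j = if j = i + (c : Fin 3) then fam k (c + c') i else 0 := by
  rcases c with _ | _ | c
  · rcases c' with _ | _ | c'
    · simp only [fam, e_mul_e, if_true, Nat.cast_zero, add_zero, eq_comm]
    · simp only [fam, zero_add, if_true, if_false, one_ne_zero, mul_smul_comm, e_mul, arr_fst,
        zero_smul, arr_snd, Nat.cast_zero, add_zero]
      by_cases h : i = j <;> simp [h, eq_comm]
    · simp [fam]
  · rcases c' with _ | _ | c'
    · simp only [fam, zero_add, if_true, if_false, one_ne_zero, smul_mul_assoc, mul_e, arr_fst,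
        zero_smul, arr_snd, Nat.cast_one, add_zero]
      by_cases h : j = i + 1
      · simp [h]
      · have h' : ¬ j - 1 = i := fun h' => h (by rw [← h', sub_add_cancel])
        simp [h, h']
    · simp [fam, arr_mul_arr]
    · simp [fam]
  · have h : c + 1 + 1 + c' ≠ 1 := by omega
    simp [fam, h]

theorem fam_mul_self (c c' : ℕ) {i j : Fin 3} (h : j = i + (c : Fin 3)) :
    fam k c i * fam k c' j = fam k (c + c') i := by rw [fam_mul, if_pos h]

theorem isRotation_rot : IsRotation (rot k) 1 := ⟨rot_fst, rot_snd⟩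

theorem isRotation_rot_symm : IsRotation (rot k).symm 2 := by
  have h : ∀ i : Fin 3, i - 2 = i + 1 := by decide
  exact ⟨fun x i => by rw [h]; rfl, fun x i => by rw [h]; rfl⟩

theorem rot_fam (c : ℕ) (i : Fin 3) : rot k (fam k c i) = fam k c (i + 1) := by
  unfold fam
  split_ifs
  · exact rot_e i
  · rw [map_smul, rot_arr]
  · exact map_zero _

theorem rot_symm_fam (c : ℕ) (i : Fin 3) : (rot k).symm (fam k c i) = fam k c (i - 1) := by
  rw [AlgEquiv.symm_apply_eq, rot_fam, sub_add_cancel]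

theorem coeff_path_self (m : ℕ) (i : Fin 3) : coeff m i (path k i) = 1 :=
  Finset.prod_eq_one fun t _ => by rw [path, arr_snd, if_pos rfl]

theorem path_add (i : Fin 3) (m n : ℕ) : path k i (m + n) = path k (i + (m : Fin 3)) n := by
  rw [path, path, Nat.cast_add, add_assoc]

variable (k) in
/-- The cochain `(w_1, …, w_r) ↦ ∑ c_i(w_1, …, w_r) x_i`, where `c_i` is the coefficient of
`α_i ⊗ α_{i+1} ⊗ ⋯`. -/
noncomputable def cochainOf (r : ℕ) (x : Fin 3 → ThreeCycle k) : Cochain k (ThreeCycle k) r :=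
  Cochain.mk (fun w => ∑ i, coeff r i w • x i)
    (LinearInEach.sum _ fun i _ w j hj => by
      obtain ⟨L, hL⟩ := coeff_lin r 0 i w j
      simp only [zero_add] at hL
      exact ⟨L.smulRight (x i), fun y => by rw [hL (Nat.zero_le _) hj]; rfl⟩)
    (fun w t ht hw => Finset.sum_eq_zero fun i _ => by
      rw [coeff_eq_zero ht (by rw [hw, one_snd]), zero_smul])

theorem cochainOf_ev (r : ℕ) (x : Fin 3 → ThreeCycle k) (w : ℕ → ThreeCycle k) :
    ev (cochainOf k r x).1 w = ∑ i, coeff r i w • x i :=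
  Cochain.mk_ev _ _ (fun w t ht hw => Finset.sum_eq_zero fun i _ => by
      rw [coeff_eq_zero ht (by rw [hw, one_snd]), zero_smul])
    (fun w w' h => Finset.sum_congr rfl fun i _ => by rw [coeff_congr h]) w

theorem pair_cochainOf (r : ℕ) (x : Fin 3 → ThreeCycle k) :
    (frobenius k).pair r (cochainOf k r x) = chainFun k r fun i => (frobenius k).form (x i) :=
  Chain.hom_ext_ev fun w => by
    rw [FrobeniusData.pair_ev, cochainOf_ev, chainFun_apply, map_sum, LinearMap.sum_apply]
    refine Finset.sum_congr rfl fun i _ => ?_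
    rw [pathFun_ev, map_smul, LinearMap.smul_apply, smul_eq_mul]
    simp only [add_comm 1]

theorem form_apply (x y : ThreeCycle k) : (frobenius k).form x y = ∑ i, (x * y).2 i := rfl

theorem form_e (i : Fin 3) : (frobenius k).form (e k i) = sndL k i := by
  ext x
  rw [form_apply, sndL_apply]
  simp

theorem form_arr (i : Fin 3) : (frobenius k).form (arr k i) = fstL k (i + 1) := by
  ext x
  rw [form_apply, fstL_apply]
  simp

theorem cotwist_cochainOf (r : ℕ) (c : ℕ) :
    (frobenius k).cotwist r (cochainOf k r (fam k c)) = cochainOf k r (fam k c) :=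
  Cochain.ext_ev fun w => by
    rw [FrobeniusData.cotwist_ev, cochainOf_ev, cochainOf_ev, map_sum]
    have h : ∀ i, coeff r i (fun t => (frobenius k).ν.symm (w t)) = coeff r (i + 1) w := fun i =>
      Finset.prod_congr rfl fun t _ => by
        rw [add_right_comm]; rfl
    have h' : ∀ i, (frobenius k).ν (fam k c i) = fam k c (i + 1) := rot_fam c
    simp only [map_smul, h, h']
    have e := Equiv.sum_comp (Equiv.addRight (1 : Fin 3)) fun i => coeff r i w • fam k c i
    simpa only [Equiv.coe_addRight] using e

/-- The arrow coordinate at a is the form ⟨e_a, ·⟩, so this is the expansion of x e_a in the basis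
v, after moving x through the form with ν. -/
theorem sum_snd_u (x : ThreeCycle k) (a : Fin 3) :
    ∑ l, ((frobenius k).u l * (frobenius k).ν x).2 a • (frobenius k).v l = x * e k a := by
  rw [← (frobenius k).form_u (x * e k a)]
  refine Finset.sum_congr rfl fun l _ => ?_
  rw [← sndL_apply, ← form_e, (frobenius k).form_ν (e k a), (frobenius k).form_assoc, ← map_mul,
    ← (frobenius k).form_ν]

theorem sum_snd_v (a : Fin 3) :
    ∑ l, ((frobenius k).v l).2 a • (frobenius k).u l = e k (a + 1) := by
  rw [← (frobenius k).form_v (e k (a + 1))]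
  refine Finset.sum_congr rfl fun l _ => ?_
  rw [← sndL_apply, ← form_e, (frobenius k).form_ν (e k a)]
  exact congrArg (fun y => (frobenius k).form _ y • _) (rot_e a)

/-- A path of length m from i ends at i + m, and the value at it ends at i + c. The hypothesis m ≡ c
lets the values multiply exactly when the paths can be concatenated. -/
theorem cup_fam {m n s : ℕ} (h : m + n = s) {c c' : ℕ} (hc : (m : Fin 3) = (c : Fin 3)) :
    cup h (cochainOf k m (fam k c)) (cochainOf k n (fam k c')) = cochainOf k s (fam k (c + c')) := by
  subst h
  refine Cochain.ext_ev fun w => ?_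
  rw [cup_ev, cochainOf_ev, cochainOf_ev, cochainOf_ev, Finset.sum_mul]
  refine Finset.sum_congr rfl fun i _ => ?_
  rw [Finset.mul_sum, Finset.sum_eq_single (i + (m : Fin 3)) (fun j _ hj => ?_) (by simp)]
  · rw [smul_mul_smul_comm, fam_mul_self c c' (by rw [hc]), coeff_add]
  · rw [smul_mul_smul_comm, fam_mul, if_neg (by rwa [← hc]), smul_zero]

variable (k) in
/-- The chain `∑ x_{i+p} ⊗ α_i ⊗ ⋯ ⊗ α_{i+p-1}` of the family `fam`. -/
noncomputable def famChain (p c : ℕ) : Chain k (ThreeCycle k) p :=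
  chainOf k p fun i => fam k c (i + (p : Fin 3))

theorem capLeft_fam {p m q : ℕ} (h : p = m + q) {c c' : ℕ} (hc : (m : Fin 3) = (c : Fin 3)) :
    capLeft h (cochainOf k m (fam k c)) (famChain k p c') = famChain k q (c + c') := by
  simp only [famChain, chainOf, map_sum]
  refine Finset.sum_congr rfl fun j _ => ?_
  rw [cyc_apply, capLeft_ev, cochainOf_ev, cyc_apply]
  have e1 : (∑ i, coeff m i (fun s => tailWord k 0 j (fam k c' (j + (p : Fin 3))) 0 (q + 1 + s)) •
      fam k c i) * fam k c' (j + (p : Fin 3)) = fam k (c + c') (j + (q : Fin 3)) := by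
    have hp : j + (p : Fin 3) = j + (q : Fin 3) + (c : Fin 3) := by
      rw [h, Nat.cast_add, ← hc]; ring
    rw [Finset.sum_mul, Finset.sum_eq_single (j + (q : Fin 3)) (fun i _ hi => ?_) (by simp)]
    · rw [smul_mul_assoc, fam_mul_self c c' hp, coeff_congr (v := path k (j + (q : Fin 3)))
        fun t ht => ?_, coeff_path_self, one_smul]
      simp only [tailWord]
      rw [if_neg (by omega), if_neg (by omega), ← path_add]
      congr 1; omega
    · rw [smul_mul_assoc, fam_mul, if_neg fun h' => hi ?_, smul_zero]
      linear_combination hp - h'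
  refine ev_congr _ fun t ht => ?_
  simp only [tailWord] at e1 ⊢
  grind

/-- The congruence on p and c' says that the coefficient at i + p ends at vertex i - 1, which is
where ν⁻¹ puts the value of the cochain on the path starting at i. The resulting path starts m steps
later, hence the reindexing of the sum. -/
theorem capRight_fam {p m q : ℕ} (h : p = m + q) {c c' : ℕ}
    (hc' : ((p + 1 + c' : ℕ) : Fin 3) = 0) :
    (frobenius k).capRight h (cochainOf k m (fam k c)) (famChain k p c') =
      famChain k q (c + c') := by
  have e := Equiv.sum_comp (Equiv.addRight (m : Fin 3))
    fun i => cyc q i (fam k (c + c') (i + (q : Fin 3)))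
  simp only [Equiv.coe_addRight] at e
  simp only [famChain, chainOf, map_sum]
  rw [← e]
  refine Finset.sum_congr rfl fun j _ => ?_
  rw [cyc_apply, FrobeniusData.capRight_ev, cochainOf_ev, cyc_apply]
  have hp : j + (m : Fin 3) + (q : Fin 3) = j + (p : Fin 3) := by
    rw [h, Nat.cast_add]; ring
  have hp' : j - 1 = j + (p : Fin 3) + (c' : Fin 3) := by
    push_cast at hc'
    linear_combination -hc'
  have e1 : fam k c' (j + (p : Fin 3)) * (frobenius k).ν.symm (∑ i, coeff m i
      (fun s => tailWord k 0 j (fam k c' (j + (p : Fin 3))) 0 (s + 1)) • fam k c i) =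
      fam k (c + c') (j + (p : Fin 3)) := by
    have h' : ∀ i, (frobenius k).ν.symm (fam k c i) = fam k c (i - 1) := rot_symm_fam c
    simp only [map_sum, map_smul, h']
    rw [Finset.mul_sum, Finset.sum_eq_single j (fun i _ hi => ?_) (by simp)]
    · rw [mul_smul_comm, fam_mul_self c' c hp', coeff_congr (v := path k j)
        fun t ht => ?_, coeff_path_self, one_smul, add_comm c]
      simp only [tailWord]
      rw [if_neg (by omega), if_neg (by omega)]
      congr 1
    · rw [mul_smul_comm, fam_mul, if_neg fun h' => hi ?_, smul_zero]
      linear_combination h' - hp'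
  rw [hp]
  have e2 : ∀ t, path k j (m + t) = path k (j + (m : Fin 3)) t := path_add j m
  refine ev_congr _ fun t ht => ?_
  rcases Nat.eq_zero_or_pos t with rfl | h0
  · rw [if_pos rfl]
    simpa only [tailWord, if_true] using e1
  · simp only [tailWord]
    rw [if_neg (by omega), if_neg (by omega), if_neg (by omega), if_neg (by omega),
      if_neg (by omega), ← e2]
    congr 1; omega

/-- The inserted factor u_l ν(a_0) must supply the arrow at position n, from vertex i + n to the
start j of the path in the chain; so only j = i + n + 1 contributes, which requires 0 < p for j to
be visible. The sum over the dual bases is then evaluated by `sum_snd_u`. -/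
theorem insertLeft_fam {p m n : ℕ} (h : m = p + 1 + n) (hp : 0 < p) {c c' : ℕ}
    (hc : (m : Fin 3) = (c : Fin 3)) (hc' : ((p + 1 + c' : ℕ) : Fin 3) = 0) :
    (frobenius k).insertLeft h (cochainOf k m (fam k c)) (famChain k p c') =
      cochainOf k n (fam k (c + c')) := by
  have hn : (n : Fin 3) = ((c + c' : ℕ) : Fin 3) := by
    rw [h] at hc
    push_cast at hc hc' ⊢
    linear_combination hc - hc'
  refine Cochain.ext_ev fun b => ?_
  rw [famChain, chainOf, map_sum (N := Cochain k (ThreeCycle k) n), ev_sum, cochainOf_ev]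
  have key : ∀ j, ev ((frobenius k).insertLeft h (cochainOf k m (fam k c))
      (cyc p j (fam k c' (j + (p : Fin 3))))).1 b = ∑ i,
        if i + (n : Fin 3) + 1 = j then coeff n i b • fam k (c + c') i else 0 := fun j => by
    rw [cyc_apply, FrobeniusData.insertLeft_ev]
    simp only [cochainOf_ev, Finset.sum_mul]
    rw [Finset.sum_comm]
    refine Finset.sum_congr rfl fun i _ => ?_
    have e1 : ∀ l, coeff m i (fun t => if t < n then b t else if t = n then (frobenius k).u l *
        (frobenius k).ν (tailWord k 0 j (fam k c' (j + (p : Fin 3))) 0 0) else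
          tailWord k 0 j (fam k c' (j + (p : Fin 3))) 0 (t - n)) =
        (coeff n i b * if i + (n : Fin 3) + 1 = j then 1 else 0) *
          ((frobenius k).u l * (frobenius k).ν (fam k c' (j + (p : Fin 3)))).2
            (i + (n : Fin 3)) := fun l => by
      rw [show m = n + (p + 1) by omega, coeff_add, coeff_succ', ← coeff_path hp]
      rw [coeff_congr (v := b) fun t ht => by rw [if_pos ht],
        coeff_congr (m := p) (v := path k j) fun t ht => ?_]
      · rw [if_neg (by omega), if_pos (by omega)]
        simp only [tailWord, if_true]
        ring
      · rw [if_neg (by omega), if_neg (by omega)]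
        simp only [tailWord]
        rw [if_neg (by omega), if_neg (by omega)]
        congr 1; omega
    simp only [e1, smul_mul_assoc, mul_smul]
    rw [← Finset.smul_sum]
    simp only [← mul_smul_comm]
    rw [← Finset.mul_sum, ← Finset.smul_sum, sum_snd_u]
    split_ifs with hj
    · rw [one_smul, ← mul_assoc, fam_mul_self, ← fam_zero, fam_mul_self _ _ (by rw [hn]), add_zero]
      rw [← hc, h, ← hj]
      push_cast
      ring
    · rw [zero_smul, mul_zero, smul_zero]
  simp only [key]
  rw [Finset.sum_comm]
  simp

theorem insertRight_fam {p m n : ℕ} (h : m = p + 1 + n) (hp : 0 < p) {c c' : ℕ}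
    (hc' : ((p + 1 + c' : ℕ) : Fin 3) = 0) :
    (frobenius k).insertRight h (cochainOf k m (fam k c)) (famChain k p c') =
      cochainOf k n (fam k (c + c')) := by
  refine Cochain.ext_ev fun b => ?_
  rw [famChain, chainOf, map_sum (N := Cochain k (ThreeCycle k) n), ev_sum, cochainOf_ev]
  have key : ∀ j, ev ((frobenius k).insertRight h (cochainOf k m (fam k c))
      (cyc p j (fam k c' (j + (p : Fin 3))))).1 b =
        coeff n (j + ((p + 1 : ℕ) : Fin 3)) b • fam k (c + c') (j + ((p + 1 : ℕ) : Fin 3)) :=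
      fun j => by
    rw [cyc_apply, FrobeniusData.insertRight_ev]
    have e1 : ∀ l i, coeff m i (fun t => if t < p then
        tailWord k 0 j (fam k c' (j + (p : Fin 3))) 0 (t + 1) else if t = p then (frobenius k).v l
          else b (t - (p + 1))) =
        ((if i = j then 1 else 0) * coeff n (i + (p : Fin 3) + 1) b) *
          ((frobenius k).v l).2 (i + (p : Fin 3)) := fun l i => by
      rw [show m = p + (n + 1) by omega, coeff_add, coeff_succ', ← coeff_path hp,
        coeff_congr (m := p) (v := path k j) fun t ht => ?_,
        coeff_congr (m := n) (v := b) fun t ht => ?_]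
      · rw [if_neg (by omega), if_pos (by omega)]
        ring
      · rw [if_neg (by omega), if_neg (by omega)]
        congr 1; omega
      · rw [if_pos ht]
        simp only [tailWord]
        rw [if_neg (by omega), if_neg (by omega)]
        congr 1
    have e2 : ∀ l, ∑ i, ((if i = j then 1 else 0) * coeff n (i + (p : Fin 3) + 1) b *
        ((frobenius k).v l).2 (i + (p : Fin 3))) • fam k c i =
        (coeff n (j + (p : Fin 3) + 1) b * ((frobenius k).v l).2 (j + (p : Fin 3))) •
          fam k c j := fun l => by
      rw [Finset.sum_eq_single j (fun i _ hi => by rw [if_neg hi, zero_mul, zero_mul, zero_smul])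
        (by simp), if_pos rfl, one_mul]
    have e3 : (frobenius k).ν (tailWord k 0 j (fam k c' (j + (p : Fin 3))) 0 0) =
        fam k c' (j + (p : Fin 3) + 1) := rot_fam c' _
    simp only [cochainOf_ev, e1, e2, e3]
    simp only [mul_smul, mul_smul_comm, ← Finset.smul_sum]
    simp only [← smul_mul_assoc]
    rw [← Finset.sum_mul, ← Finset.sum_mul, sum_snd_v, ← fam_zero, fam_mul_self _ _ (by simp),
      zero_add, fam_mul_self, add_comm c', Nat.cast_add, Nat.cast_one, ← add_assoc]
    push_cast at hc'
    linear_combination -hc'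
  simp only [key]
  have e := Equiv.sum_comp (Equiv.addRight ((p + 1 : ℕ) : Fin 3))
    fun i => coeff n i b • fam k (c + c') i
  simpa only [Equiv.coe_addRight] using e

/-- The comparison is made only through path coordinates: the product also contains words with an
idempotent in the middle, which `pathFun` does not see. This suffices, since the class of a cycle is
determined by such coordinates. The middle factor u_l ν(a_0) supplies the arrow joining the two
paths. -/
theorem chainMul_fam {p q r : ℕ} (h : p + q + 1 = r) (hp : 0 < p) (hq : 0 < q) {c c' : ℕ}
    (hc : ((p + 1 + c : ℕ) : Fin 3) = 0) (m : Fin 3) (ψ : ThreeCycle k →ₗ[k] k) :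
    pathFun r m ψ ((frobenius k).chainMul h (famChain k p c) (famChain k q c')) =
      pathFun r m ψ (famChain k r (c + c')) := by
  have key : ∀ j j', pathFun r m ψ ((frobenius k).chainMul h
      (cyc p j (fam k c (j + (p : Fin 3)))) (cyc q j' (fam k c' (j' + (q : Fin 3))))) =
      if m = j' then if m + (q : Fin 3) + 1 = j then ψ (fam k (c + c') (m + (r : Fin 3))) else 0
        else 0 := fun j j' => by
    rw [cyc_apply, cyc_apply, FrobeniusData.chainMul_ev, map_sum]
    have e1 : ∀ l, coeff r m (fun t => if 1 + t = 0 then (frobenius k).v l *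
        tailWord k 0 j' (fam k c' (j' + (q : Fin 3))) 0 0 else if 1 + t ≤ q then
          tailWord k 0 j' (fam k c' (j' + (q : Fin 3))) 0 (1 + t) else if 1 + t = q + 1 then
            (frobenius k).u l * (frobenius k).ν (tailWord k 0 j (fam k c (j + (p : Fin 3))) 0 0)
            else tailWord k 0 j (fam k c (j + (p : Fin 3))) 0 (1 + t - (q + 1))) =
        ((if m = j' then 1 else 0) * if m + (q : Fin 3) + 1 = j then 1 else 0) *
          ((frobenius k).u l * (frobenius k).ν (fam k c (j + (p : Fin 3)))).2
            (m + (q : Fin 3)) := fun l => by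
      rw [show r = q + (p + 1) by omega, coeff_add, coeff_succ', ← coeff_path hp (m + (q : Fin 3) + 1) j,
        ← coeff_path hq m j',
        coeff_congr (m := q) (v := path k j') fun t ht => ?_,
        coeff_congr (m := p) (v := path k j) fun t ht => ?_]
      · rw [if_neg (by omega), if_neg (by omega), if_pos (by omega)]
        simp only [tailWord, if_true]
        ring
      · rw [if_neg (by omega), if_neg (by omega), if_neg (by omega)]
        simp only [tailWord]
        rw [if_neg (by omega), if_neg (by omega)]
        congr 1; omega
      · rw [if_neg (by omega), if_pos (by omega)]
        simp only [tailWord]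
        rw [if_neg (by omega), if_neg (by omega)]
        congr 1; omega
    simp only [pathFun_ev, e1, if_true]
    simp only [mul_assoc, ← Finset.mul_sum]
    have e2 : ∑ l, ((frobenius k).u l * (frobenius k).ν (fam k c (j + (p : Fin 3)))).2
        (m + (q : Fin 3)) * ψ ((frobenius k).v l *
          tailWord k 0 j' (fam k c' (j' + (q : Fin 3))) 0 0) =
        ψ (fam k c (j + (p : Fin 3)) * e k (m + (q : Fin 3)) * fam k c' (j' + (q : Fin 3))) := by
      rw [← sum_snd_u, Finset.sum_mul, map_sum]
      simp only [smul_mul_assoc, map_smul, smul_eq_mul]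
      rfl
    rw [e2]
    split_ifs with h1 h2
    · have h3 : j + (p : Fin 3) = m + (r : Fin 3) := by
        rw [← h2, ← h]; push_cast; ring
      have h4 : m + (q : Fin 3) = m + (r : Fin 3) + (c : Fin 3) := by
        rw [← h]
        push_cast at hc ⊢
        linear_combination -hc
      rw [h3, ← h1, ← fam_zero, fam_mul_self _ _ h4, add_zero, fam_mul_self _ _ h4]
      ring
    all_goals ring
  simp only [famChain, chainOf, map_sum, LinearMap.sum_apply, key,
    pathFun_cyc (show 0 < r by omega)]
  simp

end Families
end ThreeCycle

end CompleteHochschild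

namespace CompleteHochschild
universe u

namespace ThreeCycle
-- Representatives, dual coordinates, and their star products and BV differentials
section Representatives
open scoped Fin.CommRing Fin.NatCast
variable {k : Type u} [Field k]

theorem natCast_eq_one_and_odd (p : ℕ) : ((p : Fin 3) = 1 ∧ Odd p) ↔ p % 6 = 1 := by
  rw [Fin.ext_iff, Fin.val_natCast, Nat.odd_iff, show ((1 : Fin 3) : ℕ) = 1 from rfl]
  omega

theorem natCast_succ_eq_one_and_even (p : ℕ) :
    (((p + 1 : ℕ) : Fin 3) = 1 ∧ Even p) ↔ p % 6 = 0 := by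
  rw [Fin.ext_iff, Fin.val_natCast, Nat.even_iff, show ((1 : Fin 3) : ℕ) = 1 from rfl]
  omega

theorem natCast_eq_two_and_odd (p : ℕ) : ((p : Fin 3) = 2 ∧ Odd p) ↔ p % 6 = 5 := by
  rw [Fin.ext_iff, Fin.val_natCast, Nat.odd_iff, show ((2 : Fin 3) : ℕ) = 2 from rfl]
  omega

theorem natCast_succ_eq_two_and_even (p : ℕ) :
    (((p + 1 : ℕ) : Fin 3) = 2 ∧ Even p) ↔ p % 6 = 4 := by
  rw [Fin.ext_iff, Fin.val_natCast, Nat.even_iff, show ((2 : Fin 3) : ℕ) = 2 from rfl]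
  omega

theorem cocycle_cycle (h3 : (3 : k) ≠ 0) (s : Fin 3) (p : ℕ) :
    cycle k s p = 0 ∨ cocycle k s p (cycle k s p) = 1 := by
  by_cases h : (p : Fin 3) = s ∧ Odd p
  · exact Or.inr (cocycle_cycle_fst h3 h)
  by_cases h' : ((p + 1 : ℕ) : Fin 3) = s ∧ Even p
  · exact Or.inr (cocycle_cycle_snd h3 h')
  · exact Or.inl (by rw [cycle, if_neg h, if_neg h'])

/-- For s = 2 the homology sits in degrees p ≡ 5 with idempotents and p ≡ 4 with arrows. With n = -p
- 1 the exponent 5 - p % 6 is the residue of n modulo 6, and for residues from 2 on the family is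
zero. -/
theorem cycle_two (p : ℕ) : cycle k 2 p = famChain k p (5 - p % 6) := by
  simp only [cycle, natCast_eq_two_and_odd, natCast_succ_eq_two_and_even]
  split_ifs with h h'
  · rw [h]; rfl
  · rw [h']; rfl
  · have e : ∀ i, fam k (5 - p % 6) i = 0 := fun i => by
      rw [fam, if_neg (by omega), if_neg (by omega)]
    simp only [famChain, chainOf, e, map_zero, Finset.sum_const_zero]

theorem chainFun_zero (p : ℕ) : chainFun k p 0 = 0 :=
  Chain.hom_ext_ev fun w => by
    rw [chainFun_apply]
    exact Finset.sum_eq_zero fun i _ => by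
      rw [pathFun_ev, Pi.zero_apply, LinearMap.zero_apply, mul_zero]

theorem pair_cochainOf_fam (r : ℕ) :
    (frobenius k).pair r (cochainOf k r (fam k (r % 6))) = cocycle k 1 r := by
  rw [pair_cochainOf]
  simp only [cocycle, natCast_eq_one_and_odd, natCast_succ_eq_one_and_even]
  split_ifs with h h'
  · rw [h]
    congr 1
    funext i
    rw [fam, if_neg one_ne_zero, if_pos rfl, map_smul, form_arr,
      ((natCast_eq_one_and_odd r).2 h).1]
  · rw [h']
    congr 1
    funext i
    have h0 := ((natCast_succ_eq_one_and_even r).2 h').1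
    push_cast at h0
    rw [fam_zero, form_e, add_eq_right.1 h0, add_zero]
  · rw [← chainFun_zero]
    congr 1
    funext i
    rw [fam, if_neg (by omega), if_neg (by omega), map_zero, Pi.zero_apply]

/-- The summands lie in e_i A α_{i-1} and α_i A e_i. Each would start and end at i while containing
an arrow, and A has no such path. -/
theorem casimir_eq_zero (a : ThreeCycle k) : (frobenius k).casimir a = 0 := by
  have h : ∀ i : Fin 3, i - 1 ≠ i ∧ i + 1 ≠ i := by decide
  change ∑ x : Fin 3 ⊕ Fin 3, basisU k x * a * basisV k x = 0
  rw [Fintype.sum_sum_type]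
  simp only [basisU_inl, basisU_inr, basisV_inl, basisV_inr]
  have e1 : ∀ i, e k i * a * arr k (i - 1) = 0 := fun i => by
    ext j
    · simp
    · by_cases hj : j = i
      · subst hj; simp [(h j).1.symm]
      · simp [hj]
  have e2 : ∀ i, arr k i * a * e k i = 0 := fun i => by
    ext j
    · simp
    · by_cases hj : j = i
      · subst hj; simp [(h j).2]
      · simp [hj]
  simp [e1, e2]

theorem norm_eq_zero : (frobenius k).norm = 0 :=
  Chain.hom_ext_ev (N := Cochain k (ThreeCycle k) 0) fun w => Cochain.ext_ev fun v => by
    rw [FrobeniusData.norm_ev']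
    exact casimir_eq_zero _

variable (k) in
/-- The representatives of `α^l` in degree `6 l` and of `α^l β` in degree `6 l + 1`. -/
noncomputable def rep : (n : ℤ) → CplxType k (ThreeCycle k) n
  | Int.ofNat r => cochainOf k r (fam k (r % 6))
  | Int.negSucc p => famChain k p (5 - p % 6)

variable (k) in
/-- The linear forms that are dual to the representatives. -/
noncomputable def coord : (n : ℤ) → CplxType k (ThreeCycle k) n →ₗ[k] k
  | Int.ofNat r => ((frobenius k).pair r).flip (cycle k 1 r)
  | Int.negSucc p => cocycle k 2 p

theorem coord_ofNat (r : ℕ) (f : Cochain k (ThreeCycle k) r) :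
    coord k (Int.ofNat r) f = (frobenius k).pair r f (cycle k 1 r) := rfl

theorem coord_rep (h3 : (3 : k) ≠ 0) : ∀ n : ℤ, n % 6 = 0 ∨ n % 6 = 1 → coord k n (rep k n) = 1
  | Int.ofNat r, h => by
    have h' : r % 6 = 0 ∨ r % 6 = 1 := by simp only [Int.ofNat_eq_natCast] at h; omega
    rw [rep, coord_ofNat, pair_cochainOf_fam]
    rcases h' with h' | h'
    · exact cocycle_cycle_snd h3 ((natCast_succ_eq_one_and_even r).2 h')
    · exact cocycle_cycle_fst h3 ((natCast_eq_one_and_odd r).2 h')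
  | Int.negSucc p, h => by
    have h' : p % 6 = 5 ∨ p % 6 = 4 := by simp only [Int.negSucc_eq] at h; omega
    rw [rep, coord, ← cycle_two]
    rcases h' with h' | h'
    · exact cocycle_cycle_fst h3 ((natCast_eq_two_and_odd p).2 h')
    · exact cocycle_cycle_snd h3 ((natCast_succ_eq_two_and_even p).2 h')

theorem coord_eq_zero : ∀ n : ℤ, n % 6 ≠ 0 → n % 6 ≠ 1 → coord k n = 0
  | Int.ofNat r, h, h' => by
    simp only [Int.ofNat_eq_natCast] at h h'
    have e : cycle k 1 r = 0 := by
      rw [cycle, if_neg (by rw [natCast_eq_one_and_odd]; omega),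
        if_neg (by rw [natCast_succ_eq_one_and_even]; omega)]
    rw [coord, e, map_zero]
    rfl
  | Int.negSucc p, h, h' => by
    simp only [Int.negSucc_eq] at h h'
    have e : cocycle k 2 p = 0 := by
      rw [cocycle, if_neg (by rw [natCast_eq_two_and_odd]; omega),
        if_neg (by rw [natCast_succ_eq_two_and_even]; omega)]
    exact e

theorem coord_d : ∀ (n : ℤ) (x : CplxType k (ThreeCycle k) n),
    coord k (n + 1) ((frobenius k).d n x) = 0
  | Int.ofNat r, f => by
    refine ((frobenius k).pair_δ f _).trans ?_
    rw [show bdry (frobenius k).ν r (cycle k 1 (r + 1)) = 0 from isRotation_rot.bdry_cycle r,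
      map_zero]
  | Int.negSucc 0, x => by
    rw [show (frobenius k).d (Int.negSucc 0) = 0 from norm_eq_zero]
    exact map_zero _
  | Int.negSucc (p + 1), x => isRotation_rot_symm.cocycle_bdry p x

theorem coord_coboundary (n : ℤ) (z : CplxType k (ThreeCycle k) n)
    (hz : z ∈ (frobenius k).coboundaries n) : coord k n z = 0 :=
  (frobenius k).coboundary_induction (P := fun n z => coord k n z = 0) coord_d n z hz

theorem rep_mem_cocycles : ∀ n : ℤ, rep k n ∈ (frobenius k).cocycles n
  | Int.ofNat r => by
    change δ r (cochainOf k r (fam k (r % 6))) = 0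
    refine (frobenius k).pair_inj fun x => ?_
    rw [FrobeniusData.pair_δ, pair_cochainOf_fam]
    refine (isRotation_rot.cocycle_bdry r x).trans ?_
    rw [map_zero]
    rfl
  | Int.negSucc 0 => by
    change (frobenius k).norm _ = 0
    rw [norm_eq_zero]
    rfl
  | Int.negSucc (p + 1) => by
    change bdry (rot k).symm p (famChain k (p + 1) _) = 0
    rw [← cycle_two]
    exact isRotation_rot_symm.bdry_cycle p

theorem act_rep : ∀ n : ℤ, (frobenius k).act n (rep k n) = rep k n
  | Int.ofNat r => cotwist_cochainOf r _
  | Int.negSucc p => by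
    change twist (rot k) p (famChain k p _) = famChain k p _
    rw [← cycle_two]
    exact twist_cycle isRotation_rot 2 p

theorem sub_mem_range_of_exists (h3 : (3 : k) ≠ 0) {s : Fin 3} {p : ℕ}
    {σ : ThreeCycle k ≃ₐ[k] ThreeCycle k} (h : IsRotation σ s) {z : Chain k (ThreeCycle k) p}
    (hz : ∃ c : k, z - c • cycle k s p ∈ LinearMap.range (bdry σ p)) :
    z - cocycle k s p z • cycle k s p ∈ LinearMap.range (bdry σ p) := by
  obtain ⟨c, y, hy⟩ := hz
  rcases cocycle_cycle h3 s p with h0 | h0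
  · rw [h0, smul_zero] at hy ⊢
    exact ⟨y, hy⟩
  · have e := h.cocycle_bdry p y
    rw [hy, map_sub, map_smul, h0, smul_eq_mul, mul_one, sub_eq_zero] at e
    rw [e]
    exact ⟨y, hy⟩

/-- Seen as a linear form, a cocycle kills boundaries. If it also kills the generating cycle it
kills all cycles, hence factors through ∂, and the factor is the pairing with some cochain g, so
that f = δ g. In degree zero every chain is a cycle and f itself vanishes. -/
theorem cochain_mem_coboundaries (h2 : (2 : k) ≠ 0) (h3 : (3 : k) ≠ 0) :
    ∀ {r : ℕ} {f : Cochain k (ThreeCycle k) r}, δ r f = 0 →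
      (frobenius k).pair r f (cycle k 1 r) = 0 → f ∈ (frobenius k).coboundaries (Int.ofNat r)
  | 0, f, hf, h0 => by
    have e : f = 0 := (frobenius k).pair_inj fun x => by
      obtain ⟨c, y, hy⟩ := isRotation_rot.exists_eq_zero h2 h3 one_ne_zero x
      have e := (frobenius k).pair_bdry_eq_zero hf y
      rw [show bdry (frobenius k).ν 0 y = x - c • cycle k 1 0 from hy, map_sub, map_smul, h0,
        smul_zero, sub_zero] at e
      rw [e, map_zero]
      rfl
    rw [e]
    exact zero_mem ((frobenius k).coboundaries (Int.ofNat 0))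
  | r + 1, f, hf, h0 => by
    have hker : LinearMap.ker (bdry (rot k) r) ≤ LinearMap.ker ((frobenius k).pair (r + 1) f) :=
      fun x hx => by
        obtain ⟨c, y, hy⟩ := isRotation_rot.exists_eq_succ h2 h3 (LinearMap.mem_ker.1 hx)
        have e := (frobenius k).pair_bdry_eq_zero hf y
        rw [show bdry (frobenius k).ν (r + 1) y = x - c • cycle k 1 (r + 1) from hy, map_sub,
          map_smul, h0, smul_zero, sub_zero] at e
        exact e
    -- Over a field a form vanishing on the kernel of a linear map extends from its image to the
    -- whole target.
    obtain ⟨G, hG⟩ : ∃ G : Chain k (ThreeCycle k) r →ₗ[k] k,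
        G ∘ₗ bdry (rot k) r = (frobenius k).pair (r + 1) f := by
      have e : (frobenius k).pair (r + 1) f ∈ LinearMap.range (bdry (rot k) r).dualMap := by
        rw [LinearMap.range_dualMap_eq_dualAnnihilator_ker, Submodule.mem_dualAnnihilator]
        exact fun x hx => hker hx
      exact e
    obtain ⟨g, rfl⟩ := (frobenius k).pair_surj G
    refine ⟨g, trivial, (frobenius k).pair_inj fun x => ?_⟩
    rw [← hG]
    exact (frobenius k).pair_δ g x

theorem chain_mem_coboundaries (h2 : (2 : k) ≠ 0) (h3 : (3 : k) ≠ 0) :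
    ∀ {p : ℕ} {z : Chain k (ThreeCycle k) p}, z ∈ (frobenius k).cocycles (Int.negSucc p) →
      z - cocycle k 2 p z • famChain k p (5 - p % 6) ∈
        (frobenius k).coboundaries (Int.negSucc p)
  | 0, z, _ => by
    obtain ⟨y, hy⟩ := sub_mem_range_of_exists h3 isRotation_rot_symm
      (isRotation_rot_symm.exists_eq_zero h2 h3 (by decide) z)
    rw [cycle_two] at hy
    exact ⟨y, trivial, hy⟩
  | p + 1, z, hz => by
    obtain ⟨y, hy⟩ := sub_mem_range_of_exists h3 isRotation_rot_symm
      (isRotation_rot_symm.exists_eq_succ (z := z) h2 h3 hz)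
    rw [cycle_two] at hy
    exact ⟨y, trivial, hy⟩

theorem pair_sub_smul_eq_zero (h3 : (3 : k) ≠ 0) (r : ℕ) (f : Cochain k (ThreeCycle k) r) :
    (frobenius k).pair r (f - (frobenius k).pair r f (cycle k 1 r) •
      cochainOf k r (fam k (r % 6))) (cycle k 1 r) = 0 := by
  rw [FrobeniusData.pair_sub, map_smul, pair_cochainOf_fam, LinearMap.smul_apply, smul_eq_mul]
  rcases cocycle_cycle h3 1 r with h | h
  · rw [h, map_zero, map_zero, mul_zero, sub_zero]
  · rw [h, mul_one, sub_self]

theorem sub_coord_smul_rep_mem (h2 : (2 : k) ≠ 0) (h3 : (3 : k) ≠ 0) :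
    ∀ {n : ℤ} {z : CplxType k (ThreeCycle k) n}, z ∈ (frobenius k).cocycles n →
      z - coord k n z • rep k n ∈ (frobenius k).coboundaries n
  | Int.ofNat r, f, hf => cochain_mem_coboundaries h2 h3
      (((frobenius k).cocycles (Int.ofNat r)).sub_mem hf
        (Submodule.smul_mem _ _ (rep_mem_cocycles _))) (pair_sub_smul_eq_zero h3 r f)
  | Int.negSucc _, _, hz => chain_mem_coboundaries h2 h3 hz

theorem natCast_mod_six (m : ℕ) : (m : Fin 3) = ((m % 6 : ℕ) : Fin 3) := by
  rw [Fin.ext_iff, Fin.val_natCast, Fin.val_natCast]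
  omega

theorem natCast_add_sub_mod_six (p : ℕ) : ((p + 1 + (5 - p % 6) : ℕ) : Fin 3) = 0 := by
  rw [Fin.ext_iff, Fin.val_natCast, show ((0 : Fin 3) : ℕ) = 0 from rfl]
  omega

/-- Both halves reduce to `cocycle_connes_cycle`, on cochains by transposition. In degree -p - 1 the
value (p + 1)/3 acquires the sign (-1)^(p+1) = -1, so that a third of the degree comes out
uniformly. -/
theorem coord_bv_rep (h3 : (3 : k) ≠ 0) : ∀ s : ℤ, (s + 1) % 6 = 1 →
    coord k s ((frobenius k).bv s (rep k (s + 1))) = ((s + 1 : ℤ) : k) / 3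
  | Int.ofNat s, h => by
    have h' : s % 6 = 0 := by simp only [Int.ofNat_eq_natCast] at h; omega
    have h0 := (natCast_succ_eq_one_and_even s).2 h'
    change (frobenius k).pair s ((frobenius k).delta s (cochainOf k (s + 1) (fam k ((s + 1) % 6))))
      (cycle k 1 s) = _
    rw [FrobeniusData.pair_delta, pair_cochainOf_fam]
    refine (isRotation_rot.cocycle_connes_cycle h3 h0.1 h0.2).trans ?_
    simp
  | Int.negSucc 0, h => by simp at h
  | Int.negSucc (p + 1), h => by
    have h' : p % 6 = 4 := by simp only [Int.negSucc_eq] at h; omega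
    have h0 := (natCast_succ_eq_two_and_even p).2 h'
    change cocycle k 2 (p + 1) (((-1 : k) ^ (p + 1)) • connes (rot k).symm p
      (famChain k p (5 - p % 6))) = _
    rw [map_smul, ← cycle_two, isRotation_rot_symm.cocycle_connes_cycle h3 h0.1 h0.2,
      h0.2.add_one.neg_one_pow, Int.negSucc_eq]
    push_cast
    rw [smul_eq_mul]
    ring

/-- In each of the six cases the exponents of β add, and their sum is the residue of r modulo 6. If
both factors are odd the sum is 2 and both sides are zero. The residues 4 and 5 of the chain degrees
also guarantee the positivity required of p and q. -/
theorem coord_star_rep : ∀ {m n r : ℤ} (h : m + n = r), m % 6 = 0 ∨ m % 6 = 1 →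
    n % 6 = 0 ∨ n % 6 = 1 → coord k r ((frobenius k).star h (rep k m) (rep k n)) =
      coord k r (rep k r)
  | Int.ofNat m, Int.ofNat n, Int.ofNat r, h, hm, hn => by
    simp only [Int.ofNat_eq_natCast] at h hm hn
    refine congrArg (coord k (Int.ofNat r)) ((cup_fam (by omega) (natCast_mod_six m)).trans ?_)
    rw [show m % 6 + n % 6 = r % 6 by omega]
    rfl
  | Int.negSucc p, Int.ofNat m, Int.negSucc q, h, hm, hn => by
    simp only [Int.ofNat_eq_natCast, Int.negSucc_eq] at h hm hn
    refine congrArg (coord k (Int.negSucc q))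
      ((capRight_fam (by omega) (natCast_add_sub_mod_six p)).trans ?_)
    rw [show m % 6 + (5 - p % 6) = 5 - q % 6 by omega]
    rfl
  | Int.ofNat m, Int.negSucc p, Int.negSucc q, h, hm, hn => by
    simp only [Int.ofNat_eq_natCast, Int.negSucc_eq] at h hm hn
    refine congrArg (coord k (Int.negSucc q))
      ((capLeft_fam (by omega) (natCast_mod_six m)).trans ?_)
    rw [show m % 6 + (5 - p % 6) = 5 - q % 6 by omega]
    rfl
  | Int.ofNat m, Int.negSucc p, Int.ofNat n, h, hm, hn => by
    simp only [Int.ofNat_eq_natCast, Int.negSucc_eq] at h hm hn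
    refine congrArg (coord k (Int.ofNat n)) ((insertLeft_fam (by omega) (by omega)
      (natCast_mod_six m) (natCast_add_sub_mod_six p)).trans ?_)
    rw [show m % 6 + (5 - p % 6) = n % 6 by omega]
    rfl
  | Int.negSucc p, Int.ofNat m, Int.ofNat n, h, hm, hn => by
    simp only [Int.ofNat_eq_natCast, Int.negSucc_eq] at h hm hn
    refine congrArg (coord k (Int.ofNat n)) ((insertRight_fam (by omega) (by omega)
      (natCast_add_sub_mod_six p)).trans ?_)
    rw [show m % 6 + (5 - p % 6) = n % 6 by omega]
    rfl
  | Int.negSucc p, Int.negSucc q, Int.negSucc r, h, hm, hn => by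
    simp only [Int.negSucc_eq] at h hm hn
    have e := chainMul_fam (k := k) (p := p) (q := q) (r := r) (by omega) (by omega) (by omega)
      (c := 5 - p % 6) (c' := 5 - q % 6) (natCast_add_sub_mod_six p)
    rw [show 5 - p % 6 + (5 - q % 6) = 5 - r % 6 by omega] at e
    change cocycle k 2 r ((frobenius k).chainMul _ (famChain k p (5 - p % 6))
      (famChain k q (5 - q % 6))) = cocycle k 2 r (famChain k r (5 - r % 6))
    unfold cocycle
    split_ifs
    · simp only [chainFun_apply, e]
    · simp only [chainFun_apply, e]
    · rfl
  | Int.ofNat _, Int.ofNat _, Int.negSucc _, h, _, _ =>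
    absurd h (by simp only [Int.ofNat_eq_natCast, Int.negSucc_eq]; omega)
  | Int.negSucc _, Int.negSucc _, Int.ofNat _, h, _, _ =>
    absurd h (by simp only [Int.ofNat_eq_natCast, Int.negSucc_eq]; omega)

end Representatives
end ThreeCycle

end CompleteHochschild

namespace CompleteHochschild
universe u

namespace ThreeCycle
-- Comparison with k[α, β, α⁻¹]/(β²)
section Comparison
variable {k : Type u} [Field k]

variable (k) in
/-- The class of `rep k n`. -/
noncomputable def G (n : ℤ) : (frobenius k).Cohomology :=
  (frobenius k).tot (rep k n) (rep_mem_cocycles n)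

/-- From here on no chain is needed: every class is a scalar times a standard class, and products
and BV differentials are determined by coordinates. -/
theorem tot_eq_coord_smul (h2 : (2 : k) ≠ 0) (h3 : (3 : k) ≠ 0) {n : ℤ}
    (z : CplxType k (ThreeCycle k) n) (hz : z ∈ (frobenius k).cocycles n) :
    (frobenius k).tot z hz = coord k n z • G k n := by
  rw [G, FrobeniusData.tot, FrobeniusData.tot, ← map_smul]
  congr 1
  exact ((frobenius k).cls_eq_iff hz (Submodule.smul_mem _ _ (rep_mem_cocycles n))).2
    (sub_coord_smul_rep_mem h2 h3 hz)

theorem G_eq_zero (h2 : (2 : k) ≠ 0) (h3 : (3 : k) ≠ 0) {n : ℤ} (h : n % 6 ≠ 0) (h' : n % 6 ≠ 1) :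
    G k n = 0 := by
  rw [G, tot_eq_coord_smul h2 h3, coord_eq_zero n h h', LinearMap.zero_apply, zero_smul]

theorem Cohomology.induction_tot {P : (frobenius k).Cohomology → Prop}
    (htot : ∀ (n : ℤ) (z : CplxType k (ThreeCycle k) n) (hz : z ∈ (frobenius k).cocycles n),
      P ((frobenius k).tot z hz)) (hadd : ∀ x y, P x → P y → P (x + y))
    (x : (frobenius k).Cohomology) : P x := by
  have h : ∀ (n : ℤ) (a : (frobenius k).HH n), P (DirectSum.lof k ℤ (frobenius k).HH n a) :=
    fun n a => by
      obtain ⟨⟨z, hz⟩, rfl⟩ := Submodule.Quotient.mk_surjective _ a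
      exact htot n z hz
  induction x using DirectSum.induction_on with
  | zero => simpa using h 0 0
  | of n a => exact h n a
  | add x y hx hy => exact hadd x y hx hy

variable (k) in
/-- The monomial in degree `n`. -/
noncomputable def monomial (n : ℤ) : Target k :=
  if n % 6 = 0 then α k (n / 6) else if n % 6 = 1 then α k (n / 6) * β k else 0

theorem monomial_even (l : ℤ) : monomial k (6 * l) = α k l := by
  rw [monomial, if_pos (by omega), show 6 * l / 6 = l by omega]

theorem monomial_odd (l : ℤ) : monomial k (6 * l + 1) = α k l * β k := by
  rw [monomial, if_neg (by omega), if_pos (by omega), show (6 * l + 1) / 6 = l by omega]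

theorem α_mul_α (m n : ℤ) : α k m * α k n = α k (m + n) := by
  rw [α, α, α, LaurentPolynomial.T_add, TrivSqZeroExt.inl_mul]

theorem β_mul_β : β k * β k = 0 := DualNumber.eps_mul_eps

theorem monomial_mul {m n : ℤ} (hm : m % 6 = 0 ∨ m % 6 = 1) (hn : n % 6 = 0 ∨ n % 6 = 1) :
    monomial k m * monomial k n = if m % 6 = 1 ∧ n % 6 = 1 then 0 else monomial k (m + n) := by
  have em : ∃ l, m = 6 * l ∨ m = 6 * l + 1 := ⟨m / 6, by omega⟩
  have en : ∃ l, n = 6 * l ∨ n = 6 * l + 1 := ⟨n / 6, by omega⟩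
  obtain ⟨a, rfl | rfl⟩ := em <;> obtain ⟨b, rfl | rfl⟩ := en
  · rw [if_neg (by omega), ← mul_add]
    simp only [monomial_even, α_mul_α]
  · rw [if_neg (by omega), show 6 * a + (6 * b + 1) = 6 * (a + b) + 1 by ring]
    simp only [monomial_even, monomial_odd]
    rw [← mul_assoc, α_mul_α]
  · rw [if_neg (by omega), show 6 * a + 1 + 6 * b = 6 * (a + b) + 1 by ring]
    simp only [monomial_even, monomial_odd]
    rw [mul_right_comm, α_mul_α]
  · rw [if_pos (by omega), monomial_odd, monomial_odd, mul_mul_mul_comm, β_mul_β, mul_zero]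

variable (k) in
/-- The coordinate of a class of degree `n`. -/
noncomputable def coordHH (n : ℤ) : (frobenius k).HH n →ₗ[k] k :=
  Submodule.liftQ _ ((coord k n).comp ((frobenius k).cocycles n).subtype)
    fun z hz => coord_coboundary n z.1 hz

variable (k) in
/-- The map from the complete cohomology to `k[α, β, α⁻¹] / (β²)`. -/
noncomputable def toTarget : (frobenius k).Cohomology →ₗ[k] Target k :=
  DirectSum.toModule k ℤ _ fun n => (coordHH k n).smulRight (monomial k n)

theorem toTarget_tot {n : ℤ} (z : CplxType k (ThreeCycle k) n)
    (hz : z ∈ (frobenius k).cocycles n) :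
    toTarget k ((frobenius k).tot z hz) = coord k n z • monomial k n := by
  rw [toTarget, FrobeniusData.tot, DirectSum.toModule_lof]
  rfl

theorem toTarget_G (h3 : (3 : k) ≠ 0) {n : ℤ} (h : n % 6 = 0 ∨ n % 6 = 1) :
    toTarget k (G k n) = monomial k n := by
  rw [G, toTarget_tot, coord_rep h3 n h, one_smul]

variable (k) in
/-- The linear map of the Laurent polynomials with `T^l ↦ G (6 l + c)`. -/
noncomputable def ofLaurent (c : ℤ) : k[T;T⁻¹] →ₗ[k] (frobenius k).Cohomology :=
  (Finsupp.linearCombination k fun l => G k (6 * l + c)).comp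
    ({ toFun := fun p => p.coeff, map_add' := fun _ _ => rfl, map_smul' := fun _ _ => rfl } :
      k[T;T⁻¹] →ₗ[k] ℤ →₀ k)

theorem ofLaurent_T (c l : ℤ) : ofLaurent k c (LaurentPolynomial.T l) = G k (6 * l + c) := by
  change Finsupp.linearCombination k (fun l => G k (6 * l + c)) (Finsupp.single l 1) = _
  rw [Finsupp.linearCombination_single, one_smul]

variable (k) in
/-- The map from `k[α, β, α⁻¹] / (β²)` to the complete cohomology. -/
noncomputable def ofTarget : Target k →ₗ[k] (frobenius k).Cohomology where
  toFun x := ofLaurent k 0 x.fst + ofLaurent k 1 x.snd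
  map_add' x y := by
    rw [TrivSqZeroExt.fst_add, TrivSqZeroExt.snd_add, map_add, map_add]
    abel
  map_smul' c x := by
    rw [TrivSqZeroExt.fst_smul, TrivSqZeroExt.snd_smul, map_smul, map_smul, smul_add]
    rfl

theorem ofTarget_α (l : ℤ) : ofTarget k (α k l) = G k (6 * l) := by
  change ofLaurent k 0 (LaurentPolynomial.T l) + ofLaurent k 1 0 = _
  rw [ofLaurent_T, map_zero, add_zero, add_zero]

theorem α_mul_β (l : ℤ) : α k l * β k = TrivSqZeroExt.inr (LaurentPolynomial.T l) := by
  rw [α, β, DualNumber.eps, TrivSqZeroExt.inl_mul_inr, smul_eq_mul, mul_one]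

theorem ofTarget_α_mul_β (l : ℤ) : ofTarget k (α k l * β k) = G k (6 * l + 1) := by
  rw [α_mul_β]
  change ofLaurent k 0 0 + ofLaurent k 1 (LaurentPolynomial.T l) = _
  rw [ofLaurent_T, map_zero, zero_add]

theorem ofTarget_monomial {n : ℤ} (h : n % 6 = 0 ∨ n % 6 = 1) :
    ofTarget k (monomial k n) = G k n := by
  rcases h with h | h
  · rw [monomial, if_pos h, ofTarget_α, show 6 * (n / 6) = n by omega]
  · rw [monomial, if_neg (by omega), if_pos h, ofTarget_α_mul_β, show 6 * (n / 6) + 1 = n by omega]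

theorem Target.induction {P : Target k → Prop} (hα : ∀ (c : k) l, P (c • α k l))
    (hβ : ∀ (c : k) l, P (c • (α k l * β k))) (hadd : ∀ x y, P x → P y → P (x + y))
    (x : Target k) : P x := by
  have h1 : ∀ p : k[T;T⁻¹], P (TrivSqZeroExt.inl p) := fun p => by
    induction p using LaurentPolynomial.induction_on' with
    | add p q hp hq =>
      rw [TrivSqZeroExt.inl_add]
      exact hadd _ _ hp hq
    | C_mul_T n a =>
      rw [← LaurentPolynomial.smul_eq_C_mul]
      exact (TrivSqZeroExt.inl_smul k[T;T⁻¹] a (LaurentPolynomial.T n : k[T;T⁻¹])).symm ▸ hα a n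
  have h2 : ∀ p : k[T;T⁻¹], P (TrivSqZeroExt.inr p) := fun p => by
    induction p using LaurentPolynomial.induction_on' with
    | add p q hp hq =>
      rw [TrivSqZeroExt.inr_add]
      exact hadd _ _ hp hq
    | C_mul_T n a =>
      rw [← LaurentPolynomial.smul_eq_C_mul]
      have := hβ a n
      rw [α_mul_β] at this
      exact (TrivSqZeroExt.inr_smul k[T;T⁻¹] a (LaurentPolynomial.T n : k[T;T⁻¹])).symm ▸ this
  rw [← TrivSqZeroExt.inl_fst_add_inr_snd_eq x]
  exact hadd _ _ (h1 _) (h2 _)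

theorem toTarget_ofTarget (h3 : (3 : k) ≠ 0) (x : Target k) :
    toTarget k (ofTarget k x) = x := by
  induction x using Target.induction with
  | hα c l => rw [map_smul, map_smul, ofTarget_α, toTarget_G h3 (by omega), monomial_even]
  | hβ c l => rw [map_smul, map_smul, ofTarget_α_mul_β, toTarget_G h3 (by omega), monomial_odd]
  | hadd x y hx hy => rw [map_add, map_add, hx, hy]

theorem ofTarget_toTarget (h2 : (2 : k) ≠ 0) (h3 : (3 : k) ≠ 0) (x : (frobenius k).Cohomology) :
    ofTarget k (toTarget k x) = x := by
  induction x using Cohomology.induction_tot with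
  | htot n z hz =>
    rw [toTarget_tot, map_smul, tot_eq_coord_smul h2 h3]
    by_cases h : n % 6 = 0 ∨ n % 6 = 1
    · rw [ofTarget_monomial h]
    · rw [not_or] at h
      rw [coord_eq_zero n h.1 h.2, LinearMap.zero_apply, zero_smul, zero_smul]
  | hadd x y hx hy => rw [map_add, map_add, hx, hy]

/-- The complete cohomology is linearly isomorphic to `k[α, β, α⁻¹] / (β²)`. -/
noncomputable def cohomologyEquiv (h2 : (2 : k) ≠ 0) (h3 : (3 : k) ≠ 0) :
    (frobenius k).Cohomology ≃ₗ[k] Target k :=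
  { toTarget k with
    invFun := ofTarget k
    left_inv := ofTarget_toTarget h2 h3
    right_inv := toTarget_ofTarget h3 }

/-- No exception is needed for two odd factors: the class in the resulting degree, congruent to 2
modulo 6, is zero. -/
theorem mulTot_G (h2 : (2 : k) ≠ 0) (h3 : (3 : k) ≠ 0) {m n : ℤ} (hm : m % 6 = 0 ∨ m % 6 = 1)
    (hn : n % 6 = 0 ∨ n % 6 = 1) : (frobenius k).mulTot (G k m) (G k n) = G k (m + n) := by
  obtain ⟨h, e⟩ := (frobenius k).isStarProduct_mulTot m n _ _ (rep_mem_cocycles m)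
    (rep_mem_cocycles n)
  rw [G, G, e, tot_eq_coord_smul h2 h3, coord_star_rep rfl hm hn,
    ← tot_eq_coord_smul h2 h3 _ (rep_mem_cocycles (m + n)), G]

theorem toTarget_mulTot (h2 : (2 : k) ≠ 0) (h3 : (3 : k) ≠ 0) (x y : (frobenius k).Cohomology) :
    toTarget k ((frobenius k).mulTot x y) = toTarget k x * toTarget k y := by
  induction x using Cohomology.induction_tot with
  | htot m z hz =>
    induction y using Cohomology.induction_tot with
    | htot n z' hz' =>
      rw [toTarget_tot, toTarget_tot, tot_eq_coord_smul h2 h3 z, tot_eq_coord_smul h2 h3 z']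
      by_cases hm : m % 6 = 0 ∨ m % 6 = 1
      · by_cases hn : n % 6 = 0 ∨ n % 6 = 1
        · rw [LinearMap.map_smul₂, map_smul, map_smul, map_smul, mulTot_G h2 h3 hm hn,
            smul_mul_smul_comm, monomial_mul hm hn, smul_smul]
          split_ifs with h
          · rw [G_eq_zero h2 h3 (by omega) (by omega), map_zero]
          · rw [toTarget_G h3 (by omega)]
        · rw [not_or] at hn
          simp [coord_eq_zero n hn.1 hn.2]
      · rw [not_or] at hm
        simp [coord_eq_zero m hm.1 hm.2]
    | hadd y y' hy hy' => rw [map_add, map_add, map_add, mul_add, hy, hy']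
  | hadd x x' hx hx' => rw [map_add, LinearMap.add_apply, map_add, map_add, add_mul, hx, hx']

theorem graded_eq_span (n : ℤ) : graded k n = Submodule.span k {monomial k n} := by
  refine le_antisymm (Submodule.span_le.2 ?_) ?_
  · rintro x (⟨l, rfl, rfl⟩ | ⟨l, rfl, rfl⟩)
    · rw [← monomial_even]
      exact Submodule.mem_span_singleton_self _
    · rw [← monomial_odd]
      exact Submodule.mem_span_singleton_self _
  · rw [Submodule.span_singleton_le_iff_mem, monomial]
    split_ifs with h h'
    · exact Submodule.subset_span (Or.inl ⟨n / 6, by omega, rfl⟩)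
    · exact Submodule.subset_span (Or.inr ⟨n / 6, by omega, rfl⟩)
    · exact zero_mem _

theorem map_range_lof (h3 : (3 : k) ≠ 0) (n : ℤ) :
    (LinearMap.range (DirectSum.lof k ℤ (frobenius k).HH n)).map (toTarget k) = graded k n := by
  rw [graded_eq_span]
  refine le_antisymm ?_ ((Submodule.span_singleton_le_iff_mem _ _).2 ?_)
  · rintro _ ⟨_, ⟨a, rfl⟩, rfl⟩
    obtain ⟨⟨z, hz⟩, rfl⟩ := Submodule.Quotient.mk_surjective _ a
    exact Submodule.mem_span_singleton.2 ⟨coord k n z, (toTarget_tot z hz).symm⟩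
  · by_cases h : n % 6 = 0 ∨ n % 6 = 1
    · exact ⟨G k n, ⟨_, rfl⟩, toTarget_G h3 h⟩
    · rw [not_or] at h
      rw [monomial, if_neg h.1, if_neg h.2]
      exact zero_mem _

theorem orderThree (h3 : (3 : k) ≠ 0) {ζ : k} (hζ : ζ ^ 2 + ζ + 1 = 0) :
    (frobenius k).OrderThree ζ where
  ν_ν_ν a := by
    have h : ∀ i : Fin 3, i - 1 - 1 - 1 = i := by decide
    exact ext (fun i => congrArg a.1 (h i)) fun i => congrArg a.2 (h i)
  three_ne_zero := h3
  root := hζ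

theorem exists_root [IsAlgClosed k] : ∃ ζ : k, ζ ^ 2 + ζ + 1 = 0 := by
  have h : (Polynomial.X ^ 2 + Polynomial.X + 1 : Polynomial k).degree ≠ 0 := by
    have : (Polynomial.X ^ 2 + Polynomial.X + 1 : Polynomial k).degree = 2 := by compute_degree!
    rw [this]
    decide
  obtain ⟨ζ, hζ⟩ := IsAlgClosed.exists_root _ h
  exact ⟨ζ, by simpa using hζ⟩

theorem bvTot_G (h2 : (2 : k) ≠ 0) {ζ : k} (h : (frobenius k).OrderThree ζ) (s : ℤ) :
    h.bvTot (G k (s + 1)) = coord k s ((frobenius k).bv s (rep k (s + 1))) • G k s := by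
  obtain ⟨h', e⟩ := h.isBVOperator_bvTot.2.2 s (rep k (s + 1)) (rep_mem_cocycles _)
    (h.mem_weightOne.2 (act_rep _))
  rw [G, e, tot_eq_coord_smul h2 h.three_ne_zero]

/-- The cohomology in degree 6 l - 1 vanishes, so nothing has to be computed. -/
theorem bvTot_even (h2 : (2 : k) ≠ 0) {ζ : k} (h : (frobenius k).OrderThree ζ) (l : ℤ) :
    h.bvTot (G k (6 * l)) = 0 := by
  have e := bvTot_G h2 h (6 * l - 1)
  rw [G_eq_zero h2 h.three_ne_zero (n := 6 * l - 1) (by omega) (by omega), smul_zero] at e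
  rwa [sub_add_cancel] at e

theorem bvTot_odd (h2 : (2 : k) ≠ 0) {ζ : k} (h : (frobenius k).OrderThree ζ) (l : ℤ) :
    h.bvTot (G k (6 * l + 1)) = ((6 * (l : k) + 1) / 3) • G k (6 * l) := by
  rw [bvTot_G h2 h, coord_bv_rep h.three_ne_zero _ (by omega)]
  push_cast
  rfl

end Comparison

/-! ### Brackets of monomials -/

section Brackets
variable {k : Type u} [Field k]

theorem bracket_even_even (h2 : (2 : k) ≠ 0) {ζ : k} (h : (frobenius k).OrderThree ζ) (m n : ℤ) :
    bvBracket (frobenius k).mulTot h.bvTot (6 * m) (6 * n) (G k (6 * m)) (G k (6 * n)) = 0 := by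
  rw [bvBracket, mulTot_G h2 h.three_ne_zero (by omega) (by omega), ← mul_add]
  simp [bvTot_even h2]

/-- The outer sign is -1 and the term with Δ(α^m) is absent, so the coefficient is the difference of
(6(m + n) + 1)/3 and (6 n + 1)/3. -/
theorem bracket_even_odd (h2 : (2 : k) ≠ 0) {ζ : k} (h : (frobenius k).OrderThree ζ) (m n : ℤ) :
    bvBracket (frobenius k).mulTot h.bvTot (6 * m) (6 * n + 1) (G k (6 * m)) (G k (6 * n + 1)) =
      (2 * (m : k)) • G k (6 * (m + n)) := by
  have h3 := h.three_ne_zero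
  rw [bvBracket, mulTot_G h2 h3 (by omega) (by omega), bvTot_even h2, bvTot_odd h2, map_smul,
    mulTot_G h2 h3 (by omega) (by omega), show 6 * m + (6 * n + 1) = 6 * (m + n) + 1 by ring,
    bvTot_odd h2, ← mul_add, map_zero, LinearMap.zero_apply, smul_zero, add_zero,
    Odd.neg_one_zpow ⟨18 * m * n + 6 * m + 3 * n, by ring⟩, Odd.neg_one_zpow ⟨3 * m, by ring⟩,
    smul_smul, ← add_smul, smul_smul]
  congr 1
  push_cast
  field_simp
  ring

theorem bracket_odd_even (h2 : (2 : k) ≠ 0) {ζ : k} (h : (frobenius k).OrderThree ζ) (m n : ℤ) :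
    bvBracket (frobenius k).mulTot h.bvTot (6 * m + 1) (6 * n) (G k (6 * m + 1)) (G k (6 * n)) =
      (-2 * (n : k)) • G k (6 * (m + n)) := by
  have h3 := h.three_ne_zero
  rw [bvBracket, mulTot_G h2 h3 (by omega) (by omega), bvTot_even h2, bvTot_odd h2, map_smul,
    LinearMap.smul_apply,
    mulTot_G h2 h3 (by omega) (by omega), show 6 * m + 1 + 6 * n = 6 * (m + n) + 1 by ring,
    bvTot_odd h2, ← mul_add, map_zero, add_zero,
    Odd.neg_one_zpow ⟨18 * m * n + 3 * m + 6 * n, by ring⟩,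
    Even.neg_one_zpow ⟨3 * m + 1, by ring⟩, Odd.neg_one_zpow ⟨3 * m, by ring⟩,
    smul_smul, smul_smul, ← add_smul, smul_smul]
  congr 1
  push_cast
  field_simp
  ring

/-- The product of the two classes is zero, so only the two mixed terms remain; with the outer sign
-1 they give (6 m + 1)/3 - (6 n + 1)/3. -/
theorem bracket_odd_odd (h2 : (2 : k) ≠ 0) {ζ : k} (h : (frobenius k).OrderThree ζ) (m n : ℤ) :
    bvBracket (frobenius k).mulTot h.bvTot (6 * m + 1) (6 * n + 1) (G k (6 * m + 1))
      (G k (6 * n + 1)) = (2 * ((m : k) - (n : k))) • G k (6 * (m + n) + 1) := by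
  have h3 := h.three_ne_zero
  rw [bvBracket, mulTot_G h2 h3 (by omega) (by omega),
    G_eq_zero h2 h3 (n := 6 * m + 1 + (6 * n + 1)) (by omega) (by omega), bvTot_odd h2,
    bvTot_odd h2, map_smul, map_smul, LinearMap.smul_apply,
    mulTot_G h2 h3 (by omega) (by omega), mulTot_G h2 h3 (by omega) (by omega),
    show 6 * m + 1 + 6 * n = 6 * (m + n) + 1 by ring,
    show 6 * m + (6 * n + 1) = 6 * (m + n) + 1 by ring, map_zero, smul_zero, zero_add,
    Odd.neg_one_zpow ⟨18 * m * n + 6 * m + 6 * n + 1, by ring⟩,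
    Odd.neg_one_zpow ⟨3 * m, by ring⟩, smul_smul, ← add_smul, smul_smul]
  congr 1
  field_simp
  ring

end Brackets
end ThreeCycle

end CompleteHochschild

theorem mainTheorem11 (k : Type*) [Field k] [IsAlgClosed k]
    (h2 : ringChar k ≠ 2) (h3 : ringChar k ≠ 3) :
    ∃ (mul : (CompleteHochschild.ThreeCycle.frobenius k).Cohomology →ₗ[k]
          (CompleteHochschild.ThreeCycle.frobenius k).Cohomology →ₗ[k]
          (CompleteHochschild.ThreeCycle.frobenius k).Cohomology)
      (Δ : (CompleteHochschild.ThreeCycle.frobenius k).Cohomology →ₗ[k]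
          (CompleteHochschild.ThreeCycle.frobenius k).Cohomology),
      -- `mul` is the `⋆`-product and `Δ` the BV differential of the complete cohomology
      (CompleteHochschild.ThreeCycle.frobenius k).IsStarProduct mul ∧
      (CompleteHochschild.ThreeCycle.frobenius k).IsBVOperator Δ ∧
      ∃ Φ : (CompleteHochschild.ThreeCycle.frobenius k).Cohomology ≃ₗ[k]
          CompleteHochschild.ThreeCycle.Target k,
        -- `Φ` is an isomorphism of graded rings
        (∀ x y, Φ (mul x y) = Φ x * Φ y) ∧
        (∀ n : ℤ, (LinearMap.range (DirectSum.lof k ℤ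
            (CompleteHochschild.ThreeCycle.frobenius k).HH n)).map Φ.toLinearMap =
          CompleteHochschild.ThreeCycle.graded k n) ∧
        -- the BV differentials on the monomials
        (∀ l : ℕ, Δ (Φ.symm (CompleteHochschild.ThreeCycle.α k l *
              CompleteHochschild.ThreeCycle.β k)) =
            ((6 * (l : k) + 1) / 3) • Φ.symm (CompleteHochschild.ThreeCycle.α k l)) ∧
        (∀ l : ℕ, Δ (Φ.symm (CompleteHochschild.ThreeCycle.α k (-(l : ℤ) - 1) *
              CompleteHochschild.ThreeCycle.β k)) =
            ((-6 * (l : k) - 5) / 3) •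
              Φ.symm (CompleteHochschild.ThreeCycle.α k (-(l : ℤ) - 1))) ∧
        (∀ n : ℤ, Δ (Φ.symm (CompleteHochschild.ThreeCycle.α k n)) = 0) ∧
        -- the two generating brackets
        CompleteHochschild.bvBracket mul Δ 6 1 (Φ.symm (CompleteHochschild.ThreeCycle.α k 1))
            (Φ.symm (CompleteHochschild.ThreeCycle.β k)) =
          (2 : k) • Φ.symm (CompleteHochschild.ThreeCycle.α k 1) ∧
        CompleteHochschild.bvBracket mul Δ 1 (-6) (Φ.symm (CompleteHochschild.ThreeCycle.β k))
            (Φ.symm (CompleteHochschild.ThreeCycle.α k (-1))) =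
          (2 : k) • Φ.symm (CompleteHochschild.ThreeCycle.α k (-1)) ∧
        -- all brackets of monomials
        (∀ m n : ℤ,
          CompleteHochschild.bvBracket mul Δ (6 * m) (6 * n)
              (Φ.symm (CompleteHochschild.ThreeCycle.α k m))
              (Φ.symm (CompleteHochschild.ThreeCycle.α k n)) = 0 ∧
          CompleteHochschild.bvBracket mul Δ (6 * m) (6 * n + 1)
              (Φ.symm (CompleteHochschild.ThreeCycle.α k m))
              (Φ.symm (CompleteHochschild.ThreeCycle.α k n *
                CompleteHochschild.ThreeCycle.β k)) =
            (2 * (m : k)) • Φ.symm (CompleteHochschild.ThreeCycle.α k (m + n)) ∧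
          CompleteHochschild.bvBracket mul Δ (6 * m + 1) (6 * n)
              (Φ.symm (CompleteHochschild.ThreeCycle.α k m *
                CompleteHochschild.ThreeCycle.β k))
              (Φ.symm (CompleteHochschild.ThreeCycle.α k n)) =
            (-2 * (n : k)) • Φ.symm (CompleteHochschild.ThreeCycle.α k (m + n)) ∧
          CompleteHochschild.bvBracket mul Δ (6 * m + 1) (6 * n + 1)
              (Φ.symm (CompleteHochschild.ThreeCycle.α k m *
                CompleteHochschild.ThreeCycle.β k))
              (Φ.symm (CompleteHochschild.ThreeCycle.α k n *
                CompleteHochschild.ThreeCycle.β k)) =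
            (2 * ((m : k) - (n : k))) • Φ.symm (CompleteHochschild.ThreeCycle.α k (m + n) *
              CompleteHochschild.ThreeCycle.β k)) := by 
  have h2' : (2 : k) ≠ 0 := Ring.two_ne_zero h2
  have h3' : (3 : k) ≠ 0 := fun h =>
    h3 (CharP.ringChar_of_prime_eq_zero Nat.prime_three (by exact_mod_cast h))
  obtain ⟨ζ, hζ⟩ := CompleteHochschild.ThreeCycle.exists_root (k := k)
  have h := CompleteHochschild.ThreeCycle.orderThree h3' hζ
  have eα : ∀ l, (CompleteHochschild.ThreeCycle.cohomologyEquiv h2' h3').symm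
      (CompleteHochschild.ThreeCycle.α k l) = CompleteHochschild.ThreeCycle.G k (6 * l) :=
    CompleteHochschild.ThreeCycle.ofTarget_α
  have eβ : ∀ l, (CompleteHochschild.ThreeCycle.cohomologyEquiv h2' h3').symm
      (CompleteHochschild.ThreeCycle.α k l * CompleteHochschild.ThreeCycle.β k) =
        CompleteHochschild.ThreeCycle.G k (6 * l + 1) :=
    CompleteHochschild.ThreeCycle.ofTarget_α_mul_β
  -- Written as α^0 β, the element β falls under the general formulas, so the two generating
  -- brackets are the cases (m, n) = (1, 0) and (0, -1).
  have e1 : CompleteHochschild.ThreeCycle.β k =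
      CompleteHochschild.ThreeCycle.α k 0 * CompleteHochschild.ThreeCycle.β k := by
    rw [CompleteHochschild.ThreeCycle.α, LaurentPolynomial.T_zero, TrivSqZeroExt.inl_one, one_mul]
  refine ⟨(CompleteHochschild.ThreeCycle.frobenius k).mulTot, h.bvTot,
    (CompleteHochschild.ThreeCycle.frobenius k).isStarProduct_mulTot, h.isBVOperator_bvTot,
    CompleteHochschild.ThreeCycle.cohomologyEquiv h2' h3',
    CompleteHochschild.ThreeCycle.toTarget_mulTot h2' h3',
    CompleteHochschild.ThreeCycle.map_range_lof h3', fun l => ?_, fun l => ?_, fun n => ?_, ?_, ?_,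
    fun m n => ⟨?_, ?_, ?_, ?_⟩⟩
  · rw [eα, eβ, CompleteHochschild.ThreeCycle.bvTot_odd h2' h, Int.cast_natCast]
  -- The formula for all integral exponents is used at -l - 1, where 6(-l - 1) + 1 = -6 l - 5.
  · rw [eα, eβ, CompleteHochschild.ThreeCycle.bvTot_odd h2' h]
    congr 1
    push_cast
    ring
  · rw [eα, CompleteHochschild.ThreeCycle.bvTot_even h2' h]
  · rw [e1, eα, eβ]
    simpa using CompleteHochschild.ThreeCycle.bracket_even_odd h2' h 1 0
  · rw [e1, eα, eβ]
    simpa using CompleteHochschild.ThreeCycle.bracket_odd_even h2' h 0 (-1)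
  · rw [eα, eα, CompleteHochschild.ThreeCycle.bracket_even_even h2' h]
  · rw [eα, eα, eβ, CompleteHochschild.ThreeCycle.bracket_even_odd h2' h]
  · rw [eα, eα, eβ, CompleteHochschild.ThreeCycle.bracket_odd_even h2' h]
  · rw [eβ, eβ, eβ, CompleteHochschild.ThreeCycle.bracket_odd_odd h2' h]
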